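/- **Setting.** Let $M$ be a complex manifold (Hausdorff, second countable) with a smooth hermitian metric, $D\Subset M$ open and $\varphi$ a real function continuous on $\overline D$. $L^2_*(D)$ is the Hilbert space of measurable forms of all bidegrees on $D$ with $\int_D |f|^2e^{-\varphi}\,dV<\infty$, where the forms $dz^I\wedge d\bar z^J$ are orthonormal at a point if $dz_1,\dots,dz_n$ is a unitary coframe there. $\bar\partial$ acts on $L^2_*(D)$ in the sense of distributions, with domain $\{f\in L^2_*(D):\bar\partial f\in L^2_*(D)\}$, and $\bar\partial^*$ is its Hilbert space adjoint. A form is harmonic if $\bar\partial f=0$ and $\bar\partial^*f=0$, and the harmonic projection is the orthogonal projection of $L^2_*(D)$ onto the closed subspace of harmonic forms. $H^*_{L^2}(D)=\ker\bar\partial/\operatorname{im}\bar\partial$, with the quotient norm. If $\bar\partial$ has closed range, the canonical solution operator $K$ is the bounded operator on $L^2_*(D)$ such that, for $f\in\operatorname{im}\bar\partial$, $Kf$ is the unique solution $u$ of $\bar\partial u=f$ orthogonal to $\ker\bar\partial$, and $Kf=0$ for $f\perp\operatorname{im}\bar\partial$ (that is, $K=\bar\partial^*\mathsf N$ with $\mathsf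 N$ the $\bar\partial$-Neumann operator). **Theorem.** For $j=1,\dots,N$ let $\Omega_j\Subset M_j$ be a domain in a hermitian manifold whose boundary is Lipschitz (locally, in suitable holomorphic coordinates, the graph of a Lipschitz function, with $\Omega_j$ on one side of it), and let $\varphi_j$ be a real function continuous on $\overline{\Omega_j}$. Suppose that $\bar\partial$ on $L^2_*(\Omega_j)$ (weight $\varphi_j$) has closed range for every $j$. Let $P_j$ be the harmonic projection and $K_j$ the canonical solution operator on $\Omega_j$. Give $\Omega=\Omega_1\times\dots\times\Omega_N$ the product metric and the weight $\sum_j\varphi_j$. For $f_j\in L^2_*(\Omega_j)$ write $f_1\otimes\dots\otimes f_N=\pi_1^*f_1\wedge\dots\wedge\pi_N^*f_N$, where $\pi_j:\Omega\to\Omega_j$ is the projection; in this way $L^2_*(\Omega)=L^2_*(\Omega_1)\hat\otimes\cdots\hat\otimes L^2_*(\Omega_N)$, the Hilbert space tensor product. Then: 1. $\bar\partial$ on $L^2_*(\Omega)$ has closed range. 2. The $L^2$ Künneth formula holds: $H^*_{L^2}(\Omega)=H^*_{L^2}(\Omega_1)\hat\otimes\cdots\hat\otimes H^*_{L^2}(\Omega_N)$,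 where $[f_1]\otimes\dots\otimes[f_N]$ corresponds to $[f_1\otimes\dots\otimes f_N]$ for $f_j\in\ker\bar\partial$. 3. The harmonic projection on $\Omega$ is $P=P_1\hat\otimes\cdots\hat\otimes P_N$. 4. For $0\le j\le N-1$ let $\mathsf Q_j$ be the harmonic projection on $U_j=\Omega_1\times\dots\times\Omega_j$, $\tau_j$ the multiplication by $(-1)^d$ on forms of degree $d$ on $U_j$, and $\mathsf I_j$ the identity on $L^2_*(\Omega_{j+2}\times\dots\times\Omega_N)$ (empty products contribute the factor $\mathbb C$). Then the bounded operators $T_{N,j}=\tau_j\mathsf Q_j\hat\otimes K_{j+1}\hat\otimes\mathsf I_j$ and $S=\sum_{j=0}^{N-1}T_{N,j}$ on $L^2_*(\Omega)$ exist, and $S$ is a solution operator for $\bar\partial$ on $\Omega$: it maps the domain of $\bar\partial$ into itself, $\bar\partial S+S\bar\partial=I-P$ on this domain, and every $f\in\operatorname{im}\bar\partial$ satisfies $Sf\in\operatorname{dom}\bar\partial$ and $\bar\partial(Sf)=f$. 5. For every $p\ge 0$ and every $\bar\partial$-closed form $f\in L^2_*(\Omega)$ of bidegree $(p,1)$, $Sf=Kf$,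 where $K$ is the canonical solution operator on $\Omega$. -/

import Mathlib

open scoped ContDiff Manifold ComplexConjugate InnerProductSpace
open MeasureTheory Set

universe u v

noncomputable section

/-! ### Exterior algebra: complex-valued forms at a point -/

/-- Complex-valued exterior forms (of all degrees) on a real vector space `E`: the exterior algebra
over `ℂ` of the complexified dual space `E →ₗ[ℝ] ℂ`. -/
abbrev CForm (E : Type*) [AddCommGroup E] [Module ℝ E] : Type _ := ExteriorAlgebra ℂ (E →ₗ[ℝ] ℂ)

namespace CForm

section Algebra

variable {E F G : Type*} [AddCommGroup E] [Module ℝ E] [AddCommGroup F] [Module ℝ F]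
  [AddCommGroup G] [Module ℝ G]

/-- Pullback of exterior forms along a linear map. -/
def pullback (A : E →ₗ[ℝ] F) : CForm F →ₐ[ℂ] CForm E :=
  ExteriorAlgebra.map (LinearMap.lcomp ℂ ℂ A)

/-- Evaluation of covectors at `v`. -/
def evalAt (v : E) : Module.Dual ℂ (E →ₗ[ℝ] ℂ) where
  toFun α := α v
  map_add' _ _ := rfl
  map_smul' _ _ := rfl

/-- Interior product with the vector `v`. -/
def interior (v : E) : CForm E →ₗ[ℂ] CForm E := CliffordAlgebra.contractLeft (evalAt v)

/-- The component of degree zero. -/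
def scalarPart : CForm E →ₐ[ℂ] ℂ := ExteriorAlgebra.algebraMapInv

/-- Multiplication by `(-1) ^ d` on forms of degree `d`. -/
def parity : CForm E →ₐ[ℂ] CForm E := CliffordAlgebra.involute

/-- For vectors `b i` and coefficients `c i j`, the sum
`∑ c i₁ j₁ ⋯ c iₖ jₖ * conj (α (b i₁, …, b iₖ)) * β (b j₁, …, b jₖ)`; only the components of
degree `k` of `α` and `β` contribute. -/
def pairing {ι : Type*} [Fintype ι] (b : ι → E) (c : Matrix ι ι ℝ) : ℕ → CForm E → CForm E → ℂ
  | 0, α, β => conj (scalarPart α) * scalarPart β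
  | k + 1, α, β => ∑ i, ∑ j, (c i j : ℂ) * pairing b c k (interior (b i) α) (interior (b j) β)

@[simp] lemma interior_algebraMap (v : E) (r : ℂ) : interior v (algebraMap ℂ (CForm E) r) = 0 :=
  CliffordAlgebra.contractLeft_algebraMap _ _ _

lemma interior_ι_mul (v : E) (a : E →ₗ[ℝ] ℂ) (x : CForm E) :
    interior v (ExteriorAlgebra.ι ℂ a * x) = a v • x - ExteriorAlgebra.ι ℂ a * interior v x :=
  CliffordAlgebra.contractLeft_ι_mul _ _ _

lemma interior_add (v w : E) (x : CForm E) : interior (v + w) x = interior v x + interior w x := by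
  have : evalAt (v + w) = evalAt v + evalAt w := by
    ext a; exact map_add a v w
  simp [interior, this]

lemma interior_smul (r : ℝ) (v : E) (x : CForm E) :
    interior (r • v) x = (r : ℂ) • interior v x := by
  have : evalAt (r • v) = (r : ℂ) • evalAt v := by
    ext a; simp [evalAt]
  simp [interior, this]

lemma interior_sum {κ : Type*} (s : Finset κ) (v : κ → E) (x : CForm E) :
    interior (∑ i ∈ s, v i) x = ∑ i ∈ s, interior (v i) x := by
  classical
  induction s using Finset.induction_on with
  | empty => simpa using interior_smul 0 (0 : E) x
  | insert a s ha ih => rw [Finset.sum_insert ha, Finset.sum_insert ha, interior_add, ih]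

lemma pullback_ι (A : E →ₗ[ℝ] F) (a : F →ₗ[ℝ] ℂ) :
    pullback A (ExteriorAlgebra.ι ℂ a) = ExteriorAlgebra.ι ℂ (a ∘ₗ A) :=
  ExteriorAlgebra.map_apply_ι _ _

lemma pullback_pullback (A : E →ₗ[ℝ] F) (B : F →ₗ[ℝ] G) (x : CForm G) :
    pullback A (pullback B x) = pullback (B ∘ₗ A) x := by
  induction x using CliffordAlgebra.left_induction with
  | algebraMap r => simp
  | add x y hx hy => simp [hx, hy]
  | ι_mul x m hx =>
    change pullback A (pullback B (ExteriorAlgebra.ι ℂ m * x)) =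
      pullback (B ∘ₗ A) (ExteriorAlgebra.ι ℂ m * x)
    simp [pullback_ι, hx, LinearMap.comp_assoc]

lemma pullback_id (x : CForm E) : pullback (LinearMap.id : E →ₗ[ℝ] E) x = x := by
  induction x using CliffordAlgebra.left_induction with
  | algebraMap r => simp
  | add x y hx hy => simp [hx, hy]
  | ι_mul x m hx =>
    change pullback LinearMap.id (ExteriorAlgebra.ι ℂ m * x) = ExteriorAlgebra.ι ℂ m * x
    simp [pullback_ι, hx]

lemma interior_pullback (A : E →ₗ[ℝ] F) (v : E) (x : CForm F) :
    interior v (pullback A x) = pullback A (interior (A v) x) := by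
  induction x using CliffordAlgebra.left_induction with
  | algebraMap r => rw [AlgHom.commutes]; erw [interior_algebraMap, interior_algebraMap]; simp
  | add x y hx hy => simp [hx, hy]
  | ι_mul x m hx =>
    change interior v (pullback A (ExteriorAlgebra.ι ℂ m * x)) =
      pullback A (interior (A v) (ExteriorAlgebra.ι ℂ m * x))
    simp [pullback_ι, hx, interior_ι_mul]

lemma scalarPart_ι_mul (a : E →ₗ[ℝ] ℂ) (x : CForm E) :
    scalarPart (ExteriorAlgebra.ι ℂ a * x) = 0 := by
  rw [map_mul]
  have : scalarPart (ExteriorAlgebra.ι ℂ a) = 0 := by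
    simp [scalarPart, ExteriorAlgebra.algebraMapInv]
  simp [this]

lemma scalarPart_pullback (A : E →ₗ[ℝ] F) (x : CForm F) :
    scalarPart (pullback A x) = scalarPart x := by
  induction x using CliffordAlgebra.left_induction with
  | algebraMap r => simp
  | add x y hx hy => simp [hx, hy]
  | ι_mul x m hx =>
    change scalarPart (pullback A (ExteriorAlgebra.ι ℂ m * x)) =
      scalarPart (ExteriorAlgebra.ι ℂ m * x)
    rw [map_mul, pullback_ι, scalarPart_ι_mul, scalarPart_ι_mul]

lemma parity_ι (a : E →ₗ[ℝ] ℂ) :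
    parity (ExteriorAlgebra.ι ℂ a) = - ExteriorAlgebra.ι ℂ a :=
  CliffordAlgebra.involute_ι _

lemma interior_parity (v : E) (x : CForm E) :
    interior v (parity x) = - parity (interior v x) := by
  induction x using CliffordAlgebra.left_induction with
  | algebraMap r => rw [AlgHom.commutes]; erw [interior_algebraMap]; simp
  | add x y hx hy => simp [hx, hy]; abel
  | ι_mul x m hx =>
    change interior v (parity (ExteriorAlgebra.ι ℂ m * x)) =
      - parity (interior v (ExteriorAlgebra.ι ℂ m * x))
    simp [parity_ι, hx, interior_ι_mul]

lemma scalarPart_parity (x : CForm E) : scalarPart (parity x) = scalarPart x := by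
  induction x using CliffordAlgebra.left_induction with
  | algebraMap r => simp
  | add x y hx hy => simp [hx, hy]
  | ι_mul x m hx =>
    change scalarPart (parity (ExteriorAlgebra.ι ℂ m * x)) =
      scalarPart (ExteriorAlgebra.ι ℂ m * x)
    rw [map_mul, parity_ι, neg_mul, map_neg, scalarPart_ι_mul, scalarPart_ι_mul, neg_zero]

lemma pullback_parity (A : E →ₗ[ℝ] F) (x : CForm F) :
    pullback A (parity x) = parity (pullback A x) := by
  induction x using CliffordAlgebra.left_induction with
  | algebraMap r => simp
  | add x y hx hy => simp [hx, hy]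
  | ι_mul x m hx =>
    change pullback A (parity (ExteriorAlgebra.ι ℂ m * x)) =
      parity (pullback A (ExteriorAlgebra.ι ℂ m * x))
    simp [pullback_ι, parity_ι, hx]

section Pairing

variable {ι κ : Type*} [Fintype ι] [Fintype κ]

lemma pairing_add_left (b : ι → E) (c : Matrix ι ι ℝ) (k : ℕ) (α α' β : CForm E) :
    pairing b c k (α + α') β = pairing b c k α β + pairing b c k α' β := by
  induction k generalizing α α' β with
  | zero => simp [pairing, add_mul]
  | succ k ih => simp [pairing, ih, mul_add, Finset.sum_add_distrib]

lemma pairing_smul_left (b : ι → E) (c : Matrix ι ι ℝ) (k : ℕ) (r : ℂ) (α β : CForm E) :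
    pairing b c k (r • α) β = conj r * pairing b c k α β := by
  induction k generalizing α β with
  | zero => simp [pairing, mul_assoc]
  | succ k ih =>
    simp only [pairing, map_smul, ih, Finset.mul_sum]
    exact Finset.sum_congr rfl fun i _ => Finset.sum_congr rfl fun j _ => by ring

lemma conj_pairing (b : ι → E) (c : Matrix ι ι ℝ) (hc : c.IsSymm) (k : ℕ) (α β : CForm E) :
    conj (pairing b c k β α) = pairing b c k α β := by
  induction k generalizing α β with
  | zero => simp [pairing, mul_comm]
  | succ k ih =>
    simp only [pairing, map_sum, map_mul, Complex.conj_ofReal, ih]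
    rw [Finset.sum_comm]
    exact Finset.sum_congr rfl fun i _ => Finset.sum_congr rfl fun j _ => by rw [hc.apply]

lemma pairing_add_right (b : ι → E) (c : Matrix ι ι ℝ) (k : ℕ) (α β β' : CForm E) :
    pairing b c k α (β + β') = pairing b c k α β + pairing b c k α β' := by
  induction k generalizing α β β' with
  | zero => simp [pairing, mul_add]
  | succ k ih => simp [pairing, ih, mul_add, Finset.sum_add_distrib]

lemma pairing_smul_right (b : ι → E) (c : Matrix ι ι ℝ) (k : ℕ) (r : ℂ) (α β : CForm E) :
    pairing b c k α (r • β) = r * pairing b c k α β := by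
  induction k generalizing α β with
  | zero => simp only [pairing, map_smul, smul_eq_mul]; ring
  | succ k ih =>
    simp only [pairing, map_smul, ih, Finset.mul_sum]
    exact Finset.sum_congr rfl fun i _ => Finset.sum_congr rfl fun j _ => by ring

lemma pairing_change (b : ι → E) (b' : κ → E) (P : Matrix ι κ ℝ)
    (hb : ∀ i, b' i = ∑ l, P l i • b l) (c : Matrix κ κ ℝ) (k : ℕ) (α β : CForm E) :
    pairing b' c k α β = pairing b (P * c * P.transpose) k α β := by
  induction k generalizing α β with
  | zero => simp [pairing]
  | succ k ih =>
    set C := P * c * P.transpose with hC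
    have hL : ∀ (δ : CForm E) (s : Finset ι) (f : ι → CForm E),
        pairing b C k (∑ l ∈ s, f l) δ = ∑ l ∈ s, pairing b C k (f l) δ := by
      intro δ s f
      classical
      induction s using Finset.induction_on with
      | empty => simpa using pairing_smul_left b C k 0 (0 : CForm E) δ
      | insert a s ha ih => rw [Finset.sum_insert ha, Finset.sum_insert ha, pairing_add_left, ih]
    have hR : ∀ (γ : CForm E) (s : Finset ι) (f : ι → CForm E),
        pairing b C k γ (∑ l ∈ s, f l) = ∑ l ∈ s, pairing b C k γ (f l) := by
      intro γ s f
      classical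
      induction s using Finset.induction_on with
      | empty => simpa using pairing_smul_right b C k 0 γ (0 : CForm E)
      | insert a s ha ih => rw [Finset.sum_insert ha, Finset.sum_insert ha, pairing_add_right, ih]
    have hX : ∀ i j, pairing b C k (interior (b' i) α) (interior (b' j) β) =
        ∑ l, ∑ m, (P l i * P m j : ℂ) *
          pairing b C k (interior (b l) α) (interior (b m) β) := by
      intro i j
      rw [hb, hb, interior_sum, interior_sum, hL]
      refine Finset.sum_congr rfl fun l _ => ?_
      rw [hR]
      refine Finset.sum_congr rfl fun m _ => ?_
      rw [interior_smul, interior_smul, pairing_smul_left, pairing_smul_right,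
        Complex.conj_ofReal]
      ring
    have hCe : ∀ l m, (C l m : ℂ) = ∑ j, ∑ i, (P l i * c i j * P m j : ℂ) := by
      intro l m
      simp only [hC, Matrix.mul_apply, Matrix.transpose_apply, Complex.ofReal_sum,
        Complex.ofReal_mul, Finset.sum_mul]
    simp only [pairing, ih, hX, hCe, Finset.mul_sum, Finset.sum_mul]
    calc _ = ∑ i, ∑ l, ∑ j, ∑ m, (c i j : ℂ) * ((P l i * P m j : ℂ) *
          pairing b C k (interior (b l) α) (interior (b m) β)) :=
          Finset.sum_congr rfl fun i _ => Finset.sum_comm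
      _ = ∑ l, ∑ i, ∑ m, ∑ j, (c i j : ℂ) * ((P l i * P m j : ℂ) *
          pairing b C k (interior (b l) α) (interior (b m) β)) := by
          rw [Finset.sum_comm]
          exact Finset.sum_congr rfl fun l _ => Finset.sum_congr rfl fun i _ => Finset.sum_comm
      _ = ∑ l, ∑ m, ∑ j, ∑ i, (c i j : ℂ) * ((P l i * P m j : ℂ) *
          pairing b C k (interior (b l) α) (interior (b m) β)) := by
          refine Finset.sum_congr rfl fun l _ => ?_
          rw [Finset.sum_comm]
          exact Finset.sum_congr rfl fun m _ => Finset.sum_comm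
      _ = _ := Finset.sum_congr rfl fun l _ => Finset.sum_congr rfl fun m _ =>
          Finset.sum_congr rfl fun j _ => Finset.sum_congr rfl fun i _ => by ring

lemma re_pairing_one_nonneg [DecidableEq ι] (b : ι → E) (k : ℕ) (α : CForm E) :
    0 ≤ (pairing b 1 k α α).re := by
  induction k generalizing α with
  | zero =>
    rw [pairing, mul_comm, Complex.mul_conj, Complex.ofReal_re]
    exact Complex.normSq_nonneg _
  | succ k ih =>
    simp only [pairing, Matrix.one_apply, Complex.re_sum]
    refine Finset.sum_nonneg fun i _ => Finset.sum_nonneg fun j _ => ?_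
    split_ifs with h
    · subst h; simpa using ih _
    · simp

lemma pairing_one_succ [DecidableEq ι] (b : ι → E) (k : ℕ) (α β : CForm E) :
    pairing b 1 (k + 1) α β = ∑ i, pairing b 1 k (interior (b i) α) (interior (b i) β) := by
  simp only [pairing, Matrix.one_apply]
  refine Finset.sum_congr rfl fun i _ => ?_
  rw [Finset.sum_eq_single i]
  · simp
  · intro j _ hj; simp [Ne.symm hj]
  · simp

/-- A form all of whose iterated contractions of lengths `≤ card ι` with the vectors of a basis have
vanishing scalar part is zero. -/
lemma eq_zero_of_pairing [LinearOrder ι] [FiniteDimensional ℝ E] (b : Module.Basis ι ℝ E)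
    (α : CForm E) (h : ∀ k ≤ Fintype.card ι, (pairing b 1 k α α).re = 0) : α = 0 := by
  -- iterated contractions
  let con : List ι → CForm E → CForm E := fun l x => l.foldr (fun i y => interior (b i) y) x
  have con_cons : ∀ i l x, con (i :: l) x = interior (b i) (con l x) := fun _ _ _ => rfl
  have con_append : ∀ l i x, con (l ++ [i]) x = con l (interior (b i) x) := by
    intro l i x; simp [con, List.foldr_append]
  have anti : ∀ (v w : E) (x : CForm E), interior v (interior w x) = - interior w (interior v x) :=
    fun v w x => CliffordAlgebra.contractLeft_comm _ _ _
  have sq : ∀ (v : E) (x : CForm E), interior v (interior v x) = 0 :=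
    fun v x => CliffordAlgebra.contractLeft_contractLeft _ _
  have con_mem : ∀ (l : List ι) (i : ι) (x : CForm E), i ∈ l → interior (b i) (con l x) = 0 := by
    intro l
    induction l with
    | nil => intro i x hi; simp at hi
    | cons a l ih =>
      intro i x hi
      rw [con_cons]
      rcases List.mem_cons.1 hi with rfl | hi
      · exact sq _ _
      · rw [anti, ih i x hi]; simp
  have con_nodup : ∀ (l : List ι) (x : CForm E), ¬ l.Nodup → con l x = 0 := by
    intro l
    induction l with
    | nil => intro x hx; simp at hx
    | cons a l ih =>
      intro x hx
      rw [con_cons]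
      by_cases ha : a ∈ l
      · exact con_mem l a x ha
      · rw [ih x (fun hl => hx (List.nodup_cons.2 ⟨ha, hl⟩))]; simp
  have con_long : ∀ (l : List ι) (x : CForm E), Fintype.card ι < l.length → con l x = 0 :=
    fun l x hl => con_nodup l x fun hn => absurd hn.length_le_card (not_le.2 hl)
  -- vanishing of the scalar parts
  have scal : ∀ (k : ℕ) (x : CForm E), (pairing b 1 k x x).re = 0 →
      ∀ l : List ι, l.length = k → scalarPart (con l x) = 0 := by
    intro k
    induction k with
    | zero =>
      intro x hx l hl
      rw [List.length_eq_zero_iff.1 hl]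
      rw [pairing, mul_comm, Complex.mul_conj, Complex.ofReal_re] at hx
      exact Complex.normSq_eq_zero.1 hx
    | succ k ih =>
      intro x hx l hl
      rw [pairing_one_succ, Complex.re_sum] at hx
      have := (Finset.sum_eq_zero_iff_of_nonneg
        (fun i _ => re_pairing_one_nonneg b k (interior (b i) x))).1 hx
      obtain ⟨l', i, rfl⟩ : ∃ l' i, l = l' ++ [i] := by
        rcases List.eq_nil_or_concat l with rfl | ⟨l', i, rfl⟩
        · simp at hl
        · exact ⟨l', i, by simp⟩
      rw [con_append]
      exact ih _ (this i (Finset.mem_univ _)) l' (by simpa using hl)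
  have scal' : ∀ l : List ι, scalarPart (con l α) = 0 := by
    intro l
    by_cases hl : l.length ≤ Fintype.card ι
    · exact scal _ α (h _ hl) l rfl
    · rw [con_long l α (not_le.1 hl), map_zero]
  -- the number operator
  let co : ι → (E →ₗ[ℝ] ℂ) := fun i => Complex.ofRealCLM.toLinearMap ∘ₗ b.coord i
  have hco : ∀ a : E →ₗ[ℝ] ℂ, ∑ i, a (b i) • co i = a := by
    intro a
    refine b.ext fun j => ?_
    rw [LinearMap.sum_apply, Finset.sum_eq_single j]
    · simp [co]
    · intro i _ hi; simp [co, Ne.symm hi]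
    · simp
  let D : CForm E →ₗ[ℂ] CForm E := ∑ i, (LinearMap.mulLeft ℂ (ExteriorAlgebra.ι ℂ (co i))) ∘ₗ
    interior (b i)
  have hD : ∀ x, D x = ∑ i, ExteriorAlgebra.ι ℂ (co i) * interior (b i) x := by
    intro x; simp [D, LinearMap.sum_apply]
  have hDι : ∀ a x, D (ExteriorAlgebra.ι ℂ a * x) =
      ExteriorAlgebra.ι ℂ a * x + ExteriorAlgebra.ι ℂ a * D x := by
    intro a x
    rw [hD, hD, Finset.mul_sum]
    simp only [interior_ι_mul, mul_sub, Finset.sum_sub_distrib]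
    have h1 : ∑ i, ExteriorAlgebra.ι ℂ (co i) * a (b i) • x = ExteriorAlgebra.ι ℂ a * x := by
      conv_rhs => rw [← hco a]
      rw [map_sum, Finset.sum_mul]
      refine Finset.sum_congr rfl fun i _ => ?_
      rw [map_smul, smul_mul_assoc, mul_smul_comm]
    rw [h1, sub_eq_add_neg, ← Finset.sum_neg_distrib]
    congr 1
    refine Finset.sum_congr rfl fun i _ => ?_
    have hs := ExteriorAlgebra.ι_add_mul_swap (R := ℂ) (co i) a
    rw [← mul_assoc, ← mul_assoc, eq_neg_of_add_eq_zero_left hs]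
    simp
  have hDdeg : ∀ (k : ℕ) (w : Fin k → (E →ₗ[ℝ] ℂ)),
      D (ExteriorAlgebra.ιMulti ℂ k w) = (k : ℂ) • ExteriorAlgebra.ιMulti ℂ k w := by
    intro k
    induction k with
    | zero =>
      intro w
      have : (1 : CForm E) = algebraMap ℂ (CForm E) 1 := by simp
      rw [ExteriorAlgebra.ιMulti_zero_apply, hD, this]
      simp only [interior_algebraMap]
      simp
    | succ k ih =>
      intro w
      rw [ExteriorAlgebra.ιMulti_succ_apply, hDι, ih]
      push_cast
      rw [add_smul, one_smul, mul_smul_comm, add_comm]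
  have kill : ∀ x : CForm E, (∀ i, interior (b i) x = 0) → scalarPart x = 0 → x = 0 := by
    intro x hx hs
    have hDx : D x = 0 := by rw [hD]; simp [hx]
    let B := (Module.finBasis ℂ (E →ₗ[ℝ] ℂ)).ExteriorAlgebra
    have hB : ∀ s, D (B s) = (s.card : ℂ) • B s := by
      intro s
      have : B s = ExteriorAlgebra.ιMulti ℂ s.card _ :=
        ExteriorAlgebra.basis_apply (Module.finBasis ℂ (E →ₗ[ℝ] ℂ)) s
      rw [this]
      exact hDdeg _ _
    have hx1 : ∑ s, (B.repr x s * s.card) • B s = 0 := by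
      rw [← hDx]
      conv_rhs => rw [← B.sum_repr x]
      rw [map_sum]
      refine Finset.sum_congr rfl fun s _ => ?_
      rw [map_smul, hB, mul_smul]
    have hx2 : ∀ s, B.repr x s * s.card = 0 := by
      have := (Fintype.linearIndependent_iff.1 B.linearIndependent) _ hx1
      exact this
    have hB0 : B ∅ = 1 := by
      have : B ∅ = ExteriorAlgebra.ιMulti ℂ 0 _ :=
        ExteriorAlgebra.basis_apply (Module.finBasis ℂ (E →ₗ[ℝ] ℂ)) ∅
      rw [this]
      exact ExteriorAlgebra.ιMulti_zero_apply _
    have hx3 : x = B.repr x ∅ • 1 := by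
      conv_lhs => rw [← B.sum_repr x]
      rw [Finset.sum_eq_single ∅, hB0]
      · intro s _ hs
        have : (s.card : ℂ) ≠ 0 := by
          simpa [Finset.card_eq_zero] using hs
        rw [(mul_eq_zero.1 (hx2 s)).resolve_right this, zero_smul]
      · simp
    rw [hx3, map_smul, map_one, smul_eq_mul, mul_one] at hs
    rw [hx3, hs, zero_smul]
  -- downward induction on the length
  have main : ∀ (m : ℕ) (l : List ι), Fintype.card ι + 1 ≤ l.length + m → con l α = 0 := by
    intro m
    induction m with
    | zero => intro l hl; exact con_long l α (by omega)
    | succ m ih =>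
      intro l hl
      refine kill _ (fun i => ?_) (scal' l)
      rw [← con_cons]
      exact ih _ (by simp; omega)
  exact main (Fintype.card ι + 1) [] (by simp)

end Pairing
end Algebra
end CForm

namespace CForm

/-- A positive definite Hermitian form on a complex vector space (conjugate-linear in the first
variable). -/
structure IsHermitianInner {E : Type*} [AddCommGroup E] [Module ℂ E]
    (h : E →ₗ⋆[ℂ] E →ₗ[ℂ] ℂ) : Prop where
  conj_symm : ∀ v w, conj (h w v) = h v w
  pos : ∀ v, v ≠ 0 → 0 < (h v v).re

/-- The Gram matrix of vectors `b i` for the real inner product `Re h`. -/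
def gram {E ι : Type*} [AddCommGroup E] [Module ℂ E] (h : E →ₗ⋆[ℂ] E →ₗ[ℂ] ℂ) (b : ι → E) :
    Matrix ι ι ℝ := Matrix.of fun i j => (h (b i) (b j)).re

lemma exists_orthonormal_basis {V : Type*} [AddCommGroup V] [Module ℝ V] [FiniteDimensional ℝ V]
    (g : V →ₗ[ℝ] V →ₗ[ℝ] ℝ) (hs : ∀ v w, g w v = g v w) (hp : ∀ v, v ≠ 0 → 0 < g v v) :
    ∃ e : Module.Basis (Fin (Module.finrank ℝ V)) ℝ V,
      ∀ i j, g (e i) (e j) = if i = j then 1 else 0 := by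
  let core : InnerProductSpace.Core ℝ V :=
    { inner := fun v w => g v w
      conj_inner_symm := fun v w => hs v w
      re_inner_nonneg := fun v => by
        by_cases hv : v = 0
        · simp [hv]
        · exact (hp v hv).le
      add_left := fun u v w => by simp
      smul_left := fun u v r => by simp
      definite := fun v hv => by
        by_contra hne
        exact (hp v hne).ne' hv }
  let _ : NormedAddCommGroup V := core.toNormedAddCommGroup
  let _ : InnerProductSpace ℝ V := InnerProductSpace.ofCore core.toCore
  refine ⟨(stdOrthonormalBasis ℝ V).toBasis, fun i j => ?_⟩
  rw [OrthonormalBasis.coe_toBasis]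
  exact orthonormal_iff_ite.1 (stdOrthonormalBasis ℝ V).orthonormal i j

section Metric

variable {E F : Type*} [NormedAddCommGroup E] [NormedSpace ℂ E] [FiniteDimensional ℂ E]
  [NormedAddCommGroup F] [NormedSpace ℂ F] [FiniteDimensional ℂ F]

/-- The Hermitian inner product on complex-valued forms induced by a Hermitian inner product `h` on
`E`, normalised so that the forms `dz^I ∧ dz̄^J` are orthonormal whenever `z₁, …, zₙ` are the
coordinates of an `h`-unitary basis. With `g^{ij}` the inverse of the Gram matrix of `Re h` in a
real basis `b`, it is the usual
`⟨α, β⟩ = ∑ k, 1 / (2 ^ k * k!) * ∑ g^{i₁ j₁} ⋯ g^{iₖ jₖ} * conj (α (b i₁, …)) * β (b j₁, …)`;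
the factor `2 ^ k` accounts for `|dz|² = 2` in the real normalisation `|dx| = |dy| = 1`. -/
def inner (h : E →ₗ⋆[ℂ] E →ₗ[ℂ] ℂ) (α β : CForm E) : ℂ :=
  ∑ k ∈ Finset.range (Module.finrank ℝ E + 1), (1 / (2 ^ k * k.factorial : ℝ) : ℝ) *
    pairing (Module.finBasis ℝ E) (gram h (Module.finBasis ℝ E))⁻¹ k α β

lemma gram_isSymm {ι : Type*} {h : E →ₗ⋆[ℂ] E →ₗ[ℂ] ℂ} (hh : IsHermitianInner h) (b : ι → E) :
    (gram h b).IsSymm := by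
  ext i j
  simp only [gram, Matrix.transpose_apply, Matrix.of_apply]
  rw [← hh.conj_symm, Complex.conj_re]

lemma exists_frame {h : E →ₗ⋆[ℂ] E →ₗ[ℂ] ℂ} (hh : IsHermitianInner h) :
    ∃ e : Module.Basis (Fin (Module.finrank ℝ E)) ℝ E,
      ∀ (b : Fin (Module.finrank ℝ E) → E), LinearIndependent ℝ b → ∀ k α β,
      pairing b (gram h b)⁻¹ k α β = pairing e 1 k α β := by
  let g : E →ₗ[ℝ] E →ₗ[ℝ] ℝ := LinearMap.mk₂ ℝ (fun v w => (h v w).re)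
    (by intros; simp)
    (by
      intro c v w
      have : c • v = (c : ℂ) • v := (Complex.coe_smul c v).symm
      rw [this, map_smulₛₗ]; simp)
    (by intros; simp)
    (by
      intro c v w
      have : c • w = (c : ℂ) • w := (Complex.coe_smul c w).symm
      rw [this, map_smul]; simp)
  obtain ⟨e, he⟩ := exists_orthonormal_basis g
    (fun v w => by simp only [g, LinearMap.mk₂_apply]; rw [← hh.conj_symm, Complex.conj_re])
    (fun v hv => hh.pos v hv)
  refine ⟨e, fun b hb k α β => ?_⟩
  let b' : Module.Basis (Fin (Module.finrank ℝ E)) ℝ E :=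
    Module.Basis.mk hb (hb.span_eq_top_of_card_eq_finrank' (by simp)).ge
  have hb' : ∀ i, b' i = b i := fun i => by simp [b']
  let P : Matrix (Fin (Module.finrank ℝ E)) (Fin (Module.finrank ℝ E)) ℝ := b'.toMatrix e
  have hP : ∀ i, e i = ∑ l, P l i • b l := by
    intro i
    simp only [← hb']
    exact (b'.sum_toMatrix_smul_self e i).symm
  have hg : P.transpose * gram h b * P = 1 := by
    ext i j
    have : g (e i) (e j) = (P.transpose * gram h b * P) i j := by
      rw [hP i, hP j]
      simp only [map_sum, LinearMap.sum_apply, map_smul, LinearMap.smul_apply, smul_eq_mul,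
        Matrix.mul_apply, Matrix.transpose_apply, Finset.sum_mul, gram, Matrix.of_apply]
      refine Finset.sum_congr rfl fun l _ => ?_
      rw [Finset.mul_sum]
      refine Finset.sum_congr rfl fun m _ => ?_
      simp only [g, LinearMap.mk₂_apply]
      ring
    rw [← this, he, Matrix.one_apply]
  have hinv : (gram h b)⁻¹ = P * 1 * P.transpose := by
    have h1 : P * (P.transpose * gram h b) = 1 := mul_eq_one_comm.1 hg
    rw [mul_one]
    refine Matrix.inv_eq_left_inv ?_
    rw [Matrix.mul_assoc, h1]
  rw [hinv, ← pairing_change b e P hP 1]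

lemma exists_frame_inner {h : E →ₗ⋆[ℂ] E →ₗ[ℂ] ℂ} (hh : IsHermitianInner h) :
    ∃ e : Module.Basis (Fin (Module.finrank ℝ E)) ℝ E, ∀ α β, inner h α β =
      ∑ k ∈ Finset.range (Module.finrank ℝ E + 1), (1 / (2 ^ k * k.factorial : ℝ) : ℝ) *
        pairing e 1 k α β := by
  obtain ⟨e, he⟩ := exists_frame hh
  refine ⟨e, fun α β => ?_⟩
  simp only [inner, he _ (Module.finBasis ℝ E).linearIndependent]

/-- The inner product on forms, as a core. -/
@[reducible] def innerCore {h : E →ₗ⋆[ℂ] E →ₗ[ℂ] ℂ} (hh : IsHermitianInner h) :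
    InnerProductSpace.Core ℂ (CForm E) where
  inner := inner h
  conj_inner_symm α β := by
    simp only [inner, map_sum, map_mul, Complex.conj_ofReal]
    refine Finset.sum_congr rfl fun k _ => ?_
    rw [conj_pairing]
    have := gram_isSymm hh (Module.finBasis ℝ E)
    rw [Matrix.IsSymm, Matrix.transpose_nonsing_inv, this]
  re_inner_nonneg α := by
    obtain ⟨e, he⟩ := exists_frame_inner hh
    rw [he]
    simp only [RCLike.re_to_complex, Complex.re_sum, Complex.re_ofReal_mul]
    exact Finset.sum_nonneg fun k _ => mul_nonneg (by positivity) (re_pairing_one_nonneg _ _ _)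
  add_left α β γ := by
    simp only [inner, pairing_add_left, mul_add, Finset.sum_add_distrib]
  smul_left α β r := by
    simp only [inner, pairing_smul_left, Finset.mul_sum]
    exact Finset.sum_congr rfl fun k _ => by ring
  definite α hα := by
    obtain ⟨e, he⟩ := exists_frame_inner hh
    refine eq_zero_of_pairing e α fun k hk => ?_
    rw [Fintype.card_fin] at hk
    have h0 : (inner h α α).re = 0 := by
      have : inner h α α = 0 := hα
      rw [this, Complex.zero_re]
    rw [he] at h0
    simp only [Complex.re_sum, Complex.re_ofReal_mul] at h0
    have := (Finset.sum_eq_zero_iff_of_nonneg fun k _ =>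
      mul_nonneg (by positivity) (re_pairing_one_nonneg _ _ _)).1 h0 k
      (Finset.mem_range.2 (by omega))
    exact (mul_eq_zero.1 this).resolve_left (by positivity)

lemma pairing_pullback {ι : Type*} [Fintype ι] (A : E →ₗ[ℝ] F) (b : ι → E) (c : Matrix ι ι ℝ)
    (k : ℕ) (α β : CForm F) :
    pairing b c k (pullback A α) (pullback A β) = pairing (fun i => A (b i)) c k α β := by
  induction k generalizing α β with
  | zero => simp [pairing, scalarPart_pullback]
  | succ k ih => simp [pairing, interior_pullback, ih]

/-- The inner product may be computed in any frame obtained by a linear isomorphism `A`. -/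
lemma inner_eq_frame {h : E →ₗ⋆[ℂ] E →ₗ[ℂ] ℂ} (hh : IsHermitianInner h) (A : E →L[ℂ] E)
    (hA : Function.Injective A) (α β : CForm E) :
    inner h α β = ∑ k ∈ Finset.range (Module.finrank ℝ E + 1), (1 / (2 ^ k * k.factorial : ℝ) : ℝ) *
      pairing (Module.finBasis ℝ E) (gram h fun i => A (Module.finBasis ℝ E i))⁻¹ k
        (pullback (A.restrictScalars ℝ).toLinearMap α)
        (pullback (A.restrictScalars ℝ).toLinearMap β) := by
  obtain ⟨e, he⟩ := exists_frame hh
  have hli : LinearIndependent ℝ fun i => A (Module.finBasis ℝ E i) :=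
    (Module.finBasis ℝ E).linearIndependent.map' (A.restrictScalars ℝ).toLinearMap
      (LinearMap.ker_eq_bot.2 hA)
  simp only [inner, pairing_pullback]
  refine Finset.sum_congr rfl fun k _ => ?_
  rw [he _ (Module.finBasis ℝ E).linearIndependent]
  exact congrArg _ (he _ hli k α β).symm

lemma pairing_parity {ι : Type*} [Fintype ι] (b : ι → E) (c : Matrix ι ι ℝ)
    (k : ℕ) (α β : CForm E) :
    pairing b c k (parity α) (parity β) = pairing b c k α β := by
  induction k generalizing α β with
  | zero => simp [pairing, scalarPart_parity]
  | succ k ih =>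
    have hneg : ∀ γ δ : CForm E, pairing b c k (-γ) (-δ) = pairing b c k γ δ := by
      intro γ δ
      have h1 := pairing_smul_left b c k (-1) γ (-δ)
      have h2 := pairing_smul_right b c k (-1) γ δ
      simp only [neg_smul, one_smul, map_neg, map_one] at h1 h2
      rw [h1, h2]; ring
    simp [pairing, interior_parity, ih, hneg]

lemma inner_parity (h : E →ₗ⋆[ℂ] E →ₗ[ℂ] ℂ) (α β : CForm E) :
    inner h (parity α) (parity β) = inner h α β := by
  simp [inner, pairing_parity]

instance : Module.Finite ℂ (CForm E) :=
  Module.Finite.of_basis (Module.finBasis ℂ (E →ₗ[ℝ] ℂ)).ExteriorAlgebra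

end Metric

/-- The forms of bidegree `(p, q)`: linear combinations of wedge products of `p` complex-linear and
`q` conjugate-linear covectors. -/
def bidegree (E : Type*) [NormedAddCommGroup E] [NormedSpace ℂ E] (p q : ℕ) :
    Submodule ℂ (CForm E) :=
  Submodule.span ℂ (ExteriorAlgebra.ι ℂ '' {a : E →ₗ[ℝ] ℂ | ∀ v, a (Complex.I • v) =
    Complex.I * a v}) ^ p *
  Submodule.span ℂ (ExteriorAlgebra.ι ℂ '' {a : E →ₗ[ℝ] ℂ | ∀ v, a (Complex.I • v) =
    -Complex.I * a v}) ^ q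

/-- The covector `∂̄ψ = ∑ (∂ψ/∂z̄ₖ) dz̄ₖ` of a smooth function `ψ`: the conjugate-linear part of the
real derivative of `ψ` at `z`. -/
def dbarFun {E : Type*} [NormedAddCommGroup E] [NormedSpace ℂ E] (ψ : E → ℂ) (z : E) :
    E →ₗ[ℝ] ℂ where
  toFun v := (fderiv ℝ ψ z v + Complex.I * fderiv ℝ ψ z (Complex.I • v)) / 2
  map_add' v w := by simp only [smul_add, map_add]; ring
  map_smul' r v := by
    simp only [smul_comm Complex.I r v, map_smul, Complex.real_smul, RingHom.id_apply]
    ring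

end CForm

/-! ### Hermitian manifolds -/

/-- A complex manifold with a smooth Hermitian metric. The tangent space at `x` is
`TangentSpace 𝓘(ℂ, Model) x`, i.e. a copy of `Model`, identified by means of the chart at `x`. -/
structure HermitianManifold where
  /-- The finite-dimensional complex vector space on which the manifold is modelled. -/
  Model : Type u
  /-- The points of the manifold. -/
  Carrier : Type v
  [normedAddCommGroup : NormedAddCommGroup Model]
  [normedSpace : NormedSpace ℂ Model]
  [finiteDimensional : FiniteDimensional ℂ Model]
  [measurableSpaceModel : MeasurableSpace Model]
  [borelSpaceModel : BorelSpace Model]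
  [topologicalSpace : TopologicalSpace Carrier]
  [t2Space : T2Space Carrier]
  [secondCountableTopology : SecondCountableTopology Carrier]
  [measurableSpace : MeasurableSpace Carrier]
  [borelSpace : BorelSpace Carrier]
  [chartedSpace : ChartedSpace Model Carrier]
  [isManifold : IsManifold 𝓘(ℂ, Model) ω Carrier]
  /-- The Hermitian metric on the tangent spaces. -/
  metric : Carrier → Model →ₗ⋆[ℂ] Model →ₗ[ℂ] ℂ
  metric_hermitian : ∀ x, CForm.IsHermitianInner (metric x)
  /-- The components of the metric in the chart at any point `x₀` are smooth. -/
  metric_smooth : ∀ (x₀ : Carrier) (v w : Model), ContDiffOn ℝ ∞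
    (fun z => metric ((chartAt Model x₀).symm z)
      (tangentCoordChange 𝓘(ℂ, Model) x₀ ((chartAt Model x₀).symm z)
        ((chartAt Model x₀).symm z) v)
      (tangentCoordChange 𝓘(ℂ, Model) x₀ ((chartAt Model x₀).symm z)
        ((chartAt Model x₀).symm z) w))
    (chartAt Model x₀).target

namespace HermitianManifold

attribute [instance] normedAddCommGroup normedSpace finiteDimensional measurableSpaceModel
  borelSpaceModel topologicalSpace t2Space secondCountableTopology measurableSpace borelSpace
  chartedSpace isManifold

instance : CoeSort HermitianManifold.{u, v} (Type v) := ⟨Carrier⟩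

variable (X : HermitianManifold.{u, v})

/-- The chart at `x₀`. -/
abbrev chart (x₀ : X) : OpenPartialHomeomorph X X.Model := chartAt X.Model x₀

/-- The coordinate frame of the chart at `x₀`: the derivative of the inverse of this chart, a linear
map from `X.Model` to the tangent space at `x`, meaningful for `x` in the domain of the chart. -/
abbrev frame (x₀ x : X) : X.Model →L[ℂ] X.Model := tangentCoordChange 𝓘(ℂ, X.Model) x₀ x x

/-- The real Gram matrix `(g_{ij})` of the metric at `x` in the chart at `x₀` (with respect to the
real coordinates of a fixed basis of the model space). -/
def gramAt (x₀ x : X) :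
    Matrix (Fin (Module.finrank ℝ X.Model)) (Fin (Module.finrank ℝ X.Model)) ℝ :=
  CForm.gram (X.metric x) fun i => X.frame x₀ x (Module.finBasis ℝ X.Model i)

/-- The Riemannian volume `√(det g) dx` on the domain of the chart at `x₀`. -/
def chartVolume (x₀ : X) : Measure X :=
  (((Module.finBasis ℝ X.Model).addHaar.restrict (X.chart x₀).target).withDensity fun z =>
    ENNReal.ofReal √((X.gramAt x₀ ((X.chart x₀).symm z)).det)).map (X.chart x₀).symm

/-- The volume measure of the Hermitian metric: the smallest measure that dominates the volumes on
the chart domains. Since any two of these agree on the overlap of their domains, it restricts to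
`X.chartVolume x₀` on the domain of the chart at `x₀`. -/
def volume : Measure X := ⨆ x₀ : X, X.chartVolume x₀

/-- The measure `e^{-φ} dV` on `Ω`. -/
def weightedVolume (Ω : Set X) (φ : X → ℝ) : Measure X :=
  (X.volume.restrict Ω).withDensity fun x => ENNReal.ofReal (Real.exp (-φ x))

/-- A (not necessarily continuous) complex-valued differential form on `X`, all degrees together:
at each point `x` an exterior form on the tangent space at `x`. -/
abbrev Form : Type _ := X → CForm X.Model

variable {X} in
/-- The form `f` at the point `x`, expressed in the coordinates of the chart at `x₀`. -/
def Form.inChart (f : X.Form) (x₀ x : X) : CForm X.Model :=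
  CForm.pullback ((X.frame x₀ x).restrictScalars ℝ).toLinearMap (f x)

variable {X} in
/-- A form is measurable if its coefficients in each chart are. -/
def Form.AEMeas (f : X.Form) (m : Measure X) : Prop :=
  ∀ (x₀ : X) (l : Module.Dual ℂ (CForm X.Model)),
    AEStronglyMeasurable (fun x => l (f.inChart x₀ x)) (m.restrict (X.chart x₀).source)

/-- The inner product on forms at the point `x`. -/
def fiberInner (x : X) (α β : CForm X.Model) : ℂ := CForm.inner (X.metric x) α β

@[reducible] def fiberCore (x : X) : InnerProductSpace.Core ℂ (CForm X.Model) :=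
  CForm.innerCore (X.metric_hermitian x)

lemma frame_injective {x₀ x : X} (hx : x ∈ (X.chart x₀).source) :
    Function.Injective (X.frame x₀ x) := by
  have h : Function.LeftInverse (tangentCoordChange 𝓘(ℂ, X.Model) x x₀ x) (X.frame x₀ x) := by
    intro v
    have hx' : x ∈ (extChartAt 𝓘(ℂ, X.Model) x₀).source := by simpa using hx
    have hxx : x ∈ (extChartAt 𝓘(ℂ, X.Model) x).source := mem_extChartAt_source x
    rw [frame, tangentCoordChange_comp ⟨⟨hx', hxx⟩, hx'⟩, tangentCoordChange_self hx']
  exact h.injective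

lemma continuousOn_gramAt (x₀ : X) (i j : Fin (Module.finrank ℝ X.Model)) :
    ContinuousOn (fun x => X.gramAt x₀ x i j) (X.chart x₀).source := by
  have h := (X.metric_smooth x₀ (Module.finBasis ℝ X.Model i)
    (Module.finBasis ℝ X.Model j)).continuousOn
  have h2 := h.comp (X.chart x₀).continuousOn (X.chart x₀).mapsTo
  refine (Complex.continuous_re.comp_continuousOn h2).congr fun x hx => ?_
  simp only [gramAt, CForm.gram, Matrix.of_apply, Function.comp, (X.chart x₀).left_inv hx]

lemma aestronglyMeasurable_pairing {α : Type*} [MeasurableSpace α] {m : Measure α} {E ι : Type*}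
    [AddCommGroup E] [Module ℝ E] [Fintype ι] (b : ι → E) (c : α → Matrix ι ι ℝ)
    (hc : ∀ i j, AEStronglyMeasurable (fun x => c x i j) m) (k : ℕ) (f g : α → CForm E)
    (hf : ∀ l : Module.Dual ℂ (CForm E), AEStronglyMeasurable (fun x => l (f x)) m)
    (hg : ∀ l : Module.Dual ℂ (CForm E), AEStronglyMeasurable (fun x => l (g x)) m) :
    AEStronglyMeasurable (fun x => CForm.pairing b (c x) k (f x) (g x)) m := by
  induction k generalizing f g with
  | zero =>
    exact (Complex.continuous_conj.comp_aestronglyMeasurable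
      (hf CForm.scalarPart.toLinearMap)).mul (hg CForm.scalarPart.toLinearMap)
  | succ k ih =>
    simp only [CForm.pairing]
    refine Finset.aestronglyMeasurable_fun_sum _ fun i _ =>
      Finset.aestronglyMeasurable_fun_sum _ fun j _ => ?_
    refine (Complex.continuous_ofReal.comp_aestronglyMeasurable (hc i j)).mul (ih _ _ ?_ ?_)
    · exact fun l => hf (l ∘ₗ CForm.interior (b i))
    · exact fun l => hg (l ∘ₗ CForm.interior (b j))

lemma exists_countable_charts : ∃ T : Set X, T.Countable ∧ ⋃ x ∈ T, (X.chart x).source = univ := by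
  obtain ⟨T, hT, h⟩ := TopologicalSpace.isOpen_iUnion_countable
    (fun x : X => (X.chart x).source) fun x => (X.chart x).open_source
  refine ⟨T, hT, h.trans ?_⟩
  exact eq_univ_of_forall fun x => mem_iUnion.2 ⟨x, mem_chart_source X.Model x⟩

lemma aestronglyMeasurable_of_chart {β : Type*} [TopologicalSpace β]
    [TopologicalSpace.PseudoMetrizableSpace β] {m : Measure X} {F : X → β}
    (h : ∀ x₀ : X, AEStronglyMeasurable F (m.restrict (X.chart x₀).source)) :
    AEStronglyMeasurable F m := by
  obtain ⟨T, hT, hU⟩ := X.exists_countable_charts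
  have : Countable T := hT.to_subtype
  rw [← m.restrict_univ, ← hU, biUnion_eq_iUnion]
  exact AEStronglyMeasurable.iUnion fun x => h x

lemma aestronglyMeasurable_fiberInner {m : Measure X} {f g : X.Form} (hf : f.AEMeas m)
    (hg : g.AEMeas m) : AEStronglyMeasurable (fun x => X.fiberInner x (f x) (g x)) m := by
  refine X.aestronglyMeasurable_of_chart fun x₀ => ?_
  have hcont := X.continuousOn_gramAt x₀
  have hmeas : MeasurableSet (X.chart x₀).source := (X.chart x₀).open_source.measurableSet
  have hinv : ∀ i j, AEStronglyMeasurable (fun x => (X.gramAt x₀ x)⁻¹ i j)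
      (m.restrict (X.chart x₀).source) := by
    intro i j
    have hA : ContinuousOn (fun x => X.gramAt x₀ x) (X.chart x₀).source :=
      continuousOn_pi.2 fun i => continuousOn_pi.2 fun j => hcont i j
    have hdet : ContinuousOn (fun x => (X.gramAt x₀ x).det) (X.chart x₀).source :=
      (Continuous.matrix_det continuous_id).comp_continuousOn hA
    have hadj : ContinuousOn (fun x => (X.gramAt x₀ x).adjugate i j) (X.chart x₀).source :=
      ((continuous_apply_apply i j).comp (Continuous.matrix_adjugate continuous_id)).comp_continuousOn hA
    simp only [Matrix.inv_def, Ring.inverse_eq_inv', Matrix.smul_apply, smul_eq_mul]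
    exact ((hdet.aemeasurable hmeas).inv.aestronglyMeasurable).mul
      (hadj.aestronglyMeasurable hmeas)
  have key : AEStronglyMeasurable (fun x =>
      ∑ k ∈ Finset.range (Module.finrank ℝ X.Model + 1), (1 / (2 ^ k * k.factorial : ℝ) : ℝ) *
        CForm.pairing (Module.finBasis ℝ X.Model) (X.gramAt x₀ x)⁻¹ k (f.inChart x₀ x)
          (g.inChart x₀ x)) (m.restrict (X.chart x₀).source) :=
    Finset.aestronglyMeasurable_fun_sum _ fun k _ => aestronglyMeasurable_const.mul
      (aestronglyMeasurable_pairing _ _ hinv k _ _ (hf x₀) (hg x₀))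
  refine key.congr ?_
  filter_upwards [ae_restrict_mem hmeas] with x hx
  exact (CForm.inner_eq_frame (X.metric_hermitian x) _ (X.frame_injective hx) _ _).symm

lemma fiberInner_re_nonneg (x : X) (α : CForm X.Model) : 0 ≤ (X.fiberInner x α α).re :=
  (X.fiberCore x).re_inner_nonneg α

lemma fiberInner_conj (x : X) (α β : CForm X.Model) :
    conj (X.fiberInner x β α) = X.fiberInner x α β :=
  (X.fiberCore x).conj_inner_symm α β

lemma fiberInner_add_left (x : X) (α β γ : CForm X.Model) :
    X.fiberInner x (α + β) γ = X.fiberInner x α γ + X.fiberInner x β γ :=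
  (X.fiberCore x).add_left α β γ

lemma fiberInner_smul_left (x : X) (α β : CForm X.Model) (r : ℂ) :
    X.fiberInner x (r • α) β = conj r * X.fiberInner x α β :=
  (X.fiberCore x).smul_left α β r

lemma norm_fiberInner_le (x : X) (α β : CForm X.Model) :
    ‖X.fiberInner x α β‖ ≤ (X.fiberInner x α α).re + (X.fiberInner x β β).re := by
  let _ : NormedAddCommGroup (CForm X.Model) := (X.fiberCore x).toNormedAddCommGroup
  let _ : InnerProductSpace ℂ (CForm X.Model) := InnerProductSpace.ofCore (X.fiberCore x).toCore
  have h1 : ‖X.fiberInner x α β‖ ≤ ‖α‖ * ‖β‖ := norm_inner_le_norm (𝕜 := ℂ) α β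
  have h2 : (X.fiberInner x α α).re = ‖α‖ ^ 2 := (norm_sq_eq_re_inner (𝕜 := ℂ) α).symm
  have h3 : (X.fiberInner x β β).re = ‖β‖ ^ 2 := (norm_sq_eq_re_inner (𝕜 := ℂ) β).symm
  rw [h2, h3]
  nlinarith [sq_nonneg (‖α‖ - ‖β‖), sq_nonneg ‖α‖, sq_nonneg ‖β‖]

lemma fiberInner_add_self_le (x : X) (α β : CForm X.Model) :
    (X.fiberInner x (α + β) (α + β)).re ≤
      2 * (X.fiberInner x α α).re + 2 * (X.fiberInner x β β).re := by
  let _ : NormedAddCommGroup (CForm X.Model) := (X.fiberCore x).toNormedAddCommGroup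
  let _ : InnerProductSpace ℂ (CForm X.Model) := InnerProductSpace.ofCore (X.fiberCore x).toCore
  have h : ∀ γ, (X.fiberInner x γ γ).re = ‖γ‖ ^ 2 := fun γ =>
    (norm_sq_eq_re_inner (𝕜 := ℂ) γ).symm
  rw [h, h, h]
  have := norm_add_le α β
  nlinarith [sq_nonneg (‖α‖ - ‖β‖), norm_nonneg (α + β)]

lemma Form.AEMeas.add {X : HermitianManifold.{u, v}} {m : Measure X} {f g : X.Form}
    (hf : f.AEMeas m) (hg : g.AEMeas m) : Form.AEMeas (f + g) m := by
  intro x₀ l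
  refine ((hf x₀ l).add (hg x₀ l)).congr (Filter.Eventually.of_forall fun x => ?_)
  simp [Form.inChart]

lemma Form.AEMeas.smul {X : HermitianManifold.{u, v}} {m : Measure X} {f : X.Form} (r : ℂ)
    (hf : f.AEMeas m) : Form.AEMeas (r • f) m := by
  intro x₀ l
  refine ((hf x₀ l).const_mul r).congr (Filter.Eventually.of_forall fun x => ?_)
  simp [Form.inChart]

/-! ### The Hilbert space of square integrable forms -/

/-- The measurable forms on `X` that are square integrable with respect to the measure `m`. -/
def squareIntegrable (m : Measure X) : Submodule ℂ X.Form where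
  carrier := {f | f.AEMeas m ∧ Integrable (fun x => (X.fiberInner x (f x) (f x)).re) m}
  zero_mem' := by
    refine ⟨fun x₀ l => ?_, ?_⟩
    · simp [Form.inChart, aestronglyMeasurable_const]
    · have : ∀ x, X.fiberInner x 0 0 = 0 := fun x => by
        simpa using X.fiberInner_smul_left x 0 0 0
      simp [this]
  add_mem' := by
    rintro f g ⟨hf, hf'⟩ ⟨hg, hg'⟩
    refine ⟨hf.add hg, ((hf'.const_mul 2).add (hg'.const_mul 2)).mono
      (Complex.continuous_re.comp_aestronglyMeasurable
        (X.aestronglyMeasurable_fiberInner (hf.add hg) (hf.add hg)))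
      (Filter.Eventually.of_forall fun x => ?_)⟩
    rw [Real.norm_of_nonneg (X.fiberInner_re_nonneg x _)]
    exact (X.fiberInner_add_self_le x (f x) (g x)).trans (le_abs_self _)
  smul_mem' := by
    rintro r f ⟨hf, hf'⟩
    refine ⟨hf.smul r, (hf'.const_mul (‖r‖ ^ 2)).congr (Filter.Eventually.of_forall fun x => ?_)⟩
    have : X.fiberInner x (r • f x) (r • f x) =
        ((‖r‖ ^ 2 : ℝ) : ℂ) * X.fiberInner x (f x) (f x) := by
      rw [X.fiberInner_smul_left, ← X.fiberInner_conj, X.fiberInner_smul_left, map_mul,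
        X.fiberInner_conj, Complex.conj_conj, ← mul_assoc, mul_comm (conj r), Complex.mul_conj,
        Complex.normSq_eq_norm_sq]
    simp only [Pi.smul_apply, this, Complex.re_ofReal_mul]

/-- The square integrable forms on `Ω` with weight `φ`. Only their values on `Ω` matter; two of
them that agree almost everywhere on `Ω` have distance zero. -/
def PreL2 (Ω : Set X) (φ : X → ℝ) : Type _ := X.squareIntegrable (X.weightedVolume Ω φ)

namespace PreL2

variable {X} {Ω : Set X} {φ : X → ℝ}

instance : AddCommGroup (X.PreL2 Ω φ) :=
  inferInstanceAs (AddCommGroup (X.squareIntegrable (X.weightedVolume Ω φ)))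

instance : Module ℂ (X.PreL2 Ω φ) :=
  inferInstanceAs (Module ℂ (X.squareIntegrable (X.weightedVolume Ω φ)))

/-- The underlying form of an element of `PreL2`. -/
def form (f : X.PreL2 Ω φ) : X.Form := Subtype.val f

lemma form_add (f g : X.PreL2 Ω φ) : (f + g).form = f.form + g.form := rfl

lemma form_smul (r : ℂ) (f : X.PreL2 Ω φ) : (r • f).form = r • f.form := rfl

lemma form_aemeas (f : X.PreL2 Ω φ) : f.form.AEMeas (X.weightedVolume Ω φ) := f.2.1

lemma integrable_fiberInner (f g : X.PreL2 Ω φ) :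
    Integrable (fun x => X.fiberInner x (f.form x) (g.form x)) (X.weightedVolume Ω φ) := by
  refine (f.2.2.add g.2.2).mono (X.aestronglyMeasurable_fiberInner f.2.1 g.2.1)
    (Filter.Eventually.of_forall fun x => ?_)
  exact (X.norm_fiberInner_le x _ _).trans (le_abs_self _)

/-- The inner product `∫_Ω ⟨f, g⟩ e^{-φ} dV`. -/
instance : PreInnerProductSpace.Core ℂ (X.PreL2 Ω φ) where
  inner f g := ∫ x, X.fiberInner x (f.form x) (g.form x) ∂X.weightedVolume Ω φ
  conj_inner_symm f g := by
    rw [← integral_conj]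
    simp only [X.fiberInner_conj]
  re_inner_nonneg f := by
    have h : RCLike.re (∫ x, X.fiberInner x (f.form x) (f.form x) ∂X.weightedVolume Ω φ) =
      ∫ x, (X.fiberInner x (f.form x) (f.form x)).re ∂X.weightedVolume Ω φ :=
      (integral_re (integrable_fiberInner f f)).symm
    rw [h]
    exact integral_nonneg fun x => X.fiberInner_re_nonneg x _
  add_left f g k := by
    rw [← integral_add (integrable_fiberInner f k) (integrable_fiberInner g k)]
    simp only [form_add, Pi.add_apply, X.fiberInner_add_left]
  smul_left f g r := by
    rw [← integral_const_mul]
    simp only [form_smul, Pi.smul_apply, X.fiberInner_smul_left]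

instance : SeminormedAddCommGroup (X.PreL2 Ω φ) :=
  InnerProductSpace.Core.toSeminormedAddCommGroup (𝕜 := ℂ)

instance : InnerProductSpace ℂ (X.PreL2 Ω φ) := InnerProductSpace.ofCore inferInstance

lemma inner_def (f g : X.PreL2 Ω φ) :
    ⟪f, g⟫_ℂ = ∫ x, X.fiberInner x (f.form x) (g.form x) ∂X.weightedVolume Ω φ := rfl

end PreL2

/-- The Hilbert space `L²_*(Ω)` of square integrable forms of all degrees on `Ω`, with weight `φ`:
forms are identified if they agree almost everywhere on `Ω`. -/
abbrev L2 (Ω : Set X) (φ : X → ℝ) : Type _ := SeparationQuotient (X.PreL2 Ω φ)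

variable {X} in
/-- The class in `L²_*(Ω)` of a square integrable form. -/
def PreL2.toL2 {Ω : Set X} {φ : X → ℝ} (f : X.PreL2 Ω φ) : X.L2 Ω φ := SeparationQuotient.mk f

end HermitianManifold

namespace HermitianManifold

variable {X : HermitianManifold.{u, v}} {Ω : Set X} {φ : X → ℝ}

namespace PreL2

/-- The pointwise norm of a form. -/
def pointNorm (x : X) (α : CForm X.Model) : ℝ := √(X.fiberInner x α α).re

lemma pointNorm_nonneg (x : X) (α : CForm X.Model) : 0 ≤ pointNorm x α := Real.sqrt_nonneg _

lemma pointNorm_sq (x : X) (α : CForm X.Model) :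
    pointNorm x α ^ 2 = (X.fiberInner x α α).re := Real.sq_sqrt (X.fiberInner_re_nonneg x α)

lemma memLp_pointNorm (f : X.PreL2 Ω φ) :
    MemLp (fun x => pointNorm x (f.form x)) 2 (X.weightedVolume Ω φ) := by
  have hm : AEStronglyMeasurable (fun x => pointNorm x (f.form x)) (X.weightedVolume Ω φ) :=
    Real.continuous_sqrt.comp_aestronglyMeasurable
      (Complex.continuous_re.comp_aestronglyMeasurable
        (X.aestronglyMeasurable_fiberInner f.2.1 f.2.1))
  rw [memLp_two_iff_integrable_sq hm]
  simp only [pointNorm_sq]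
  exact f.2.2

lemma norm_toLp_pointNorm (f : X.PreL2 Ω φ) : ‖(memLp_pointNorm f).toLp _‖ = ‖f‖ := by
  have h1 : ‖(memLp_pointNorm f).toLp _‖ ^ 2 =
      ∫ x, (X.fiberInner x (f.form x) (f.form x)).re ∂X.weightedVolume Ω φ := by
    rw [← real_inner_self_eq_norm_sq, L2.inner_def]
    refine integral_congr_ae ?_
    filter_upwards [(memLp_pointNorm f).coeFn_toLp] with x hx
    rw [hx, real_inner_self_eq_norm_sq, Real.norm_of_nonneg (pointNorm_nonneg _ _), pointNorm_sq]
  have h2 : ‖f‖ ^ 2 =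
      ∫ x, (X.fiberInner x (f.form x) (f.form x)).re ∂X.weightedVolume Ω φ := by
    rw [@norm_sq_eq_re_inner ℂ, inner_def]
    exact (integral_re (integrable_fiberInner f f)).symm
  exact (sq_eq_sq₀ (norm_nonneg _) (norm_nonneg _)).1 (h1.trans h2.symm)

lemma norm_le_of_ae (f : X.PreL2 Ω φ) (G : Lp ℝ 2 (X.weightedVolume Ω φ))
    (h : ∀ᵐ x ∂X.weightedVolume Ω φ, pointNorm x (f.form x) ≤ G x) : ‖f‖ ≤ ‖G‖ := by
  rw [← norm_toLp_pointNorm f]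
  refine Lp.norm_le_norm_of_ae_le ?_
  filter_upwards [h, (memLp_pointNorm f).coeFn_toLp] with x hx hx'
  rw [hx', Real.norm_of_nonneg (pointNorm_nonneg _ _)]
  exact hx.trans (le_abs_self _)

lemma exists_limit_of_summable {V : Type*} [NormedAddCommGroup V] [InnerProductSpace ℂ V]
    [FiniteDimensional ℂ V] (a : ℕ → V) (ha : Summable fun n => ‖a n‖) :
    ∃ s : V, (∀ k, ‖s - ∑ i ∈ Finset.range k, a i‖ ≤ ∑' i, ‖a (i + k)‖) ∧
      ∀ l : Module.Dual ℂ V, Filter.Tendsto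
        (fun k => l (∑ i ∈ Finset.range k, a i)) Filter.atTop (nhds (l s)) := by
  have : CompleteSpace V := FiniteDimensional.complete ℂ V
  have hs : Summable a := ha.of_norm
  refine ⟨∑' i, a i, fun k => ?_, fun l => ?_⟩
  · have h1 := hs.sum_add_tsum_nat_add k
    have h2 : ∑' i, a i - ∑ i ∈ Finset.range k, a i = ∑' i, a (i + k) := by
      rw [← h1]; abel
    rw [h2]
    exact norm_tsum_le_tsum_norm ((summable_nat_add_iff k).2 ha)
  · exact (l.continuous_of_finiteDimensional.tendsto _).comp hs.hasSum.tendsto_sum_nat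

lemma exists_pointwise_limit (x : X) (a : ℕ → CForm X.Model)
    (ha : Summable fun n => pointNorm x (a n)) :
    ∃ s : CForm X.Model,
      (∀ k, pointNorm x (s - ∑ i ∈ Finset.range k, a i) ≤ ∑' i, pointNorm x (a (i + k))) ∧
      ∀ l : Module.Dual ℂ (CForm X.Model), Filter.Tendsto
        (fun k => l (∑ i ∈ Finset.range k, a i)) Filter.atTop (nhds (l s)) := by
  let _ : NormedAddCommGroup (CForm X.Model) := (X.fiberCore x).toNormedAddCommGroup
  let _ : InnerProductSpace ℂ (CForm X.Model) := InnerProductSpace.ofCore (X.fiberCore x).toCore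
  have hn : ∀ α : CForm X.Model, pointNorm x α = ‖α‖ := fun α => by
    rw [pointNorm, ← Real.sqrt_sq (norm_nonneg α)]
    congr 1
    exact (norm_sq_eq_re_inner (𝕜 := ℂ) α).symm
  have ha' : Summable fun n => ‖a n‖ := by simpa only [hn] using ha
  obtain ⟨s, h1, h2⟩ := exists_limit_of_summable a ha'
  refine ⟨s, fun k => ?_, h2⟩
  simp only [hn]
  exact h1 k

lemma form_sum (f : ℕ → X.PreL2 Ω φ) (k : ℕ) (x : X) :
    (∑ i ∈ Finset.range k, f i).form x = ∑ i ∈ Finset.range k, (f i).form x := by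
  induction k with
  | zero => rfl
  | succ k ih => rw [Finset.sum_range_succ, Finset.sum_range_succ, form_add, Pi.add_apply, ih]

lemma form_sub (f g : X.PreL2 Ω φ) : (f - g).form = f.form - g.form := rfl

/-- Riesz-Fischer: the space `L²_*(Ω)` is complete. -/
instance : CompleteSpace (X.L2 Ω φ) := by
  refine NormedAddCommGroup.completeSpace_of_summable_imp_tendsto fun w hw => ?_
  choose f hf using fun n => SeparationQuotient.surjective_mk (w n)
  set m := X.weightedVolume Ω φ with hm
  let g : ℕ → Lp ℝ 2 m := fun n => (memLp_pointNorm (f n)).toLp _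
  have hg : Summable fun n => ‖g n‖ := by
    refine hw.congr fun n => ?_
    rw [norm_toLp_pointNorm, ← hf n, SeparationQuotient.norm_mk]
  let T : ℕ → Lp ℝ 2 m := fun k => ∑' n, g (n + k)
  have hgx : ∀ᵐ x ∂m, ∀ n, g n x = pointNorm x ((f n).form x) :=
    ae_all_iff.2 fun n => (memLp_pointNorm (f n)).coeFn_toLp
  have hT : ∀ᵐ x ∂m, ∀ k, HasSum (fun n => pointNorm x ((f (n + k)).form x)) (T k x) := by
    refine ae_all_iff.2 fun k => ?_
    have hk : ∑' n, ‖g (n + k)‖ₑ ≠ ⊤ :=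
      tsum_enorm_ne_top_iff_summable_norm.2 ((summable_nat_add_iff k).2 hg)
    filter_upwards [Lp.hasSum_coeFn_tsum hk, hgx] with x hx hx'
    simpa only [hx'] using hx
  have hlim : ∀ x, ∃ s : CForm X.Model, Summable (fun n => pointNorm x ((f n).form x)) →
      (∀ k, pointNorm x (s - ∑ i ∈ Finset.range k, (f i).form x) ≤
        ∑' i, pointNorm x ((f (i + k)).form x)) ∧
      ∀ l : Module.Dual ℂ (CForm X.Model), Filter.Tendsto
        (fun k => l (∑ i ∈ Finset.range k, (f i).form x)) Filter.atTop (nhds (l s)) := by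
    intro x
    by_cases hx : Summable (fun n => pointNorm x ((f n).form x))
    · obtain ⟨s, hs⟩ := exists_pointwise_limit x _ hx
      exact ⟨s, fun _ => hs⟩
    · exact ⟨0, fun h => absurd h hx⟩
  choose F hF using hlim
  have hsum : ∀ᵐ x ∂m, Summable (fun n => pointNorm x ((f n).form x)) := by
    filter_upwards [hT] with x hx using (hx 0).summable
  have hbound : ∀ᵐ x ∂m, ∀ k,
      pointNorm x (F x - ∑ i ∈ Finset.range k, (f i).form x) ≤ T k x := by
    filter_upwards [hT, hsum] with x hx hx' k
    exact ((hF x hx').1 k).trans (hx k).tsum_eq.le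
  have hFm : Form.AEMeas F m := by
    intro x₀ l
    refine aestronglyMeasurable_of_tendsto_ae Filter.atTop
      (f := fun k x => l (Form.inChart (∑ i ∈ Finset.range k, f i).form x₀ x))
      (fun k => (form_aemeas (∑ i ∈ Finset.range k, f i)) x₀ l) ?_
    refine ae_restrict_of_ae ?_
    filter_upwards [hsum] with x hx
    simp only [Form.inChart, form_sum]
    exact (hF x hx).2 (l ∘ₗ (CForm.pullback ((X.frame x₀ x).restrictScalars ℝ).toLinearMap
      ).toLinearMap)
  have hFi : Integrable (fun x => (X.fiberInner x (F x) (F x)).re) m := by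
    refine (Lp.memLp (T 0)).integrable_sq.mono
      (Complex.continuous_re.comp_aestronglyMeasurable
        (X.aestronglyMeasurable_fiberInner hFm hFm)) ?_
    filter_upwards [hbound] with x hx
    have h0 := hx 0
    rw [Finset.range_zero, Finset.sum_empty, sub_zero] at h0
    rw [Real.norm_of_nonneg (X.fiberInner_re_nonneg x _), ← pointNorm_sq, Real.norm_of_nonneg
      (sq_nonneg _)]
    exact pow_le_pow_left₀ (pointNorm_nonneg _ _) h0 2
  let F' : X.PreL2 Ω φ := ⟨F, hFm, hFi⟩
  refine ⟨SeparationQuotient.mk F', ?_⟩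
  rw [tendsto_iff_norm_sub_tendsto_zero]
  refine squeeze_zero (fun _ => norm_nonneg _) (g := fun k => ‖T k‖) (fun k => ?_) ?_
  · have h1 : ∑ i ∈ Finset.range k, w i = SeparationQuotient.mk (∑ i ∈ Finset.range k, f i) := by
      simp only [← hf]
      exact (map_sum (SeparationQuotient.mkCLM ℂ (X.PreL2 Ω φ)) f (Finset.range k)).symm
    rw [h1, norm_sub_rev, ← SeparationQuotient.mk_sub, SeparationQuotient.norm_mk]
    refine norm_le_of_ae _ _ ?_
    filter_upwards [hbound] with x hx
    have := hx k
    rw [form_sub, Pi.sub_apply, form_sum]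
    exact this
  · simpa using (tendsto_sum_nat_add g).norm

lemma form_parity_aemeas {f : X.Form} {m : Measure X} (hf : f.AEMeas m) :
    Form.AEMeas (fun x => CForm.parity (f x)) m := by
  intro x₀ l
  simp only [Form.inChart, CForm.pullback_parity]
  exact hf x₀ (l ∘ₗ CForm.parity.toLinearMap)

/-- Multiplication of forms of degree `d` by `(-1) ^ d`. -/
def parity : X.PreL2 Ω φ →ₗᵢ[ℂ] X.PreL2 Ω φ where
  toFun f := ⟨fun x => CForm.parity (f.form x), form_parity_aemeas f.2.1, by
    have := f.2.2
    simp only [fiberInner, CForm.inner_parity] at this ⊢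
    exact this⟩
  map_add' f g := Subtype.ext (funext fun x => map_add CForm.parity (f.form x) (g.form x))
  map_smul' r f := Subtype.ext (funext fun x => map_smul CForm.parity r (f.form x))
  norm_map' f := by
    have h : ∀ g : X.PreL2 Ω φ, ‖g‖ ^ 2 =
        RCLike.re (∫ x, X.fiberInner x (g.form x) (g.form x) ∂X.weightedVolume Ω φ) := fun g => by
      rw [@norm_sq_eq_re_inner ℂ, inner_def]
    refine (sq_eq_sq₀ (norm_nonneg _) (norm_nonneg _)).1 ?_
    rw [h, h]
    congr 2
    funext x
    exact CForm.inner_parity _ _ _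

end PreL2

/-- The operator `τ` on `L²_*(Ω)` that multiplies forms of degree `d` by `(-1) ^ d`. -/
def parity : X.L2 Ω φ →L[ℂ] X.L2 Ω φ :=
  SeparationQuotient.liftCLM
    ((SeparationQuotient.mkCLM ℂ (X.PreL2 Ω φ)).comp PreL2.parity.toContinuousLinearMap)
    fun f g hfg => by
      rw [Metric.inseparable_iff] at hfg
      have h : dist (PreL2.parity f) (PreL2.parity g) = 0 := by
        rw [PreL2.parity.dist_map, hfg]
      exact SeparationQuotient.mk_eq_mk.2 (Metric.inseparable_iff.2 h)

end HermitianManifold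

/-! ### Products of Hermitian manifolds -/

namespace HermitianManifold

section Pi

variable {ι : Type} [Fintype ι] (X : ι → HermitianManifold.{u, v})

/-- The product charts on a finite product of manifolds. -/
@[reducible] def piCharts : ChartedSpace (∀ i, (X i).Model) (∀ i, X i) :=
  piChartedSpace (fun i => (X i).Model) (fun i => X i)

lemma isManifold_pi :
    @IsManifold ℂ _ (∀ i, (X i).Model) _ _ (∀ i, (X i).Model) _ 𝓘(ℂ, ∀ i, (X i).Model) ω
      (∀ i, X i) _ (piCharts X) := by
  let _ : ChartedSpace (∀ i, (X i).Model) (∀ i, X i) := piCharts X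
  refine isManifold_of_contDiffOn _ _ _ ?_
  rintro _ _ ⟨e, he, rfl⟩ ⟨e', he', rfl⟩
  refine contDiffOn_pi.2 fun i => ?_
  have h := ((contDiffGroupoid ω 𝓘(ℂ, (X i).Model)).compatible (he i trivial) (he' i trivial))
  rw [contDiffGroupoid, mem_groupoid_of_pregroupoid] at h
  have h1 : ContDiffOn ℂ ω _ _ := h.1
  refine (h1.comp (ContinuousLinearMap.proj (R := ℂ)
    (φ := fun i => (X i).Model) i).contDiff.contDiffOn ?_)
  intro z hz
  have h2 := hz.1
  refine ⟨⟨?_, ?_⟩, by simp⟩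
  · exact h2.1 i trivial
  · exact h2.2 i trivial

lemma tangentCoordChange_pi (x₀ x : ∀ i, X i) (hx : ∀ i, x i ∈ ((X i).chart (x₀ i)).source)
    (v : ∀ i, (X i).Model) (i : ι) :
    @tangentCoordChange ℂ _ (∀ i, (X i).Model) _ _ (∀ i, (X i).Model) _ 𝓘(ℂ, ∀ i, (X i).Model)
      (∀ i, X i) _ (piCharts X)
      (@IsManifold.of_le ℂ _ _ _ _ _ _ _ _ _ (piCharts X) 1 ω le_top (isManifold_pi X)) x₀ x x v i =
      (X i).frame (x₀ i) (x i) (v i) := by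
  let _ : ChartedSpace (∀ i, (X i).Model) (∀ i, X i) := piCharts X
  have _ : IsManifold 𝓘(ℂ, ∀ i, (X i).Model) ω (∀ i, X i) := isManifold_pi X
  have h1 := hasFDerivWithinAt_tangentCoordChange (I := 𝓘(ℂ, ∀ i, (X i).Model)) (x := x₀) (y := x)
    (z := x) (by
      refine ⟨?_, mem_extChartAt_source _⟩
      rw [extChartAt_source]
      exact fun i _ => hx i)
  have h2 : ∀ i, HasFDerivWithinAt _ ((X i).frame (x₀ i) (x i)) _ _ := fun i =>
    hasFDerivWithinAt_tangentCoordChange (I := 𝓘(ℂ, (X i).Model)) (x := x₀ i) (y := x i)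
    (z := x i) ⟨by rw [extChartAt_source]; exact hx i, mem_extChartAt_source _⟩
  simp only [ModelWithCorners.range_eq_univ, hasFDerivWithinAt_univ] at h1 h2
  have h3 := hasFDerivAt_pi'.1 h1 i
  have h4 := (h2 i).comp (extChartAt 𝓘(ℂ, ∀ i, (X i).Model) x₀ x)
    (ContinuousLinearMap.proj (R := ℂ) (φ := fun i => (X i).Model) i).hasFDerivAt
  have h5 := h3.unique h4
  exact congrArg (fun L => L v) h5

/-- The product of Hermitian metrics: the sum of the pullbacks. -/
def piMetric (x : ∀ i, X i) : (∀ i, (X i).Model) →ₗ⋆[ℂ] (∀ i, (X i).Model) →ₗ[ℂ] ℂ :=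
  LinearMap.mk₂'ₛₗ (starRingEnd ℂ) (RingHom.id ℂ) (fun v w => ∑ i, (X i).metric (x i) (v i) (w i))
    (by intro v v' w; simp [Finset.sum_add_distrib])
    (by intro r v w; simp [Finset.mul_sum])
    (by intro v w w'; simp [Finset.sum_add_distrib])
    (by intro r v w; simp [Finset.mul_sum])

lemma piMetric_apply (x : ∀ i, X i) (v w : ∀ i, (X i).Model) :
    piMetric X x v w = ∑ i, (X i).metric (x i) (v i) (w i) := rfl

/-- The product `∏ i, X i` of finitely many Hermitian manifolds, with the product metric. -/
def pi : HermitianManifold.{u, v} :=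
  let _ : ChartedSpace (∀ i, (X i).Model) (∀ i, X i) := piCharts X
  have _ : IsManifold 𝓘(ℂ, ∀ i, (X i).Model) ω (∀ i, X i) := isManifold_pi X
  have _ : ∀ i, ProperSpace (X i).Model := fun i => FiniteDimensional.proper ℂ (X i).Model
  { Model := ∀ i, (X i).Model
    Carrier := ∀ i, X i
    metric := piMetric X
    metric_hermitian := fun x =>
      { conj_symm := fun v w => by
          simp only [piMetric_apply, map_sum, ((X _).metric_hermitian _).conj_symm]
        pos := fun v hv => by
          obtain ⟨i, hi⟩ := Function.ne_iff.1 hv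
          simp only [piMetric_apply, Complex.re_sum]
          refine Finset.sum_pos' (fun j _ => ?_)
            ⟨i, Finset.mem_univ i, ((X i).metric_hermitian (x i)).pos (v i) hi⟩
          by_cases hj : v j = 0
          · simp [hj]
          · exact (((X j).metric_hermitian (x j)).pos (v j) hj).le }
    metric_smooth := fun x₀ v w => by
      have h : ContDiffOn ℝ ∞ (fun z : ∀ i, (X i).Model => ∑ i, (X i).metric
          (((X i).chart (x₀ i)).symm (z i))
          ((X i).frame (x₀ i) (((X i).chart (x₀ i)).symm (z i)) (v i))
          ((X i).frame (x₀ i) (((X i).chart (x₀ i)).symm (z i)) (w i)))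
          (chartAt (∀ i, (X i).Model) x₀).target := by
        refine ContDiffOn.sum fun i _ => ?_
        exact ((X i).metric_smooth (x₀ i) (v i) (w i)).comp (ContinuousLinearMap.proj (R := ℝ)
          (φ := fun i => (X i).Model) i).contDiff.contDiffOn fun z hz => hz i trivial
      refine h.congr fun z hz => ?_
      rw [piMetric_apply]
      refine Finset.sum_congr rfl fun i _ => ?_
      have hsrc : ∀ i, (chartAt (∀ i, (X i).Model) x₀).symm z i ∈ ((X i).chart (x₀ i)).source :=
        fun i => ((X i).chart (x₀ i)).map_target (hz i trivial)
      rw [tangentCoordChange_pi X x₀ _ hsrc, tangentCoordChange_pi X x₀ _ hsrc]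
      rfl }

end Pi

end HermitianManifold

/-! ### Lipschitz domains and the `L²` Cauchy-Riemann operator -/

namespace HermitianManifold

section Dbar

variable {X : HermitianManifold.{u, v}}

/-- A relatively compact open set with Lipschitz boundary: near each boundary point, after an
`ℝ`-linear identification of the model space with `ℝ^(m-1) × ℝ` in suitable holomorphic coordinates,
it is the set of points above the graph of a Lipschitz function. -/
structure IsLipschitzDomain (Ω : Set X) : Prop where
  isOpen : IsOpen Ω
  isCompact_closure : IsCompact (closure Ω)
  boundary : ∀ x ∈ frontier Ω, ∃ e ∈ IsManifold.maximalAtlas 𝓘(ℂ, X.Model) ω X,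
    ∃ U : Set X, IsOpen U ∧ x ∈ U ∧ U ⊆ e.source ∧
    ∃ (L : X.Model ≃L[ℝ] EuclideanSpace ℝ (Fin (2 * Module.finrank ℂ X.Model - 1)) × ℝ)
      (C : NNReal) (g : EuclideanSpace ℝ (Fin (2 * Module.finrank ℂ X.Model - 1)) → ℝ),
      LipschitzWith C g ∧ ∀ y ∈ U, y ∈ Ω ↔ g (L (e y)).1 < (L (e y)).2

/-- `ψ` is a smooth compactly supported function in the image under the chart at `x₀` of the part of
`Ω` covered by this chart. -/
structure IsTestFunction (Ω : Set X) (x₀ : X) (ψ : X.Model → ℂ) : Prop where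
  smooth : ContDiff ℝ ∞ ψ
  hasCompactSupport : HasCompactSupport ψ
  tsupport_subset : tsupport ψ ⊆ (X.chart x₀).target ∩ (X.chart x₀).symm ⁻¹' Ω

/-- `∂̄f = g` on `Ω` in the sense of distributions: in the coordinates of each chart,
`∫ ψ g = - ∫ ∂̄ψ ∧ f` (as an identity of vectors of coefficients, both sides being integrable) for
all test functions `ψ`. -/
def IsWeakDbar (Ω : Set X) (f g : X.Form) : Prop :=
  ∀ (x₀ : X) (ψ : X.Model → ℂ), IsTestFunction Ω x₀ ψ → ∀ l : Module.Dual ℂ (CForm X.Model),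
    Integrable (fun z => ψ z * l (g.inChart x₀ ((X.chart x₀).symm z)))
      (Module.finBasis ℝ X.Model).addHaar ∧
    Integrable (fun z => l (ExteriorAlgebra.ι ℂ (CForm.dbarFun ψ z) *
      f.inChart x₀ ((X.chart x₀).symm z))) (Module.finBasis ℝ X.Model).addHaar ∧
    ∫ z, ψ z * l (g.inChart x₀ ((X.chart x₀).symm z)) ∂(Module.finBasis ℝ X.Model).addHaar =
      - ∫ z, l (ExteriorAlgebra.ι ℂ (CForm.dbarFun ψ z) * f.inChart x₀ ((X.chart x₀).symm z))
        ∂(Module.finBasis ℝ X.Model).addHaar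

lemma IsWeakDbar.add {Ω : Set X} {f f' g g' : X.Form} (h : IsWeakDbar Ω f g)
    (h' : IsWeakDbar Ω f' g') : IsWeakDbar Ω (f + f') (g + g') := by
  intro x₀ ψ hψ l
  obtain ⟨h1, h2, h3⟩ := h x₀ ψ hψ l
  obtain ⟨h1', h2', h3'⟩ := h' x₀ ψ hψ l
  have e1 : ∀ z, ψ z * l (Form.inChart (g + g') x₀ ((X.chart x₀).symm z)) =
      ψ z * l (g.inChart x₀ ((X.chart x₀).symm z)) +
      ψ z * l (g'.inChart x₀ ((X.chart x₀).symm z)) := fun z => by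
    simp [Form.inChart, mul_add]
  have e2 : ∀ z, l (ExteriorAlgebra.ι ℂ (CForm.dbarFun ψ z) *
      Form.inChart (f + f') x₀ ((X.chart x₀).symm z)) =
      l (ExteriorAlgebra.ι ℂ (CForm.dbarFun ψ z) * f.inChart x₀ ((X.chart x₀).symm z)) +
      l (ExteriorAlgebra.ι ℂ (CForm.dbarFun ψ z) * f'.inChart x₀ ((X.chart x₀).symm z)) :=
    fun z => by simp [Form.inChart, mul_add]
  simp only [e1, e2]
  refine ⟨h1.add h1', h2.add h2', ?_⟩
  rw [integral_add h1 h1', integral_add h2 h2', h3, h3', neg_add]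

lemma IsWeakDbar.smul {Ω : Set X} {f g : X.Form} (r : ℂ) (h : IsWeakDbar Ω f g) :
    IsWeakDbar Ω (r • f) (r • g) := by
  intro x₀ ψ hψ l
  obtain ⟨h1, h2, h3⟩ := h x₀ ψ hψ l
  have e1 : ∀ z, ψ z * l (Form.inChart (r • g) x₀ ((X.chart x₀).symm z)) =
      r * (ψ z * l (g.inChart x₀ ((X.chart x₀).symm z))) := fun z => by
    simp only [Form.inChart, Pi.smul_apply, map_smul, smul_eq_mul]; ring
  have e2 : ∀ z, l (ExteriorAlgebra.ι ℂ (CForm.dbarFun ψ z) *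
      Form.inChart (r • f) x₀ ((X.chart x₀).symm z)) =
      r * l (ExteriorAlgebra.ι ℂ (CForm.dbarFun ψ z) * f.inChart x₀ ((X.chart x₀).symm z)) :=
    fun z => by simp [Form.inChart]
  simp only [e1, e2]
  refine ⟨h1.const_mul r, h2.const_mul r, ?_⟩
  rw [integral_const_mul, integral_const_mul, h3, mul_neg]

lemma isWeakDbar_zero (Ω : Set X) : IsWeakDbar Ω (0 : X.Form) 0 := by
  intro x₀ ψ hψ l
  simp [Form.inChart]

variable (X) (Ω : Set X) (φ : X → ℝ)

/-- The graph of the (maximal, weak) operator `∂̄` on `L²_*(Ω)`. -/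
def dbarGraph : Submodule ℂ (X.L2 Ω φ × X.L2 Ω φ) where
  carrier := {p | ∃ f g : X.PreL2 Ω φ, f.toL2 = p.1 ∧ g.toL2 = p.2 ∧ IsWeakDbar Ω f.form g.form}
  zero_mem' := ⟨0, 0, rfl, rfl, isWeakDbar_zero Ω⟩
  add_mem' := by
    rintro _ _ ⟨f, g, hf, hg, h⟩ ⟨f', g', hf', hg', h'⟩
    exact ⟨f + f', g + g', by rw [Prod.fst_add, ← hf, ← hf']; rfl,
      by rw [Prod.snd_add, ← hg, ← hg']; rfl, h.add h'⟩
  smul_mem' := by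
    rintro r _ ⟨f, g, hf, hg, h⟩
    exact ⟨r • f, r • g, by rw [Prod.smul_fst, ← hf]; rfl, by rw [Prod.smul_snd, ← hg]; rfl,
      h.smul r⟩

/-- The operator `∂̄` on `L²_*(Ω)`, acting on forms of all degrees: its domain consists of the `f`
in `L²_*(Ω)` whose distributional `∂̄f` is in `L²_*(Ω)`. -/
def dbar : X.L2 Ω φ →ₗ.[ℂ] X.L2 Ω φ := (X.dbarGraph Ω φ).toLinearPMap

/-- The range of `∂̄`. -/
def dbarRange : Submodule ℂ (X.L2 Ω φ) := LinearMap.range (X.dbar Ω φ).toFun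

/-- The kernel of `∂̄`. -/
def dbarKer : Submodule ℂ (X.L2 Ω φ) :=
  (LinearMap.ker (X.dbar Ω φ).toFun).map (X.dbar Ω φ).domain.subtype

/-- The operator `∂̄` on `L²_*(Ω)` has closed range. -/
def HasClosedRange : Prop := IsClosed (X.dbarRange Ω φ : Set (X.L2 Ω φ))

/-- The kernel of the Hilbert space adjoint `∂̄*`. -/
def dbarAdjointKer : Submodule ℂ (X.L2 Ω φ) :=
  (LinearMap.ker (X.dbar Ω φ).adjoint.toFun).map (X.dbar Ω φ).adjoint.domain.subtype

/-- The harmonic forms: `∂̄f = 0` and `∂̄*f = 0`. -/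
def harmonic : Submodule ℂ (X.L2 Ω φ) := X.dbarKer Ω φ ⊓ X.dbarAdjointKer Ω φ

/-- The harmonic projection: the orthogonal projection of `L²_*(Ω)` onto the harmonic forms (which
are a closed subspace). -/
def harmonicProjection : X.L2 Ω φ →L[ℂ] X.L2 Ω φ :=
  (X.harmonic Ω φ).topologicalClosure.starProjection

variable {X Ω φ} in
/-- `K` is the canonical solution operator: `K f` is the solution `u` of `∂̄u = f` orthogonal to the
kernel of `∂̄` if `f` is in the range of `∂̄`, and `K f = 0` if `f` is orthogonal to this range. -/
structure IsCanonicalSolution (K : X.L2 Ω φ →L[ℂ] X.L2 Ω φ) : Prop where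
  solves : ∀ f ∈ X.dbarRange Ω φ, K f ∈ (X.dbarKer Ω φ)ᗮ ∧
    ∃ h : K f ∈ (X.dbar Ω φ).domain, X.dbar Ω φ ⟨K f, h⟩ = f
  eq_zero : ∀ f ∈ (X.dbarRange Ω φ)ᗮ, K f = 0

open Classical in
/-- The canonical solution operator of `∂̄`, which exists (and is unique) if `∂̄` has closed range. -/
def canonicalSolution : X.L2 Ω φ →L[ℂ] X.L2 Ω φ :=
  if h : ∃ K : X.L2 Ω φ →L[ℂ] X.L2 Ω φ, IsCanonicalSolution K then h.choose else 0

/-- The class of `L²` forms of bidegree `(p, q)`. -/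
def IsBidegree {X : HermitianManifold.{u, v}} {Ω : Set X} {φ : X → ℝ} (p q : ℕ) (F : X.L2 Ω φ) :
    Prop :=
  ∃ f : X.PreL2 Ω φ, f.toL2 = F ∧ ∀ x, f.form x ∈ CForm.bidegree X.Model p q

/-! ### `L²` cohomology -/

/-- The `L²` cohomology `H*_{L²}(Ω) = ker ∂̄ / im ∂̄` (all degrees together). -/
def Cohomology : Type _ :=
  X.dbarKer Ω φ ⧸ (X.dbarRange Ω φ).comap (X.dbarKer Ω φ).subtype

namespace Cohomology

variable {X Ω φ}

instance : AddCommGroup (X.Cohomology Ω φ) :=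
  inferInstanceAs (AddCommGroup (X.dbarKer Ω φ ⧸ (X.dbarRange Ω φ).comap (X.dbarKer Ω φ).subtype))

instance : Module ℂ (X.Cohomology Ω φ) :=
  inferInstanceAs (Module ℂ (X.dbarKer Ω φ ⧸ (X.dbarRange Ω φ).comap (X.dbarKer Ω φ).subtype))

/-- The cohomology class of a `∂̄`-closed form. -/
def mk : X.dbarKer Ω φ →ₗ[ℂ] X.Cohomology Ω φ := Submodule.mkQ _

/-- The component of a class orthogonal to the range of `∂̄`. -/
def orthRep : X.Cohomology Ω φ →ₗ[ℂ] X.L2 Ω φ :=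
  Submodule.liftQ _ ((X.dbarRange Ω φ)ᗮ.starProjection.toLinearMap ∘ₗ
    (X.dbarKer Ω φ).subtype) fun f hf => by
      have h : (f : X.L2 Ω φ) ∈ (X.dbarRange Ω φ)ᗮᗮ :=
        Submodule.le_orthogonal_orthogonal _ hf
      simpa using (Submodule.starProjection_apply_eq_zero_iff _).2 h

/-- The quotient inner product on cohomology: the inner product of the components orthogonal to the
range of `∂̄`. The corresponding (semi)norm is the quotient (semi)norm. -/
instance : PreInnerProductSpace.Core ℂ (X.Cohomology Ω φ) where
  inner a b := ⟪orthRep a, orthRep b⟫_ℂ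
  conj_inner_symm a b := inner_conj_symm _ _
  re_inner_nonneg a := inner_self_nonneg
  add_left a b c := by rw [map_add, inner_add_left]
  smul_left a b r := by rw [map_smul, inner_smul_left]

instance : SeminormedAddCommGroup (X.Cohomology Ω φ) :=
  InnerProductSpace.Core.toSeminormedAddCommGroup (𝕜 := ℂ)

instance : InnerProductSpace ℂ (X.Cohomology Ω φ) := InnerProductSpace.ofCore inferInstance

end Cohomology

end Dbar

end HermitianManifold

/-! ### Tensor products -/

namespace HermitianManifold

section Factors

variable {ι κ : Type} [Fintype ι] [Fintype κ] (X : ι → HermitianManifold.{u, v})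

/-- The derivative of the projection `∏ i, X i → X i` onto a factor. -/
def tangentProj (i : ι) : (pi X).Model →ₗ[ℝ] (X i).Model :=
  (LinearMap.proj i : (∀ i, (X i).Model) →ₗ[ℝ] (X i).Model)

/-- The derivative of the projection `∏ i, X i → ∏ k, X (σ k)` onto some of the factors. -/
def tangentProjs (σ : κ → ι) : (pi X).Model →ₗ[ℝ] (pi fun k => X (σ k)).Model :=
  (LinearMap.pi fun k => LinearMap.proj (σ k) :
    (∀ i, (X i).Model) →ₗ[ℝ] ∀ k, (X (σ k)).Model)

variable {X}

/-- The pullback to `∏ i, X i` of a form on `X i`. -/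
def pullFactor (i : ι) (f : (X i).Form) : (pi X).Form :=
  fun x => CForm.pullback (tangentProj X i) (f (x i))

/-- The pullback to `∏ i, X i` of a form on `∏ k, X (σ k)`. -/
def pullFactors (σ : κ → ι) (f : (pi fun k => X (σ k)).Form) : (pi X).Form :=
  fun x => CForm.pullback (tangentProjs X σ) (f fun k => x (σ k))

/-- The product `∏ i, Ω i` of subsets of the factors. -/
def piDomain (Ω : ∀ i, Set (X i)) : Set (pi X) := {x | ∀ i, x i ∈ Ω i}

/-- The sum `∑ i, φ i` of weights on the factors, as a function on the product. -/
def piWeight (φ : ∀ i, X i → ℝ) : pi X → ℝ := fun x => ∑ i, φ i (x i)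

/-- The space `L²_*` on the product domain `∏ i, Ω i`, with the product metric and the weight
`∑ i, φ i`. -/
abbrev PiL2 (Ω : ∀ i, Set (X i)) (φ : ∀ i, X i → ℝ) : Type _ :=
  (pi X).L2 (piDomain Ω) (piWeight φ)

end Factors

section Tensor

variable {N : ℕ} {X : Fin N → HermitianManifold.{u, v}} {Ω : ∀ j, Set (X j)} {φ : ∀ j, X j → ℝ}

/-- The form `f₁ ⊗ ⋯ ⊗ f_N = π₁^* f₁ ∧ ⋯ ∧ π_N^* f_N` on the product. -/
def wedge (f : ∀ j, (X j).Form) : (pi X).Form :=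
  fun x => (List.ofFn fun j => pullFactor j (f j) x).prod

/-- `T = F₁ ⊗ ⋯ ⊗ F_N` for square integrable forms `F j` on `Ω j`. -/
def IsTensor (F : ∀ j, (X j).L2 (Ω j) (φ j)) (T : PiL2 Ω φ) : Prop :=
  ∃ (f : ∀ j, (X j).PreL2 (Ω j) (φ j)) (t : (pi X).PreL2 (piDomain Ω) (piWeight φ)),
    (∀ j, (f j).toL2 = F j) ∧ t.toL2 = T ∧ t.form = wedge fun j => (f j).form

/-- `T = A₁ ⊗̂ ⋯ ⊗̂ A_N` for bounded operators `A j` on `L²_*(Ω j)`. -/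
def IsTensorOp (A : ∀ j, (X j).L2 (Ω j) (φ j) →L[ℂ] (X j).L2 (Ω j) (φ j))
    (T : PiL2 Ω φ →L[ℂ] PiL2 Ω φ) : Prop :=
  ∀ F, ∃ R R', IsTensor F R ∧ IsTensor (fun j => A j (F j)) R' ∧ T R = R'

/-- `L²_*` on `∏ i < j, Ω i`. -/
abbrev L2Before (Ω : ∀ j, Set (X j)) (φ : ∀ j, X j → ℝ) (j : Fin N) : Type _ :=
  PiL2 (fun i : {i : Fin N // i < j} => Ω i) fun i => φ i

/-- `L²_*` on `∏ i > j, Ω i`. -/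
abbrev L2After (Ω : ∀ j, Set (X j)) (φ : ∀ j, X j → ℝ) (j : Fin N) : Type _ :=
  PiL2 (fun i : {i : Fin N // j < i} => Ω i) fun i => φ i

/-- `T = F ⊗ G ⊗ H` for square integrable forms `F` on `∏ i < j, Ω i`, `G` on `Ω j` and `H` on
`∏ i > j, Ω i`. -/
def IsTensorAt (j : Fin N) (F : L2Before Ω φ j) (G : (X j).L2 (Ω j) (φ j)) (H : L2After Ω φ j)
    (T : PiL2 Ω φ) : Prop :=
  ∃ (f : (pi fun i : {i : Fin N // i < j} => X i).PreL2 (piDomain fun i => Ω i)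
      (piWeight fun i => φ i))
    (g : (X j).PreL2 (Ω j) (φ j))
    (h : (pi fun i : {i : Fin N // j < i} => X i).PreL2 (piDomain fun i => Ω i)
      (piWeight fun i => φ i))
    (t : (pi X).PreL2 (piDomain Ω) (piWeight φ)),
    f.toL2 = F ∧ g.toL2 = G ∧ h.toL2 = H ∧ t.toL2 = T ∧
    ∀ x, t.form x = pullFactors Subtype.val f.form x * pullFactor j g.form x *
      pullFactors Subtype.val h.form x

/-- `T = A ⊗̂ B ⊗̂ C` for bounded operators `A`, `B`, `C` on the spaces `L²_*` of `∏ i < j, Ω i`,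
`Ω j` and `∏ i > j, Ω i`. -/
def IsTensorOpAt (j : Fin N) (A : L2Before Ω φ j →L[ℂ] L2Before Ω φ j)
    (B : (X j).L2 (Ω j) (φ j) →L[ℂ] (X j).L2 (Ω j) (φ j))
    (C : L2After Ω φ j →L[ℂ] L2After Ω φ j) (T : PiL2 Ω φ →L[ℂ] PiL2 Ω φ) : Prop :=
  ∀ F G H, ∃ R R', IsTensorAt j F G H R ∧ IsTensorAt j (A F) (B G) (C H) R' ∧ T R = R'

/-- The operator `τ Q` on `L²_*` of `∏ i < j, Ω i`: the harmonic projection `Q` followed by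
multiplication by `(-1) ^ d` on forms of degree `d`. -/
def parityHarmonicBefore (Ω : ∀ j, Set (X j)) (φ : ∀ j, X j → ℝ) (j : Fin N) :
    L2Before Ω φ j →L[ℂ] L2Before Ω φ j :=
  parity.comp (harmonicProjection (pi fun i : {i : Fin N // i < j} => X i)
    (piDomain fun i => Ω i) (piWeight fun i => φ i))

end Tensor

end HermitianManifold

/-- The multilinear map `t` exhibits the complete space `H` as the Hilbert space tensor product of
the (pre-)Hilbert spaces `V j`. -/
structure IsHilbertTensorProduct {ι : Type*} [Fintype ι] {V : ι → Type*} {H : Type*}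
    [∀ j, SeminormedAddCommGroup (V j)] [∀ j, InnerProductSpace ℂ (V j)]
    [SeminormedAddCommGroup H] [InnerProductSpace ℂ H] (t : MultilinearMap ℂ V H) : Prop where
  completeSpace : CompleteSpace H
  t0Space : T0Space H
  inner_apply : ∀ x y, ⟪t x, t y⟫_ℂ = ∏ j, ⟪x j, y j⟫_ℂ
  dense_span : Dense (Submodule.span ℂ (Set.range t) : Set H)

end

/-!
The forms on a product of domains are treated by Hilbert space methods, with the graph of `∂̄` as the
basic object. At each point, the fiber of forms on the product is the tensor product of the fibers on
the factors, as an inner product space (`fiberInner_tensorForm`), and the weighted volume is the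
product of the weighted volumes. Together with the fact that measurable rectangles generate the
measurable sets, this shows that `L²_*(Ω)` is the Hilbert space tensor product of the spaces
`L²_*(Ω_j)` (`isHilbertTensorProduct_piData`). On tensors of forms in the domains, `∂̄` and its adjoint
are given by the Leibniz rule: for `∂̄` one integrates by parts along the factors
(`tensor_mem_dbarGraph`); the graph of the adjoint is the closed span of the pairs which represent the
functionals that define `∂̄`, and for these one uses products of test functions
(`tensor_mem_dbarGraph_adjoint`).

The rest is about abstract closed densely defined operators `d` with `d² = 0` (`IsHilbertComplex`) and
their tensor products (`IsTensorComplex`). If the range of `d` is closed, the harmonic projection `P`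
and the canonical inverse `K` satisfy `d K + K d = 1 - P`. The point is that this passes to the
product, for which one has to know that the graph of `d` on the product is the closed span of the
tensors that it contains (`eq_tensorGraph`). To see this, consider the operators
`A = P + K K* + K* K` on the factors. They are bounded, selfadjoint and injective, with `d A = K*` and
`d* A = K`. Hence `⊗ A_j` is injective, has values in the closed span of tensors in the graph norm,
and commutes with `d` on its domain, by the Leibniz rules for `d` and for `d*`. For an element `q` of
the domain which is orthogonal to the tensors in the graph norm, the inner product with `A A q`, where
`A` now stands for `⊗ A_j`, gives `‖A q‖² + ‖A d q‖² = 0`, so `q = 0`.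

On tensors, the formula `d S + S d = 1 - ⊗ P_j` for the operator
`S = ∑_j τP₁ ⊗ ⋯ ⊗ τP_{j-1} ⊗ K_j ⊗ 1 ⊗ ⋯ ⊗ 1` is a telescoping sum, and by density it holds on the
whole domain (`homotopy_solution`). Since `⊗ P_j` vanishes on the range and has harmonic values, it
follows that the range is closed, that `⊗ P_j` is the harmonic projection, and that `S` solves the
equation. The Künneth formula is obtained from the representation of cohomology classes by harmonic
forms (`isHilbertTensorProduct_kunneth`).

For forms of bidegree `(p, 1)` it remains to show that `S f` is orthogonal to the kernel of `∂̄`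
(`solution_mem_orthogonal`). The decomposition by antiholomorphic degree is obtained from the unitary
operators that multiply forms of bidegree `(p, q)` by `ζ ^ q`, where `ζ` is a root of unity of large
order (`isRotation_rotate`). In a tensor of total degree one, exactly one factor `x_j` has degree one,
and the other factors have degree zero and are annihilated by the adjoint. On such a tensor all terms
of `S` vanish except `τPx₁ ⊗ ⋯ ⊗ K x_j ⊗ ⋯ ⊗ x_N`, which is the image of
`Px₁ ⊗ ⋯ ⊗ A x_j ⊗ ⋯ ⊗ x_N` under the adjoint.
-/


noncomputable section

/-! ### The inner product of exterior forms -/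

namespace CForm

section Fiber

variable {E : Type*} [AddCommGroup E] [Module ℝ E] {ι κ : Type*} [Fintype ι] [Fintype κ]

lemma interior_interior_comm (v w : E) (x : CForm E) :
    interior v (interior w x) = - interior w (interior v x) :=
  CliffordAlgebra.contractLeft_comm _ _ _

lemma interior_interior_self (v : E) (x : CForm E) : interior v (interior v x) = 0 :=
  CliffordAlgebra.contractLeft_contractLeft _ _

@[simp] lemma interior_one (v : E) : interior v (1 : CForm E) = 0 := by
  have : (1 : CForm E) = algebraMap ℂ (CForm E) 1 := by simp
  rw [this, interior_algebraMap]

lemma pairing_zero_left (b : ι → E) (c : Matrix ι ι ℝ) (k : ℕ) (β : CForm E) :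
    pairing b c k 0 β = 0 := by
  simpa using pairing_smul_left b c k 0 (0 : CForm E) β

lemma pairing_sub_left (b : ι → E) (c : Matrix ι ι ℝ) (k : ℕ) (α α' β : CForm E) :
    pairing b c k (α - α') β = pairing b c k α β - pairing b c k α' β := by
  have h := pairing_add_left b c k (α - α') α' β
  rw [sub_add_cancel] at h
  rw [h, add_sub_cancel_right]

lemma pairing_neg_right (b : ι → E) (c : Matrix ι ι ℝ) (k : ℕ) (α β : CForm E) :
    pairing b c k α (-β) = - pairing b c k α β := by
  simpa using pairing_smul_right b c k (-1) α β

/-- Contracting with a vector twice gives zero, so that at most `card ι - #s` further contractions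
are possible if those with `b i` for `i ∈ s` already give zero. -/
lemma pairing_eq_zero_of_interior [DecidableEq ι] (b : ι → E) (k : ℕ) (s : Finset ι)
    (α β : CForm E) (hs : ∀ i ∈ s, interior (b i) α = 0) (hk : Fintype.card ι < k + s.card) :
    pairing b 1 k α β = 0 := by
  induction k generalizing s α β with
  | zero => exact absurd (Finset.card_le_univ s) (by omega)
  | succ k ih =>
    rw [pairing_one_succ]
    refine Finset.sum_eq_zero fun i _ => ?_
    by_cases hi : i ∈ s
    · rw [hs i hi, pairing_zero_left]
    · refine ih (insert i s) _ _ (fun j hj => ?_) (by rw [Finset.card_insert_of_notMem hi]; omega)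
      rcases Finset.mem_insert.1 hj with rfl | hj
      · exact interior_interior_self _ _
      · rw [interior_interior_comm, hs j hj]; simp

/-- There are no nonzero contractions of length greater than the dimension. -/
lemma pairing_eq_zero_of_card_lt [DecidableEq ι] (b : ι → E) (k : ℕ) (α β : CForm E)
    (hk : Fintype.card ι < k) : pairing b 1 k α β = 0 :=
  pairing_eq_zero_of_interior b k ∅ α β (by simp) (by simpa using hk)

/-- Exterior multiplication by a covector is adjoint to contraction, degree by degree. -/
lemma pairing_ι_mul [DecidableEq ι] (b : ι → E) (k : ℕ) (a : E →ₗ[ℝ] ℂ) (x β : CForm E) :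
    pairing b 1 (k + 1) (ExteriorAlgebra.ι ℂ a * x) β =
      (k + 1) * ∑ i, conj (a (b i)) * pairing b 1 k x (interior (b i) β) := by
  induction k generalizing x β with
  | zero =>
    rw [pairing_one_succ]
    have h0 : scalarPart (ExteriorAlgebra.ι ℂ a) = 0 := by simpa using scalarPart_ι_mul a 1
    simp [pairing, interior_ι_mul, h0, mul_assoc]
  | succ k ih =>
    rw [pairing_one_succ]
    simp only [interior_ι_mul, pairing_sub_left, pairing_smul_left, ih,
      Finset.sum_sub_distrib]
    -- contractions anticommute, so that the remaining terms are again of the form `pairing b 1 (k + 1)`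
    have h : ∑ i, ((k : ℂ) + 1) * ∑ j, conj (a (b j)) *
        pairing b 1 k (interior (b i) x) (interior (b j) (interior (b i) β)) =
        - (((k : ℂ) + 1) * ∑ j, conj (a (b j)) * pairing b 1 (k + 1) x (interior (b j) β)) := by
      rw [← Finset.mul_sum, Finset.sum_comm, ← mul_neg, ← Finset.sum_neg_distrib]
      congr 1
      refine Finset.sum_congr rfl fun j _ => ?_
      rw [pairing_one_succ, ← Finset.mul_sum, ← mul_neg, ← Finset.sum_neg_distrib]
      congr 1
      refine Finset.sum_congr rfl fun i _ => ?_
      rw [interior_interior_comm, pairing_neg_right]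
    rw [h]
    push_cast
    ring

/-- The normalised inner product of exterior forms in a frame `b` that is regarded as
orthonormal. -/
def frameInner [DecidableEq ι] (b : ι → E) (α β : CForm E) : ℂ :=
  ∑ k ∈ Finset.range (Fintype.card ι + 1), (1 / (2 ^ k * k.factorial : ℝ) : ℝ) * pairing b 1 k α β

section frameInner

variable [DecidableEq ι] (b : ι → E)

/-- Exterior multiplication by a covector is adjoint to contraction, up to the factor `1 / 2` that
comes from the normalisation. -/
lemma frameInner_ι_mul (a : E →ₗ[ℝ] ℂ) (x β : CForm E) :
    frameInner b (ExteriorAlgebra.ι ℂ a * x) β =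
      (1 / 2) * ∑ i, conj (a (b i)) * frameInner b x (interior (b i) β) := by
  have h0 : pairing b 1 0 (ExteriorAlgebra.ι ℂ a * x) β = 0 := by
    simp [pairing, scalarPart_ι_mul]
  have h1 : ∀ y, frameInner b x y = ∑ k ∈ Finset.range (Fintype.card ι),
      (1 / (2 ^ k * k.factorial : ℝ) : ℝ) * pairing b 1 k x y +
      (1 / (2 ^ Fintype.card ι * (Fintype.card ι).factorial : ℝ) : ℝ) *
        pairing b 1 (Fintype.card ι) x y := fun y => Finset.sum_range_succ _ _
  -- the summand with `k = card ι` on the right-hand side, which has no counterpart on the left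
  have h2 : ∑ i, conj (a (b i)) * pairing b 1 (Fintype.card ι) x (interior (b i) β) = 0 := by
    have := pairing_ι_mul b (Fintype.card ι) a x β
    rw [pairing_eq_zero_of_card_lt _ _ _ _ (Nat.lt_succ_self _)] at this
    exact (mul_eq_zero.1 this.symm).resolve_left (Nat.cast_add_one_ne_zero _)
  rw [frameInner, Finset.sum_range_succ', h0, mul_zero, add_zero]
  simp only [h1, mul_add, Finset.sum_add_distrib, pairing_ι_mul]
  have h3 : ∑ i, conj (a (b i)) *
      ((1 / (2 ^ Fintype.card ι * (Fintype.card ι).factorial : ℝ) : ℝ) *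
        pairing b 1 (Fintype.card ι) x (interior (b i) β)) = 0 := by
    rw [← mul_zero (((1 / (2 ^ Fintype.card ι * (Fintype.card ι).factorial : ℝ) : ℝ) : ℂ)), ← h2,
      Finset.mul_sum]
    exact Finset.sum_congr rfl fun i _ => by ring
  rw [h3, mul_zero, add_zero]
  simp only [Finset.mul_sum]
  rw [Finset.sum_comm]
  refine Finset.sum_congr rfl fun i _ => Finset.sum_congr rfl fun k _ => ?_
  have hk : ((k : ℂ) + 1) ≠ 0 := by exact_mod_cast Nat.succ_ne_zero k
  have hf : (k.factorial : ℂ) ≠ 0 := by exact_mod_cast Nat.factorial_ne_zero k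
  rw [Nat.factorial_succ, pow_succ]
  push_cast
  field_simp

lemma frameInner_one (β : CForm E) : frameInner b 1 β = scalarPart β := by
  rw [frameInner, Finset.sum_range_succ', Finset.sum_eq_zero]
  · simp [pairing]
  · intro k _
    rw [pairing_one_succ, Finset.sum_eq_zero, mul_zero]
    intro i _
    rw [interior_one, pairing_zero_left]

lemma frameInner_conj (α β : CForm E) : conj (frameInner b β α) = frameInner b α β := by
  simp only [frameInner, map_sum, map_mul, Complex.conj_ofReal]
  exact Finset.sum_congr rfl fun k _ => by rw [conj_pairing _ _ Matrix.transpose_one]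

lemma frameInner_add_left (α α' β : CForm E) :
    frameInner b (α + α') β = frameInner b α β + frameInner b α' β := by
  simp only [frameInner, pairing_add_left, mul_add, Finset.sum_add_distrib]

lemma frameInner_smul_left (r : ℂ) (α β : CForm E) :
    frameInner b (r • α) β = conj r * frameInner b α β := by
  simp only [frameInner, pairing_smul_left, Finset.mul_sum]
  exact Finset.sum_congr rfl fun k _ => by ring

lemma frameInner_zero_left (β : CForm E) : frameInner b 0 β = 0 := by
  simpa using frameInner_smul_left b 0 0 β

lemma frameInner_zero_right (β : CForm E) : frameInner b β 0 = 0 := by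
  rw [← frameInner_conj, frameInner_zero_left, map_zero]

lemma frameInner_add_right (α β β' : CForm E) :
    frameInner b α (β + β') = frameInner b α β + frameInner b α β' := by
  rw [← frameInner_conj, frameInner_add_left, map_add, frameInner_conj, frameInner_conj]

lemma frameInner_smul_right (r : ℂ) (α β : CForm E) :
    frameInner b α (r • β) = r * frameInner b α β := by
  rw [← frameInner_conj, frameInner_smul_left, map_mul, frameInner_conj, Complex.conj_conj]

end frameInner

/-- Contraction is an antiderivation. -/
lemma interior_mul (v : E) (x y : CForm E) :
    interior v (x * y) = interior v x * y + parity x * interior v y := by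
  induction x using CliffordAlgebra.left_induction with
  | algebraMap r => rw [AlgHom.commutes]; erw [interior_algebraMap]; simp [Algebra.algebraMap_eq_smul_one]
  | add x x' hx hx' => simp only [add_mul, map_add, hx, hx']; abel
  | ι_mul x m hx =>
    change interior v (ExteriorAlgebra.ι ℂ m * x * y) =
      interior v (ExteriorAlgebra.ι ℂ m * x) * y +
        parity (ExteriorAlgebra.ι ℂ m * x) * interior v y
    rw [mul_assoc, interior_ι_mul, interior_ι_mul, hx, map_mul, parity_ι]
    simp only [sub_mul, mul_add, smul_mul_assoc, mul_assoc, neg_mul]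
    abel

lemma mul_ι (x : CForm E) (a : E →ₗ[ℝ] ℂ) :
    ExteriorAlgebra.ι ℂ a * x = parity x * ExteriorAlgebra.ι ℂ a := by
  induction x using CliffordAlgebra.left_induction with
  | algebraMap r => rw [AlgHom.commutes]; exact (Algebra.commutes r _).symm
  | add x x' hx hx' => simp only [add_mul, mul_add, map_add, hx, hx']
  | ι_mul x m hx =>
    change ExteriorAlgebra.ι ℂ a * (ExteriorAlgebra.ι ℂ m * x) =
      parity (ExteriorAlgebra.ι ℂ m * x) * ExteriorAlgebra.ι ℂ a
    have hs := ExteriorAlgebra.ι_add_mul_swap (R := ℂ) a m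
    rw [← mul_assoc, eq_neg_of_add_eq_zero_left hs, map_mul, parity_ι, neg_mul, mul_assoc, hx]
    simp only [neg_mul, mul_assoc]

variable {F : Type*} [AddCommGroup F] [Module ℝ F]

/-- Exterior multiplication by forms pulled back from a factor is isometric in the sense of tensor
products, as long as the other factors have no component along the given one. -/
lemma frameInner_pullback_mul [DecidableEq ι] [DecidableEq κ] (b : κ → E) (c : ι → F)
    (A : E →ₗ[ℝ] F) (i₀ : ι ↪ κ) (hA : ∀ i, A (b (i₀ i)) = c i)
    (hA' : ∀ k, k ∉ range i₀ → A (b k) = 0) (α β : CForm F) (x y : CForm E)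
    (hx : ∀ i, interior (b (i₀ i)) x = 0) (hy : ∀ i, interior (b (i₀ i)) y = 0) :
    frameInner b (pullback A α * x) (pullback A β * y) = frameInner c α β * frameInner b x y := by
  have hsum : ∀ f : κ → ℂ, (∀ k, k ∉ range i₀ → f k = 0) → ∑ k, f k = ∑ i, f (i₀ i) := by
    intro f hf
    rw [← Finset.sum_map Finset.univ i₀ f]
    refine (Finset.sum_subset (Finset.subset_univ _) fun k _ hk => hf k fun ⟨i, hi⟩ => hk ?_).symm
    exact Finset.mem_map.2 ⟨i, Finset.mem_univ _, hi⟩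
  -- the case `α = 1`, to which the general case is reduced by moving covectors to the other side
  have hbase : ∀ β : CForm F, frameInner b x (pullback A β * y) =
      scalarPart β * frameInner b x y := by
    intro β
    induction β using CliffordAlgebra.left_induction with
    | algebraMap r =>
      rw [AlgHom.commutes, AlgHom.commutes, Algebra.algebraMap_eq_smul_one, smul_mul_assoc, one_mul,
        frameInner_smul_right]
      simp
    | add β β' h h' => simp only [map_add, add_mul, frameInner_add_right, h, h']
    | ι_mul β m h =>
      change frameInner b x (pullback A (ExteriorAlgebra.ι ℂ m * β) * y) =
        scalarPart (ExteriorAlgebra.ι ℂ m * β) * frameInner b x y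
      rw [scalarPart_ι_mul, zero_mul, map_mul, pullback_ι, mul_assoc, ← frameInner_conj,
        frameInner_ι_mul, hsum]
      · simp [hx, frameInner_zero_right]
      · intro k hk; simp [hA' k hk]
  induction α using CliffordAlgebra.left_induction generalizing β with
  | algebraMap r =>
    rw [AlgHom.commutes]
    simp only [Algebra.algebraMap_eq_smul_one, smul_mul_assoc, one_mul, frameInner_smul_left,
      hbase, frameInner_one]
    ring
  | add α α' h h' => simp only [map_add, add_mul, frameInner_add_left, h, h']
  | ι_mul α m h =>
    change frameInner b (pullback A (ExteriorAlgebra.ι ℂ m * α) * x) _ =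
      frameInner c (ExteriorAlgebra.ι ℂ m * α) β * frameInner b x y
    rw [map_mul, pullback_ι, mul_assoc, frameInner_ι_mul, frameInner_ι_mul, hsum]
    · rw [mul_assoc, Finset.sum_mul]
      congr 1
      refine Finset.sum_congr rfl fun i _ => ?_
      rw [interior_mul, hy, mul_zero, add_zero, interior_pullback, LinearMap.comp_apply, hA, h]
      ring
    · intro k hk; simp [hA' k hk]

/-- The product formula for the inner product: if the frame `b` of `E` is the disjoint union of
frames `c a` of the factors, the exterior product of forms pulled back from the factors behaves like
a tensor product. -/
lemma frameInner_list_prod {α : Type*} [DecidableEq α] {J : α → Type*} [∀ a, Fintype (J a)]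
    [∀ a, DecidableEq (J a)] [DecidableEq κ] {F : α → Type*} [∀ a, AddCommGroup (F a)]
    [∀ a, Module ℝ (F a)] (b : κ → E) (c : ∀ a, J a → F a) (A : ∀ a, E →ₗ[ℝ] F a)
    (e : (Σ a, J a) ≃ κ) (hA : ∀ a i, A a (b (e ⟨a, i⟩)) = c a i)
    (hA' : ∀ a a' i, a ≠ a' → A a (b (e ⟨a', i⟩)) = 0) (f g : ∀ a, CForm (F a)) (l : List α)
    (hl : l.Nodup) :
    frameInner b (l.map fun a => pullback (A a) (f a)).prod
      (l.map fun a => pullback (A a) (g a)).prod = (l.map fun a => frameInner (c a) (f a) (g a)).prod := by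
  -- vectors along a factor that does not occur contract to zero
  have hint : ∀ (f : ∀ a, CForm (F a)) (l : List α) (a : α), a ∉ l → ∀ i : J a,
      interior (b (e ⟨a, i⟩)) (l.map fun a => pullback (A a) (f a)).prod = 0 := by
    intro f l
    induction l with
    | nil => intro a _ i; simp
    | cons a' l ih =>
      intro a ha i
      rw [List.mem_cons, not_or] at ha
      rw [List.map_cons, List.prod_cons, interior_mul, ih a ha.2, mul_zero, add_zero,
        interior_pullback, hA' _ _ _ (Ne.symm ha.1)]
      have h0 := interior_smul 0 (0 : F a') (f a')
      rw [zero_smul] at h0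
      rw [h0]; simp
  induction l with
  | nil => simp [frameInner_one]
  | cons a l ih =>
    rw [List.nodup_cons] at hl
    simp only [List.map_cons, List.prod_cons]
    rw [frameInner_pullback_mul b (c a) (A a) ⟨fun i => e ⟨a, i⟩, fun i j h => by simpa using h⟩
      (hA a) _ _ _ _ _ (hint f l a hl.1) (hint g l a hl.1), ih hl.2]
    intro k hk
    obtain ⟨⟨a', i⟩, rfl⟩ := e.surjective k
    refine hA' _ _ _ ?_
    rintro rfl
    exact hk ⟨i, rfl⟩

end Fiber

section Metric

variable {E : Type*} [NormedAddCommGroup E] [NormedSpace ℂ E] [FiniteDimensional ℂ E]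
  {ι : Type*} [Fintype ι] [DecidableEq ι]

/-- The real part of a Hermitian inner product, as a real bilinear form. -/
def reForm (h : E →ₗ⋆[ℂ] E →ₗ[ℂ] ℂ) : E →ₗ[ℝ] E →ₗ[ℝ] ℝ :=
  LinearMap.mk₂ ℝ (fun v w => (h v w).re)
    (by intros; simp)
    (by
      intro c v w
      have : c • v = (c : ℂ) • v := (Complex.coe_smul c v).symm
      rw [this, map_smulₛₗ]; simp)
    (by intros; simp)
    (by
      intro c v w
      have : c • w = (c : ℂ) • w := (Complex.coe_smul c w).symm
      rw [this, map_smul]; simp)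

@[simp] lemma reForm_apply (h : E →ₗ⋆[ℂ] E →ₗ[ℂ] ℂ) (v w : E) : reForm h v w = (h v w).re := rfl

lemma exists_reForm_orthonormal {h : E →ₗ⋆[ℂ] E →ₗ[ℂ] ℂ} (hh : IsHermitianInner h) :
    ∃ e : Module.Basis (Fin (Module.finrank ℝ E)) ℝ E,
      ∀ i j, (h (e i) (e j)).re = if i = j then 1 else 0 :=
  exists_orthonormal_basis (reForm h)
    (fun v w => by rw [reForm_apply, reForm_apply, ← hh.conj_symm, Complex.conj_re])
    fun v hv => hh.pos v hv

/-- The Gram matrix in a basis, computed from an orthonormal one. -/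
lemma gram_eq_of_orthonormal {κ : Type*} [Fintype κ] [DecidableEq κ]
    {h : E →ₗ⋆[ℂ] E →ₗ[ℂ] ℂ} (e : Module.Basis ι ℝ E)
    (he : ∀ i j, (h (e i) (e j)).re = if i = j then 1 else 0) (b : κ → E) :
    gram h b = (e.toMatrix b).transpose * e.toMatrix b := by
  ext i j
  have hb : ∀ i, b i = ∑ l, e.toMatrix b l i • e l := fun i => (e.sum_toMatrix_smul_self b i).symm
  have h1 : gram h b i j = reForm h (b i) (b j) := rfl
  rw [h1, hb i, hb j]
  simp only [map_sum, LinearMap.sum_apply, map_smul, LinearMap.smul_apply, smul_eq_mul,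
    Matrix.mul_apply, Matrix.transpose_apply, reForm_apply, he]
  simp [mul_comm]

/-- The inner product of forms may be computed in any orthonormal real basis. -/
lemma inner_eq_frameInner {h : E →ₗ⋆[ℂ] E →ₗ[ℂ] ℂ} (e : Module.Basis ι ℝ E)
    (he : ∀ i j, (h (e i) (e j)).re = if i = j then 1 else 0) (α β : CForm E) :
    inner h α β = frameInner e α β := by
  set b := Module.finBasis ℝ E with hb
  have hcard : Fintype.card ι = Module.finrank ℝ E := (Module.finrank_eq_card_basis e).symm
  rw [inner, frameInner, hcard]
  refine Finset.sum_congr rfl fun k _ => ?_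
  congr 1
  let P : Matrix (Fin (Module.finrank ℝ E)) ι ℝ := b.toMatrix e
  have hinv : (gram h b)⁻¹ = P * (1 : Matrix ι ι ℝ) * P.transpose := by
    rw [Matrix.mul_one]
    refine Matrix.inv_eq_left_inv ?_
    rw [gram_eq_of_orthonormal e he b, Matrix.mul_assoc, ← Matrix.mul_assoc P.transpose,
      ← Matrix.transpose_mul, Module.Basis.toMatrix_mul_toMatrix_flip, Matrix.transpose_one,
      Matrix.one_mul, Module.Basis.toMatrix_mul_toMatrix_flip]
  rw [hinv, ← pairing_change b e P (fun i => (b.sum_toMatrix_smul_self e i).symm) 1]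

/-- The volume factor of a Hermitian inner product in a basis. -/
lemma sqrt_det_gram {h : E →ₗ⋆[ℂ] E →ₗ[ℂ] ℂ} (e : Module.Basis ι ℝ E)
    (he : ∀ i j, (h (e i) (e j)).re = if i = j then 1 else 0) (b : ι → E) :
    √(gram h b).det = |e.det b| := by
  rw [gram_eq_of_orthonormal e he, Matrix.det_mul, Matrix.det_transpose, Real.sqrt_mul_self_eq_abs,
    Module.Basis.det_apply]

/-- Transformation of the volume factor under a linear map. -/
lemma sqrt_det_gram_map {h : E →ₗ⋆[ℂ] E →ₗ[ℂ] ℂ} (hh : IsHermitianInner h)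
    (A : E →ₗ[ℝ] E) (b : Fin (Module.finrank ℝ E) → E) :
    √(gram h fun i => A (b i)).det = |LinearMap.det A| * √(gram h b).det := by
  obtain ⟨e, he⟩ := exists_reForm_orthonormal hh
  have : (fun i => A (b i)) = A ∘ b := rfl
  rw [sqrt_det_gram e he, sqrt_det_gram e he, this, Module.Basis.det_comp, abs_mul]

lemma sqrt_det_gram_pos {h : E →ₗ⋆[ℂ] E →ₗ[ℂ] ℂ} (hh : IsHermitianInner h)
    (b : Module.Basis (Fin (Module.finrank ℝ E)) ℝ E) : 0 < √(gram h b).det := by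
  obtain ⟨e, he⟩ := exists_reForm_orthonormal hh
  rw [sqrt_det_gram e he]
  exact abs_pos.2 (Module.Basis.isUnit_det e b).ne_zero

end Metric

end CForm

/-! ### The Riemannian volume -/

namespace HermitianManifold

section Volume

variable {X : HermitianManifold.{u, v}}

instance : ProperSpace X.Model := FiniteDimensional.proper ℂ X.Model

variable (X) in
/-- The Lebesgue measure on the model space. -/
abbrev haar : Measure X.Model := (Module.finBasis ℝ X.Model).addHaar

lemma measurableSet_chart_source (x₀ : X) : MeasurableSet (X.chart x₀).source :=
  (X.chart x₀).open_source.measurableSet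

lemma measurableSet_chart_target (x₀ : X) : MeasurableSet (X.chart x₀).target :=
  (X.chart x₀).open_target.measurableSet

lemma measurableSet_target_inter_preimage (x₀ : X) {s : Set X} (hs : MeasurableSet s) :
    MeasurableSet ((X.chart x₀).target ∩ (X.chart x₀).symm ⁻¹' s) := by
  have h : Measurable ((X.chart x₀).target.domRestrict (X.chart x₀).symm) :=
    (continuousOn_iff_continuous_domRestrict.1 (X.chart x₀).continuousOn_symm).measurable
  have := (measurableSet_chart_target x₀).subtype_image (h hs)
  convert this using 1
  ext z
  simp [Set.domRestrict, and_comm]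

lemma aemeasurable_chart_symm (x₀ : X) {m : Measure X.Model}
    (hm : m ≪ X.haar.restrict (X.chart x₀).target) : AEMeasurable (X.chart x₀).symm m :=
  ((X.chart x₀).continuousOn_symm.aemeasurable (measurableSet_chart_target x₀)).mono_ac hm

/-- The density of the Riemannian volume in the coordinates of the chart at `x₀`. -/
def chartDensity (x₀ x : X) : ℝ := √(X.gramAt x₀ x).det

/-- The volume in a chart as an integral over the model space. -/
lemma chartVolume_apply (x₀ : X) {s : Set X} (hs : MeasurableSet s) :
    X.chartVolume x₀ s = ∫⁻ z in (X.chart x₀).target ∩ (X.chart x₀).symm ⁻¹' s,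
      ENNReal.ofReal (chartDensity x₀ ((X.chart x₀).symm z)) ∂X.haar := by
  have hm := aemeasurable_chart_symm x₀ (withDensity_absolutelyContinuous
    (X.haar.restrict (X.chart x₀).target)
    fun z => ENNReal.ofReal √((X.gramAt x₀ ((X.chart x₀).symm z)).det))
  -- the inverse of the chart has junk values outside the target, which is a null set here
  have h1 : (X.haar.restrict (X.chart x₀).target).withDensity
      (fun z => ENNReal.ofReal √((X.gramAt x₀ ((X.chart x₀).symm z)).det))
        ((X.chart x₀).target)ᶜ = 0 :=
    withDensity_absolutelyContinuous _ _ (by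
      rw [Measure.restrict_apply (measurableSet_chart_target x₀).compl]; simp)
  rw [chartVolume, Measure.map_apply_of_aemeasurable hm hs, ← measure_inter_add_sdiff _
    (measurableSet_chart_target x₀), inter_comm, measure_mono_null (sdiff_subset_compl _ _) h1, add_zero,
    withDensity_apply _ (measurableSet_target_inter_preimage x₀ hs), Measure.restrict_restrict
    (measurableSet_target_inter_preimage x₀ hs), inter_comm _ (X.chart x₀).target,
    ← inter_assoc, inter_self]
  rfl

lemma frame_comp_tangentCoordChange {x₀ x₁ x : X} (h₀ : x ∈ (X.chart x₀).source)
    (h₁ : x ∈ (X.chart x₁).source) (v : X.Model) :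
    X.frame x₁ x (tangentCoordChange 𝓘(ℂ, X.Model) x₀ x₁ x v) = X.frame x₀ x v := by
  refine tangentCoordChange_comp ⟨⟨?_, ?_⟩, mem_extChartAt_source x⟩ <;> simpa

lemma hasFDerivAt_transition {x₀ x₁ : X} {z : X.Model} (hz : z ∈ (X.chart x₀).target)
    (h₁ : (X.chart x₀).symm z ∈ (X.chart x₁).source) :
    HasFDerivAt (fun z => X.chart x₁ ((X.chart x₀).symm z))
      (tangentCoordChange 𝓘(ℂ, X.Model) x₀ x₁ ((X.chart x₀).symm z)) z := by
  have h := hasFDerivWithinAt_tangentCoordChange (I := 𝓘(ℂ, X.Model)) (x := x₀) (y := x₁)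
    (z := (X.chart x₀).symm z) ⟨by simpa using (X.chart x₀).map_target hz, by simpa using h₁⟩
  have hz' : extChartAt 𝓘(ℂ, X.Model) x₀ ((X.chart x₀).symm z) = z := by
    simpa using (X.chart x₀).right_inv hz
  rw [hz', ModelWithCorners.range_eq_univ, hasFDerivWithinAt_univ] at h
  exact h

/-- The densities in two charts differ by the Jacobian of the transition map. -/
lemma chartDensity_eq {x₀ x₁ x : X} (h₀ : x ∈ (X.chart x₀).source)
    (h₁ : x ∈ (X.chart x₁).source) :
    chartDensity x₀ x = |((tangentCoordChange 𝓘(ℂ, X.Model) x₀ x₁ x).restrictScalars ℝ).det| *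
      chartDensity x₁ x := by
  set T := ((tangentCoordChange 𝓘(ℂ, X.Model) x₀ x₁ x).restrictScalars ℝ).toLinearMap
  set A₁ := ((X.frame x₁ x).restrictScalars ℝ).toLinearMap
  have h := fun A => CForm.sqrt_det_gram_map (X.metric_hermitian x) A (Module.finBasis ℝ X.Model)
  have e₀ : chartDensity x₀ x = |LinearMap.det (A₁ ∘ₗ T)| *
      √(CForm.gram (X.metric x) (Module.finBasis ℝ X.Model)).det := by
    rw [← h]
    simp only [chartDensity, gramAt, ← frame_comp_tangentCoordChange h₀ h₁]
    rfl
  have e₁ : chartDensity x₁ x = |LinearMap.det A₁| *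
      √(CForm.gram (X.metric x) (Module.finBasis ℝ X.Model)).det := by
    rw [← h]; rfl
  rw [e₀, e₁, LinearMap.det_comp, abs_mul, mul_comm |LinearMap.det A₁|, mul_assoc]

/-- The volumes of two charts agree on the overlap of their domains. -/
lemma chartVolume_eq_of_subset (x₀ x₁ : X) {s : Set X} (hs : MeasurableSet s)
    (h₀ : s ⊆ (X.chart x₀).source) (h₁ : s ⊆ (X.chart x₁).source) :
    X.chartVolume x₀ s = X.chartVolume x₁ s := by
  rw [chartVolume_apply x₀ hs, chartVolume_apply x₁ hs]
  have himg : (X.chart x₁).target ∩ (X.chart x₁).symm ⁻¹' s =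
      (fun z => X.chart x₁ ((X.chart x₀).symm z)) ''
        ((X.chart x₀).target ∩ (X.chart x₀).symm ⁻¹' s) := by
    ext w
    constructor
    · rintro ⟨hw, hws⟩
      refine ⟨X.chart x₀ ((X.chart x₁).symm w), ⟨(X.chart x₀).map_source (h₀ hws), ?_⟩, ?_⟩
      · rw [mem_preimage, (X.chart x₀).left_inv (h₀ hws)]; exact hws
      · simp only [(X.chart x₀).left_inv (h₀ hws), (X.chart x₁).right_inv hw]
    · rintro ⟨z, ⟨hz, hzs⟩, rfl⟩
      refine ⟨(X.chart x₁).map_source (h₁ hzs), ?_⟩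
      rw [mem_preimage, (X.chart x₁).left_inv (h₁ hzs)]; exact hzs
  -- change of variables under the transition map
  rw [himg, lintegral_image_eq_lintegral_abs_det_fderiv_mul X.haar
    (measurableSet_target_inter_preimage x₀ hs)
    (f' := fun z => (tangentCoordChange 𝓘(ℂ, X.Model) x₀ x₁
      ((X.chart x₀).symm z)).restrictScalars ℝ)]
  · refine setLIntegral_congr_fun (measurableSet_target_inter_preimage x₀ hs) ?_
    rintro z ⟨hz, hzs⟩
    have hz' : (X.chart x₁).symm (X.chart x₁ ((X.chart x₀).symm z)) = (X.chart x₀).symm z :=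
      (X.chart x₁).left_inv (h₁ hzs)
    simp only [hz']
    rw [chartDensity_eq (h₀ hzs) (h₁ hzs), ENNReal.ofReal_mul (abs_nonneg _)]
  · rintro z ⟨hz, hzs⟩
    exact ((hasFDerivAt_transition hz (h₁ hzs)).restrictScalars ℝ).hasFDerivWithinAt
  · rintro z ⟨hz, hzs⟩ w ⟨hw, hws⟩ h
    have := (X.chart x₁).injOn (h₁ hzs) (h₁ hws) h
    exact (X.chart x₀).symm.injOn hz hw this

lemma chartVolume_compl_source (x₀ : X) : X.chartVolume x₀ (X.chart x₀).sourceᶜ = 0 := by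
  rw [chartVolume_apply x₀ (measurableSet_chart_source x₀).compl]
  have : (X.chart x₀).target ∩ (X.chart x₀).symm ⁻¹' (X.chart x₀).sourceᶜ = ∅ := by
    ext z
    simp only [mem_inter_iff, mem_preimage, mem_compl_iff, mem_empty_iff_false, iff_false, not_and,
      not_not]
    exact fun hz => (X.chart x₀).map_target hz
  rw [this]; simp

/-- On the domain of a chart the volume measure is the volume of this chart. -/
lemma volume_apply_of_subset (x₀ : X) {s : Set X} (hs : MeasurableSet s)
    (h₀ : s ⊆ (X.chart x₀).source) : X.volume s = X.chartVolume x₀ s := by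
  -- a disjoint measurable cover by parts of chart domains
  obtain ⟨T, hT, hU⟩ := X.exists_countable_charts
  have hTn : T.Nonempty := by
    by_contra h
    rw [not_nonempty_iff_eq_empty] at h
    rw [h] at hU
    simp only [mem_empty_iff_false, iUnion_false, iUnion_empty] at hU
    exact (hU.symm ▸ mem_univ x₀ : x₀ ∈ (∅ : Set X))
  obtain ⟨c, rfl⟩ := hT.exists_eq_range hTn
  rw [biUnion_range] at hU
  let A : ℕ → Set X := disjointed fun n => (X.chart (c n)).source
  have hA : ∀ n, A n ⊆ (X.chart (c n)).source := fun n => disjointed_subset _ n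
  have hAm : ∀ n, MeasurableSet (A n) :=
    fun n => MeasurableSet.disjointed (fun n => measurableSet_chart_source (c n)) n
  have hAd : Pairwise (Function.onFun Disjoint A) := disjoint_disjointed _
  have hAU : ⋃ n, A n = univ := by rw [iUnion_disjointed, hU]
  have hsplit : ∀ (m : Measure X) {s : Set X}, MeasurableSet s → m s = ∑' n, m (s ∩ A n) := by
    intro m s hs
    rw [← measure_iUnion (fun i j hij => (hAd hij).mono inter_subset_right inter_subset_right)
      fun n => hs.inter (hAm n), ← inter_iUnion, hAU, inter_univ]
  -- the chart volumes, glued along this cover; `ν` is an upper bound of all of them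
  let ν : Measure X := Measure.sum fun n => (X.chartVolume (c n)).restrict (A n)
  have hν : ∀ {s : Set X}, MeasurableSet s → ν s = ∑' n, X.chartVolume (c n) (s ∩ A n) := by
    intro s hs
    rw [Measure.sum_apply _ hs]
    simp only [Measure.restrict_apply hs]
  have hν0 : ∀ (x : X) {s : Set X}, MeasurableSet s → s ⊆ (X.chart x).source →
      ν s = X.chartVolume x s := by
    intro x s hs hsx
    rw [hν hs, hsplit (X.chartVolume x) hs]
    exact tsum_congr fun n => chartVolume_eq_of_subset _ _ (hs.inter (hAm n))
      (inter_subset_right.trans (hA n)) (inter_subset_left.trans hsx)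
  have hle : X.volume ≤ ν := by
    refine iSup_le fun x => Measure.le_iff.2 fun s hs => ?_
    rw [← measure_inter_add_sdiff s (measurableSet_chart_source x),
      measure_mono_null (sdiff_subset_compl _ _) (chartVolume_compl_source x), add_zero,
      ← hν0 x (hs.inter (measurableSet_chart_source x)) inter_subset_right]
    exact measure_mono inter_subset_left
  have hge : ∀ x, X.chartVolume x ≤ X.volume := le_iSup X.chartVolume
  refine le_antisymm ((hle s).trans (hν0 x₀ hs h₀).le) (hge x₀ s)

lemma volume_restrict_source (x₀ : X) :
    X.volume.restrict (X.chart x₀).source = X.chartVolume x₀ := by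
  ext s hs
  rw [Measure.restrict_apply hs, volume_apply_of_subset x₀ (hs.inter (measurableSet_chart_source x₀))
    inter_subset_right]
  conv_rhs => rw [← measure_inter_add_sdiff s (measurableSet_chart_source x₀),
    measure_mono_null (sdiff_subset_compl _ _) (chartVolume_compl_source x₀), add_zero]

lemma continuousOn_chartDensity (x₀ : X) : ContinuousOn (chartDensity x₀) (X.chart x₀).source := by
  have hA : ContinuousOn (fun x => X.gramAt x₀ x) (X.chart x₀).source :=
    continuousOn_pi.2 fun i => continuousOn_pi.2 fun j => X.continuousOn_gramAt x₀ i j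
  exact Real.continuous_sqrt.comp_continuousOn
    ((Continuous.matrix_det continuous_id).comp_continuousOn hA)

lemma chartDensity_pos {x₀ x : X} (hx : x ∈ (X.chart x₀).source) : 0 < chartDensity x₀ x := by
  have h := CForm.sqrt_det_gram_map (X.metric_hermitian x)
    ((X.frame x₀ x).restrictScalars ℝ).toLinearMap (Module.finBasis ℝ X.Model)
  have h0 := CForm.sqrt_det_gram_pos (X.metric_hermitian x) (Module.finBasis ℝ X.Model)
  have hd : LinearMap.det ((X.frame x₀ x).restrictScalars ℝ).toLinearMap ≠ 0 := by
    have hi : Function.Injective ((X.frame x₀ x).restrictScalars ℝ).toLinearMap :=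
      X.frame_injective hx
    exact ((LinearEquiv.ofInjectiveEndo _ hi).isUnit_det').ne_zero
  have : chartDensity x₀ x = _ := h
  rw [this]
  exact mul_pos (abs_pos.2 hd) h0

/-- The volume is finite on compact neighborhoods inside a chart, on which its density is bounded. -/
instance : IsLocallyFiniteMeasure X.volume := by
  refine ⟨fun x => ?_⟩
  have ht := (X.chart x).open_target.mem_nhds ((X.chart x).map_source (mem_chart_source X.Model x))
  obtain ⟨r, hr, hr'⟩ := Metric.nhds_basis_closedBall.mem_iff.1 ht
  set K := Metric.closedBall (X.chart x x) r with hK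
  have hKc : IsCompact K := isCompact_closedBall _ _
  refine ⟨(X.chart x).symm '' K, ?_, ?_⟩
  · have := (X.chart x).symm.image_mem_nhds (x := X.chart x x)
      ((X.chart x).map_source (mem_chart_source X.Model x)) (Metric.closedBall_mem_nhds _ hr)
    rwa [(X.chart x).left_inv (mem_chart_source X.Model x)] at this
  · have hKi : IsCompact ((X.chart x).symm '' K) :=
      hKc.image_of_continuousOn ((X.chart x).continuousOn_symm.mono hr')
    rw [volume_apply_of_subset x hKi.measurableSet (by
      rintro _ ⟨z, hz, rfl⟩; exact (X.chart x).map_target (hr' hz)),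
      chartVolume_apply x hKi.measurableSet]
    refine lt_of_le_of_lt (lintegral_mono_set (t := K) ?_) ?_
    · rintro z ⟨hz, w, hw, hwz⟩
      rwa [← (X.chart x).symm.injOn (hr' hw) hz hwz]
    · have hc : ContinuousOn (fun z => chartDensity x ((X.chart x).symm z)) K :=
        (continuousOn_chartDensity x).comp ((X.chart x).continuousOn_symm.mono hr')
          fun z hz => (X.chart x).map_target (hr' hz)
      exact (hc.integrableOn_compact hKc).lintegral_lt_top

end Volume

section Weighted

variable {X : HermitianManifold.{u, v}} {Ω : Set X} {φ : X → ℝ}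

/-- A relatively compact open set with a weight that is continuous up to the boundary. -/
structure IsBoundedDomain (Ω : Set X) (φ : X → ℝ) : Prop where
  isOpen : IsOpen Ω
  isCompact_closure : IsCompact (closure Ω)
  continuousOn : ContinuousOn φ (closure Ω)

lemma IsBoundedDomain.isFiniteMeasure (h : IsBoundedDomain Ω φ) :
    IsFiniteMeasure (X.weightedVolume Ω φ) := by
  have hc : ContinuousOn (fun x => Real.exp (-φ x)) (closure Ω) := h.continuousOn.neg.rexp
  obtain ⟨C, hC⟩ := (h.isCompact_closure.image_of_continuousOn hc).bddAbove
  refine ⟨?_⟩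
  rw [weightedVolume, withDensity_apply _ MeasurableSet.univ, Measure.restrict_univ]
  calc ∫⁻ x in Ω, ENNReal.ofReal (Real.exp (-φ x)) ∂X.volume
      ≤ ∫⁻ x in Ω, ENNReal.ofReal C ∂X.volume := by
        refine setLIntegral_mono' h.isOpen.measurableSet fun x hx => ?_
        exact ENNReal.ofReal_le_ofReal (hC ⟨x, subset_closure hx, rfl⟩)
    _ = ENNReal.ofReal C * X.volume Ω := by simp
    _ < ⊤ := ENNReal.mul_lt_top ENNReal.ofReal_lt_top
        ((measure_mono subset_closure).trans_lt h.isCompact_closure.measure_lt_top)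

/-- The part of the image of the chart at `x₀` that corresponds to `Ω`. -/
abbrev chartDomain (Ω : Set X) (x₀ : X) : Set X.Model :=
  (X.chart x₀).target ∩ (X.chart x₀).symm ⁻¹' Ω

lemma isOpen_chartDomain (hΩ : IsOpen Ω) (x₀ : X) : IsOpen (chartDomain Ω x₀) :=
  (X.chart x₀).isOpen_inter_preimage_symm hΩ

/-- The density of `e^{-φ} dV` in the coordinates of the chart at `x₀`. -/
def weightedDensity (φ : X → ℝ) (x₀ x : X) : ℝ := chartDensity x₀ x * Real.exp (-φ x)

lemma weightedDensity_pos {x₀ x : X} (hx : x ∈ (X.chart x₀).source) :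
    0 < weightedDensity φ x₀ x := mul_pos (chartDensity_pos hx) (Real.exp_pos _)

lemma IsBoundedDomain.continuousOn_weightedDensity (h : IsBoundedDomain Ω φ) (x₀ : X) :
    ContinuousOn (fun z => weightedDensity φ x₀ ((X.chart x₀).symm z)) (chartDomain Ω x₀) :=
  ((continuousOn_chartDensity x₀).comp ((X.chart x₀).continuousOn_symm.mono inter_subset_left)
    fun z hz => (X.chart x₀).map_target hz.1).mul
  ((h.continuousOn.neg.rexp).comp ((X.chart x₀).continuousOn_symm.mono inter_subset_left)
    fun z hz => subset_closure hz.2)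

/-- The measure `e^{-φ} dV` in a chart as an integral over the model space. -/
lemma IsBoundedDomain.weightedVolume_apply (h : IsBoundedDomain Ω φ) (x₀ : X) {s : Set X}
    (hs : MeasurableSet s) (hsx : s ⊆ (X.chart x₀).source) :
    X.weightedVolume Ω φ s = ∫⁻ z in chartDomain (Ω ∩ s) x₀,
      ENNReal.ofReal (weightedDensity φ x₀ ((X.chart x₀).symm z)) ∂X.haar := by
  set ν := (X.haar.restrict (X.chart x₀).target).withDensity fun z =>
    ENNReal.ofReal (chartDensity x₀ ((X.chart x₀).symm z)) with hν
  have hΩs := h.isOpen.measurableSet.inter hs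
  have hm : AEMeasurable (X.chart x₀).symm ν :=
    aemeasurable_chart_symm x₀ (withDensity_absolutelyContinuous _ _)
  have hw : AEMeasurable (fun x => ENNReal.ofReal (Real.exp (-φ x)))
      (X.volume.restrict (Ω ∩ s)) :=
    ((h.continuousOn.neg.rexp.mono (inter_subset_left.trans subset_closure)).aemeasurable
      hΩs).ennreal_ofReal
  have hd : ∀ t ⊆ (X.chart x₀).target, MeasurableSet t → AEMeasurable
      (fun z => ENNReal.ofReal (chartDensity x₀ ((X.chart x₀).symm z))) (X.haar.restrict t) :=
    fun t ht htm => (((continuousOn_chartDensity x₀).comp ((X.chart x₀).continuousOn_symm.mono ht)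
      fun z hz => (X.chart x₀).map_target (ht hz)).aemeasurable htm).ennreal_ofReal
  -- the volume on `Ω ∩ s` is the image of a measure with a density on the model space
  have hres : X.volume.restrict (Ω ∩ s) = (ν.restrict (chartDomain (Ω ∩ s) x₀)).map
      (X.chart x₀).symm := by
    have h1 : X.volume.restrict (Ω ∩ s) = (X.chartVolume x₀).restrict (Ω ∩ s) := by
      rw [← volume_restrict_source, Measure.restrict_restrict hΩs, inter_eq_left.2
        (inter_subset_right.trans hsx)]
    have h2 : ν.restrict ((X.chart x₀).symm ⁻¹' (Ω ∩ s)) = ν.restrict (chartDomain (Ω ∩ s) x₀) := by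
      refine Measure.restrict_congr_set ?_
      have : ∀ᵐ z ∂ν, z ∈ (X.chart x₀).target :=
        (withDensity_absolutelyContinuous _ _).ae_le (ae_restrict_mem (measurableSet_chart_target x₀))
      filter_upwards [this] with z hz
      exact propext ⟨fun h => ⟨hz, h⟩, fun h => h.2⟩
    rw [h1, ← h2]
    exact Measure.restrict_map_of_aemeasurable hm hΩs
  rw [weightedVolume, withDensity_apply _ hs, Measure.restrict_restrict hs, inter_comm, hres]
  rw [hres] at hw
  have hsm := measurableSet_target_inter_preimage x₀ hΩs
  rw [lintegral_map' hw (hm.mono_measure Measure.restrict_le_self), hν,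
    restrict_withDensity hsm, Measure.restrict_restrict hsm, inter_eq_left.2 inter_subset_left]
  have hw' : AEMeasurable (fun z => ENNReal.ofReal (Real.exp (-φ ((X.chart x₀).symm z))))
      (X.haar.restrict (chartDomain (Ω ∩ s) x₀)) :=
    (((h.continuousOn.neg.rexp).comp ((X.chart x₀).continuousOn_symm.mono inter_subset_left)
      fun z hz => subset_closure hz.2.1).aemeasurable hsm).ennreal_ofReal
  rw [lintegral_withDensity_eq_lintegral_mul₀ (hd _ inter_subset_left hsm) hw']
  refine lintegral_congr fun z => ?_
  exact (ENNReal.ofReal_mul (Real.sqrt_nonneg _)).symm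

/-- In a chart, `e^{-φ} dV` is the image of a measure with a positive density. -/
lemma IsBoundedDomain.weightedVolume_restrict (h : IsBoundedDomain Ω φ) (x₀ : X) :
    (X.weightedVolume Ω φ).restrict (X.chart x₀).source =
      ((X.haar.restrict (chartDomain Ω x₀)).withDensity fun z =>
        ENNReal.ofReal (weightedDensity φ x₀ ((X.chart x₀).symm z))).map (X.chart x₀).symm := by
  have hm := aemeasurable_chart_symm x₀ ((withDensity_absolutelyContinuous
    (X.haar.restrict (chartDomain Ω x₀)) (fun z =>
        ENNReal.ofReal (weightedDensity φ x₀ ((X.chart x₀).symm z)))).trans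
        (Measure.absolutelyContinuous_of_le (Measure.restrict_mono_set _ inter_subset_left)))
  have hΩm := measurableSet_target_inter_preimage x₀ h.isOpen.measurableSet
  ext s hs
  rw [Measure.restrict_apply hs, h.weightedVolume_apply x₀ (hs.inter (measurableSet_chart_source x₀))
    inter_subset_right, Measure.map_apply_of_aemeasurable hm hs]
  have h1 : (X.haar.restrict (chartDomain Ω x₀)).withDensity (fun z =>
        ENNReal.ofReal (weightedDensity φ x₀ ((X.chart x₀).symm z))) (X.chart x₀).targetᶜ = 0 :=
    withDensity_absolutelyContinuous _ _ (by
      rw [Measure.restrict_apply (measurableSet_chart_target x₀).compl]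
      refine measure_mono_null (t := ∅) ?_ measure_empty
      rintro z ⟨hz, hz', _⟩
      exact hz hz')
  rw [← measure_inter_add_sdiff ((X.chart x₀).symm ⁻¹' s) (measurableSet_chart_target x₀),
    measure_mono_null (sdiff_subset_compl _ _) h1, add_zero, inter_comm _ (X.chart x₀).target,
    withDensity_apply _ (measurableSet_target_inter_preimage x₀ hs), Measure.restrict_restrict
    (measurableSet_target_inter_preimage x₀ hs)]
  congr 2
  ext z
  simp only [chartDomain, mem_inter_iff, mem_preimage]
  constructor
  · rintro ⟨h1, h2, h3, h4⟩; exact ⟨⟨h1, h3⟩, h1, h2⟩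
  · rintro ⟨⟨h1, h3⟩, _, h2⟩; exact ⟨h1, h2, h3, (X.chart x₀).map_target h1⟩

/-- Since its density is positive, `e^{-φ} dV` has no null sets besides those of Lebesgue measure. -/
lemma IsBoundedDomain.haar_absolutelyContinuous (h : IsBoundedDomain Ω φ) (x₀ : X) :
    X.haar.restrict (chartDomain Ω x₀) ≪ (X.haar.restrict (chartDomain Ω x₀)).withDensity fun z =>
        ENNReal.ofReal (weightedDensity φ x₀ ((X.chart x₀).symm z)) := by
  have hΩm := measurableSet_target_inter_preimage x₀ h.isOpen.measurableSet
  refine withDensity_absolutelyContinuous'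
    (((h.continuousOn_weightedDensity x₀).aemeasurable hΩm).ennreal_ofReal) ?_
  filter_upwards [ae_restrict_mem hΩm] with z hz
  exact (ENNReal.ofReal_pos.2 (weightedDensity_pos ((X.chart x₀).map_target hz.1))).ne'

end Weighted

end HermitianManifold

/-! ### The volume of a product -/

lemma CForm.sqrt_det_gram_basis {E : Type*} [NormedAddCommGroup E] [NormedSpace ℂ E]
    [FiniteDimensional ℂ E] {h : E →ₗ⋆[ℂ] E →ₗ[ℂ] ℂ} (hh : IsHermitianInner h) (A : E →ₗ[ℝ] E)
    (b : Module.Basis (Fin (Module.finrank ℝ E)) ℝ E) (b' : Fin (Module.finrank ℝ E) → E) :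
    √(gram h fun i => A (b' i)).det = |b.det b'| * √(gram h fun i => A (b i)).det := by
  obtain ⟨e, he⟩ := exists_reForm_orthonormal hh
  have h1 : e.det b' = e.det b * b.det b' := by
    rw [Module.Basis.det_apply, Module.Basis.det_apply, Module.Basis.det_apply, ← Matrix.det_mul,
      Module.Basis.toMatrix_mul_toMatrix]
  rw [sqrt_det_gram_map hh, sqrt_det_gram_map hh, sqrt_det_gram e he, sqrt_det_gram e he, h1,
    abs_mul]
  ring

/-- A version of `Matrix.det_blockDiagonal'` for blocks of different sizes, indexed by any finite
type. -/
lemma Matrix.det_blockDiagonal'_eq {ι : Type*} [Fintype ι] [DecidableEq ι] {J : ι → Type*}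
    [∀ i, Fintype (J i)] [∀ i, DecidableEq (J i)] (M : ∀ i, Matrix (J i) (J i) ℝ) :
    (Matrix.blockDiagonal' M).det = ∏ i, (M i).det := by
  -- the determinant of a block triangular matrix needs an order of the blocks
  let o : LinearOrder ι := LinearOrder.lift' (Fintype.equivFin ι) (Fintype.equivFin ι).injective
  have h := Matrix.blockTriangular_blockDiagonal' M
  rw [h.det_fintype]
  refine Finset.prod_congr rfl fun k _ => ?_
  rw [← Matrix.det_submatrix_equiv_self (Equiv.sigmaSubtype k) (M k)]
  congr 1
  ext ⟨⟨i, a⟩, hi⟩ ⟨⟨j, b⟩, hj⟩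
  cases hi
  cases hj
  exact Matrix.blockDiagonal'_apply_eq M _ a b

namespace HermitianManifold

section PiVolume

variable {ι : Type} [Fintype ι] {X : ι → HermitianManifold.{u, v}}

lemma pi_chart_source (x₀ : pi X) : ((pi X).chart x₀).source =
    Set.pi univ fun i => ((X i).chart (x₀ i)).source := rfl

lemma pi_metric_apply (x : pi X) (v w : (pi X).Model) :
    (pi X).metric x v w = ∑ i, (X i).metric (x i) (v i) (w i) := rfl

lemma pi_frame_apply {x₀ x : pi X} (hx : x ∈ ((pi X).chart x₀).source) (v : (pi X).Model) (i : ι) :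
    (pi X).frame x₀ x v i = (X i).frame (x₀ i) (x i) (v i) :=
  tangentCoordChange_pi X x₀ x (fun i => hx i trivial) v i

lemma piDomain_eq (Ω : ∀ i, Set (X i)) : piDomain Ω = Set.pi univ Ω := by
  ext x
  exact ⟨fun h i _ => h i, fun h i => h i trivial⟩

lemma IsBoundedDomain.pi {Ω : ∀ i, Set (X i)} {φ : ∀ i, X i → ℝ}
    (h : ∀ i, IsBoundedDomain (Ω i) (φ i)) : IsBoundedDomain (piDomain Ω) (piWeight φ) := by
  have hcl : closure (piDomain Ω) = Set.pi univ fun i => closure (Ω i) := by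
    rw [piDomain_eq]
    exact closure_pi_set univ Ω
  refine ⟨?_, ?_, ?_⟩
  · rw [piDomain_eq]
    exact isOpen_set_pi finite_univ fun i _ => (h i).isOpen
  · rw [hcl]
    exact isCompact_univ_pi fun i => (h i).isCompact_closure
  · rw [hcl]
    refine continuousOn_finsetSum _ fun i _ => (h i).continuousOn.comp
      (continuous_apply (A := fun i => (X i).Carrier) i).continuousOn fun x hx => hx i trivial

/-- The Lebesgue measure of a product is the product measure if the basis that normalises it is
adapted to the product. -/
lemma addHaar_pi_basis {E : ι → Type*} [∀ i, NormedAddCommGroup (E i)] [∀ i, NormedSpace ℝ (E i)]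
    [∀ i, FiniteDimensional ℝ (E i)] [∀ i, MeasurableSpace (E i)] [∀ i, BorelSpace (E i)]
    {J : ι → Type*} [∀ i, Fintype (J i)] (b : ∀ i, Module.Basis (J i) ℝ (E i)) :
    (Pi.basis b).addHaar = Measure.pi fun i => (b i).addHaar := by
  classical
  have _ : ∀ i, ProperSpace (E i) := fun i => FiniteDimensional.proper ℝ (E i)
  rw [Module.Basis.addHaar_eq_iff]
  have : (((Pi.basis b).parallelepiped : TopologicalSpace.PositiveCompacts (∀ i, E i)) :
      Set (∀ i, E i)) = Set.pi univ fun i => parallelepiped (b i) := by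
    ext z
    rw [Module.Basis.coe_parallelepiped, parallelepiped_basis_eq]
    simp only [parallelepiped_basis_eq, mem_ofPred_eq, Set.mem_pi, mem_univ, true_implies,
      Pi.basis_repr, Sigma.forall]
  rw [this, Measure.pi_pi]
  simp [Module.Basis.addHaar_self]

variable (X) in
/-- An enumeration of the real coordinates of a product. -/
def piBasisEquiv : (Σ i, Fin (Module.finrank ℝ (X i).Model)) ≃
    Fin (Module.finrank ℝ (pi X).Model) :=
  Fintype.equivFinOfCardEq (Module.finrank_eq_card_basis
    (Pi.basis fun i => Module.finBasis ℝ (X i).Model)).symm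

variable (X) in
/-- The real basis of the model space of a product that consists of bases of the factors. -/
def piBasis : Module.Basis (Fin (Module.finrank ℝ (pi X).Model)) ℝ (pi X).Model :=
  (Pi.basis fun i => Module.finBasis ℝ (X i).Model).reindex (piBasisEquiv X)

lemma addHaar_piBasis : (piBasis X).addHaar =
    (Measure.pi fun i => (X i).haar : Measure (∀ i, (X i).Model)) :=
  (Module.Basis.addHaar_reindex _ _).trans (addHaar_pi_basis _)

variable (X) in
/-- The factor between the Lebesgue measure of the model space of a product and the product of
Lebesgue measures. -/
def haarFactor : ℝ := |(piBasis X).det (Module.finBasis ℝ (pi X).Model)|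

lemma haarFactor_pos : 0 < haarFactor X :=
  abs_pos.2 (Module.Basis.isUnit_det _ _).ne_zero

lemma addHaar_eq_smul {E κ : Type*} [NormedAddCommGroup E] [NormedSpace ℝ E] [MeasurableSpace E]
    [BorelSpace E] [Fintype κ] [DecidableEq κ] (b b' : Module.Basis κ ℝ E) :
    b'.addHaar = ENNReal.ofReal |b.det b'|⁻¹ • b.addHaar := by
  have hpos : 0 < |b.det b'| := abs_pos.2 (Module.Basis.isUnit_det _ _).ne_zero
  have hc : ENNReal.ofReal |b.det b'| ≠ 0 := (ENNReal.ofReal_pos.2 hpos).ne'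
  have : FiniteDimensional ℝ E := b.finiteDimensional_of_finite
  have : ProperSpace E := FiniteDimensional.proper ℝ E
  have hs : (ENNReal.ofReal |b.det b'|⁻¹ • b.addHaar).IsAddHaarMeasure :=
    Measure.IsAddHaarMeasure.smul _ (ENNReal.ofReal_pos.2 (inv_pos.2 hpos)).ne' ENNReal.ofReal_ne_top
  refine (b'.addHaar_eq_iff _).2 ?_
  rw [Module.Basis.coe_parallelepiped, Measure.smul_apply, Measure.addHaar_parallelepiped,
    smul_eq_mul, ENNReal.ofReal_inv_of_pos hpos]
  exact ENNReal.inv_mul_cancel hc ENNReal.ofReal_ne_top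

lemma pi_haar : (pi X).haar = (ENNReal.ofReal (haarFactor X)⁻¹ •
    Measure.pi fun i => (X i).haar : Measure (∀ i, (X i).Model)) := by
  rw [← addHaar_piBasis]
  exact addHaar_eq_smul (piBasis X) _

/-- In a basis adapted to the product, the Gram matrix is block diagonal. -/
lemma pi_gram_basis [DecidableEq ι] {x₀ x : pi X} (hx : x ∈ ((pi X).chart x₀).source) :
    CForm.gram ((pi X).metric x) (fun p => (pi X).frame x₀ x
      (Pi.basis (fun i => Module.finBasis ℝ (X i).Model) p : ∀ i, (X i).Model)) =
      Matrix.blockDiagonal' fun i => (X i).gramAt (x₀ i) (x i) := by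
  ext ⟨i, k⟩ ⟨j, l⟩
  have hfr : ∀ (v : (pi X).Model) m, (pi X).frame x₀ x v m =
    (X m).frame (x₀ m) (x m) (v m) := pi_frame_apply hx
  have h1 : CForm.gram ((pi X).metric x) (fun p => (pi X).frame x₀ x
      (Pi.basis (fun i => Module.finBasis ℝ (X i).Model) p : ∀ i, (X i).Model)) ⟨i, k⟩ ⟨j, l⟩ =
      ∑ m, ((X m).metric (x m)
        ((X m).frame (x₀ m) (x m) ((Pi.single i (Module.finBasis ℝ (X i).Model k) : ∀ i, (X i).Model) m))
        ((X m).frame (x₀ m) (x m) ((Pi.single j (Module.finBasis ℝ (X j).Model l) : ∀ i, (X i).Model) m))).re := by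
    rw [← Complex.re_sum]
    change ((pi X).metric x _ _).re = _
    rw [pi_metric_apply]
    refine congrArg Complex.re (Finset.sum_congr rfl fun m _ => ?_)
    refine congrArg₂ (fun v w => (X m).metric (x m) v w) ((hfr _ m).trans ?_) ((hfr _ m).trans ?_)
    · simp only [Pi.basis_apply]
    · simp only [Pi.basis_apply]
  rw [h1, Finset.sum_eq_single i]
  · by_cases hij : i = j
    · subst hij
      rw [Matrix.blockDiagonal'_apply_eq]
      simp [gramAt, CForm.gram]
    · rw [Matrix.blockDiagonal'_apply_ne _ _ _ hij, Pi.single_eq_of_ne hij]; simp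
  · intro m _ hm
    rw [Pi.single_eq_of_ne hm]; simp
  · simp

/-- `haarFactor` enters because `Module.finBasis` of a product is not adapted to the product; it
cancels against the factor in `pi_haar`. -/
lemma pi_chartDensity {x₀ x : pi X} (hx : x ∈ ((pi X).chart x₀).source) :
    chartDensity x₀ x = haarFactor X * ∏ i, chartDensity (X := X i) (x₀ i) (x i) := by
  classical
  have h1 := CForm.sqrt_det_gram_basis ((pi X).metric_hermitian x)
    (((pi X).frame x₀ x).restrictScalars ℝ).toLinearMap (piBasis X)
    (Module.finBasis ℝ (pi X).Model)
  refine h1.trans ?_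
  congr 1
  have h2 : (CForm.gram ((pi X).metric x) (fun i => (pi X).frame x₀ x (piBasis X i))).det =
      (Matrix.blockDiagonal' fun i => (X i).gramAt (x₀ i) (x i)).det := by
    rw [← pi_gram_basis hx]
    refine Eq.trans ?_ (Matrix.det_submatrix_equiv_self (piBasisEquiv X).symm _)
    congr 1
    ext k l
    have hb : ∀ k, piBasis X k = (Pi.basis (fun i => Module.finBasis ℝ (X i).Model)
      ((piBasisEquiv X).symm k) : ∀ i, (X i).Model) := fun k => Module.Basis.reindex_apply
        (Pi.basis fun i => Module.finBasis ℝ (X i).Model) (piBasisEquiv X) k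
    change ((pi X).metric x ((pi X).frame x₀ x (piBasis X k))
      ((pi X).frame x₀ x (piBasis X l))).re = _
    rw [hb, hb]
    rfl
  refine (congrArg Real.sqrt h2).trans ?_
  have hpos : ∀ i ∈ Finset.univ, 0 ≤ ((X i).gramAt (x₀ i) (x i)).det := by
    intro i _
    by_contra hneg
    have := chartDensity_pos (X := X i) (hx i trivial)
    rw [chartDensity, Real.sqrt_eq_zero_of_nonpos (not_le.1 hneg).le] at this
    exact lt_irrefl _ this
  rw [Matrix.det_blockDiagonal'_eq, Real.sqrt_prod _ hpos]
  rfl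

lemma pi_weightedDensity {φ : ∀ i, X i → ℝ} {x₀ x : pi X} (hx : x ∈ ((pi X).chart x₀).source) :
    weightedDensity (piWeight φ) x₀ x =
      haarFactor X * ∏ i, weightedDensity (φ i) (x₀ i) (x i) := by
  simp only [weightedDensity, pi_chartDensity hx, piWeight, Finset.prod_mul_distrib,
    ← Finset.sum_neg_distrib, Real.exp_sum]
  ring

/-- The measure of a box inside a product of charts, by Tonelli's theorem. -/
lemma pi_weightedVolume_apply {Ω : ∀ i, Set (X i)} {φ : ∀ i, X i → ℝ}
    (h : ∀ i, IsBoundedDomain (Ω i) (φ i)) (x₀ : pi X) {s : ∀ i, Set (X i)}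
    (hs : ∀ i, MeasurableSet (s i)) (hsx : ∀ i, s i ⊆ ((X i).chart (x₀ i)).source) :
    (pi X).weightedVolume (piDomain Ω) (piWeight φ) (Set.pi univ s) =
      ∏ i, (X i).weightedVolume (Ω i) (φ i) (s i) := by
  have hfin := fun i => (h i).isFiniteMeasure
  have hsm : MeasurableSet (Set.pi univ s) := MeasurableSet.univ_pi hs
  -- the box and the densities in coordinates
  let D : ∀ i, Set (X i).Model := fun i => chartDomain (Ω i ∩ s i) (x₀ i)
  have hD : ∀ i, MeasurableSet (D i) := fun i =>
    measurableSet_target_inter_preimage _ ((h i).isOpen.measurableSet.inter (hs i))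
  have hdom : chartDomain (piDomain Ω ∩ Set.pi univ s) x₀ = Set.pi univ D := by
    ext z
    exact ⟨fun h i _ => ⟨h.1 i trivial, h.2.1 i, h.2.2 i trivial⟩, fun h =>
      ⟨fun i _ => (h i trivial).1, fun i => (h i trivial).2.1, fun i _ => (h i trivial).2.2⟩⟩
  let f : ∀ i, (X i).Model → ℝ := fun i z =>
    weightedDensity (φ i) (x₀ i) (((X i).chart (x₀ i)).symm z)
  have hf0 : ∀ i, ∀ᵐ z ∂(X i).haar.restrict (D i), 0 ≤ f i z := fun i => by
    filter_upwards [ae_restrict_mem (hD i)] with z hz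
    exact (weightedDensity_pos (((X i).chart (x₀ i)).map_target hz.1)).le
  have hfi : ∀ i, Integrable (f i) ((X i).haar.restrict (D i)) := fun i => by
    refine ⟨((((h i).continuousOn_weightedDensity (x₀ i)).mono
      (inter_subset_inter_right _ (preimage_mono inter_subset_left))).aestronglyMeasurable
        (hD i)), ?_⟩
    rw [hasFiniteIntegral_iff_ofReal (hf0 i)]
    rw [← (h i).weightedVolume_apply (x₀ i) (hs i) (hsx i)]
    exact measure_lt_top _ _
  have e1 : ∀ i, (X i).weightedVolume (Ω i) (φ i) (s i) =
      ENNReal.ofReal (∫ z in D i, f i z ∂(X i).haar) := fun i => by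
    rw [(h i).weightedVolume_apply (x₀ i) (hs i) (hsx i),
      ofReal_integral_eq_lintegral_ofReal (hfi i) (hf0 i)]
  simp only [e1]
  have hres : (Measure.pi fun i => (X i).haar).restrict (Set.pi univ D) =
    Measure.pi fun i => (X i).haar.restrict (D i) := Measure.restrict_pi_pi _ _
  have hdens : ∀ z : ∀ i, (X i).Model, z ∈ Set.pi univ D →
      weightedDensity (piWeight φ) x₀ (((pi X).chart x₀).symm z) =
        haarFactor X * ∏ i, f i (z i) := fun z hz =>
    pi_weightedDensity (fun i _ => ((X i).chart (x₀ i)).map_target (hz i trivial).1)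
  -- the integral over the box in coordinates, with respect to the product measure
  have e2 : (pi X).haar.restrict (Set.pi univ D) = (ENNReal.ofReal (haarFactor X)⁻¹ •
      Measure.pi fun i => (X i).haar.restrict (D i) : Measure (∀ i, (X i).Model)) := by
    rw [pi_haar, ← hres]
    exact Measure.restrict_smul _ _ _
  have e3 : (∫⁻ z : ∀ i, (X i).Model, ENNReal.ofReal
      (weightedDensity (piWeight φ) x₀ (((pi X).chart x₀).symm z))
      ∂(ENNReal.ofReal (haarFactor X)⁻¹ • Measure.pi fun i => (X i).haar.restrict (D i))) =
      ENNReal.ofReal (∏ i, ∫ z in D i, f i z ∂(X i).haar) := by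
    rw [← integral_fintype_prod_eq_prod f, lintegral_smul_measure,
      ofReal_integral_eq_lintegral_ofReal (Integrable.fintype_prod_dep hfi), smul_eq_mul,
      ← lintegral_const_mul' _ _ ENNReal.ofReal_ne_top]
    · refine lintegral_congr_ae ?_
      rw [← hres]
      filter_upwards [ae_restrict_mem (MeasurableSet.univ_pi hD)] with z hz
      rw [hdens z hz, ← ENNReal.ofReal_mul (inv_nonneg.2 haarFactor_pos.le), ← mul_assoc,
        inv_mul_cancel₀ haarFactor_pos.ne', one_mul]
    · rw [← hres]
      filter_upwards [ae_restrict_mem (MeasurableSet.univ_pi hD)] with z hz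
      exact Finset.prod_nonneg fun i _ =>
        (weightedDensity_pos (((X i).chart (x₀ i)).map_target (hz i trivial).1)).le
  rw [← ENNReal.ofReal_prod_of_nonneg fun i _ => integral_nonneg_of_ae (hf0 i), ← e3, ← e2]
  refine ((IsBoundedDomain.pi h).weightedVolume_apply x₀ hsm
    (Set.pi_mono fun i _ => hsx i)).trans ?_
  rw [hdom]
  rfl

/-- The measure `e^{-φ} dV` of a product domain is the product measure. -/
lemma pi_weightedVolume {Ω : ∀ i, Set (X i)} {φ : ∀ i, X i → ℝ}
    (h : ∀ i, IsBoundedDomain (Ω i) (φ i)) :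
    (pi X).weightedVolume (piDomain Ω) (piWeight φ) =
      (Measure.pi fun i => (X i).weightedVolume (Ω i) (φ i) : Measure (∀ i, X i)) := by
  have hfin := fun i => (h i).isFiniteMeasure
  obtain ⟨T, hT, hU⟩ := (pi X).exists_countable_charts
  refine (Measure.ext_iff_of_biUnion_eq_univ hT hU).2 fun x₀ _ => ?_
  have hres := Measure.restrict_pi_pi (fun i => (X i).weightedVolume (Ω i) (φ i))
    fun i => ((X i).chart (x₀ i)).source
  refine Eq.trans ?_ hres.symm
  refine (Measure.pi_eq fun s hs => ?_).symm
  have hm : MeasurableSet (Set.pi univ s) := MeasurableSet.univ_pi hs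
  refine (Measure.restrict_apply hm).trans ?_
  rw [pi_chart_source, ← Set.pi_inter_distrib]
  refine (pi_weightedVolume_apply h x₀
    (fun i => (hs i).inter (measurableSet_chart_source _)) fun i => inter_subset_right).trans ?_
  exact Finset.prod_congr rfl fun i _ => (Measure.restrict_apply (hs i)).symm

end PiVolume

end HermitianManifold

/-! ### Products of forms pulled back from the factors -/

section ListProd

variable {α : Type*} [DecidableEq α] {M : Type*} [Monoid M]

lemma List.Nodup.exists_split {l : List α} (hl : l.Nodup) {a : α} (ha : a ∈ l) :
    ∃ l₁ l₂, l = l₁ ++ a :: l₂ ∧ a ∉ l₁ ∧ a ∉ l₂ := by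
  obtain ⟨l₁, l₂, rfl⟩ := List.append_of_mem ha
  rw [List.nodup_append] at hl
  refine ⟨l₁, l₂, rfl, fun h => hl.2.2 a h a List.mem_cons_self rfl, (List.nodup_cons.1 hl.2.1).1⟩

lemma List.prod_map_split {β : α → Type*} (G : ∀ a, β a → M) (l₁ l₂ : List α) (a : α)
    (h₁ : a ∉ l₁) (h₂ : a ∉ l₂) (f : ∀ a, β a) (z : β a) :
    ((l₁ ++ a :: l₂).map fun i => G i (Function.update f a z i)).prod =
      (l₁.map fun i => G i (f i)).prod * G a z * (l₂.map fun i => G i (f i)).prod := by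
  have h : ∀ l : List α, a ∉ l → (l.map fun i => G i (Function.update f a z i)) =
      l.map fun i => G i (f i) := fun l hl => List.map_congr_left fun i hi => by
    have hne : i ≠ a := by rintro rfl; exact hl hi
    rw [Function.update_of_ne hne]
  rw [List.map_append, List.map_cons, h _ h₁, h _ h₂, List.prod_append, List.prod_cons,
    Function.update_self, mul_assoc]

end ListProd

namespace CForm

variable {E : Type*} [NormedAddCommGroup E] [NormedSpace ℂ E] [FiniteDimensional ℂ E]

/-- Coefficients of a product as polynomials in the coefficients of the factors. -/
lemma apply_mul (l : Module.Dual ℂ (CForm E)) (x y : CForm E) :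
    l (x * y) = ∑ i, ∑ j, (Module.finBasis ℂ (CForm E)).coord i x *
      (Module.finBasis ℂ (CForm E)).coord j y *
        l (Module.finBasis ℂ (CForm E) i * Module.finBasis ℂ (CForm E) j) := by
  conv_lhs => rw [← (Module.finBasis ℂ (CForm E)).sum_repr x,
    ← (Module.finBasis ℂ (CForm E)).sum_repr y]
  simp only [Finset.sum_mul_sum, map_sum, smul_mul_smul_comm, map_smul, smul_eq_mul,
    Module.Basis.coord_apply]

lemma aestronglyMeasurable_mul {β : Type*} [MeasurableSpace β] {m : Measure β}
    {f g : β → CForm E}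
    (hf : ∀ l : Module.Dual ℂ (CForm E), AEStronglyMeasurable (fun x => l (f x)) m)
    (hg : ∀ l : Module.Dual ℂ (CForm E), AEStronglyMeasurable (fun x => l (g x)) m)
    (l : Module.Dual ℂ (CForm E)) : AEStronglyMeasurable (fun x => l (f x * g x)) m := by
  have h : ∀ x, l (f x * g x) = _ := fun x => apply_mul l (f x) (g x)
  simp only [h]
  exact Finset.aestronglyMeasurable_fun_sum _ fun i _ => Finset.aestronglyMeasurable_fun_sum _
    fun j _ => ((hf _).mul (hg _)).mul_const _

lemma aestronglyMeasurable_list_prod {β α : Type*} [MeasurableSpace β] {m : Measure β}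
    {f : α → β → CForm E} (s : List α)
    (hf : ∀ a ∈ s, ∀ l : Module.Dual ℂ (CForm E), AEStronglyMeasurable (fun x => l (f a x)) m)
    (l : Module.Dual ℂ (CForm E)) :
    AEStronglyMeasurable (fun x => l (s.map fun a => f a x).prod) m := by
  induction s generalizing l with
  | nil => exact aestronglyMeasurable_const (b := l 1)
  | cons a s ih =>
    simp only [List.map_cons, List.prod_cons]
    exact aestronglyMeasurable_mul (hf a List.mem_cons_self)
      (ih fun b hb => hf b (List.mem_cons_of_mem _ hb)) l

end CForm

namespace HermitianManifold

lemma PreL2.ext {X : HermitianManifold.{u, v}} {Ω : Set X} {φ : X → ℝ} {f g : X.PreL2 Ω φ}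
    (h : f.form = g.form) : f = g := Subtype.ext h

lemma PreL2.inner_toL2 {X : HermitianManifold.{u, v}} {Ω : Set X} {φ : X → ℝ}
    (f g : X.PreL2 Ω φ) : ⟪f.toL2, g.toL2⟫_ℂ = ⟪f, g⟫_ℂ := SeparationQuotient.inner_mk_mk _ _

lemma PreL2.exists_rep {X : HermitianManifold.{u, v}} {Ω : Set X} {φ : X → ℝ} (F : X.L2 Ω φ) :
    ∃ f : X.PreL2 Ω φ, f.toL2 = F := SeparationQuotient.surjective_mk F

/-- A decomposition of a weighted domain `ΩZ` in `Z` as a product of weighted domains in the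
manifolds `Y a`, with an order in which forms on the factors are multiplied. -/
structure ProductData {α : Type} [Fintype α] (Z : HermitianManifold.{u, v}) (ΩZ : Set Z)
    (φZ : Z → ℝ) (Y : α → HermitianManifold.{u, v}) (Ω : ∀ a, Set (Y a)) (φ : ∀ a, Y a → ℝ) where
  /-- The projections to the factors. -/
  proj : ∀ a, Z → Y a
  /-- Their derivatives. -/
  dproj : ∀ a, Z.Model →ₗ[ℝ] (Y a).Model
  /-- The order of the factors. -/
  order : List α
  nodup : order.Nodup
  mem_order : ∀ a, a ∈ order
  bijective : Function.Bijective fun v a => dproj a v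
  metric_eq : ∀ x v w, Z.metric x v w =
    ∑ a, (Y a).metric (proj a x) (dproj a v) (dproj a w)
  mapsTo : ∀ x₀ x, x ∈ (Z.chart x₀).source → ∀ a, proj a x ∈ ((Y a).chart (proj a x₀)).source
  frame_eq : ∀ x₀ x, x ∈ (Z.chart x₀).source → ∀ a v,
    dproj a (Z.frame x₀ x v) = (Y a).frame (proj a x₀) (proj a x) (dproj a v)
  isFiniteMeasure : ∀ a, IsFiniteMeasure ((Y a).weightedVolume (Ω a) (φ a))
  measurePreserving : MeasurePreserving (fun x a => proj a x) (Z.weightedVolume ΩZ φZ)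
    (Measure.pi fun a => (Y a).weightedVolume (Ω a) (φ a))

namespace ProductData

variable {α : Type} [Fintype α] {Z : HermitianManifold.{u, v}} {ΩZ : Set Z}
    {φZ : Z → ℝ} {Y : α → HermitianManifold.{u, v}} {Ω : ∀ a, Set (Y a)} {φ : ∀ a, Y a → ℝ}
    (D : ProductData Z ΩZ φZ Y Ω φ)

/-- The exterior product of the pullbacks of forms on the factors. -/
def tensorForm (f : ∀ a, (Y a).Form) : Z.Form :=
  fun x => (D.order.map fun a => CForm.pullback (D.dproj a) (f a (D.proj a x))).prod

lemma prod_order (c : α → ℂ) : (D.order.map c).prod = ∏ a, c a := by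
  classical
  rw [← List.prod_toFinset c D.nodup]
  congr 1
  ext a
  simp [D.mem_order a]

/-- The tangent space of the product is the product of the tangent spaces. -/
def equiv : Z.Model ≃ₗ[ℝ] ∀ a, (Y a).Model :=
  LinearEquiv.ofBijective (LinearMap.pi D.dproj) D.bijective

lemma dproj_equiv_symm (w : ∀ a, (Y a).Model) (a : α) : D.dproj a (D.equiv.symm w) = w a :=
  congrFun (D.equiv.apply_symm_apply w) a

/-- The fibers of the forms on `Z` are tensor products: the inner product of exterior products is the
product of the inner products. -/
lemma fiberInner_tensorForm (f g : ∀ a, (Y a).Form) (x : Z) :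
    Z.fiberInner x (D.tensorForm f x) (D.tensorForm g x) =
      ∏ a, (Y a).fiberInner (D.proj a x) (f a (D.proj a x)) (g a (D.proj a x)) := by
  classical
  choose c hc using fun a => CForm.exists_reForm_orthonormal ((Y a).metric_hermitian (D.proj a x))
  -- orthonormal frames of the factors give an orthonormal frame of the product
  let b := (Pi.basis c).map D.equiv.symm
  have hb : ∀ a i a', D.dproj a' (b ⟨a, i⟩) = (Pi.single a (c a i) : ∀ a, (Y a).Model) a' := by
    intro a i a'
    rw [Module.Basis.map_apply, D.dproj_equiv_symm, Pi.basis_apply]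
  have hon : ∀ p q, (Z.metric x (b p) (b q)).re = if p = q then 1 else 0 := by
    rintro ⟨a, i⟩ ⟨a', j⟩
    rw [D.metric_eq, Complex.re_sum, Finset.sum_eq_single a]
    · rw [hb, hb, Pi.single_eq_same]
      by_cases h : a = a'
      · subst h
        rw [Pi.single_eq_same, hc]
        simp
      · rw [Pi.single_eq_of_ne h, map_zero, Complex.zero_re, if_neg]
        exact fun h' => h (congrArg Sigma.fst h')
    · intro a'' _ h
      rw [hb, Pi.single_eq_of_ne h]; simp
    · simp
  have h1 := CForm.inner_eq_frameInner (h := Z.metric x) b hon (D.tensorForm f x) (D.tensorForm g x)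
  refine h1.trans ((CForm.frameInner_list_prod b (fun a => c a) D.dproj (Equiv.refl _)
    (fun a i => ?_) (fun a a' i h => ?_) _ _ D.order D.nodup).trans ?_)
  · rw [Equiv.refl_apply, hb, Pi.single_eq_same]
  · rw [Equiv.refl_apply, hb, Pi.single_eq_of_ne h]
  · rw [D.prod_order]
    exact Finset.prod_congr rfl fun a _ => (CForm.inner_eq_frameInner _ (hc a) _ _).symm

lemma pullback_frame_dproj {x₀ x : Z} (hx : x ∈ (Z.chart x₀).source) (a : α)
    (β : CForm (Y a).Model) :
    CForm.pullback ((Z.frame x₀ x).restrictScalars ℝ).toLinearMap (CForm.pullback (D.dproj a) β) =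
      CForm.pullback (D.dproj a)
        (CForm.pullback (((Y a).frame (D.proj a x₀) (D.proj a x)).restrictScalars ℝ).toLinearMap β) := by
  rw [CForm.pullback_pullback, CForm.pullback_pullback]
  congr 2
  exact LinearMap.ext fun v => D.frame_eq x₀ x hx a v

lemma inChart_tensorForm (f : ∀ a, (Y a).Form) {x₀ x : Z} (hx : x ∈ (Z.chart x₀).source) :
    (D.tensorForm f).inChart x₀ x = (D.order.map fun a => CForm.pullback (D.dproj a)
      ((f a).inChart (D.proj a x₀) (D.proj a x))).prod := by
  rw [Form.inChart, tensorForm, map_list_prod, List.map_map]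
  congr 1
  refine List.map_congr_left fun a _ => ?_
  exact D.pullback_frame_dproj hx a _

lemma quasiMeasurePreserving_proj (a : α) :
    Measure.QuasiMeasurePreserving (D.proj a) (Z.weightedVolume ΩZ φZ)
      ((Y a).weightedVolume (Ω a) (φ a)) :=
  have := D.isFiniteMeasure
  (Measure.quasiMeasurePreserving_eval (fun a => (Y a).weightedVolume (Ω a) (φ a)) a).comp
    D.measurePreserving.quasiMeasurePreserving

lemma aemeas_tensorForm {f : ∀ a, (Y a).Form}
    (hf : ∀ a, (f a).AEMeas ((Y a).weightedVolume (Ω a) (φ a))) :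
    (D.tensorForm f).AEMeas (Z.weightedVolume ΩZ φZ) := by
  intro x₀ l
  have h1 : ∀ a ∈ D.order, ∀ l : Module.Dual ℂ (CForm Z.Model), AEStronglyMeasurable
      (fun x => l (CForm.pullback (D.dproj a) ((f a).inChart (D.proj a x₀) (D.proj a x))))
      ((Z.weightedVolume ΩZ φZ).restrict (Z.chart x₀).source) := by
    intro a _ l
    have h2 := hf a (D.proj a x₀) (l ∘ₗ (CForm.pullback (D.dproj a)).toLinearMap)
    exact h2.comp_quasiMeasurePreserving
      ((D.quasiMeasurePreserving_proj a).restrict fun x hx => D.mapsTo x₀ x hx a)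
  refine (CForm.aestronglyMeasurable_list_prod D.order h1 l).congr ?_
  filter_upwards [ae_restrict_mem (measurableSet_chart_source x₀)] with x hx
  rw [D.inChart_tensorForm f hx]

lemma integrable_prod_proj {G : ∀ a, Y a → ℂ}
    (hG : ∀ a, Integrable (G a) ((Y a).weightedVolume (Ω a) (φ a))) :
    Integrable (fun x => ∏ a, G a (D.proj a x)) (Z.weightedVolume ΩZ φZ) :=
  have := D.isFiniteMeasure
  have h := Integrable.fintype_prod_dep hG
  (D.measurePreserving.integrable_comp h.aestronglyMeasurable).2 h

lemma integral_prod_proj {G : ∀ a, Y a → ℂ}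
    (hG : ∀ a, Integrable (G a) ((Y a).weightedVolume (Ω a) (φ a))) :
    ∫ x, ∏ a, G a (D.proj a x) ∂Z.weightedVolume ΩZ φZ =
      ∏ a, ∫ y, G a y ∂(Y a).weightedVolume (Ω a) (φ a) := by
  have := D.isFiniteMeasure
  have h := Integrable.fintype_prod_dep hG
  rw [← integral_fintype_prod_eq_prod, ← D.measurePreserving.map_eq, integral_map
    D.measurePreserving.measurable.aemeasurable]
  rw [D.measurePreserving.map_eq]
  exact h.aestronglyMeasurable

/-- The exterior product of square integrable forms on the factors. -/
def tensorPre (f : ∀ a, (Y a).PreL2 (Ω a) (φ a)) : Z.PreL2 ΩZ φZ :=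
  ⟨D.tensorForm fun a => (f a).form, D.aemeas_tensorForm fun a => (f a).form_aemeas, by
    simp only [D.fiberInner_tensorForm]
    exact (D.integrable_prod_proj fun a => PreL2.integrable_fiberInner (f a) (f a)).re⟩

lemma form_tensorPre (f : ∀ a, (Y a).PreL2 (Ω a) (φ a)) :
    (D.tensorPre f).form = D.tensorForm fun a => (f a).form := rfl

lemma inner_tensorPre (f g : ∀ a, (Y a).PreL2 (Ω a) (φ a)) :
    ⟪D.tensorPre f, D.tensorPre g⟫_ℂ = ∏ a, ⟪f a, g a⟫_ℂ := by
  simp only [PreL2.inner_def, form_tensorPre, D.fiberInner_tensorForm]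
  exact D.integral_prod_proj fun a => PreL2.integrable_fiberInner (f a) (g a)

/-- The class of a product depends only on the classes of the factors, since inner products do. -/
lemma toL2_tensorPre_congr {f g : ∀ a, (Y a).PreL2 (Ω a) (φ a)}
    (h : ∀ a, (f a).toL2 = (g a).toL2) : (D.tensorPre f).toL2 = (D.tensorPre g).toL2 := by
  rw [← sub_eq_zero, ← inner_self_eq_zero (𝕜 := ℂ)]
  simp only [inner_sub_left, inner_sub_right, PreL2.inner_toL2, D.inner_tensorPre]
  simp only [← PreL2.inner_toL2, h, sub_self]

/-- The dependence of a product on one of its factors. -/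
lemma tensorForm_update [DecidableEq α] (a : α) : ∃ l r : (∀ a, (Y a).Form) → Z.Form,
    ∀ f z, D.tensorForm (Function.update f a z) =
      l f * (fun x => CForm.pullback (D.dproj a) (z (D.proj a x))) * r f := by
  obtain ⟨l₁, l₂, h, h₁, h₂⟩ := D.nodup.exists_split (D.mem_order a)
  refine ⟨fun f x => (l₁.map fun a => CForm.pullback (D.dproj a) (f a (D.proj a x))).prod,
    fun f x => (l₂.map fun a => CForm.pullback (D.dproj a) (f a (D.proj a x))).prod,
    fun f z => funext fun x => ?_⟩
  rw [tensorForm, h]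
  exact List.prod_map_split (fun a (f : (Y a).Form) => CForm.pullback (D.dproj a) (f (D.proj a x)))
    l₁ l₂ a h₁ h₂ f z

lemma tensorPre_update_add [DecidableEq α] (f : ∀ a, (Y a).PreL2 (Ω a) (φ a)) (a : α)
    (x y : (Y a).PreL2 (Ω a) (φ a)) : D.tensorPre (Function.update f a (x + y)) =
      D.tensorPre (Function.update f a x) + D.tensorPre (Function.update f a y) := by
  obtain ⟨l, r, h⟩ := D.tensorForm_update a
  have hu : ∀ z, (fun i => (Function.update f a z i).form) =
      Function.update (fun i => (f i).form) a z.form := fun z =>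
    funext fun i => Function.apply_update (fun i (g : (Y i).PreL2 (Ω i) (φ i)) => g.form) f a z i
  refine PreL2.ext ?_
  simp only [PreL2.form_add, form_tensorPre, hu, h]
  rw [← add_mul, ← mul_add]
  congr 2
  exact funext fun p => map_add _ _ _

lemma tensorPre_update_smul [DecidableEq α] (f : ∀ a, (Y a).PreL2 (Ω a) (φ a)) (a : α) (c : ℂ)
    (x : (Y a).PreL2 (Ω a) (φ a)) : D.tensorPre (Function.update f a (c • x)) =
      c • D.tensorPre (Function.update f a x) := by
  obtain ⟨l, r, h⟩ := D.tensorForm_update a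
  have hu : ∀ z, (fun i => (Function.update f a z i).form) =
      Function.update (fun i => (f i).form) a z.form := fun z =>
    funext fun i => Function.apply_update (fun i (g : (Y i).PreL2 (Ω i) (φ i)) => g.form) f a z i
  refine PreL2.ext ?_
  simp only [PreL2.form_smul, form_tensorPre, hu, h]
  rw [← smul_mul_assoc, ← mul_smul_comm]
  congr 2
  exact funext fun p => map_smul (CForm.pullback (D.dproj a)) c _

lemma toL2_update [DecidableEq α] (f : ∀ a, (Y a).PreL2 (Ω a) (φ a)) (a : α)
    (x : (Y a).PreL2 (Ω a) (φ a)) : (fun i => (Function.update f a x i).toL2) =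
      Function.update (fun i => (f i).toL2) a x.toL2 :=
  funext fun i => Function.apply_update (fun i (g : (Y i).PreL2 (Ω i) (φ i)) => g.toL2) f a x i

/-- The exterior product of square integrable forms, as a multilinear map. -/
def tensor : MultilinearMap ℂ (fun a => (Y a).L2 (Ω a) (φ a)) (Z.L2 ΩZ φZ) where
  toFun F := (D.tensorPre fun a => (PreL2.exists_rep (F a)).choose).toL2
  map_update_add' F a x y := by
    choose f hf using fun a => PreL2.exists_rep (F a)
    obtain ⟨x, rfl⟩ := PreL2.exists_rep x
    obtain ⟨y, rfl⟩ := PreL2.exists_rep y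
    obtain rfl : (fun a => (f a).toL2) = F := funext hf
    have h : ∀ z, (D.tensorPre fun i => (PreL2.exists_rep
        (Function.update (fun a => (f a).toL2) a z.toL2 i)).choose).toL2 =
        (D.tensorPre (Function.update f a z)).toL2 := fun z => by
      refine D.toL2_tensorPre_congr fun i => ?_
      rw [(PreL2.exists_rep _).choose_spec]
      exact (congrFun (toL2_update f a z) i).symm
    have hxy : x.toL2 + y.toL2 = (x + y).toL2 := rfl
    rw [hxy, h, h, h, D.tensorPre_update_add]
    rfl
  map_update_smul' F a c x := by
    choose f hf using fun a => PreL2.exists_rep (F a)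
    obtain ⟨x, rfl⟩ := PreL2.exists_rep x
    obtain rfl : (fun a => (f a).toL2) = F := funext hf
    have h : ∀ z, (D.tensorPre fun i => (PreL2.exists_rep
        (Function.update (fun a => (f a).toL2) a z.toL2 i)).choose).toL2 =
        (D.tensorPre (Function.update f a z)).toL2 := fun z => by
      refine D.toL2_tensorPre_congr fun i => ?_
      rw [(PreL2.exists_rep _).choose_spec]
      exact (congrFun (toL2_update f a z) i).symm
    have hxy : c • x.toL2 = (c • x).toL2 := rfl
    rw [hxy, h, h, D.tensorPre_update_smul]
    rfl

lemma tensor_toL2 (f : ∀ a, (Y a).PreL2 (Ω a) (φ a)) :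
    D.tensor (fun a => (f a).toL2) = (D.tensorPre f).toL2 :=
  D.toL2_tensorPre_congr fun a => (PreL2.exists_rep (f a).toL2).choose_spec

lemma inner_tensor (F G : ∀ a, (Y a).L2 (Ω a) (φ a)) :
    ⟪D.tensor F, D.tensor G⟫_ℂ = ∏ a, ⟪F a, G a⟫_ℂ := by
  choose f hf using fun a => PreL2.exists_rep (F a)
  choose g hg using fun a => PreL2.exists_rep (G a)
  obtain rfl : (fun a => (f a).toL2) = F := funext hf
  obtain rfl : (fun a => (g a).toL2) = G := funext hg
  simp only [tensor_toL2, PreL2.inner_toL2, D.inner_tensorPre]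

end ProductData

end HermitianManifold

/-! ### The decompositions of a product of domains -/

namespace HermitianManifold

section PiData

variable {ι : Type} [Fintype ι] [LinearOrder ι] {X : ι → HermitianManifold.{u, v}}
  {Ω : ∀ i, Set (X i)} {φ : ∀ i, X i → ℝ}

/-- A product of domains, decomposed into its factors. -/
def piData (h : ∀ i, IsBoundedDomain (Ω i) (φ i)) :
    ProductData (pi X) (piDomain Ω) (piWeight φ) X Ω φ where
  proj i x := x i
  dproj := tangentProj X
  order := Finset.univ.sort (· ≤ ·)
  nodup := Finset.sort_nodup _ _
  mem_order a := by simp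
  bijective := ⟨fun _ _ h => h, fun w => ⟨w, rfl⟩⟩
  metric_eq _ _ _ := rfl
  mapsTo _ _ hx i := hx i trivial
  frame_eq _ _ hx i w := pi_frame_apply hx w i
  isFiniteMeasure i := (h i).isFiniteMeasure
  measurePreserving := by
    refine ⟨measurable_pi_lambda (δ := ι) _ fun i => measurable_pi_apply (X := fun i => X i) i, ?_⟩
    exact Measure.map_id.trans (pi_weightedVolume h)

variable (j : ι)

/-- The family that consists of families indexed by the `i < j` and by the `i > j` and of an object
with index `j`. -/
def glue {β : ι → Sort*} (w₀ : ∀ i : {i // i < j}, β i) (w : β j) (w₁ : ∀ i : {i // j < i}, β i)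
    (i : ι) : β i :=
  if h : i < j then w₀ ⟨i, h⟩ else if h' : j < i then w₁ ⟨i, h'⟩ else
    le_antisymm (not_lt.1 h) (not_lt.1 h') ▸ w

section glue

variable {j} {β : ι → Sort*} (w₀ : ∀ i : {i // i < j}, β i) (w : β j)
  (w₁ : ∀ i : {i // j < i}, β i)

lemma glue_before (i : {i // i < j}) : glue j w₀ w w₁ i = w₀ i := by
  rw [glue, dif_pos i.2]

lemma glue_self : glue j w₀ w w₁ j = w := by
  rw [glue, dif_neg (lt_irrefl j), dif_neg (lt_irrefl j)]

lemma glue_after (i : {i // j < i}) : glue j w₀ w w₁ i = w₁ i := by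
  rw [glue, dif_neg (lt_asymm i.2), dif_pos i.2]

lemma forall_block {p : ι → Prop} :
    (∀ i, p i) ↔ (∀ i : {i // i < j}, p i) ∧ p j ∧ ∀ i : {i // j < i}, p i := by
  refine ⟨fun h => ⟨fun i => h i, h j, fun i => h i⟩, fun h i => ?_⟩
  rcases lt_trichotomy i j with hi | rfl | hi
  · exact h.1 ⟨i, hi⟩
  · exact h.2.1
  · exact h.2.2 ⟨i, hi⟩

lemma prod_block {M : Type*} [CommMonoid M] (f : ι → M) :
    ∏ i, f i = f j * ((∏ i : {i // j < i}, f i) * ∏ i : {i // i < j}, f i) := by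
  let e : Option ({i // j < i} ⊕ {i // i < j}) → ι := fun a =>
    a.elim j (Sum.elim Subtype.val Subtype.val)
  have he : Function.Bijective e := by
    constructor
    · rintro (_ | ⟨a, ha⟩ | ⟨a, ha⟩) (_ | ⟨b, hb⟩ | ⟨b, hb⟩) h
      · rfl
      · exact absurd h hb.ne
      · exact absurd h hb.ne'
      · exact absurd h ha.ne'
      · obtain rfl : a = b := h; rfl
      · exact absurd h (hb.trans ha).ne'
      · exact absurd h ha.ne
      · exact absurd h (ha.trans hb).ne
      · obtain rfl : a = b := h; rfl
    · intro i
      rcases lt_trichotomy i j with hi | rfl | hi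
      · exact ⟨some (Sum.inr ⟨i, hi⟩), rfl⟩
      · exact ⟨none, rfl⟩
      · exact ⟨some (Sum.inl ⟨i, hi⟩), rfl⟩
  rw [← he.prod_comp f, Fintype.prod_option, Fintype.prod_sum_type]
  rfl

end glue

variable (X) in
/-- The factors `∏ i < j, X i`, `X j` and `∏ i > j, X i` of a product. -/
def blockManifold : Option Bool → HermitianManifold.{u, v}
  | none => X j
  | some false => pi fun i : {i // i < j} => X i
  | some true => pi fun i : {i // j < i} => X i

variable (Ω) in
/-- The factors `∏ i < j, Ω i`, `Ω j` and `∏ i > j, Ω i` of a product. -/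
def blockDomain : ∀ a, Set (blockManifold X j a)
  | none => Ω j
  | some false => piDomain fun i : {i // i < j} => Ω i
  | some true => piDomain fun i : {i // j < i} => Ω i

variable (φ) in
/-- The weights on the three factors. -/
def blockWeight : ∀ a, blockManifold X j a → ℝ
  | none => φ j
  | some false => piWeight fun i : {i // i < j} => φ i
  | some true => piWeight fun i : {i // j < i} => φ i

lemma isBoundedDomain_block (h : ∀ i, IsBoundedDomain (Ω i) (φ i)) :
    ∀ a, IsBoundedDomain (blockDomain Ω j a) (blockWeight φ j a)
  | none => h j
  | some false => IsBoundedDomain.pi fun i : {i // i < j} => h i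
  | some true => IsBoundedDomain.pi fun i : {i // j < i} => h i

variable (X) in
/-- The projections to the three factors. -/
def blockProj : ∀ a, pi X → blockManifold X j a
  | none => fun x => x j
  | some false => fun x i => x i
  | some true => fun x i => x i

variable (X) in
/-- The derivatives of the projections to the three factors. -/
def blockDproj : ∀ a, (pi X).Model →ₗ[ℝ] (blockManifold X j a).Model
  | none => tangentProj X j
  | some false => tangentProjs X (Subtype.val : {i // i < j} → ι)
  | some true => tangentProjs X (Subtype.val : {i // j < i} → ι)

/-- The rectangles in the three factors. -/
def blockRect : ∀ a, Set (Set (blockManifold X j a))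
  | none => {s | MeasurableSet s}
  | some false => Set.pi univ '' Set.pi univ fun i : {i // i < j} => {s : Set (X i) | MeasurableSet s}
  | some true => Set.pi univ '' Set.pi univ fun i : {i // j < i} => {s : Set (X i) | MeasurableSet s}

lemma generateFrom_blockRect : ∀ a, MeasurableSpace.generateFrom (blockRect (X := X) j a) =
    (blockManifold X j a).measurableSpace
  | none => MeasurableSpace.generateFrom_measurableSet
  | some false => generateFrom_pi
  | some true => generateFrom_pi

lemma isPiSystem_blockRect : ∀ a, IsPiSystem (blockRect (X := X) j a)
  | none => MeasurableSpace.isPiSystem_measurableSet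
  | some false => isPiSystem_pi
  | some true => isPiSystem_pi

lemma univ_mem_blockRect : ∀ a, univ ∈ blockRect (X := X) j a
  | none => MeasurableSet.univ
  | some false => ⟨fun _ => univ, fun _ _ => MeasurableSet.univ, Set.pi_univ univ⟩
  | some true => ⟨fun _ => univ, fun _ _ => MeasurableSet.univ, Set.pi_univ univ⟩

/-- The measures agree on products of rectangles. -/
lemma measurePreserving_block (h : ∀ i, IsBoundedDomain (Ω i) (φ i)) :
    MeasurePreserving (fun x a => blockProj X j a x)
      ((pi X).weightedVolume (piDomain Ω) (piWeight φ))
      (Measure.pi fun a => (blockManifold X j a).weightedVolume (blockDomain Ω j a)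
        (blockWeight φ j a)) := by
  have hfin := fun a => (isBoundedDomain_block j h a).isFiniteMeasure
  have hfin' := fun i => (h i).isFiniteMeasure
  have hmeas : Measurable fun (x : ∀ i, X i) a => blockProj X j a x := by
    refine measurable_pi_lambda _ fun a => ?_
    match a with
    | none => exact measurable_pi_apply (X := fun i => X i) j
    | some false => exact measurable_pi_lambda _ fun i => measurable_pi_apply (X := fun i => X i) i.1
    | some true => exact measurable_pi_lambda _ fun i => measurable_pi_apply (X := fun i => X i) i.1
  refine ⟨hmeas, ?_⟩
  refine (Measure.pi_eq_generateFrom (C := blockRect (X := X) j) (generateFrom_blockRect j)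
    (isPiSystem_blockRect j) (fun a => ⟨fun _ => univ, fun _ => univ_mem_blockRect j a,
      fun _ => measure_lt_top _ _, iUnion_const univ⟩) fun s hs => ?_).symm
  obtain ⟨t₀, ht₀, hs₀⟩ := hs (some false)
  obtain ⟨t₁, ht₁, hs₁⟩ := hs (some true)
  have hsm : ∀ a, MeasurableSet (s a) := fun a => by
    rw [← generateFrom_blockRect j a]
    exact MeasurableSpace.measurableSet_generateFrom (hs a)
  let sn : Set (X j) := s none
  have gb := glue_before (β := fun i => Set (X i)) t₀ sn t₁
  have gs := glue_self (β := fun i => Set (X i)) t₀ sn t₁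
  have ga := glue_after (β := fun i => Set (X i)) t₀ sn t₁
  -- a product of rectangles is a box in the whole product
  have hpre : (fun (x : ∀ i, X i) a => blockProj X j a x) ⁻¹' Set.pi univ s =
      Set.pi univ (glue j (β := fun i => Set (X i)) t₀ sn t₁) := by
    ext x
    constructor
    · intro hx
      suffices H : ∀ i, x i ∈ glue j (β := fun i => Set (X i)) t₀ sn t₁ i from fun i _ => H i
      refine (forall_block (j := j)).2 ⟨fun i => ?_, ?_, fun i => ?_⟩
      · have := hx (some false) trivial
        rw [← hs₀] at this
        rw [gb]
        exact this i trivial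
      · rw [gs]
        exact hx none trivial
      · have := hx (some true) trivial
        rw [← hs₁] at this
        rw [ga]
        exact this i trivial
    · rintro hx (_ | _ | _) _
      · have := hx j trivial
        rwa [gs] at this
      · rw [← hs₀]
        intro i _
        have := hx i.1 trivial
        rwa [gb] at this
      · rw [← hs₁]
        intro i _
        have := hx i.1 trivial
        rwa [ga] at this
  refine (Measure.map_apply hmeas (MeasurableSet.univ_pi hsm)).trans ?_
  refine (congrArg _ hpre).trans ?_
  rw [pi_weightedVolume h]
  refine (Measure.pi_pi _ _).trans ?_
  rw [prod_block (j := j), Fintype.prod_option, Fintype.prod_bool]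
  have e₀ : (blockManifold X j (some false)).weightedVolume (blockDomain Ω j (some false))
      (blockWeight φ j (some false)) (s (some false)) =
      ∏ i : {i // i < j}, (X i).weightedVolume (Ω i) (φ i) (t₀ i) := by
    rw [← hs₀]
    refine (congrArg (fun m : Measure (∀ i : {i // i < j}, X i) => m (Set.pi univ t₀))
      (pi_weightedVolume fun i : {i // i < j} => h i)).trans ?_
    exact Measure.pi_pi _ _
  have e₁ : (blockManifold X j (some true)).weightedVolume (blockDomain Ω j (some true))
      (blockWeight φ j (some true)) (s (some true)) =
      ∏ i : {i // j < i}, (X i).weightedVolume (Ω i) (φ i) (t₁ i) := by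
    rw [← hs₁]
    refine (congrArg (fun m : Measure (∀ i : {i // j < i}, X i) => m (Set.pi univ t₁))
      (pi_weightedVolume fun i : {i // j < i} => h i)).trans ?_
    exact Measure.pi_pi _ _
  rw [e₀, e₁]
  simp only [gb, gs, ga]
  rfl

/-- A product of domains, decomposed into three factors. -/
def blockData (h : ∀ i, IsBoundedDomain (Ω i) (φ i)) :
    ProductData (pi X) (piDomain Ω) (piWeight φ) (blockManifold X j) (blockDomain Ω j)
      (blockWeight φ j) where
  proj := blockProj X j
  dproj := blockDproj X j
  -- the natural order of the factors, which is not the one of `Option Bool`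
  order := [some false, none, some true]
  nodup := by simp
  mem_order := by rintro (_ | _ | _) <;> simp
  bijective := by
    constructor
    · intro w w' h
      have h₀ := congrFun h (some false)
      have h₁ := congrFun h (some true)
      refine funext ((forall_block (j := j)).2 ⟨fun i => congrFun h₀ i, congrFun h none,
        fun i => congrFun h₁ i⟩)
    · intro w
      refine ⟨glue j (β := fun i => (X i).Model) (w (some false)) (w none) (w (some true)), ?_⟩
      funext a
      match a with
      | none => exact glue_self (β := fun i => (X i).Model) _ _ _
      | some false => exact funext fun i => glue_before (β := fun i => (X i).Model) _ _ _ i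
      | some true => exact funext fun i => glue_after (β := fun i => (X i).Model) _ _ _ i
  metric_eq x w w' := by
    rw [Fintype.sum_option, Fintype.sum_bool]
    refine (pi_metric_apply x w w').trans ?_
    -- `prod_block` for sums
    have := prod_block (M := Multiplicative ℂ) (j := j) fun i =>
      Multiplicative.ofAdd ((X i).metric (x i) (w i) (w' i))
    exact this
  mapsTo := by
    rintro x₀ x hx (_ | _ | _)
    · exact hx j trivial
    · exact fun i _ => hx i.1 trivial
    · exact fun i _ => hx i.1 trivial
  frame_eq := by
    rintro x₀ x hx (_ | _ | _) w
    · exact pi_frame_apply hx w j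
    · exact funext fun i => (pi_frame_apply hx w i.1).trans
        (pi_frame_apply (X := fun i : {i // i < j} => X i) (x₀ := fun i => x₀ i)
          (x := fun i => x i) (fun i _ => hx i.1 trivial) (fun i => w i) i).symm
    · exact funext fun i => (pi_frame_apply hx w i.1).trans
        (pi_frame_apply (X := fun i : {i // j < i} => X i) (x₀ := fun i => x₀ i)
          (x := fun i => x i) (fun i _ => hx i.1 trivial) (fun i => w i) i).symm
  isFiniteMeasure a := (isBoundedDomain_block j h a).isFiniteMeasure
  measurePreserving := measurePreserving_block j h

end PiData

section FinTensor

variable {N : ℕ} {X : Fin N → HermitianManifold.{u, v}} {Ω : ∀ j, Set (X j)} {φ : ∀ j, X j → ℝ}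

lemma isTensor_tensor (h : ∀ i, IsBoundedDomain (Ω i) (φ i)) (F : ∀ j, (X j).L2 (Ω j) (φ j)) :
    IsTensor F ((piData h).tensor F) := by
  choose f hf using fun a => PreL2.exists_rep (F a)
  obtain rfl : (fun a => (f a).toL2) = F := funext hf
  refine ⟨f, (piData h).tensorPre f, fun _ => rfl, ((piData h).tensor_toL2 f).symm, ?_⟩
  have ho : (piData h).order = List.finRange N := Fin.sort_univ N
  funext x
  rw [ProductData.form_tensorPre, ProductData.tensorForm, ho, wedge, List.ofFn_eq_map]
  rfl

/-- Three forms on the factors `∏ i < j, Ω i`, `Ω j` and `∏ i > j, Ω i`, as a family. -/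
def blockFamily {j : Fin N} (F : L2Before Ω φ j) (G : (X j).L2 (Ω j) (φ j)) (H : L2After Ω φ j) :
    ∀ a, (blockManifold X j a).L2 (blockDomain Ω j a) (blockWeight φ j a)
  | none => G
  | some false => F
  | some true => H

lemma isTensorAt_tensor (h : ∀ i, IsBoundedDomain (Ω i) (φ i)) (j : Fin N) (F : L2Before Ω φ j)
    (G : (X j).L2 (Ω j) (φ j)) (H : L2After Ω φ j) :
    IsTensorAt j F G H ((blockData j h).tensor (blockFamily F G H)) := by
  choose f hf using fun a => PreL2.exists_rep (blockFamily F G H a)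
  refine ⟨f (some false), f none, f (some true), (blockData j h).tensorPre f, hf (some false),
    hf none, hf (some true), ?_, fun x => ?_⟩
  · rw [← (blockData j h).tensor_toL2]
    exact congrArg _ (funext hf)
  · rw [ProductData.form_tensorPre, mul_assoc]
    refine congrArg₂ (· * ·) rfl (congrArg₂ (· * ·) rfl ?_)
    exact mul_one _

end FinTensor

end HermitianManifold

/-! ### Functionals given by test functions -/

namespace CForm

lemma continuousOn_pairing {β E ι : Type*} [TopologicalSpace β] [AddCommGroup E] [Module ℝ E]
    [Fintype ι] {s : Set β} (b : ι → E) (c : β → Matrix ι ι ℝ)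
    (hc : ∀ i j, ContinuousOn (fun x => c x i j) s) (k : ℕ) (α α' : CForm E) :
    ContinuousOn (fun x => pairing b (c x) k α α') s := by
  induction k generalizing α α' with
  | zero => exact continuousOn_const
  | succ k ih =>
    simp only [pairing]
    exact continuousOn_finsetSum _ fun i _ => continuousOn_finsetSum _ fun j _ =>
      (Complex.continuous_ofReal.comp_continuousOn (hc i j)).mul (ih _ _)

end CForm

namespace HermitianManifold

section Chart

variable {X : HermitianManifold.{u, v}} {Ω : Set X} {φ : X → ℝ}

/-- The inner product of forms at `x`, in the coordinates of the chart at `x₀`. -/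
def chartInner (x₀ x : X) (α β : CForm X.Model) : ℂ :=
  ∑ k ∈ Finset.range (Module.finrank ℝ X.Model + 1), (1 / (2 ^ k * k.factorial : ℝ) : ℝ) *
    CForm.pairing (Module.finBasis ℝ X.Model) (X.gramAt x₀ x)⁻¹ k α β

lemma fiberInner_eq_chartInner {x₀ x : X} (hx : x ∈ (X.chart x₀).source) (f g : X.Form) :
    X.fiberInner x (f x) (g x) = chartInner x₀ x (f.inChart x₀ x) (g.inChart x₀ x) :=
  CForm.inner_eq_frame (X.metric_hermitian x) _ (X.frame_injective hx) _ _

lemma continuousOn_chartInner (x₀ : X) (α β : CForm X.Model) :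
    ContinuousOn (fun x => chartInner x₀ x α β) (X.chart x₀).source := by
  have hA : ContinuousOn (fun x => X.gramAt x₀ x) (X.chart x₀).source :=
    continuousOn_pi.2 fun i => continuousOn_pi.2 fun j => X.continuousOn_gramAt x₀ i j
  have hinv : ∀ i j, ContinuousOn (fun x => (X.gramAt x₀ x)⁻¹ i j) (X.chart x₀).source := by
    intro i j
    have hdet : ContinuousOn (fun x => (X.gramAt x₀ x).det) (X.chart x₀).source :=
      (Continuous.matrix_det continuous_id).comp_continuousOn hA
    have hadj : ContinuousOn (fun x => (X.gramAt x₀ x).adjugate i j) (X.chart x₀).source :=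
      ((continuous_apply_apply i j).comp
        (Continuous.matrix_adjugate continuous_id)).comp_continuousOn hA
    simp only [Matrix.inv_def, Ring.inverse_eq_inv', Matrix.smul_apply, smul_eq_mul]
    refine (hdet.inv₀ fun x hx => ?_).mul hadj
    exact (Real.sqrt_pos.1 (chartDensity_pos hx)).ne'
  exact continuousOn_finsetSum _ fun k _ => continuousOn_const.mul
    (CForm.continuousOn_pairing _ _ hinv k _ _)

/-- The form at `x` whose expression in the chart at `x₀` is `β`. -/
def coordForm (x₀ : X) (β : CForm X.Model) : X.Form := fun x =>
  CForm.pullback ((tangentCoordChange 𝓘(ℂ, X.Model) x x₀ x).restrictScalars ℝ).toLinearMap β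

lemma inChart_coordForm {x₀ x₁ x : X} (h₀ : x ∈ (X.chart x₀).source)
    (h₁ : x ∈ (X.chart x₁).source) (β : CForm X.Model) :
    (coordForm x₀ β).inChart x₁ x =
      CForm.pullback ((tangentCoordChange 𝓘(ℂ, X.Model) x₁ x₀ x).restrictScalars ℝ).toLinearMap β := by
  rw [Form.inChart, coordForm, CForm.pullback_pullback]
  congr 2
  refine LinearMap.ext fun w => ?_
  refine tangentCoordChange_comp (I := 𝓘(ℂ, X.Model)) ⟨⟨?_, mem_extChartAt_source x⟩, ?_⟩
  · simpa using h₁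
  · simpa using h₀

lemma inChart_coordForm_self {x₀ x : X} (hx : x ∈ (X.chart x₀).source) (β : CForm X.Model) :
    (coordForm x₀ β).inChart x₀ x = β := by
  rw [inChart_coordForm hx hx]
  have : ((tangentCoordChange 𝓘(ℂ, X.Model) x₀ x₀ x).restrictScalars ℝ).toLinearMap =
      LinearMap.id := LinearMap.ext fun w => tangentCoordChange_self (by simpa using hx)
  rw [this, CForm.pullback_id]

lemma coordForm_inChart {x₀ x : X} (hx : x ∈ (X.chart x₀).source) (f : X.Form) :
    coordForm x₀ (f.inChart x₀ x) x = f x := by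
  rw [Form.inChart, coordForm, CForm.pullback_pullback]
  have : ((X.frame x₀ x).restrictScalars ℝ).toLinearMap ∘ₗ
      ((tangentCoordChange 𝓘(ℂ, X.Model) x x₀ x).restrictScalars ℝ).toLinearMap =
      LinearMap.id := by
    refine LinearMap.ext fun w => ?_
    have hx' : x ∈ (extChartAt 𝓘(ℂ, X.Model) x₀).source := by simpa using hx
    refine (tangentCoordChange_comp (I := 𝓘(ℂ, X.Model))
      ⟨⟨mem_extChartAt_source x, hx'⟩, mem_extChartAt_source x⟩).trans ?_
    exact tangentCoordChange_self (mem_extChartAt_source x)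
  rw [this, CForm.pullback_id]

lemma chartInner_eq_fiberInner {x₀ x : X} (hx : x ∈ (X.chart x₀).source) (α β : CForm X.Model) :
    chartInner x₀ x α β = X.fiberInner x (coordForm x₀ α x) (coordForm x₀ β x) := by
  rw [fiberInner_eq_chartInner hx, inChart_coordForm_self hx, inChart_coordForm_self hx]

lemma fiberInner_self_eq_zero {x : X} {α : CForm X.Model} (h : (X.fiberInner x α α).re = 0) :
    α = 0 := by
  refine (X.fiberCore x).definite α (Complex.ext h ?_)
  have := X.fiberInner_conj x α α
  exact Complex.conj_eq_iff_im.1 this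

lemma chartInner_self_pos {x₀ x : X} (hx : x ∈ (X.chart x₀).source) {α : CForm X.Model}
    (hα : α ≠ 0) : 0 < (chartInner x₀ x α α).re := by
  rw [chartInner_eq_fiberInner hx]
  refine lt_of_le_of_ne (X.fiberInner_re_nonneg x _) fun h => hα ?_
  have h0 := fiberInner_self_eq_zero h.symm
  rw [← inChart_coordForm_self hx α, Form.inChart, h0, map_zero]

/-- The inner product `chartInner` as a sesquilinear map. -/
def chartSesq (x₀ x : X) : CForm X.Model →ₗ⋆[ℂ] CForm X.Model →ₗ[ℂ] ℂ :=
  LinearMap.mk₂'ₛₗ (starRingEnd ℂ) (RingHom.id ℂ) (chartInner x₀ x)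
    (fun a b c => by simp only [chartInner, CForm.pairing_add_left, mul_add,
      Finset.sum_add_distrib])
    (fun r a b => by
      simp only [chartInner, CForm.pairing_smul_left, Finset.mul_sum, smul_eq_mul]
      exact Finset.sum_congr rfl fun k _ => by ring)
    (fun a b c => by simp only [chartInner, CForm.pairing_add_right, mul_add,
      Finset.sum_add_distrib])
    (fun r a b => by
      simp only [chartInner, CForm.pairing_smul_right, Finset.mul_sum, smul_eq_mul,
        RingHom.id_apply]
      exact Finset.sum_congr rfl fun k _ => by ring)

lemma chartInner_sum {κ : Type*} [Fintype κ] (x₀ x : X) (b : κ → CForm X.Model) (c : κ → ℂ) :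
    chartInner x₀ x (∑ i, c i • b i) (∑ i, c i • b i) =
      ∑ i, ∑ j, conj (c i) * c j * chartInner x₀ x (b i) (b j) := by
  change chartSesq x₀ x _ _ = ∑ i, ∑ j, conj (c i) * c j * chartSesq x₀ x (b i) (b j)
  simp only [map_sum, LinearMap.sum_apply, LinearMap.map_smulₛₗ, LinearMap.smul_apply, smul_eq_mul,
    RingHom.id_apply]
  simp only [Finset.mul_sum]
  rw [Finset.sum_comm]
  exact Finset.sum_congr rfl fun i _ => Finset.sum_congr rfl fun j _ => by ring

/-- On compact subsets of a chart domain all inner products of the coefficients are comparable. -/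
lemma exists_norm_sq_le_chartInner (x₀ : X) {K : Set X} (hK : IsCompact K)
    (hKs : K ⊆ (X.chart x₀).source) (l : Module.Dual ℂ (CForm X.Model)) :
    ∃ C, 0 ≤ C ∧ ∀ x ∈ K, ∀ α, ‖l α‖ ^ 2 ≤ C * (chartInner x₀ x α α).re := by
  set n := Module.finrank ℂ (CForm X.Model) with hn
  set b : Module.Basis (Fin n) ℂ (CForm X.Model) := Module.finBasis ℂ (CForm X.Model) with hb
  -- the quadratic form has a positive minimum on the product of `K` and the unit sphere
  let q : X × (Fin n → ℂ) → ℝ := fun p =>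
    (∑ i, ∑ j, conj (p.2 i) * p.2 j * chartInner x₀ p.1 (b i) (b j)).re
  have hq : ∀ x c, q (x, c) = (chartInner x₀ x (∑ i, c i • b i) (∑ i, c i • b i)).re :=
    fun x c => by rw [chartInner_sum]
  have hqc : ContinuousOn q (K ×ˢ Metric.sphere 0 1) := by
    refine Complex.continuous_re.comp_continuousOn (continuousOn_finsetSum _ fun i _ =>
      continuousOn_finsetSum _ fun j _ => ContinuousOn.mul ?_ ?_)
    · fun_prop
    · exact (continuousOn_chartInner x₀ (b i) (b j)).comp continuousOn_fst fun p hp => hKs hp.1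
  have hl : ∀ c : Fin n → ℂ, ‖l (∑ i, c i • b i)‖ ≤ ‖c‖ * ∑ i, ‖l (b i)‖ := by
    intro c
    rw [map_sum, Finset.mul_sum]
    refine norm_sum_le_of_le _ fun i _ => ?_
    rw [map_smul, smul_eq_mul, norm_mul]
    exact mul_le_mul_of_nonneg_right (norm_le_pi_norm c i) (norm_nonneg _)
  set L := ∑ i, ‖l (b i)‖ with hL
  have hL0 : 0 ≤ L := Finset.sum_nonneg fun i _ => norm_nonneg _
  rcases (K ×ˢ Metric.sphere (0 : Fin n → ℂ) 1).eq_empty_or_nonempty with he | hne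
  · refine ⟨0, le_rfl, fun x hx α => ?_⟩
    rw [zero_mul]
    have : b.equivFun α = 0 := by
      by_contra h0
      have : (x, (‖b.equivFun α‖⁻¹ : ℂ) • b.equivFun α) ∈ K ×ˢ Metric.sphere (0 : Fin n → ℂ) 1 := by
        refine ⟨hx, ?_⟩
        rw [mem_sphere_zero_iff_norm, norm_smul, norm_inv, Complex.norm_real, norm_norm,
          inv_mul_cancel₀ (norm_ne_zero_iff.2 h0)]
      rw [he] at this
      exact this
    have : α = 0 := by simpa using this
    simp [this]
  · obtain ⟨⟨x₁, c₁⟩, h₁, hmin⟩ := (hK.prod (isCompact_sphere 0 1)).exists_isMinOn hne hqc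
    have hm : 0 < q (x₁, c₁) := by
      rw [hq]
      refine chartInner_self_pos (hKs h₁.1) fun h0 => ?_
      have hc : c₁ = 0 := by
        funext i
        exact Fintype.linearIndependent_iff.1 b.linearIndependent c₁ h0 i
      have := mem_sphere_zero_iff_norm.1 h₁.2
      simp [hc] at this
    set m := q (x₁, c₁)
    refine ⟨L ^ 2 / m, by positivity, fun x hx α => ?_⟩
    set c : Fin n → ℂ := b.equivFun α with hc
    have hα : ∑ i, c i • b i = α := b.sum_equivFun α
    have h2 : m * ‖c‖ ^ 2 ≤ (chartInner x₀ x α α).re := by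
      rcases eq_or_ne c 0 with h0 | h0
      · have : α = 0 := by rw [← hα, h0]; simp
        rw [h0, this]
        have hz : chartInner x₀ x 0 0 = 0 := by simp [chartInner, CForm.pairing_zero_left]
        simp [hz]
      · have hn0 : ‖c‖ ≠ 0 := norm_ne_zero_iff.2 h0
        have h3 := hmin (a := (x, (‖c‖⁻¹ : ℂ) • c)) ⟨hx, by
          rw [mem_sphere_zero_iff_norm, norm_smul, norm_inv, Complex.norm_real, norm_norm,
            inv_mul_cancel₀ hn0]⟩
        have h4 : q (x, (‖c‖⁻¹ : ℂ) • c) = ‖c‖⁻¹ ^ 2 * (chartInner x₀ x α α).re := by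
          have : q (x, (‖c‖⁻¹ : ℂ) • c) = (((‖c‖⁻¹ ^ 2 : ℝ) : ℂ) *
              ∑ i, ∑ j, conj (c i) * c j * chartInner x₀ x (b i) (b j)).re := by
            simp only [q, Finset.mul_sum]
            congr 1
            refine Finset.sum_congr rfl fun i _ => Finset.sum_congr rfl fun j _ => ?_
            simp only [Pi.smul_apply, smul_eq_mul, map_mul, map_inv₀, Complex.conj_ofReal]
            push_cast
            ring
          rw [this, Complex.re_ofReal_mul, ← chartInner_sum, hα]
        have h3' : m ≤ ‖c‖⁻¹ ^ 2 * (chartInner x₀ x α α).re := h4 ▸ h3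
        calc m * ‖c‖ ^ 2 ≤ ‖c‖⁻¹ ^ 2 * (chartInner x₀ x α α).re * ‖c‖ ^ 2 := by gcongr
          _ = (chartInner x₀ x α α).re := by field_simp
    calc ‖l α‖ ^ 2 ≤ (‖c‖ * L) ^ 2 := by
          have := hl c
          rw [hα] at this
          gcongr
      _ = L ^ 2 / m * (m * ‖c‖ ^ 2) := by field_simp
      _ ≤ _ := by gcongr

/-- Integrals over a chart domain with respect to `e^{-φ} dV`, in coordinates. -/
lemma IsBoundedDomain.integral_chart (h : IsBoundedDomain Ω φ) (x₀ : X) {E : Type*}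
    [NormedAddCommGroup E] [NormedSpace ℝ E] {g : X → E}
    (hg : Integrable g ((X.weightedVolume Ω φ).restrict (X.chart x₀).source)) :
    IntegrableOn (fun z => weightedDensity φ x₀ ((X.chart x₀).symm z) • g ((X.chart x₀).symm z))
      (chartDomain Ω x₀) X.haar ∧
    ∫ z in chartDomain Ω x₀, weightedDensity φ x₀ ((X.chart x₀).symm z) • g ((X.chart x₀).symm z)
      ∂X.haar = ∫ x in (X.chart x₀).source, g x ∂X.weightedVolume Ω φ := by
  have hΩm := measurableSet_target_inter_preimage x₀ h.isOpen.measurableSet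
  set ν := (X.haar.restrict (chartDomain Ω x₀)).withDensity fun z =>
        ENNReal.ofReal (weightedDensity φ x₀ ((X.chart x₀).symm z)) with hν
  have hm : AEMeasurable (X.chart x₀).symm ν := aemeasurable_chart_symm x₀
    ((withDensity_absolutelyContinuous _ _).trans
        (Measure.absolutelyContinuous_of_le (Measure.restrict_mono_set _ inter_subset_left)))
  have hd : AEMeasurable (fun z => ENNReal.ofReal (weightedDensity φ x₀ ((X.chart x₀).symm z)))
      (X.haar.restrict (chartDomain Ω x₀)) :=
    ((h.continuousOn_weightedDensity x₀).aemeasurable hΩm).ennreal_ofReal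
  have hlt : ∀ᵐ z ∂X.haar.restrict (chartDomain Ω x₀),
      ENNReal.ofReal (weightedDensity φ x₀ ((X.chart x₀).symm z)) < ⊤ :=
    Filter.Eventually.of_forall fun _ => ENNReal.ofReal_lt_top
  have hcongr : (fun z => (ENNReal.ofReal (weightedDensity φ x₀ ((X.chart x₀).symm z))).toReal •
      g ((X.chart x₀).symm z)) =ᵐ[X.haar.restrict (chartDomain Ω x₀)]
      fun z => weightedDensity φ x₀ ((X.chart x₀).symm z) • g ((X.chart x₀).symm z) := by
    filter_upwards [ae_restrict_mem hΩm] with z hz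
    rw [ENNReal.toReal_ofReal (weightedDensity_pos ((X.chart x₀).map_target hz.1)).le]
  rw [h.weightedVolume_restrict x₀, ← hν] at hg ⊢
  constructor
  · have h1 := (integrable_map_measure hg.aestronglyMeasurable hm).1 hg
    exact ((integrable_withDensity_iff_integrable_smul₀' hd hlt).1 h1).congr hcongr
  · rw [integral_map hm hg.aestronglyMeasurable, hν, integral_withDensity_eq_integral_toReal_smul₀
      hd hlt]
    exact (integral_congr_ae hcongr).symm

lemma IsBoundedDomain.aestronglyMeasurable_inChart (h : IsBoundedDomain Ω φ) (x₀ : X) {f : X.Form}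
    (hf : f.AEMeas (X.weightedVolume Ω φ)) (l : Module.Dual ℂ (CForm X.Model)) :
    AEStronglyMeasurable (fun z => l (f.inChart x₀ ((X.chart x₀).symm z)))
      (X.haar.restrict (chartDomain Ω x₀)) := by
  have h1 := hf x₀ l
  rw [h.weightedVolume_restrict x₀] at h1
  refine (h1.comp_aemeasurable (aemeasurable_chart_symm x₀ ?_)).mono_ac
    (h.haar_absolutelyContinuous x₀)
  exact (withDensity_absolutelyContinuous _ _).trans
    (Measure.absolutelyContinuous_of_le (Measure.restrict_mono_set _ inter_subset_left))

lemma PreL2.norm_sq (f : X.PreL2 Ω φ) :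
    ‖f‖ ^ 2 = ∫ x, (X.fiberInner x (f.form x) (f.form x)).re ∂X.weightedVolume Ω φ := by
  rw [@norm_sq_eq_re_inner ℂ, PreL2.inner_def]
  exact (integral_re (PreL2.integrable_fiberInner f f)).symm

/-- The coefficients of square integrable forms in a chart are locally integrable, with an estimate
by the norm. -/
lemma IsBoundedDomain.exists_integral_norm_le (h : IsBoundedDomain Ω φ) (x₀ : X)
    {K : Set X.Model} (hK : IsCompact K) (hKs : K ⊆ chartDomain Ω x₀)
    (l : Module.Dual ℂ (CForm X.Model)) :
    ∃ C, 0 ≤ C ∧ ∀ f : X.PreL2 Ω φ,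
      IntegrableOn (fun z => l (f.form.inChart x₀ ((X.chart x₀).symm z))) K X.haar ∧
      ∫ z in K, ‖l (f.form.inChart x₀ ((X.chart x₀).symm z))‖ ∂X.haar ≤ C * ‖f‖ := by
  have hcs : ContinuousOn (X.chart x₀).symm K :=
    (X.chart x₀).continuousOn_symm.mono (hKs.trans inter_subset_left)
  obtain ⟨C₁, hC₁, hl⟩ := exists_norm_sq_le_chartInner x₀ (hK.image_of_continuousOn hcs)
    (by rintro _ ⟨z, hz, rfl⟩; exact (X.chart x₀).map_target (hKs hz).1) l
  obtain ⟨c, hc, hcρ⟩ : ∃ c, 0 < c ∧ ∀ z ∈ K, c ≤ weightedDensity φ x₀ ((X.chart x₀).symm z) := by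
    rcases K.eq_empty_or_nonempty with rfl | hne
    · exact ⟨1, one_pos, by simp⟩
    · obtain ⟨z₀, hz₀, hmin⟩ :=
        hK.exists_isMinOn hne ((h.continuousOn_weightedDensity x₀).mono hKs)
      exact ⟨_, weightedDensity_pos ((X.chart x₀).map_target (hKs hz₀).1), fun z hz => hmin hz⟩
  set V := X.haar.real K with hV
  have hV0 : 0 ≤ V := measureReal_nonneg
  refine ⟨(V + C₁ / c) / 2, by positivity, fun f => ?_⟩
  set F : X.Model → ℂ := fun z => l (f.form.inChart x₀ ((X.chart x₀).symm z)) with hF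
  set q : X.Model → ℝ := fun z => weightedDensity φ x₀ ((X.chart x₀).symm z) *
    (X.fiberInner ((X.chart x₀).symm z) (f.form ((X.chart x₀).symm z))
      (f.form ((X.chart x₀).symm z))).re with hq
  obtain ⟨hqi, hqe⟩ := h.integral_chart x₀ ((f.2.2).restrict (s := (X.chart x₀).source))
  have hbound : ∀ z ∈ K, ‖F z‖ ^ 2 ≤ C₁ / c * q z := by
    intro z hz
    have hzs := (X.chart x₀).map_target (hKs hz).1
    have h1 := hl _ ⟨z, hz, rfl⟩ (f.form.inChart x₀ ((X.chart x₀).symm z))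
    rw [← fiberInner_eq_chartInner hzs] at h1
    have h2 := X.fiberInner_re_nonneg ((X.chart x₀).symm z) (f.form ((X.chart x₀).symm z))
    calc ‖F z‖ ^ 2 ≤ C₁ / c * (c * (X.fiberInner ((X.chart x₀).symm z)
          (f.form ((X.chart x₀).symm z)) (f.form ((X.chart x₀).symm z))).re) := by
            rw [← mul_assoc, div_mul_cancel₀ _ hc.ne']; exact h1
      _ ≤ _ := by
        have := hcρ z hz
        exact mul_le_mul_of_nonneg_left (mul_le_mul_of_nonneg_right this h2) (by positivity)
  have hKm := hK.measurableSet
  have hqK : IntegrableOn q K X.haar := IntegrableOn.mono_set hqi hKs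
  have hq0 : ∀ z ∈ chartDomain Ω x₀, 0 ≤ q z := fun z hz => mul_nonneg
    (weightedDensity_pos ((X.chart x₀).map_target hz.1)).le (X.fiberInner_re_nonneg _ _)
  have hqle : ∫ z in K, q z ∂X.haar ≤ ‖f‖ ^ 2 := by
    have hΩm := measurableSet_target_inter_preimage x₀ h.isOpen.measurableSet
    calc ∫ z in K, q z ∂X.haar ≤ ∫ z in chartDomain Ω x₀, q z ∂X.haar := by
          refine setIntegral_mono_set hqi ?_ hKs.eventuallyLE
          filter_upwards [ae_restrict_mem hΩm] with z hz using hq0 z hz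
      _ = ∫ x in (X.chart x₀).source, (X.fiberInner x (f.form x) (f.form x)).re
          ∂X.weightedVolume Ω φ := hqe
      _ ≤ _ := by
        rw [PreL2.norm_sq]
        exact setIntegral_le_integral f.2.2
          (Filter.Eventually.of_forall fun x => X.fiberInner_re_nonneg x _)
  have hK1 : IntegrableOn (fun _ => (1 : ℝ)) K X.haar := integrableOn_const hK.measure_lt_top.ne
  have hs : ∀ s : ℝ, 0 < s → IntegrableOn (fun z => (s + C₁ / c * q z / s) / 2) K X.haar :=
    fun s _ => ((((integrableOn_const hK.measure_lt_top.ne : IntegrableOn (fun _ => s) K X.haar)).add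
      ((hqK.const_mul (C₁ / c)).div_const s)).div_const 2)
  -- the inequality `2|F| ≤ s + |F|² / s` takes the place of the Cauchy-Schwarz inequality; the choice
  -- `s = ‖f‖` gives the estimate if `f ≠ 0`, and small `s` give it if `f = 0`
  have hpt : ∀ s : ℝ, 0 < s → ∀ z ∈ K, ‖F z‖ ≤ (s + C₁ / c * q z / s) / 2 := by
    intro s hs z hz
    have h1 := hbound z hz
    have h2 : ‖F z‖ * 2 ≤ s + ‖F z‖ ^ 2 / s := by
      rw [← sub_nonneg]
      have : s + ‖F z‖ ^ 2 / s - ‖F z‖ * 2 = (s - ‖F z‖) ^ 2 / s := by field_simp; ring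
      rw [this]; positivity
    have h3 : ‖F z‖ ^ 2 / s ≤ C₁ / c * q z / s := by gcongr
    linarith
  have hFm : AEStronglyMeasurable F (X.haar.restrict K) :=
    (h.aestronglyMeasurable_inChart x₀ f.form_aemeas l).mono_measure
      (Measure.restrict_mono_set _ hKs)
  have hFi : IntegrableOn F K X.haar := (hs 1 one_pos).mono' hFm (by
    filter_upwards [ae_restrict_mem hKm] with z hz using hpt 1 one_pos z hz)
  have hmain : ∀ s : ℝ, 0 < s → ∫ z in K, ‖F z‖ ∂X.haar ≤ (s * V + C₁ / c * ‖f‖ ^ 2 / s) / 2 := by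
    intro s hs'
    calc ∫ z in K, ‖F z‖ ∂X.haar ≤ ∫ z in K, (s + C₁ / c * q z / s) / 2 ∂X.haar :=
          setIntegral_mono_on hFi.norm (hs s hs') hKm (hpt s hs')
      _ = (s * V + C₁ / c * (∫ z in K, q z ∂X.haar) / s) / 2 := by
        have hc : Integrable (fun _ => s) (X.haar.restrict K) :=
          integrableOn_const hK.measure_lt_top.ne
        rw [integral_div, integral_add hc ((hqK.const_mul (C₁ / c)).div_const s), integral_div,
          integral_const_mul, setIntegral_const, smul_eq_mul, mul_comm s]
      _ ≤ _ := by gcongr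
  refine ⟨hFi, ?_⟩
  rcases (norm_nonneg f).eq_or_lt with h0 | h0
  · rw [← h0, mul_zero]
    rw [← h0] at hmain
    refine le_of_forall_pos_le_add fun ε hε => ?_
    refine (hmain (ε / (V + 1)) (by positivity)).trans ?_
    have : ε / (V + 1) * V ≤ ε := by
      rw [div_mul_eq_mul_div, div_le_iff₀ (by positivity)]
      nlinarith
    norm_num
    linarith
  · refine (hmain ‖f‖ h0).trans (le_of_eq ?_)
    field_simp

end Chart

end HermitianManifold

namespace HermitianManifold

section Functional

variable {X : HermitianManifold.{u, v}} {Ω : Set X} {φ : X → ℝ}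

/-- `ψ` is a continuous function with compact support in the image under the chart at `x₀` of the
part of `Ω` covered by this chart. -/
structure IsCutoff (Ω : Set X) (x₀ : X) (ψ : X.Model → ℂ) : Prop where
  continuous : Continuous ψ
  hasCompactSupport : HasCompactSupport ψ
  tsupport_subset : tsupport ψ ⊆ chartDomain Ω x₀

lemma IsTestFunction.isCutoff {x₀ : X} {ψ : X.Model → ℂ} (hψ : IsTestFunction Ω x₀ ψ) :
    IsCutoff Ω x₀ ψ := ⟨hψ.smooth.continuous, hψ.hasCompactSupport, hψ.tsupport_subset⟩

/-- The functional `f ↦ ∫ ψ l(f)` given by a continuous function `ψ` with compact support in a chart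
is bounded on square integrable forms. -/
lemma IsBoundedDomain.exists_norm_integral_le (h : IsBoundedDomain Ω φ) {x₀ : X} {ψ : X.Model → ℂ}
    (hψ : IsCutoff Ω x₀ ψ) (l : Module.Dual ℂ (CForm X.Model)) :
    ∃ C, 0 ≤ C ∧ ∀ f : X.PreL2 Ω φ,
      Integrable (fun z => ψ z * l (f.form.inChart x₀ ((X.chart x₀).symm z))) X.haar ∧
      ‖∫ z, ψ z * l (f.form.inChart x₀ ((X.chart x₀).symm z)) ∂X.haar‖ ≤ C * ‖f‖ := by
  obtain ⟨C, hC, hf⟩ := h.exists_integral_norm_le x₀ hψ.hasCompactSupport.isCompact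
    hψ.tsupport_subset l
  obtain ⟨M, hM⟩ := hψ.hasCompactSupport.exists_bound_of_continuous hψ.continuous
  have hM0 : 0 ≤ M := (norm_nonneg _).trans (hM 0)
  refine ⟨M * C, by positivity, fun f => ?_⟩
  obtain ⟨h1, h2⟩ := hf f
  have hsupp : Function.support (fun z => ψ z * l (f.form.inChart x₀ ((X.chart x₀).symm z))) ⊆
      tsupport ψ := fun z hz => subset_tsupport _ (left_ne_zero_of_mul hz)
  have h3 : IntegrableOn (fun z => ψ z * l (f.form.inChart x₀ ((X.chart x₀).symm z)))
      (tsupport ψ) X.haar := Integrable.bdd_mul h1 hψ.continuous.aestronglyMeasurable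
        (Filter.Eventually.of_forall hM)
  refine ⟨(integrableOn_iff_integrable_of_support_subset hsupp).1 h3, ?_⟩
  rw [← setIntegral_eq_integral_of_forall_compl_eq_zero (s := tsupport ψ) fun z hz => by
    rw [image_eq_zero_of_notMem_tsupport hz, zero_mul]]
  calc _ ≤ ∫ z in tsupport ψ, ‖ψ z * l (f.form.inChart x₀ ((X.chart x₀).symm z))‖ ∂X.haar :=
        norm_integral_le_integral_norm _
    _ ≤ ∫ z in tsupport ψ, M * ‖l (f.form.inChart x₀ ((X.chart x₀).symm z))‖ ∂X.haar := by
        refine integral_mono h3.norm (h1.norm.const_mul M) fun z => ?_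
        rw [norm_mul]
        exact mul_le_mul_of_nonneg_right (hM z) (norm_nonneg _)
    _ ≤ M * C * ‖f‖ := by
        rw [integral_const_mul, mul_assoc]
        gcongr

lemma IsBoundedDomain.integrable_cutoff (h : IsBoundedDomain Ω φ) {x₀ : X} {ψ : X.Model → ℂ}
    (hψ : IsCutoff Ω x₀ ψ) (l : Module.Dual ℂ (CForm X.Model)) (f : X.PreL2 Ω φ) :
    Integrable (fun z => ψ z * l (f.form.inChart x₀ ((X.chart x₀).symm z))) X.haar :=
  ((h.exists_norm_integral_le hψ l).choose_spec.2 f).1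

/-- The functional `f ↦ ∫ ψ l(f)` on square integrable forms. -/
def IsBoundedDomain.preFunctional (h : IsBoundedDomain Ω φ) {x₀ : X} {ψ : X.Model → ℂ}
    (hψ : IsCutoff Ω x₀ ψ) (l : Module.Dual ℂ (CForm X.Model)) : X.PreL2 Ω φ →ₗ[ℂ] ℂ where
  toFun f := ∫ z, ψ z * l (f.form.inChart x₀ ((X.chart x₀).symm z)) ∂X.haar
  map_add' f g := by
    rw [← integral_add (h.integrable_cutoff hψ l f) (h.integrable_cutoff hψ l g)]
    refine integral_congr_ae (Filter.Eventually.of_forall fun z => ?_)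
    simp [PreL2.form_add, Form.inChart, mul_add]
  map_smul' r f := by
    rw [RingHom.id_apply, smul_eq_mul, ← integral_const_mul]
    refine integral_congr_ae (Filter.Eventually.of_forall fun z => ?_)
    simp only [PreL2.form_smul, Form.inChart, Pi.smul_apply, map_smul, smul_eq_mul]
    ring

/-- The functional `f ↦ ∫ ψ l(f)` on `L²_*(Ω)`. -/
def IsBoundedDomain.functional (h : IsBoundedDomain Ω φ) {x₀ : X} {ψ : X.Model → ℂ}
    (hψ : IsCutoff Ω x₀ ψ) (l : Module.Dual ℂ (CForm X.Model)) : X.L2 Ω φ →L[ℂ] ℂ :=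
  SeparationQuotient.liftCLM ((h.preFunctional hψ l).mkContinuous
    (h.exists_norm_integral_le hψ l).choose
    fun f => ((h.exists_norm_integral_le hψ l).choose_spec.2 f).2)
    fun _ _ hfg => (hfg.map (ContinuousLinearMap.continuous _)).eq

lemma IsBoundedDomain.functional_toL2 (h : IsBoundedDomain Ω φ) {x₀ : X} {ψ : X.Model → ℂ}
    (hψ : IsCutoff Ω x₀ ψ) (l : Module.Dual ℂ (CForm X.Model)) (f : X.PreL2 Ω φ) :
    h.functional hψ l f.toL2 = ∫ z, ψ z * l (f.form.inChart x₀ ((X.chart x₀).symm z)) ∂X.haar :=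
  rfl

/-- The coefficients in countably many charts determine a form up to null sets. -/
lemma IsBoundedDomain.toL2_eq_zero (h : IsBoundedDomain Ω φ) (f : X.PreL2 Ω φ)
    (hf : ∀ x₀, ∀ᵐ z ∂X.haar.restrict (chartDomain Ω x₀), f.form ((X.chart x₀).symm z) = 0) :
    f.toL2 = 0 := by
  have h0 : ∀ x, 0 ≤ (X.fiberInner x (f.form x) (f.form x)).re := fun x =>
    X.fiberInner_re_nonneg x _
  have hz : ∀ x, X.fiberInner x 0 0 = 0 := fun x => by
    simpa using X.fiberInner_smul_left x 0 0 0
  have hloc : ∀ x₀, ∀ᵐ x ∂(X.weightedVolume Ω φ).restrict (X.chart x₀).source,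
      (X.fiberInner x (f.form x) (f.form x)).re = 0 := by
    intro x₀
    refine (integral_eq_zero_iff_of_nonneg_ae (Filter.Eventually.of_forall h0)
      f.2.2.restrict).1 ?_
    refine (h.integral_chart x₀ (f.2.2).restrict).2.symm.trans ?_
    refine integral_eq_zero_of_ae ?_
    filter_upwards [hf x₀] with z hz'
    have : f.1 ((X.chart x₀).symm z) = 0 := hz'
    simp [this, hz]
  obtain ⟨T, hT, hU⟩ := X.exists_countable_charts
  have hae := (ae_restrict_biUnion_iff (μ := X.weightedVolume Ω φ)
    (fun x : X => (X.chart x).source) hT _).2 fun x₀ _ => hloc x₀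
  rw [hU, Measure.restrict_univ] at hae
  have hn : ‖f.toL2‖ = 0 := by
    have h1 : ‖f‖ ^ 2 = 0 := by
      rw [PreL2.norm_sq]
      exact integral_eq_zero_of_ae hae
    exact (SeparationQuotient.norm_mk f).trans (pow_eq_zero_iff two_ne_zero |>.1 h1)
  exact norm_eq_zero.1 hn

/-- Test functions separate the elements of `L²_*(Ω)`. -/
lemma IsBoundedDomain.eq_zero_of_functional (h : IsBoundedDomain Ω φ) (F : X.L2 Ω φ)
    (hF : ∀ (x₀ : X) (ψ : X.Model → ℂ) (hψ : IsTestFunction Ω x₀ ψ) l,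
      h.functional hψ.isCutoff l F = 0) : F = 0 := by
  obtain ⟨f, rfl⟩ := PreL2.exists_rep F
  refine h.toL2_eq_zero f fun x₀ => ?_
  have hm := measurableSet_target_inter_preimage x₀ h.isOpen.measurableSet
  have key : ∀ l : Module.Dual ℂ (CForm X.Model), ∀ᵐ z ∂X.haar, z ∈ chartDomain Ω x₀ →
      l (f.form.inChart x₀ ((X.chart x₀).symm z)) = 0 := by
    intro l
    refine IsOpen.ae_eq_zero_of_integral_contDiff_smul_eq_zero (isOpen_chartDomain h.isOpen x₀) ?_
      fun g hg hgc hgs => ?_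
    · refine (locallyIntegrableOn_iff (isOpen_chartDomain h.isOpen x₀).isLocallyClosed).2
        fun K hK hKc => ?_
      obtain ⟨C, -, hC⟩ := h.exists_integral_norm_le x₀ hKc hK l
      exact (hC f).1
    · have hts : tsupport (fun z => (g z : ℂ)) ⊆ tsupport g :=
        closure_mono fun z hz hz' => hz (by simp [hz'])
      have hψ : IsTestFunction Ω x₀ fun z => (g z : ℂ) :=
        ⟨Complex.ofRealCLM.contDiff.comp hg, hgc.mono' ((subset_tsupport _).trans hts),
          hts.trans hgs⟩
      exact hF x₀ _ hψ l
  let b := Module.finBasis ℂ (CForm X.Model)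
  rw [ae_restrict_iff' hm]
  filter_upwards [ae_all_iff.2 fun i => key (b.coord i)] with z hz hz'
  have h0 : f.form.inChart x₀ ((X.chart x₀).symm z) = 0 :=
    b.ext_elem fun i => by
      rw [map_zero]
      exact hz i hz'
  rw [← coordForm_inChart ((X.chart x₀).map_target hz'.1) f.form, h0, coordForm, map_zero]

end Functional

/-! ### The graph of the Cauchy-Riemann operator -/

section Graph

variable {X : HermitianManifold.{u, v}} {Ω : Set X} {φ : X → ℝ}

variable (X) in
/-- The real coordinates, as complex-valued covectors. -/
def coordCovector (k : Fin (Module.finrank ℝ X.Model)) : X.Model →ₗ[ℝ] ℂ :=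
  Complex.ofRealCLM.toLinearMap ∘ₗ (Module.finBasis ℝ X.Model).coord k

lemma sum_coordCovector (a : X.Model →ₗ[ℝ] ℂ) :
    ∑ k, a (Module.finBasis ℝ X.Model k) • coordCovector X k = a := by
  refine (Module.finBasis ℝ X.Model).ext fun j => ?_
  rw [LinearMap.sum_apply, Finset.sum_eq_single j]
  · simp [coordCovector]
  · intro i _ hi; simp [coordCovector, Ne.symm hi]
  · simp

/-- The real components of `∂̄ψ`. -/
def dbarComp (ψ : X.Model → ℂ) (k : Fin (Module.finrank ℝ X.Model)) (z : X.Model) : ℂ :=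
  CForm.dbarFun ψ z (Module.finBasis ℝ X.Model k)

/-- In real coordinates, the functional `f ↦ ∫ l(∂̄ψ ∧ f)` is a sum of functionals given by the
components of `∂̄ψ`. -/
lemma apply_dbarFun (l : Module.Dual ℂ (CForm X.Model)) (ψ : X.Model → ℂ) (z : X.Model)
    (α : CForm X.Model) : l (ExteriorAlgebra.ι ℂ (CForm.dbarFun ψ z) * α) =
      ∑ k, dbarComp ψ k z *
        (l ∘ₗ LinearMap.mulLeft ℂ (ExteriorAlgebra.ι ℂ (coordCovector X k))) α := by
  conv_lhs => rw [← sum_coordCovector (CForm.dbarFun ψ z)]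
  simp [Finset.sum_mul, dbarComp]

lemma contDiff_dbarComp {ψ : X.Model → ℂ} (hψ : ContDiff ℝ ∞ ψ)
    (k : Fin (Module.finrank ℝ X.Model)) : ContDiff ℝ ∞ (dbarComp ψ k) := by
  have h1 : ∀ w : X.Model, ContDiff ℝ ∞ fun z => fderiv ℝ ψ z w := fun w =>
    (hψ.fderiv_right (by exact_mod_cast le_top)).clm_apply contDiff_const
  exact ((h1 _).add (contDiff_const.mul (h1 _))).div_const 2

lemma support_dbarFun_subset {ψ : X.Model → ℂ} {z : X.Model} (hz : z ∉ tsupport ψ) :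
    CForm.dbarFun ψ z = 0 := by
  have h : fderiv ℝ ψ z = 0 := by
    by_contra h
    exact hz (support_fderiv_subset ℝ h)
  ext w
  simp [CForm.dbarFun, h]

lemma IsTestFunction.dbarComp {x₀ : X} {ψ : X.Model → ℂ} (hψ : IsTestFunction Ω x₀ ψ)
    (k : Fin (Module.finrank ℝ X.Model)) : IsTestFunction Ω x₀ (dbarComp ψ k) := by
  have hs : Function.support (HermitianManifold.dbarComp ψ k) ⊆ tsupport ψ := by
    intro z hz
    by_contra h
    exact hz (by rw [HermitianManifold.dbarComp, support_dbarFun_subset h]; rfl)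
  exact ⟨contDiff_dbarComp hψ.smooth k, hψ.hasCompactSupport.mono' hs,
    (closure_minimal hs (isClosed_tsupport ψ)).trans hψ.tsupport_subset⟩

/-- The functional `f ↦ ∫ l(∂̄ψ ∧ f)` on `L²_*(Ω)`. -/
def IsBoundedDomain.dbarFunctional (h : IsBoundedDomain Ω φ) {x₀ : X} {ψ : X.Model → ℂ}
    (hψ : IsTestFunction Ω x₀ ψ) (l : Module.Dual ℂ (CForm X.Model)) : X.L2 Ω φ →L[ℂ] ℂ :=
  ∑ k, h.functional (hψ.dbarComp k).isCutoff
    (l ∘ₗ LinearMap.mulLeft ℂ (ExteriorAlgebra.ι ℂ (coordCovector X k)))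

lemma IsBoundedDomain.integrable_dbar (h : IsBoundedDomain Ω φ) {x₀ : X} {ψ : X.Model → ℂ}
    (hψ : IsTestFunction Ω x₀ ψ) (l : Module.Dual ℂ (CForm X.Model)) (f : X.PreL2 Ω φ) :
    Integrable (fun z => l (ExteriorAlgebra.ι ℂ (CForm.dbarFun ψ z) *
      f.form.inChart x₀ ((X.chart x₀).symm z))) X.haar := by
  simp only [apply_dbarFun]
  exact integrable_finsetSum _ fun k _ => h.integrable_cutoff (hψ.dbarComp k).isCutoff _ f

lemma IsBoundedDomain.dbarFunctional_toL2 (h : IsBoundedDomain Ω φ) {x₀ : X} {ψ : X.Model → ℂ}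
    (hψ : IsTestFunction Ω x₀ ψ) (l : Module.Dual ℂ (CForm X.Model)) (f : X.PreL2 Ω φ) :
    h.dbarFunctional hψ l f.toL2 = ∫ z, l (ExteriorAlgebra.ι ℂ (CForm.dbarFun ψ z) *
      f.form.inChart x₀ ((X.chart x₀).symm z)) ∂X.haar := by
  simp only [apply_dbarFun]
  rw [integral_finsetSum _ fun k _ => h.integrable_cutoff (hψ.dbarComp k).isCutoff _ f]
  rw [dbarFunctional, sum_apply]
  rfl

lemma IsBoundedDomain.isWeakDbar_iff (h : IsBoundedDomain Ω φ) (f g : X.PreL2 Ω φ) :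
    IsWeakDbar Ω f.form g.form ↔ ∀ (x₀ : X) (ψ : X.Model → ℂ) (hψ : IsTestFunction Ω x₀ ψ) l,
      h.functional hψ.isCutoff l g.toL2 = - h.dbarFunctional hψ l f.toL2 := by
  simp only [h.functional_toL2, h.dbarFunctional_toL2]
  exact ⟨fun H x₀ ψ hψ l => (H x₀ ψ hψ l).2.2, fun H x₀ ψ hψ l =>
    ⟨h.integrable_cutoff hψ.isCutoff l g, h.integrable_dbar hψ l f, H x₀ ψ hψ l⟩⟩

/-- The graph of `∂̄` is the common kernel of bounded functionals; in particular it does not depend on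
the choice of representatives. -/
lemma IsBoundedDomain.mem_dbarGraph_iff (h : IsBoundedDomain Ω φ) (p : X.L2 Ω φ × X.L2 Ω φ) :
    p ∈ X.dbarGraph Ω φ ↔ ∀ (x₀ : X) (ψ : X.Model → ℂ) (hψ : IsTestFunction Ω x₀ ψ) l,
      h.functional hψ.isCutoff l p.2 = - h.dbarFunctional hψ l p.1 := by
  constructor
  · rintro ⟨f, g, hf, hg, H⟩
    rw [← hf, ← hg]
    exact (h.isWeakDbar_iff f g).1 H
  · intro H
    obtain ⟨f, hf⟩ := PreL2.exists_rep p.1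
    obtain ⟨g, hg⟩ := PreL2.exists_rep p.2
    refine ⟨f, g, hf, hg, (h.isWeakDbar_iff f g).2 ?_⟩
    rw [hf, hg]
    exact H

lemma IsBoundedDomain.isClosed_dbarGraph (h : IsBoundedDomain Ω φ) :
    IsClosed (X.dbarGraph Ω φ : Set (X.L2 Ω φ × X.L2 Ω φ)) := by
  have : (X.dbarGraph Ω φ : Set (X.L2 Ω φ × X.L2 Ω φ)) =
      ⋂ (x₀ : X) (ψ : X.Model → ℂ) (hψ : IsTestFunction Ω x₀ ψ) (l),
        {p | h.functional hψ.isCutoff l p.2 = - h.dbarFunctional hψ l p.1} := by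
    ext p
    simp only [mem_iInter]
    exact h.mem_dbarGraph_iff p
  rw [this]
  refine isClosed_iInter fun x₀ => isClosed_iInter fun ψ => isClosed_iInter fun hψ =>
    isClosed_iInter fun l => isClosed_eq ?_ ?_
  · exact (ContinuousLinearMap.continuous _).comp continuous_snd
  · exact ((ContinuousLinearMap.continuous _).comp continuous_fst).neg

lemma IsBoundedDomain.graph_dbar (h : IsBoundedDomain Ω φ) :
    (X.dbar Ω φ).graph = X.dbarGraph Ω φ := by
  refine Submodule.toLinearPMap_graph_eq _ fun p hp h0 => ?_
  refine h.eq_zero_of_functional _ fun x₀ ψ hψ l => ?_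
  rw [(h.mem_dbarGraph_iff p).1 hp x₀ ψ hψ l, h0, map_zero, neg_zero]

end Graph

end HermitianManifold

/-! ### Closedness of constant forms in holomorphic coordinates, and `∂̄∂̄ = 0` -/

namespace HermitianManifold

section Symmetric

variable {X : HermitianManifold.{u, v}} {Ω : Set X} {φ : X → ℝ}

/-- Second derivatives cancel in exterior products. -/
lemma sum_symm_ι_mul_ι (Q : Fin (Module.finrank ℝ X.Model) → Fin (Module.finrank ℝ X.Model) → ℂ)
    (hQ : ∀ k m, Q k m = Q m k) (α : CForm X.Model) :
    ∑ k, ∑ m, Q k m • (ExteriorAlgebra.ι ℂ (coordCovector X k) *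
      (ExteriorAlgebra.ι ℂ (coordCovector X m) * α)) = 0 := by
  have h : ∀ k m, ExteriorAlgebra.ι ℂ (coordCovector X k) *
      (ExteriorAlgebra.ι ℂ (coordCovector X m) * α) =
      -(ExteriorAlgebra.ι ℂ (coordCovector X m) *
      (ExteriorAlgebra.ι ℂ (coordCovector X k) * α)) := fun k m => by
    rw [← mul_assoc, eq_neg_of_add_eq_zero_left (ExteriorAlgebra.ι_add_mul_swap (R := ℂ)
      (coordCovector X k) (coordCovector X m)), neg_mul, mul_assoc]
  have h2 : ∑ k, ∑ m, Q k m • (ExteriorAlgebra.ι ℂ (coordCovector X k) *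
      (ExteriorAlgebra.ι ℂ (coordCovector X m) * α)) =
      - ∑ k, ∑ m, Q k m • (ExteriorAlgebra.ι ℂ (coordCovector X k) *
      (ExteriorAlgebra.ι ℂ (coordCovector X m) * α)) := by
    conv_lhs => rw [Finset.sum_comm]
    simp only [← Finset.sum_neg_distrib, ← smul_neg]
    refine Finset.sum_congr rfl fun k _ => Finset.sum_congr rfl fun m _ => ?_
    rw [hQ m k, h m k]
  rw [eq_neg_iff_add_eq_zero, ← two_smul ℂ] at h2
  exact (smul_eq_zero.1 h2).resolve_left two_ne_zero

/-- The symmetry of second derivatives. -/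
lemma dbarComp_comm {ψ : X.Model → ℂ} (hψ : ContDiff ℝ ∞ ψ)
    (k m : Fin (Module.finrank ℝ X.Model)) (z : X.Model) :
    dbarComp (dbarComp ψ k) m z = dbarComp (dbarComp ψ m) k z := by
  set D := fderiv ℝ (fderiv ℝ ψ) z with hD
  have hsymm : ∀ w w', D w w' = D w' w := fun w w' =>
    (hψ.contDiffAt.isSymmSndFDerivAt (n := ∞) (x := z)
      (by rw [minSmoothness_of_isRCLikeNormedField]; exact ENat.LEInfty.out)).eq w w'
  have hd : DifferentiableAt ℝ (fderiv ℝ ψ) z :=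
    ((hψ.fderiv_right (m := 1) (by rw [one_add_one_eq_two]; exact ENat.LEInfty.out)).differentiable
      one_ne_zero).differentiableAt
  have h1 : ∀ w, HasFDerivAt (fun z => fderiv ℝ ψ z w)
      ((ContinuousLinearMap.apply ℝ ℂ w).comp D) z := fun w =>
    (ContinuousLinearMap.apply ℝ ℂ w).hasFDerivAt.comp z hd.hasFDerivAt
  have h2 : ∀ k w, fderiv ℝ (dbarComp ψ k) z w = (D w (Module.finBasis ℝ X.Model k) +
      Complex.I * D w (Complex.I • Module.finBasis ℝ X.Model k)) / 2 := by
    intro k w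
    have h3 := (((h1 (Module.finBasis ℝ X.Model k)).add
      ((h1 (Complex.I • Module.finBasis ℝ X.Model k)).const_mul Complex.I)).mul_const (1 / 2))
    have h4 : dbarComp ψ k = fun z => (fderiv ℝ ψ z (Module.finBasis ℝ X.Model k) +
      Complex.I * fderiv ℝ ψ z (Complex.I • Module.finBasis ℝ X.Model k)) * (1 / 2) := by
      funext z; simp only [dbarComp, CForm.dbarFun, LinearMap.coe_mk, AddHom.coe_mk]; ring
    rw [h4]
    have h5 := congrArg (fun L => L w) h3.fderiv
    refine h5.trans ?_
    simp only [smul_apply, add_apply, ContinuousLinearMap.comp_apply, ContinuousLinearMap.apply_apply, smul_eq_mul]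
    ring
  have h6 : ∀ k m, dbarComp (dbarComp ψ k) m z =
      (fderiv ℝ (dbarComp ψ k) z (Module.finBasis ℝ X.Model m) + Complex.I *
      fderiv ℝ (dbarComp ψ k) z (Complex.I • Module.finBasis ℝ X.Model m)) / 2 := fun k m => rfl
  rw [h6, h6, h2, h2, h2, h2, hsymm (Module.finBasis ℝ X.Model m) (Module.finBasis ℝ X.Model k),
    hsymm (Complex.I • Module.finBasis ℝ X.Model k) (Module.finBasis ℝ X.Model m),
    hsymm (Complex.I • Module.finBasis ℝ X.Model m) (Module.finBasis ℝ X.Model k),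
    hsymm (Complex.I • Module.finBasis ℝ X.Model m) (Complex.I • Module.finBasis ℝ X.Model k)]
  ring

/-- `∂̄∂̄ = 0`. -/
lemma IsBoundedDomain.dbar_dbar (h : IsBoundedDomain Ω φ) {F G : X.L2 Ω φ}
    (hFG : (F, G) ∈ X.dbarGraph Ω φ) : (G, 0) ∈ X.dbarGraph Ω φ := by
  rw [h.mem_dbarGraph_iff]
  intro x₀ ψ hψ l
  obtain ⟨f, rfl⟩ := PreL2.exists_rep F
  rw [map_zero, zero_eq_neg, dbarFunctional, sum_apply]
  have h1 : ∀ k, h.functional (hψ.dbarComp k).isCutoff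
      (l ∘ₗ LinearMap.mulLeft ℂ (ExteriorAlgebra.ι ℂ (coordCovector X k))) G =
      - ∑ m, ∫ z, dbarComp (dbarComp ψ k) m z * (l ∘ₗ LinearMap.mulLeft ℂ (ExteriorAlgebra.ι ℂ
        (coordCovector X k)) ∘ₗ LinearMap.mulLeft ℂ (ExteriorAlgebra.ι ℂ (coordCovector X m)))
        (f.form.inChart x₀ ((X.chart x₀).symm z)) ∂X.haar := by
    intro k
    refine ((h.mem_dbarGraph_iff _).1 hFG x₀ _ (hψ.dbarComp k) _).trans ?_
    rw [dbarFunctional, sum_apply]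
    rfl
  simp only [h1]
  rw [Finset.sum_neg_distrib, neg_eq_zero]
  have hint : ∀ k m, Integrable (fun z => dbarComp (dbarComp ψ k) m z * (l ∘ₗ LinearMap.mulLeft ℂ
      (ExteriorAlgebra.ι ℂ (coordCovector X k)) ∘ₗ LinearMap.mulLeft ℂ (ExteriorAlgebra.ι ℂ
      (coordCovector X m))) (f.form.inChart x₀ ((X.chart x₀).symm z))) X.haar := fun k m =>
    h.integrable_cutoff ((hψ.dbarComp k).dbarComp m).isCutoff _ f
  have h2 : ∀ k, ∑ m, ∫ z, dbarComp (dbarComp ψ k) m z * (l ∘ₗ LinearMap.mulLeft ℂ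
      (ExteriorAlgebra.ι ℂ (coordCovector X k)) ∘ₗ LinearMap.mulLeft ℂ (ExteriorAlgebra.ι ℂ
      (coordCovector X m))) (f.form.inChart x₀ ((X.chart x₀).symm z)) ∂X.haar =
      ∫ z, ∑ m, dbarComp (dbarComp ψ k) m z * (l ∘ₗ LinearMap.mulLeft ℂ
      (ExteriorAlgebra.ι ℂ (coordCovector X k)) ∘ₗ LinearMap.mulLeft ℂ (ExteriorAlgebra.ι ℂ
      (coordCovector X m))) (f.form.inChart x₀ ((X.chart x₀).symm z)) ∂X.haar := fun k =>
    (integral_finsetSum _ fun m _ => hint k m).symm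
  simp only [h2]
  rw [← integral_finsetSum _ fun k _ => integrable_finsetSum _ fun m _ => hint k m]
  refine integral_eq_zero_of_ae (Filter.Eventually.of_forall fun z => ?_)
  -- the second derivatives are symmetric, and the exterior product is alternating
  have h3 := congrArg l (sum_symm_ι_mul_ι (fun k m => dbarComp (dbarComp ψ k) m z)
    (fun k m => dbarComp_comm hψ.smooth k m z) (f.form.inChart x₀ ((X.chart x₀).symm z)))
  simpa [map_sum] using h3

end Symmetric

section Holomorphic

variable {X : HermitianManifold.{u, v}}

/-- The coefficients of the pullback of a constant form depend continuously on the linear map. -/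
lemma continuous_apply_pullback (l : Module.Dual ℂ (CForm X.Model)) (β : CForm X.Model) :
    Continuous fun A : X.Model →L[ℂ] X.Model =>
      l (CForm.pullback (A.restrictScalars ℝ).toLinearMap β) := by
  induction β using CliffordAlgebra.left_induction generalizing l with
  | algebraMap r => simp only [AlgHom.commutes]; exact continuous_const
  | add β β' h h' => simp only [map_add]; exact (h l).add (h' l)
  | ι_mul β a h =>
    have h1 : ∀ A : X.Model →L[ℂ] X.Model,
        l (CForm.pullback (A.restrictScalars ℝ).toLinearMap (ExteriorAlgebra.ι ℂ a * β)) =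
        ∑ k, a (A (Module.finBasis ℝ X.Model k)) *
          (l ∘ₗ LinearMap.mulLeft ℂ (ExteriorAlgebra.ι ℂ (coordCovector X k)))
          (CForm.pullback (A.restrictScalars ℝ).toLinearMap β) := by
      intro A
      rw [map_mul, CForm.pullback_ι,
        ← sum_coordCovector (a ∘ₗ (A.restrictScalars ℝ).toLinearMap)]
      simp [Finset.sum_mul]
    refine Continuous.congr ?_ fun A => (h1 A).symm
    refine continuous_finsetSum _ fun k _ => Continuous.mul ?_ (h _)
    have ha : Continuous a := LinearMap.continuous_of_finiteDimensional a
    exact ha.comp (ContinuousLinearMap.apply ℂ X.Model (Module.finBasis ℝ X.Model k)).continuous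

/-- A smooth function on an open set, multiplied by a test function in this set, is smooth. -/
lemma contDiff_mul_of_tsupport {E : Type*} [NormedAddCommGroup E] [NormedSpace ℝ E] {U : Set E}
    (hU : IsOpen U) {c ψ : E → ℂ} (hc : ContDiffOn ℝ ∞ c U) (hψ : ContDiff ℝ ∞ ψ)
    (hs : tsupport ψ ⊆ U) : ContDiff ℝ ∞ fun z => c z * ψ z := by
  refine contDiff_iff_contDiffAt.2 fun z => ?_
  by_cases hz : z ∈ tsupport ψ
  · exact (hc.contDiffAt (hU.mem_nhds (hs hz))).mul hψ.contDiffAt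
  · refine (contDiffAt_const (c := (0 : ℂ))).congr_of_eventuallyEq ?_
    filter_upwards [(isClosed_tsupport ψ).isOpen_compl.mem_nhds hz] with w hw
    rw [image_eq_zero_of_notMem_tsupport hw, mul_zero]

lemma dbarFun_mul {E : Type*} [NormedAddCommGroup E] [NormedSpace ℂ E] {f g : E → ℂ} {z : E}
    (hf : DifferentiableAt ℝ f z) (hg : DifferentiableAt ℝ g z) :
    CForm.dbarFun (fun z => f z * g z) z = f z • CForm.dbarFun g z + g z • CForm.dbarFun f z := by
  ext w
  simp only [CForm.dbarFun, LinearMap.coe_mk, AddHom.coe_mk, LinearMap.add_apply,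
    LinearMap.smul_apply, smul_eq_mul]
  have h : fderiv ℝ (fun z => f z * g z) z = f z • fderiv ℝ g z + g z • fderiv ℝ f z :=
    fderiv_fun_mul hf hg
  rw [h]
  simp only [add_apply, smul_apply, smul_eq_mul]
  ring

lemma integrable_mul_pullback {T : X.Model → X.Model} {U : Set X.Model} (hU : IsOpen U)
    (hT : ContDiffOn ℂ ω T U) {ψ : X.Model → ℂ} (hψ : Continuous ψ) (hc : HasCompactSupport ψ)
    (hs : tsupport ψ ⊆ U) (β : CForm X.Model) (l : Module.Dual ℂ (CForm X.Model)) :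
    Integrable (fun z => ψ z *
      l (CForm.pullback ((fderiv ℂ T z).restrictScalars ℝ).toLinearMap β)) X.haar := by
  refine Continuous.integrable_of_hasCompactSupport ?_ hc.mul_right
  refine continuous_iff_continuousAt.2 fun z => ?_
  by_cases hz : z ∈ tsupport ψ
  · have hd : ContinuousOn (fderiv ℂ T) U :=
      (hT.fderiv_of_isOpen (m := 0) hU (by exact_mod_cast le_top)).continuousOn
    exact hψ.continuousAt.mul ((continuous_apply_pullback l β).continuousAt.comp
      (hd.continuousAt (hU.mem_nhds (hs hz))))
  · refine (continuousAt_const (y := (0 : ℂ))).congr ?_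
    filter_upwards [(isClosed_tsupport ψ).isOpen_compl.mem_nhds hz] with w hw
    rw [image_eq_zero_of_notMem_tsupport hw, zero_mul]

lemma integral_dbarComp {ψ : X.Model → ℂ} (hψ : ContDiff ℝ ∞ ψ) (hc : HasCompactSupport ψ)
    (k : Fin (Module.finrank ℝ X.Model)) : ∫ z, dbarComp ψ k z ∂X.haar = 0 := by
  have hd : ∀ w : X.Model, Continuous fun z => fderiv ℝ ψ z w := fun w =>
    ((hψ.continuous_fderiv (by simp)).clm_apply continuous_const)
  have hcd : ∀ w : X.Model, HasCompactSupport fun z => fderiv ℝ ψ z w := fun w =>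
    hc.fderiv_apply ℝ w
  have h0 : ∀ w : X.Model, ∫ z, fderiv ℝ ψ z w ∂X.haar = 0 := by
    intro w
    have h := integral_mul_fderiv_eq_neg_fderiv_mul_of_integrable (μ := X.haar) (𝕜 := ℂ)
      (f := ψ) (g := fun _ => (1 : ℂ)) (v := w)
      (by simpa using (hd w).integrable_of_hasCompactSupport (hcd w)) (by simp)
      (by simpa using hψ.continuous.integrable_of_hasCompactSupport hc)
      (fun z _ => hψ.differentiable (by simp) z) (fun z _ => differentiableAt_const _)
    simpa using h
  have hi : ∀ w : X.Model, Integrable (fun z => fderiv ℝ ψ z w) X.haar := fun w =>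
    (hd w).integrable_of_hasCompactSupport (hcd w)
  simp only [dbarComp, CForm.dbarFun, LinearMap.coe_mk, AddHom.coe_mk]
  rw [integral_div, integral_add (hi _) ((hi _).const_mul _), integral_const_mul, h0, h0]
  simp

/-- The pullback of a constant form under a holomorphic map is closed, in the weak sense. -/
lemma integral_dbarFun_mul_pullback {T : X.Model → X.Model} {U : Set X.Model} (hU : IsOpen U)
    (hT : ContDiffOn ℂ ω T U) {ψ : X.Model → ℂ} (hψ : ContDiff ℝ ∞ ψ) (hc : HasCompactSupport ψ)
    (hs : tsupport ψ ⊆ U) (β : CForm X.Model) (l : Module.Dual ℂ (CForm X.Model)) :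
    ∫ z, l (ExteriorAlgebra.ι ℂ (CForm.dbarFun ψ z) *
      CForm.pullback ((fderiv ℂ T z).restrictScalars ℝ).toLinearMap β) ∂X.haar = 0 := by
  have hcomp : ∀ (ψ : X.Model → ℂ) (hψ : ContDiff ℝ ∞ ψ) (hc : HasCompactSupport ψ)
      (hs : tsupport ψ ⊆ U) k, HasCompactSupport (dbarComp ψ k) ∧ tsupport (dbarComp ψ k) ⊆ U := by
    intro ψ hψ hc hs k
    have hs' : Function.support (HermitianManifold.dbarComp ψ k) ⊆ tsupport ψ := by
      intro z hz
      by_contra h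
      exact hz (by rw [HermitianManifold.dbarComp, support_dbarFun_subset h]; rfl)
    exact ⟨hc.mono' hs', (closure_minimal hs' (isClosed_tsupport ψ)).trans hs⟩
  have hint : ∀ (ψ : X.Model → ℂ) (hψ : ContDiff ℝ ∞ ψ) (hc : HasCompactSupport ψ)
      (hs : tsupport ψ ⊆ U) (β : CForm X.Model) (l : Module.Dual ℂ (CForm X.Model)),
      Integrable (fun z => l (ExteriorAlgebra.ι ℂ (CForm.dbarFun ψ z) *
      CForm.pullback ((fderiv ℂ T z).restrictScalars ℝ).toLinearMap β)) X.haar := by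
    intro ψ hψ hc hs β l
    simp only [apply_dbarFun]
    exact integrable_finsetSum _ fun k _ => integrable_mul_pullback hU hT
      (contDiff_dbarComp hψ k).continuous (hcomp ψ hψ hc hs k).1 (hcomp ψ hψ hc hs k).2 β _
  induction β using CliffordAlgebra.left_induction generalizing l ψ with
  | algebraMap r =>
    simp only [AlgHom.commutes, apply_dbarFun]
    rw [integral_finsetSum]
    · refine Finset.sum_eq_zero fun k _ => ?_
      rw [integral_mul_const, integral_dbarComp hψ hc, zero_mul]
    · intro k _
      exact ((contDiff_dbarComp hψ k).continuous.integrable_of_hasCompactSupport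
        (hcomp ψ hψ hc hs k).1).mul_const _
  | add β β' h h' =>
    simp only [map_add, mul_add]
    rw [integral_add (hint ψ hψ hc hs β l) (hint ψ hψ hc hs β' l), h hψ hc hs, h' hψ hc hs, add_zero]
  | ι_mul β a h =>
    -- the coefficients of the pullback of the covector `a`
    let c : Fin (Module.finrank ℝ X.Model) → X.Model → ℂ := fun k z =>
      a (fderiv ℂ T z (Module.finBasis ℝ X.Model k))
    have hdT : ContDiffOn ℂ ω (fderiv ℂ T) U := hT.fderiv_of_isOpen hU (by simp)
    have ha : Continuous a := LinearMap.continuous_of_finiteDimensional a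
    let a' : X.Model →L[ℝ] ℂ := ⟨a, ha⟩
    have hcs : ∀ k, ContDiffOn ℝ ∞ (c k) U := fun k =>
      a'.contDiff.comp_contDiffOn (((hdT.clm_apply contDiffOn_const).restrict_scalars ℝ).of_le
        (by simp))
    have hψc : ∀ k, ContDiff ℝ ∞ fun z => c k z * ψ z := fun k =>
      contDiff_mul_of_tsupport hU (hcs k) hψ hs
    have hψcc : ∀ k, HasCompactSupport fun z => c k z * ψ z := fun k => hc.mul_left
    have hψcs : ∀ k, tsupport (fun z => c k z * ψ z) ⊆ U := fun k =>
      (closure_mono (Function.support_mul_subset_right _ _)).trans hs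
    -- the induction hypothesis for the test functions `c k * ψ`
    have hzero : ∀ k, ∫ z, (l ∘ₗ LinearMap.mulLeft ℂ (ExteriorAlgebra.ι ℂ (coordCovector X k)))
        (ExteriorAlgebra.ι ℂ (CForm.dbarFun (fun z => c k z * ψ z) z) *
        CForm.pullback ((fderiv ℂ T z).restrictScalars ℝ).toLinearMap β) ∂X.haar = 0 := fun k =>
      h (hψc k) (hψcc k) (hψcs k) _
    -- `∂̄(c_k ψ) = c_k ∂̄ψ + ψ ∂̄c_k`, where `∑ ∂̄c_k ∧ dx_k` vanishes because `a` is pulled back under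
    -- a holomorphic map
    have hsum : ∀ z, l (ExteriorAlgebra.ι ℂ (CForm.dbarFun ψ z) *
        CForm.pullback ((fderiv ℂ T z).restrictScalars ℝ).toLinearMap
          (ExteriorAlgebra.ι ℂ a * β)) =
        - ∑ k, (l ∘ₗ LinearMap.mulLeft ℂ (ExteriorAlgebra.ι ℂ (coordCovector X k)))
        (ExteriorAlgebra.ι ℂ (CForm.dbarFun (fun z => c k z * ψ z) z) *
        CForm.pullback ((fderiv ℂ T z).restrictScalars ℝ).toLinearMap β) := by
      intro z
      set γ := CForm.pullback ((fderiv ℂ T z).restrictScalars ℝ).toLinearMap β with hγ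
      by_cases hz : z ∈ tsupport ψ
      swap
      · have h0 : ∀ k, CForm.dbarFun (fun z => c k z * ψ z) z = 0 := fun k =>
          support_dbarFun_subset fun hz' =>
            hz (closure_mono (Function.support_mul_subset_right _ _) hz')
        simp [support_dbarFun_subset hz, h0]
      have hzU := hs hz
      have hdc : ∀ k, DifferentiableAt ℝ (c k) z := fun k =>
        ((hcs k).differentiableOn (by simp)).differentiableAt (hU.mem_nhds hzU)
      have hd : DifferentiableAt ℝ ψ z := hψ.differentiable (by simp) z
      have hpull : a ∘ₗ ((fderiv ℂ T z).restrictScalars ℝ).toLinearMap =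
          ∑ k, c k z • coordCovector X k :=
        (sum_coordCovector (a ∘ₗ ((fderiv ℂ T z).restrictScalars ℝ).toLinearMap)).symm
      -- the derivative of the coefficients is symmetric
      set H := fderiv ℂ (fderiv ℂ T) z with hH
      have hHs : ∀ w w', H w w' = H w' w := fun w w' =>
        ((hT.contDiffAt (hU.mem_nhds hzU)).isSymmSndFDerivAt (n := ω)
          (by rw [minSmoothness_of_isRCLikeNormedField]; exact le_top)).eq w w'
      have hHd : HasFDerivAt (fderiv ℂ T) H z :=
        ((hdT.differentiableOn (by simp)).differentiableAt (hU.mem_nhds hzU)).hasFDerivAt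
      have hck : ∀ k w, fderiv ℝ (c k) z w = a (H w (Module.finBasis ℝ X.Model k)) := by
        intro k w
        have h1 := a'.hasFDerivAt.comp z
          (((ContinuousLinearMap.apply ℂ X.Model (Module.finBasis ℝ X.Model k)).hasFDerivAt.comp z
          hHd).restrictScalars ℝ)
        exact congrArg (fun L => L w) h1.fderiv
      have hQ : ∀ k m, CForm.dbarFun (c k) z (Module.finBasis ℝ X.Model m) =
          CForm.dbarFun (c m) z (Module.finBasis ℝ X.Model k) := by
        intro k m
        simp only [CForm.dbarFun, LinearMap.coe_mk, AddHom.coe_mk, hck, map_smul,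
          smul_apply]
        rw [hHs]
      have hsymm := congrArg l (sum_symm_ι_mul_ι (fun k m => CForm.dbarFun (c k) z
        (Module.finBasis ℝ X.Model m)) hQ γ)
      have hexp : ∀ k, CForm.dbarFun (c k) z = ∑ m, CForm.dbarFun (c k) z
        (Module.finBasis ℝ X.Model m) • coordCovector X m := fun k => (sum_coordCovector _).symm
      have h1 : ∑ k, l (ExteriorAlgebra.ι ℂ (coordCovector X k) *
          (ExteriorAlgebra.ι ℂ (CForm.dbarFun (c k) z) * γ)) = 0 := by
        rw [map_zero] at hsymm
        rw [← hsymm, map_sum]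
        refine Finset.sum_congr rfl fun k _ => ?_
        conv_lhs => rw [hexp k]
        simp [Finset.sum_mul, Finset.mul_sum]
      have h2 : ∀ k, ExteriorAlgebra.ι ℂ (CForm.dbarFun ψ z) *
          (ExteriorAlgebra.ι ℂ (coordCovector X k) * γ) =
          -(ExteriorAlgebra.ι ℂ (coordCovector X k) *
          (ExteriorAlgebra.ι ℂ (CForm.dbarFun ψ z) * γ)) := fun k => by
        rw [← mul_assoc, eq_neg_of_add_eq_zero_left (ExteriorAlgebra.ι_add_mul_swap (R := ℂ)
          (CForm.dbarFun ψ z) (coordCovector X k)), neg_mul, mul_assoc]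
      rw [map_mul (CForm.pullback _), CForm.pullback_ι, hpull, ← hγ]
      simp only [dbarFun_mul (hdc _) hd, map_sum, map_add, map_smul, add_mul, Finset.sum_mul,
        Finset.mul_sum, smul_mul_assoc, mul_smul_comm, h2, LinearMap.comp_apply,
        LinearMap.mulLeft_apply, smul_eq_mul, mul_add, Finset.sum_add_distrib, map_neg, mul_neg,
        Finset.sum_neg_distrib]
      rw [← Finset.mul_sum, h1, mul_zero, add_zero]
    simp only [hsum]
    rw [integral_neg, integral_finsetSum, Finset.sum_eq_zero fun k _ => hzero k, neg_zero]
    intro k _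
    exact hint _ (hψc k) (hψcc k) (hψcs k) β _

end Holomorphic

end HermitianManifold

/-! ### Forms with constant coefficients in a chart, cut off -/

namespace HermitianManifold

variable {X : HermitianManifold.{u, v}} {Ω : Set X} {φ : X → ℝ}

lemma continuousOn_apply_inChart_coordForm (x₀ x₁ : X) (β : CForm X.Model)
    (l : Module.Dual ℂ (CForm X.Model)) :
    ContinuousOn (fun x => l ((coordForm x₀ β).inChart x₁ x))
      ((X.chart x₀).source ∩ (X.chart x₁).source) := by
  have h1 : ContinuousOn (tangentCoordChange 𝓘(ℂ, X.Model) x₁ x₀)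
      ((X.chart x₀).source ∩ (X.chart x₁).source) := by
    refine (continuousOn_tangentCoordChange (I := 𝓘(ℂ, X.Model)) x₁ x₀).mono fun x hx => ?_
    simpa using hx.symm
  exact ((continuous_apply_pullback l β).comp_continuousOn h1).congr fun x hx => by
    rw [inChart_coordForm hx.1 hx.2]; rfl

/-- The form with constant coefficients `β` in the chart at `x₀`, multiplied by a function. -/
def cutForm (x₀ : X) (c : X → ℂ) (β : CForm X.Model) : X.Form := fun x => c x • coordForm x₀ β x

lemma inChart_cutForm (x₀ x₁ x : X) (c : X → ℂ) (β : CForm X.Model) :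
    (cutForm x₀ c β).inChart x₁ x = c x • (coordForm x₀ β).inChart x₁ x := by
  simp [Form.inChart, cutForm]

lemma fiberInner_cutForm (x₀ x : X) (c : X → ℂ) (β α : CForm X.Model) :
    X.fiberInner x (cutForm x₀ c β x) α = conj (c x) * X.fiberInner x (coordForm x₀ β x) α := by
  rw [cutForm, X.fiberInner_smul_left]

lemma fiberInner_cutForm_self (x₀ x : X) (c : X → ℂ) (β : CForm X.Model) :
    (X.fiberInner x (cutForm x₀ c β x) (cutForm x₀ c β x)).re =
      ‖c x‖ ^ 2 * (X.fiberInner x (coordForm x₀ β x) (coordForm x₀ β x)).re := by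
  rw [fiberInner_cutForm, ← X.fiberInner_conj, fiberInner_cutForm, map_mul, X.fiberInner_conj,
    Complex.conj_conj, ← mul_assoc, mul_comm (conj _), Complex.mul_conj, Complex.normSq_eq_norm_sq,
    Complex.re_ofReal_mul]

/-- A form with constant coefficients in a chart is square integrable on a bounded domain, after
multiplication by a function that makes it bounded. -/
lemma IsBoundedDomain.cutForm_mem (h : IsBoundedDomain Ω φ) {x₀ : X} {c : X → ℂ}
    (hc : AEStronglyMeasurable c (X.weightedVolume Ω φ)) (hs : ∀ x ∉ (X.chart x₀).source, c x = 0)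
    (β : CForm X.Model) (C : ℝ)
    (hC : ∀ x ∈ (X.chart x₀).source, ‖c x‖ ^ 2 * (chartInner x₀ x β β).re ≤ C) :
    cutForm x₀ c β ∈ X.squareIntegrable (X.weightedVolume Ω φ) := by
  have hm : Form.AEMeas (cutForm x₀ c β) (X.weightedVolume Ω φ) := by
    intro x₁ l
    have hms := (measurableSet_chart_source x₀).inter (measurableSet_chart_source x₁)
    have h1 : AEStronglyMeasurable (((X.chart x₀).source ∩ (X.chart x₁).source).indicator
        fun x => l ((coordForm x₀ β).inChart x₁ x)) (X.weightedVolume Ω φ) :=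
      (aestronglyMeasurable_indicator_iff hms).2
        ((continuousOn_apply_inChart_coordForm x₀ x₁ β l).aestronglyMeasurable hms)
    refine (hc.restrict.mul h1.restrict).congr ?_
    filter_upwards [ae_restrict_mem (measurableSet_chart_source x₁)] with x hx
    rw [inChart_cutForm, map_smul, smul_eq_mul, Pi.mul_apply]
    by_cases hx₀ : x ∈ (X.chart x₀).source
    · rw [indicator_of_mem (show x ∈ _ ∩ _ from ⟨hx₀, hx⟩)]
    · rw [hs x hx₀, zero_mul, zero_mul]
  have := h.isFiniteMeasure
  refine ⟨hm, Integrable.of_bound (Complex.continuous_re.comp_aestronglyMeasurable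
    (X.aestronglyMeasurable_fiberInner hm hm)) (max C 0) (Filter.Eventually.of_forall fun x => ?_)⟩
  rw [Real.norm_of_nonneg (X.fiberInner_re_nonneg x _), fiberInner_cutForm_self]
  by_cases hx₀ : x ∈ (X.chart x₀).source
  · rw [← chartInner_eq_fiberInner hx₀]
    exact (hC x hx₀).trans (le_max_left _ _)
  · rw [hs x hx₀]; simp

lemma aestronglyMeasurable_indicator_source (x₀ : X) {c : X → ℂ} {m : Measure X}
    (hc : ContinuousOn c (X.chart x₀).source) :
    AEStronglyMeasurable ((X.chart x₀).source.indicator c) m :=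
  (aestronglyMeasurable_indicator_iff (measurableSet_chart_source x₀)).2
    (hc.aestronglyMeasurable (measurableSet_chart_source x₀))

/-- The form `η β` in the coordinates of the chart at `x₀`, for a constant form `β` and a function
`η` with compact support. -/
def IsBoundedDomain.testForm (h : IsBoundedDomain Ω φ) {x₀ : X} {η : X.Model → ℂ}
    (hη : IsCutoff Ω x₀ η) (β : CForm X.Model) : X.PreL2 Ω φ :=
  ⟨cutForm x₀ ((X.chart x₀).source.indicator fun x => η (X.chart x₀ x)) β, by
    have hcs : ContinuousOn (X.chart x₀).symm (tsupport η) :=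
      (X.chart x₀).continuousOn_symm.mono (hη.tsupport_subset.trans inter_subset_left)
    have hK : IsCompact ((X.chart x₀).symm '' tsupport η) :=
      hη.hasCompactSupport.isCompact.image_of_continuousOn hcs
    have hKs : (X.chart x₀).symm '' tsupport η ⊆ (X.chart x₀).source := by
      rintro _ ⟨z, hz, rfl⟩
      exact (X.chart x₀).map_target (hη.tsupport_subset hz).1
    obtain ⟨M, hM⟩ := hK.exists_bound_of_continuousOn
      ((continuousOn_chartInner x₀ β β).mono hKs)
    obtain ⟨L, hL⟩ := hη.hasCompactSupport.exists_bound_of_continuous hη.continuous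
    refine h.cutForm_mem (aestronglyMeasurable_indicator_source x₀
      (c := fun x => η (X.chart x₀ x))
      (hη.continuous.comp_continuousOn (X.chart x₀).continuousOn)) (fun x hx =>
      indicator_of_notMem hx _) β (L ^ 2 * max M 0) fun x hx => ?_
    rw [indicator_of_mem hx]
    have h0 : 0 ≤ (chartInner x₀ x β β).re := by
      rw [chartInner_eq_fiberInner hx]; exact X.fiberInner_re_nonneg x _
    by_cases hz : X.chart x₀ x ∈ tsupport η
    · have h1 := hM x ⟨_, hz, (X.chart x₀).left_inv hx⟩
      gcongr
      · exact hL _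
      · exact ((Complex.re_le_norm _).trans h1).trans (le_max_left _ _)
    · rw [image_eq_zero_of_notMem_tsupport hz]
      simp only [norm_zero, ne_eq, OfNat.ofNat_ne_zero, not_false_eq_true, zero_pow, zero_mul]
      positivity⟩

lemma IsBoundedDomain.form_testForm (h : IsBoundedDomain Ω φ) {x₀ : X} {η : X.Model → ℂ}
    (hη : IsCutoff Ω x₀ η) (β : CForm X.Model) : (h.testForm hη β).form =
      cutForm x₀ ((X.chart x₀).source.indicator fun x => η (X.chart x₀ x)) β := rfl

/-- The form `η β` is in the domain of `∂̄`, and its image is `∂̄η ∧ β`. -/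
lemma IsBoundedDomain.testForm_mem_dbarGraph (h : IsBoundedDomain Ω φ) {x₀ : X} {η : X.Model → ℂ}
    (hη : IsTestFunction Ω x₀ η) (β : CForm X.Model) :
    ((h.testForm hη.isCutoff β).toL2, ∑ k, (h.testForm (hη.dbarComp k).isCutoff
      (ExteriorAlgebra.ι ℂ (coordCovector X k) * β)).toL2) ∈ X.dbarGraph Ω φ := by
  rw [h.mem_dbarGraph_iff]
  intro x₁ ψ hψ l
  rw [map_sum, h.dbarFunctional_toL2, eq_neg_iff_add_eq_zero]
  simp only [h.functional_toL2]
  rw [← integral_finsetSum _ fun k _ => h.integrable_cutoff hψ.isCutoff l _, ← integral_add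
    (integrable_finsetSum _ fun k _ => h.integrable_cutoff hψ.isCutoff l _)
    (h.integrable_dbar hψ l _)]
  simp only [h.form_testForm, inChart_cutForm]
  set W : Set X.Model := (X.chart x₁).target ∩ (X.chart x₁).symm ⁻¹' (X.chart x₀).source with hW
  have hWo : IsOpen W := (X.chart x₁).isOpen_inter_preimage_symm (X.chart x₀).open_source
  -- the transition map, which is holomorphic
  let T : X.Model → X.Model := fun z => X.chart x₀ ((X.chart x₁).symm z)
  have hT : ContDiffOn ℂ ω T W := by
    have := contDiffOn_ext_coord_change (I := 𝓘(ℂ, X.Model)) (n := ω) x₀ x₁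
    simpa [Function.comp_def, T, hW] using this
  have hdT : ∀ z ∈ W, HasFDerivAt T (tangentCoordChange 𝓘(ℂ, X.Model) x₁ x₀
      ((X.chart x₁).symm z)) z := fun z hz => hasFDerivAt_transition hz.1 hz.2
  -- the product of both test functions; its derivative collects the two integrands, and the integral
  -- vanishes since pullbacks of constant forms under holomorphic maps are closed
  let Ψ : X.Model → ℂ := fun z => ψ z * W.indicator (fun z => η (T z)) z
  -- the support of `Ψ` is a compact subset of `W`
  set K : Set X.Model := tsupport ψ ∩ (X.chart x₁).symm ⁻¹' ((X.chart x₀).symm '' tsupport η)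
    with hK
  have hKη : IsCompact ((X.chart x₀).symm '' tsupport η) :=
    hη.hasCompactSupport.isCompact.image_of_continuousOn
      ((X.chart x₀).continuousOn_symm.mono (hη.tsupport_subset.trans inter_subset_left))
  have hKc : IsClosed K := ((X.chart x₁).continuousOn_symm.mono (hψ.tsupport_subset.trans
    inter_subset_left)).preimage_isClosed_of_isClosed (isClosed_tsupport ψ) hKη.isClosed
  have hKW : K ⊆ W := by
    rintro z ⟨hz, w, hw, hwz⟩
    refine ⟨(hψ.tsupport_subset hz).1, ?_⟩
    rw [mem_preimage, ← hwz]
    exact (X.chart x₀).map_target (hη.tsupport_subset hw).1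
  have hΨ0 : ∀ z ∉ K, Ψ z = 0 := by
    intro z hz
    by_cases hzW : z ∈ W
    · by_cases hz1 : z ∈ tsupport ψ
      · have : T z ∉ tsupport η := fun hT' => hz ⟨hz1, T z, hT', (X.chart x₀).left_inv hzW.2⟩
        simp only [Ψ, indicator_of_mem hzW, image_eq_zero_of_notMem_tsupport this, mul_zero]
      · simp only [Ψ, image_eq_zero_of_notMem_tsupport hz1, zero_mul]
    · simp only [Ψ, indicator_of_notMem hzW, mul_zero]
  have hΨs : tsupport Ψ ⊆ K := closure_minimal (fun z hz => by_contra fun h => hz (hΨ0 z h)) hKc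
  have hΨc : HasCompactSupport Ψ :=
    (hψ.hasCompactSupport.isCompact.of_isClosed_subset hKc inter_subset_left).of_isClosed_subset
      (isClosed_tsupport _) hΨs
  have hηT : ContDiffOn ℝ ∞ (fun z => η (T z)) W :=
    hη.smooth.comp_contDiffOn ((hT.restrict_scalars ℝ).of_le (by simp))
  have hΨeq : ∀ z ∈ W, Ψ =ᶠ[nhds z] fun z => ψ z * η (T z) := fun z hz => by
    filter_upwards [hWo.mem_nhds hz] with w hw
    simp only [Ψ, indicator_of_mem hw]
  have hΨd : ContDiff ℝ ∞ Ψ := by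
    refine contDiff_iff_contDiffAt.2 fun z => ?_
    by_cases hz : z ∈ W
    · exact (hψ.smooth.contDiffAt.mul (hηT.contDiffAt (hWo.mem_nhds hz))).congr_of_eventuallyEq
        (hΨeq z hz)
    · refine (contDiffAt_const (c := (0 : ℂ))).congr_of_eventuallyEq ?_
      filter_upwards [hKc.isOpen_compl.mem_nhds fun h => hz (hKW h)] with w hw using hΨ0 w hw
  rw [← integral_dbarFun_mul_pullback hWo hT hΨd hΨc (hΨs.trans hKW) β l]
  refine integral_congr_ae (Filter.Eventually.of_forall fun z => ?_)
  beta_reduce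
  by_cases hz : z ∈ W
  · have hder : CForm.dbarFun (fun z => η (T z)) z =
        CForm.dbarFun η (T z) ∘ₗ ((fderiv ℂ T z).restrictScalars ℝ).toLinearMap := by
      have h1 := ((hη.smooth.differentiable (by simp) (T z)).hasFDerivAt.comp z
        ((hdT z hz).restrictScalars ℝ)).fderiv
      have h2 : ∀ w, fderiv ℝ (fun z => η (T z)) z w = fderiv ℝ η (T z) (fderiv ℂ T z w) :=
        fun w => by rw [(hdT z hz).fderiv]; exact congrArg (fun L => L w) h1
      ext w
      simp only [CForm.dbarFun, LinearMap.coe_mk, AddHom.coe_mk, h2, LinearMap.comp_apply]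
      change _ = (fderiv ℝ η (T z) (fderiv ℂ T z w) +
        Complex.I * fderiv ℝ η (T z) (Complex.I • fderiv ℂ T z w)) / 2
      rw [map_smul]
    have hd : CForm.dbarFun Ψ z = ψ z • (CForm.dbarFun η (T z) ∘ₗ
        ((fderiv ℂ T z).restrictScalars ℝ).toLinearMap) + η (T z) • CForm.dbarFun ψ z := by
      rw [← hder, ← dbarFun_mul (hψ.smooth.differentiable (by simp) z)
        ((hηT.differentiableOn (by simp)).differentiableAt (hWo.mem_nhds hz))]
      ext w
      simp only [CForm.dbarFun, LinearMap.coe_mk, AddHom.coe_mk, (hΨeq z hz).fderiv_eq]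
    have hsum : CForm.dbarFun η (T z) = ∑ k, dbarComp η k (T z) • coordCovector X k :=
      (sum_coordCovector _).symm
    have hp : ∀ β, (coordForm x₀ β).inChart x₁ ((X.chart x₁).symm z) =
        CForm.pullback ((fderiv ℂ T z).restrictScalars ℝ).toLinearMap β := fun β => by
      rw [inChart_coordForm hz.2 ((X.chart x₁).map_target hz.1), (hdT z hz).fderiv]
    have hι : ExteriorAlgebra.ι ℂ (CForm.dbarFun η (T z) ∘ₗ
        ((fderiv ℂ T z).restrictScalars ℝ).toLinearMap) = ∑ k, dbarComp η k (T z) •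
        CForm.pullback ((fderiv ℂ T z).restrictScalars ℝ).toLinearMap
          (ExteriorAlgebra.ι ℂ (coordCovector X k)) := by
      rw [← CForm.pullback_ι, hsum, map_sum, map_sum]
      simp only [map_smul]
    rw [hd, map_add (ExteriorAlgebra.ι ℂ), map_smul (ExteriorAlgebra.ι ℂ), hι]
    simp only [hp, map_mul (CForm.pullback _), indicator_of_mem (show (X.chart x₁).symm z ∈ (X.chart x₀).source from hz.2)]
    simp [T, map_sum, add_mul, Finset.sum_mul, Finset.mul_sum]
  · have hd : CForm.dbarFun Ψ z = 0 := support_dbarFun_subset fun h => hz (hKW (hΨs h))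
    rw [hd, map_zero, zero_mul, map_zero]
    by_cases hz1 : z ∈ tsupport ψ
    · have : (X.chart x₁).symm z ∉ (X.chart x₀).source := fun h =>
        hz ⟨(hψ.tsupport_subset hz1).1, h⟩
      simp [indicator_of_notMem this]
    · simp [image_eq_zero_of_notMem_tsupport hz1, support_dbarFun_subset hz1]

end HermitianManifold

/-! ### The domain of the Cauchy-Riemann operator is dense -/

namespace HermitianManifold

variable {X : HermitianManifold.{u, v}} {Ω : Set X} {φ : X → ℝ}

lemma eq_zero_of_chartInner_basis {κ : Type*} [Fintype κ]
    (b : Module.Basis κ ℂ (CForm X.Model)) {x₀ x : X}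
    (hx : x ∈ (X.chart x₀).source) {α : CForm X.Model} (h : ∀ i, chartInner x₀ x (b i) α = 0) :
    α = 0 := by
  by_contra hα
  refine (chartInner_self_pos hx hα).ne' ?_
  have h1 : chartInner x₀ x α α = chartSesq x₀ x (∑ i, b.repr α i • b i) α := by
    rw [b.sum_repr]; rfl
  have h2 : ∀ i, chartSesq x₀ x (b i) α = 0 := h
  rw [h1, map_sum, LinearMap.sum_apply]
  simp [LinearMap.map_smulₛₗ, h2]

/-- The forms with compact support and constant coefficients times a test function in a chart span a
dense subspace. -/
lemma IsBoundedDomain.eq_zero_of_inner_testForm (h : IsBoundedDomain Ω φ) (F : X.L2 Ω φ)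
    (hF : ∀ (x₀ : X) (η : X.Model → ℂ) (hη : IsTestFunction Ω x₀ η) (β : CForm X.Model),
      ⟪(h.testForm hη.isCutoff β).toL2, F⟫_ℂ = 0) : F = 0 := by
  obtain ⟨f, rfl⟩ := PreL2.exists_rep F
  refine h.toL2_eq_zero f fun x₀ => ?_
  have hO := isOpen_chartDomain h.isOpen x₀
  have hm := hO.measurableSet
  let b := Module.finBasis ℂ (CForm X.Model)
  have hsum : ∀ (β : CForm X.Model) (z : X.Model),
      chartInner x₀ ((X.chart x₀).symm z) β (f.form.inChart x₀ ((X.chart x₀).symm z)) =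
      ∑ i, chartInner x₀ ((X.chart x₀).symm z) β (b i) *
        b.coord i (f.form.inChart x₀ ((X.chart x₀).symm z)) := by
    intro β z
    change chartSesq x₀ _ β _ = _
    conv_lhs => rw [← b.sum_repr (f.form.inChart x₀ ((X.chart x₀).symm z))]
    rw [map_sum]
    refine Finset.sum_congr rfl fun i _ => ?_
    rw [map_smul, smul_eq_mul, mul_comm]
    rfl
  -- the inner products with constant forms integrate to zero against all test functions
  have key : ∀ β : CForm X.Model, ∀ᵐ z ∂X.haar, z ∈ chartDomain Ω x₀ →
      weightedDensity φ x₀ ((X.chart x₀).symm z) •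
      chartInner x₀ ((X.chart x₀).symm z) β (f.form.inChart x₀ ((X.chart x₀).symm z)) = 0 := by
    intro β
    refine IsOpen.ae_eq_zero_of_integral_contDiff_smul_eq_zero hO ?_ fun g hg hgc hgs => ?_
    · refine (locallyIntegrableOn_iff hO.isLocallyClosed).2 fun K hK hKc => ?_
      refine IntegrableOn.continuousOn_smul ?_ ((h.continuousOn_weightedDensity x₀).mono hK) hKc
      simp only [hsum]
      refine integrable_finsetSum _ fun i _ => ?_
      obtain ⟨C, -, hC⟩ := h.exists_integral_norm_le x₀ hKc hK (b.coord i)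
      exact (hC f).1.continuousOn_mul ((continuousOn_chartInner x₀ β (b i)).comp
        ((X.chart x₀).continuousOn_symm.mono (hK.trans inter_subset_left))
        fun z hz => (X.chart x₀).map_target (hK hz).1) hKc
    · have hts : tsupport (fun z => (g z : ℂ)) ⊆ tsupport g :=
        closure_mono fun z hz hz' => hz (by simp [hz'])
      have hη : IsTestFunction Ω x₀ fun z => (g z : ℂ) :=
        ⟨Complex.ofRealCLM.contDiff.comp hg, hgc.mono' ((subset_tsupport _).trans hts),
          hts.trans hgs⟩
      have h0 := hF x₀ _ hη β
      rw [PreL2.inner_toL2, PreL2.inner_def, ← setIntegral_eq_integral_of_forall_compl_eq_zero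
        (s := (X.chart x₀).source) fun x hx => by
          rw [h.form_testForm, fiberInner_cutForm, indicator_of_notMem hx, map_zero, zero_mul],
        ← (h.integral_chart x₀ (PreL2.integrable_fiberInner _ f).restrict).2] at h0
      rw [← setIntegral_eq_integral_of_forall_compl_eq_zero (s := chartDomain Ω x₀) fun z hz => by
        rw [image_eq_zero_of_notMem_tsupport fun hz' => hz (hgs hz'), zero_smul], ← h0]
      refine setIntegral_congr_fun hm fun z hz => ?_
      have hs := (X.chart x₀).map_target hz.1
      simp only [h.form_testForm, fiberInner_cutForm, indicator_of_mem hs,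
        (X.chart x₀).right_inv hz.1, fiberInner_eq_chartInner hs (coordForm x₀ β) f.form,
        inChart_coordForm_self hs, Complex.conj_ofReal]
      simp only [Complex.real_smul]
      ring
  rw [ae_restrict_iff' hm]
  filter_upwards [ae_all_iff.2 fun i => key (b i)] with z hz hz'
  have hs := (X.chart x₀).map_target hz'.1
  have h0 : f.form.inChart x₀ ((X.chart x₀).symm z) = 0 :=
    eq_zero_of_chartInner_basis b hs fun i =>
      (smul_eq_zero.1 (hz i hz')).resolve_left (weightedDensity_pos hs).ne'
  rw [← coordForm_inChart hs f.form, h0, coordForm, map_zero]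

/-- The forms `η β` are in the domain, and they span a dense subspace. -/
lemma IsBoundedDomain.dense_domain (h : IsBoundedDomain Ω φ) :
    Dense ((X.dbar Ω φ).domain : Set (X.L2 Ω φ)) := by
  rw [Submodule.dense_iff_topologicalClosure_eq_top, Submodule.topologicalClosure_eq_top_iff,
    Submodule.eq_bot_iff]
  refine fun F hF => h.eq_zero_of_inner_testForm F fun x₀ η hη β => ?_
  refine (Submodule.mem_orthogonal _ _).1 hF _ ?_
  have h1 := h.testForm_mem_dbarGraph hη β
  rw [← h.graph_dbar] at h1
  exact LinearPMap.mem_domain_of_mem_graph h1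

end HermitianManifold

/-! ### Density of the exterior products of forms on the factors -/

namespace HermitianManifold

namespace ProductData

variable {α : Type} [Fintype α] {Z : HermitianManifold.{u, v}} {ΩZ : Set Z}
    {φZ : Z → ℝ} {Y : α → HermitianManifold.{u, v}} {Ω : ∀ a, Set (Y a)} {φ : ∀ a, Y a → ℝ}
    (D : ProductData Z ΩZ φZ Y Ω φ)

/-- The exterior product, at a point, of the pullbacks of forms on the factors. -/
def wedgeMap : MultilinearMap ℂ (fun a => CForm (Y a).Model) (CForm Z.Model) where
  toFun β := (D.order.map fun a => CForm.pullback (D.dproj a) (β a)).prod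
  map_update_add' β a x y := by
    obtain ⟨l₁, l₂, h, h₁, h₂⟩ := D.nodup.exists_split (D.mem_order a)
    rw [h]
    have hs := List.prod_map_split (fun a (β : CForm (Y a).Model) => CForm.pullback (D.dproj a) β)
      l₁ l₂ a h₁ h₂ β
    rw [hs, hs, hs, map_add, mul_add, add_mul]
  map_update_smul' β a c x := by
    obtain ⟨l₁, l₂, h, h₁, h₂⟩ := D.nodup.exists_split (D.mem_order a)
    rw [h]
    have hs := List.prod_map_split (fun a (β : CForm (Y a).Model) => CForm.pullback (D.dproj a) β)
      l₁ l₂ a h₁ h₂ β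
    rw [hs, hs, map_smul, mul_smul_comm, smul_mul_assoc]

lemma wedgeMap_apply (β : ∀ a, CForm (Y a).Model) :
    D.wedgeMap β = (D.order.map fun a => CForm.pullback (D.dproj a) (β a)).prod := rfl

/-- Multiplication by a covector that comes from one factor: it has to be moved past the preceding
factors. -/
lemma ι_mul_prod (a : α) (m : (Y a).Model →ₗ[ℝ] ℂ) (l₁ l₂ : List α)
    (β : ∀ a, CForm (Y a).Model) :
    ExteriorAlgebra.ι ℂ (m ∘ₗ D.dproj a) *
      ((l₁ ++ a :: l₂).map fun a => CForm.pullback (D.dproj a) (β a)).prod =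
      (l₁.map fun a => CForm.pullback (D.dproj a) (CForm.parity (β a))).prod *
        CForm.pullback (D.dproj a) (ExteriorAlgebra.ι ℂ m * β a) *
        (l₂.map fun a => CForm.pullback (D.dproj a) (β a)).prod := by
  induction l₁ with
  | nil => simp [CForm.pullback_ι, mul_assoc]
  | cons b l₁ ih =>
    rw [List.cons_append, List.map_cons, List.prod_cons, ← mul_assoc, CForm.mul_ι, mul_assoc, ih,
      List.map_cons, List.prod_cons, CForm.pullback_parity]
    simp only [mul_assoc]

lemma sum_comp_dproj (m : Z.Model →ₗ[ℝ] ℂ) [DecidableEq α] :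
    m = ∑ a, (m ∘ₗ D.equiv.symm.toLinearMap ∘ₗ LinearMap.single ℝ (fun a => (Y a).Model) a) ∘ₗ
      D.dproj a := by
  ext v
  have hv : v = D.equiv.symm (∑ a, Pi.single a (D.dproj a v)) := by
    rw [Finset.univ_sum_single]
    exact (D.equiv.symm_apply_apply v).symm
  conv_lhs => rw [hv]
  rw [map_sum, map_sum, LinearMap.sum_apply]
  rfl

/-- The span of the exterior products is closed under multiplication by covectors, which are sums of
covectors that come from the factors. -/
lemma span_range_wedgeMap : Submodule.span ℂ (range D.wedgeMap) = ⊤ := by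
  classical
  refine eq_top_iff.2 fun x _ => ?_
  induction x using CliffordAlgebra.left_induction with
  | algebraMap r =>
    have h1 : D.wedgeMap (fun _ => 1) = 1 := by
      simp [wedgeMap_apply]
    have h2 : (algebraMap ℂ (CForm Z.Model)) r = r • D.wedgeMap (fun _ => 1) := by
      rw [h1, Algebra.algebraMap_eq_smul_one]
    exact h2 ▸ Submodule.smul_mem _ r (Submodule.subset_span ⟨_, rfl⟩)
  | add x y hx hy => exact Submodule.add_mem _ (hx trivial) (hy trivial)
  | ι_mul x m hx =>
    change ExteriorAlgebra.ι ℂ m * x ∈ _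
    have hle : Submodule.span ℂ (range D.wedgeMap) ≤ (Submodule.span ℂ (range D.wedgeMap)).comap
        (LinearMap.mulLeft ℂ (ExteriorAlgebra.ι ℂ m)) := by
      refine Submodule.span_le.2 ?_
      rintro _ ⟨β, rfl⟩
      change ExteriorAlgebra.ι ℂ m * D.wedgeMap β ∈ Submodule.span ℂ (range D.wedgeMap)
      rw [D.sum_comp_dproj m, map_sum, Finset.sum_mul]
      refine Submodule.sum_mem _ fun a _ => ?_
      obtain ⟨l₁, l₂, h, h₁, h₂⟩ := D.nodup.exists_split (D.mem_order a)
      have hd : ∀ b ∈ l₁, b ∉ l₂ := fun b hb hb' => by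
        have := D.nodup
        rw [h, List.nodup_append] at this
        exact this.2.2 b hb b (List.mem_cons_of_mem _ hb') rfl
      rw [wedgeMap_apply, h, D.ι_mul_prod]
      refine Submodule.subset_span ⟨fun b => if b = a then ExteriorAlgebra.ι ℂ (m ∘ₗ
        D.equiv.symm.toLinearMap ∘ₗ LinearMap.single ℝ (fun a => (Y a).Model) b) * β b else
        if b ∈ l₁ then CForm.parity (β b) else β b, ?_⟩
      rw [wedgeMap_apply, h, List.map_append, List.map_cons, List.prod_append, List.prod_cons,
        if_pos rfl, mul_assoc]
      congr 2
      · refine List.map_congr_left fun b hb => ?_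
        rw [if_neg (ne_of_mem_of_not_mem hb h₁), if_pos hb]
      · congr 1
        refine List.map_congr_left fun b hb => ?_
        rw [if_neg (ne_of_mem_of_not_mem hb h₂), if_neg fun h => hd b h hb]
    exact hle (hx trivial)

/-- An integrable function on a product whose integrals over the measurable rectangles vanish is
zero. -/
lemma ae_eq_zero_of_forall_rect (hD : Z.measurableSpace ≤ MeasurableSpace.comap
      (fun x a => D.proj a x) MeasurableSpace.pi) {g : Z → ℂ}
    (hg : Integrable g (Z.weightedVolume ΩZ φZ))
    (h : ∀ s : ∀ a, Set (Y a), (∀ a, MeasurableSet (s a)) →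
      ∫ x in (fun x a => D.proj a x) ⁻¹' univ.pi s, g x ∂Z.weightedVolume ΩZ φZ = 0) :
    g =ᵐ[Z.weightedVolume ΩZ φZ] 0 := by
  have hm := D.measurePreserving.measurable
  refine hg.ae_eq_zero_of_forall_setIntegral_eq_zero fun S hS hlt => ?_
  obtain ⟨S', hS', rfl⟩ := hD S hS
  clear hS hlt
  induction S', hS' using MeasurableSpace.induction_on_inter
      (s := univ.pi '' univ.pi fun a => {s : Set (Y a) | MeasurableSet s}) generateFrom_pi.symm
      isPiSystem_pi with
  | empty => simp
  | basic t ht =>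
    obtain ⟨s, hs, rfl⟩ := ht
    exact h s fun a => hs a trivial
  | compl t ht ih =>
    have huniv := h (fun _ => univ) fun _ => MeasurableSet.univ
    rw [pi_univ, preimage_univ, setIntegral_univ] at huniv
    have := integral_add_compl (hm ht) hg
    rw [ih, zero_add, huniv] at this
    exact this
  | iUnion t hd ht ih =>
    rw [preimage_iUnion, integral_iUnion (fun i => hm (ht i))
      (fun i j hij => (hd hij).preimage _) hg.integrableOn]
    simp [ih]

/-- The function by which a constant form is multiplied to make it bounded. -/
def boundingFactor {X : HermitianManifold.{u, v}} (x₀ : X) (β : CForm X.Model) : X → ℂ :=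
  (X.chart x₀).source.indicator fun x => ((1 + (chartInner x₀ x β β).re : ℝ) : ℂ)⁻¹

lemma chartInner_self_nonneg {X : HermitianManifold.{u, v}} {x₀ x : X}
    (hx : x ∈ (X.chart x₀).source) (β : CForm X.Model) : 0 ≤ (chartInner x₀ x β β).re := by
  rw [chartInner_eq_fiberInner hx]
  exact X.fiberInner_re_nonneg x _

lemma boundingFactor_ne_zero {X : HermitianManifold.{u, v}} {x₀ x : X}
    (hx : x ∈ (X.chart x₀).source) (β : CForm X.Model) : boundingFactor x₀ β x ≠ 0 := by
  have := chartInner_self_nonneg hx β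
  rw [boundingFactor, indicator_of_mem hx]
  exact inv_ne_zero (Complex.ofReal_ne_zero.2 (by positivity))

lemma cutForm_boundingFactor_mem {X : HermitianManifold.{u, v}} {Ω : Set X} {φ : X → ℝ}
    (h : IsBoundedDomain Ω φ) (x₀ : X) (β : CForm X.Model) {s : Set X} (hs : MeasurableSet s) :
    cutForm x₀ (fun x => s.indicator 1 x * boundingFactor x₀ β x) β ∈
      X.squareIntegrable (X.weightedVolume Ω φ) := by
  have hm : AEStronglyMeasurable (fun x => s.indicator 1 x * boundingFactor x₀ β x)
      (X.weightedVolume Ω φ) := by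
    refine AEStronglyMeasurable.mul (aestronglyMeasurable_const.indicator hs)
      (aestronglyMeasurable_indicator_source x₀ ?_)
    refine ContinuousOn.inv₀ (Complex.continuous_ofReal.comp_continuousOn (continuousOn_const.add
      (Complex.continuous_re.comp_continuousOn (continuousOn_chartInner x₀ β β)))) fun x hx => ?_
    have := chartInner_self_nonneg hx β
    exact Complex.ofReal_ne_zero.2 (by positivity)
  refine h.cutForm_mem hm (fun x hx => ?_) β 1 fun x hx => ?_
  · simp only [boundingFactor, indicator_of_notMem hx, mul_zero]
  · have h0 := chartInner_self_nonneg hx β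
    have h1 : ‖s.indicator (1 : X → ℂ) x‖ ≤ 1 := by
      by_cases hxs : x ∈ s <;> simp [hxs]
    simp only [boundingFactor, indicator_of_mem hx, norm_mul, norm_inv]
    rw [Complex.norm_of_nonneg (by positivity)]
    set q := (chartInner x₀ x β β).re
    have h2 : ‖s.indicator (1 : X → ℂ) x‖ * (1 + q)⁻¹ ≤ 1 * (1 + q)⁻¹ := by gcongr
    calc _ ≤ (1 * (1 + q)⁻¹) ^ 2 * q := by gcongr
      _ ≤ 1 := by
        rw [one_mul, inv_pow, inv_mul_le_iff₀ (by positivity)]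
        nlinarith

/-- The exterior products of forms on the factors span a dense subspace. -/
lemma eq_zero_of_inner_tensor (hD : Z.measurableSpace ≤ MeasurableSpace.comap
      (fun x a => D.proj a x) MeasurableSpace.pi) (h : ∀ a, IsBoundedDomain (Ω a) (φ a))
    (F : Z.L2 ΩZ φZ) (hF : ∀ G, ⟪D.tensor G, F⟫_ℂ = 0) : F = 0 := by
  obtain ⟨f, rfl⟩ := PreL2.exists_rep F
  have hloc : ∀ x₀ : Z, ∀ᵐ x ∂(Z.weightedVolume ΩZ φZ).restrict (Z.chart x₀).source,
      f.form x = 0 := by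
    intro x₀
    let b := fun a => Module.finBasis ℂ (CForm (Y a).Model)
    -- the forms on the factors, restricted to measurable sets
    let u : ∀ (i : ∀ a, Fin (Module.finrank ℂ (CForm (Y a).Model))) (s : ∀ a, Set (Y a)),
        (∀ a, MeasurableSet (s a)) → ∀ a, (Y a).PreL2 (Ω a) (φ a) := fun i s hs a =>
      ⟨_, cutForm_boundingFactor_mem (h a) (D.proj a x₀) (b a (i a)) (hs a)⟩
    have hu : ∀ i s hs x, D.tensorForm (fun a => (u i s hs a).form) x =
        (∏ a, (s a).indicator (1 : Y a → ℂ) (D.proj a x)) • (∏ a, boundingFactor (D.proj a x₀) (b a (i a))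
          (D.proj a x)) • D.wedgeMap fun a => coordForm (D.proj a x₀) (b a (i a)) (D.proj a x) := by
      intro i s hs x
      rw [smul_smul, ← Finset.prod_mul_distrib, ← MultilinearMap.map_smul_univ]
      rfl
    have hprod : ∀ (s : ∀ a, Set (Y a)) (x : Z), ∏ a, (s a).indicator (1 : Y a → ℂ) (D.proj a x) =
        ((fun x a => D.proj a x) ⁻¹' univ.pi s).indicator 1 x := by
      intro s x
      by_cases hx : x ∈ (fun x a => D.proj a x) ⁻¹' univ.pi s
      · rw [indicator_of_mem hx]
        exact Finset.prod_eq_one fun a _ => indicator_of_mem (hx a trivial) _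
      · rw [indicator_of_notMem hx]
        have : ∃ a, D.proj a x ∉ s a := by
          by_contra! h
          exact hx fun a _ => h a
        obtain ⟨a, ha⟩ := this
        exact Finset.prod_eq_zero (Finset.mem_univ a) (indicator_of_notMem ha _)
    -- the inner products with exterior products of the basis forms vanish, because their integrals
    -- over all measurable rectangles do
    have key : ∀ i : ∀ a, Fin (Module.finrank ℂ (CForm (Y a).Model)),
        ∀ᵐ x ∂Z.weightedVolume ΩZ φZ, Z.fiberInner x
          (D.tensorForm (fun a => (u i (fun _ => univ) (fun _ => MeasurableSet.univ) a).form) x)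
          (f.form x) = 0 := by
      intro i
      refine D.ae_eq_zero_of_forall_rect hD (PreL2.integrable_fiberInner
        (D.tensorPre (u i (fun _ => univ) fun _ => MeasurableSet.univ)) f) fun s hs => ?_
      have h1 := hF fun a => (u i s hs a).toL2
      rw [tensor_toL2, PreL2.inner_toL2, PreL2.inner_def] at h1
      rw [← h1, ← integral_indicator (D.measurePreserving.measurable (MeasurableSet.univ_pi hs))]
      refine integral_congr_ae (Filter.Eventually.of_forall fun x => ?_)
      have h2 : (D.tensorPre (u i s hs)).form x = (∏ a, (s a).indicator (1 : Y a → ℂ)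
          (D.proj a x)) • D.tensorForm (fun a => (u i (fun _ => univ)
          (fun _ => MeasurableSet.univ) a).form) x := by
        rw [hu i (fun _ => univ) fun _ => MeasurableSet.univ, form_tensorPre, hu i s hs]
        simp
      beta_reduce
      rw [h2, Z.fiberInner_smul_left, hprod]
      by_cases hx : x ∈ (fun x a => D.proj a x) ⁻¹' univ.pi s
      · rw [indicator_of_mem hx, indicator_of_mem hx, Pi.one_apply, map_one, one_mul]
      · rw [indicator_of_notMem hx, indicator_of_notMem hx, map_zero, zero_mul]
    filter_upwards [ae_restrict_of_ae (ae_all_iff.2 key),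
      ae_restrict_mem (measurableSet_chart_source x₀)] with x hx hxs
    -- `f` is orthogonal to the exterior products of forms on the factors, which span the fiber at `x`
    let L : CForm Z.Model →ₗ[ℂ] ℂ :=
      { toFun := fun α => Z.fiberInner x (f.form x) α
        map_add' := fun α β => by
          rw [← Z.fiberInner_conj, Z.fiberInner_add_left, map_add, Z.fiberInner_conj,
            Z.fiberInner_conj]
        map_smul' := fun r α => by
          rw [← Z.fiberInner_conj, Z.fiberInner_smul_left, map_mul, Z.fiberInner_conj,
            Complex.conj_conj]
          rfl }
    let E : ∀ a, CForm (Y a).Model →ₗ[ℂ] CForm (Y a).Model := fun a =>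
      (CForm.pullback ((tangentCoordChange 𝓘(ℂ, (Y a).Model) (D.proj a x) (D.proj a x₀)
        (D.proj a x)).restrictScalars ℝ).toLinearMap).toLinearMap
    have h0 : (L.compMultilinearMap D.wedgeMap).compLinearMap E = 0 := by
      refine Module.Basis.ext_multilinear b fun i => ?_
      have h1 := hx i
      rw [hu i (fun _ => univ) fun _ => MeasurableSet.univ, Z.fiberInner_smul_left, Z.fiberInner_smul_left] at h1
      simp only [indicator_univ, Pi.one_apply, Finset.prod_const_one, map_one, one_mul] at h1
      have h2 := (mul_eq_zero.1 h1).resolve_left ((map_ne_zero _).2 (Finset.prod_ne_zero_iff.2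
        fun a _ => boundingFactor_ne_zero (D.mapsTo x₀ x hxs a) _))
      change Z.fiberInner x (f.form x) _ = 0
      rw [← Z.fiberInner_conj]
      exact (congrArg _ h2).trans (map_zero _)
    have h1 : ∀ γ, L (D.wedgeMap γ) = 0 := by
      intro γ
      have h2 : ∀ a, E a (Form.inChart (fun _ => γ a) (D.proj a x₀) (D.proj a x)) = γ a :=
        fun a => coordForm_inChart (D.mapsTo x₀ x hxs a) fun _ => γ a
      have h3 := DFunLike.congr_fun h0 fun a =>
        Form.inChart (fun _ => γ a) (D.proj a x₀) (D.proj a x)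
      simpa [MultilinearMap.compLinearMap_apply, h2] using h3
    have hL : L = 0 := by
      refine LinearMap.ext_on_range (v := D.wedgeMap) D.span_range_wedgeMap fun γ => ?_
      rw [h1, LinearMap.zero_apply]
    have h2 : L (f.form x) = 0 := by rw [hL, LinearMap.zero_apply]
    exact fiberInner_self_eq_zero (congrArg Complex.re h2)
  obtain ⟨T, hT, hU⟩ := Z.exists_countable_charts
  have hae := (ae_restrict_biUnion_iff (μ := Z.weightedVolume ΩZ φZ)
    (fun x : Z => (Z.chart x).source) hT _).2 fun x₀ _ => hloc x₀
  rw [hU, Measure.restrict_univ] at hae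
  rw [← inner_self_eq_zero (𝕜 := ℂ), PreL2.inner_toL2, PreL2.inner_def]
  refine integral_eq_zero_of_ae ?_
  filter_upwards [hae] with x hx
  rw [hx]
  simpa using Z.fiberInner_smul_left x 0 0 0

end ProductData

end HermitianManifold

/-! ### The Leibniz rule and integration over lines -/

section Leibniz

variable {ι : Type*} [Fintype ι] [LinearOrder ι] {V : ι → Type*} [∀ i, AddCommGroup (V i)]
  [∀ i, Module ℂ (V i)] {W : Type*} [AddCommGroup W] [Module ℂ W]

/-- The factor with index `i` in the `j`-th term of the Leibniz rule, for a pair that consists of an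
element and its derivative. -/
def leibnizSlot (τ : ∀ i, V i →ₗ[ℂ] V i) (j i : ι) : V i × V i →ₗ[ℂ] V i :=
  if i < j then τ i ∘ₗ LinearMap.fst ℂ _ _ else
    if i = j then LinearMap.snd ℂ _ _ else LinearMap.fst ℂ _ _

/-- The derivative of a product, for a derivation twisted by `τ`. -/
def leibniz (τ : ∀ i, V i →ₗ[ℂ] V i) (t : MultilinearMap ℂ V W) :
    MultilinearMap ℂ (fun i => V i × V i) W :=
  ∑ j, t.compLinearMap (leibnizSlot τ j)

lemma leibniz_apply (τ : ∀ i, V i →ₗ[ℂ] V i) (t : MultilinearMap ℂ V W) (p : ∀ i, V i × V i) :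
    leibniz τ t p = ∑ j, t fun i => leibnizSlot τ j i (p i) := by
  simp [leibniz, MultilinearMap.compLinearMap_apply]

variable (τ : ∀ i, V i →ₗ[ℂ] V i) {i j : ι}

lemma leibnizSlot_of_lt (h : i < j) (p : V i × V i) : leibnizSlot τ j i p = τ i p.1 := by
  rw [leibnizSlot, if_pos h]; rfl

lemma leibnizSlot_self (p : V j × V j) : leibnizSlot τ j j p = p.2 := by
  rw [leibnizSlot, if_neg (lt_irrefl j), if_pos rfl]; rfl

lemma leibnizSlot_of_gt (h : j < i) (p : V i × V i) : leibnizSlot τ j i p = p.1 := by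
  rw [leibnizSlot, if_neg h.asymm, if_neg h.ne']; rfl

lemma leibnizSlot_congr (h : i ≠ j) {p q : V i × V i} (hpq : p.1 = q.1) :
    leibnizSlot τ j i p = leibnizSlot τ j i q := by
  rcases h.lt_or_gt with h | h
  · rw [leibnizSlot_of_lt τ h, leibnizSlot_of_lt τ h, hpq]
  · rw [leibnizSlot_of_gt τ h, leibnizSlot_of_gt τ h, hpq]

end Leibniz

section Slices

variable {ι : Type} [Fintype ι] [DecidableEq ι] {E : ι → Type*}

/-- A function on a product whose integrals over all lines parallel to one axis vanish has integral
zero. -/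
lemma integral_pi_eq_zero_of_slices [∀ i, MeasurableSpace (E i)] (μ : ∀ i, Measure (E i))
    [∀ i, SigmaFinite (μ i)] {H : (∀ i, E i) → ℂ} (hH : Integrable H (Measure.pi μ)) (j : ι)
    (h : ∀ z, ∫ t, H (Function.update z j t) ∂μ j = 0) : ∫ z, H z ∂Measure.pi μ = 0 := by
  have hp := (measurePreserving_piEquivPiSubtypeProd μ (· = j)).symm
  have hint := (hp.integrable_comp_emb (MeasurableEquiv.measurableEmbedding _)).2 hH
  rw [← hp.integral_comp']
  refine (integral_prod_symm _ hint).trans ?_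
  have hu : ∀ inst : Fintype {i // i = j}, MeasurePreserving
      (MeasurableEquiv.piUnique fun i : {i // i = j} => E i)
      (Measure.pi fun i : {i // i = j} => μ i) (μ j) := by
    intro inst
    exact measurePreserving_piUnique fun i : {i // i = j} => μ i
  refine integral_eq_zero_of_ae (Filter.Eventually.of_forall fun y => ?_)
  refine ((hu _).symm.integral_comp'
    (fun x => H ((MeasurableEquiv.piEquivPiSubtypeProd E fun x => x = j).symm (x, y)))).symm.trans
    ?_
  by_cases hE : IsEmpty (E j)
  · have : IsEmpty (E (default : {i // i = j}).1) := hE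
    exact integral_of_isEmpty
  · obtain ⟨t₀⟩ := not_isEmpty_iff.1 hE
    let z : ∀ i, E i := fun i => if hi : i = j then hi ▸ t₀ else y ⟨i, hi⟩
    refine (integral_congr_ae (Filter.Eventually.of_forall fun t => ?_)).trans (h z)
    refine congrArg H (funext fun i => ?_)
    by_cases hi : i = j
    · subst hi
      rw [Function.update_self]
      simp [MeasurableEquiv.piEquivPiSubtypeProd, Equiv.piEquivPiSubtypeProd,
        MeasurableEquiv.piUnique, Equiv.piUnique]
      rfl
    · rw [Function.update_of_ne hi]
      simp [MeasurableEquiv.piEquivPiSubtypeProd, Equiv.piEquivPiSubtypeProd, z, hi]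

variable [∀ i, NormedAddCommGroup (E i)] [∀ i, NormedSpace ℂ (E i)]

/-- On a product of vector spaces, `∂̄ψ` is the sum of its parts in the directions of the factors. -/
lemma CForm.dbarFun_pi {ψ : (∀ i, E i) → ℂ} {z : ∀ i, E i} (hψ : DifferentiableAt ℝ ψ z) :
    CForm.dbarFun ψ z = ∑ i, CForm.dbarFun (fun t => ψ (Function.update z i t)) (z i) ∘ₗ
      (LinearMap.proj i : (∀ i, E i) →ₗ[ℝ] E i) := by
  have h1 : ∀ i w, fderiv ℝ (fun t => ψ (Function.update z i t)) (z i) w =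
      fderiv ℝ ψ z (Pi.single i w) := by
    intro i w
    have h2 : DifferentiableAt ℝ ψ (Function.update z i (z i)) := by
      rwa [Function.update_eq_self]
    have h3 := (h2.hasFDerivAt.comp (z i) (hasFDerivAt_update z (z i))).fderiv
    have h4 := congrArg (fun L => L w) h3
    refine h4.trans ?_
    rw [Function.update_eq_self, ContinuousLinearMap.comp_apply]
    congr 1
    ext k
    by_cases hk : k = i
    · subst hk; simp
    · simp [hk]
  have hv : ∀ v : ∀ i, E i, fderiv ℝ ψ z v = ∑ i, fderiv ℝ ψ z (Pi.single i (v i)) := fun v => by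
    rw [← map_sum, Finset.univ_sum_single]
  refine LinearMap.ext fun v => ?_
  rw [LinearMap.sum_apply]
  simp only [CForm.dbarFun, LinearMap.coe_mk, AddHom.coe_mk, LinearMap.comp_apply, h1,
    LinearMap.proj_apply]
  rw [hv v, hv (Complex.I • v), Finset.mul_sum, ← Finset.sum_add_distrib, Finset.sum_div]
  rfl

end Slices

/-! ### The Leibniz rule for the Cauchy-Riemann operator -/

namespace HermitianManifold

section LeibnizDbar

variable {ι : Type} [Fintype ι] [LinearOrder ι] {X : ι → HermitianManifold.{u, v}}
  {Ω : ∀ i, Set (X i)} {φ : ∀ i, X i → ℝ}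

/-- The operators `τ` on forms at points of the factors. -/
abbrev fiberParity (X : ι → HermitianManifold.{u, v}) (i : ι) :
    CForm (X i).Model →ₗ[ℂ] CForm (X i).Model := CForm.parity.toLinearMap

/-- The factors of an exterior product are in increasing order. -/
lemma piData_exists_split (h : ∀ i, IsBoundedDomain (Ω i) (φ i)) (j : ι) :
    ∃ l₁ l₂, (piData h).order = l₁ ++ j :: l₂ ∧ (∀ i ∈ l₁, i < j) ∧ ∀ i ∈ l₂, j < i := by
  obtain ⟨l₁, l₂, hl⟩ := List.append_of_mem ((piData h).mem_order j)
  have hs : (piData h).order.Pairwise (· < ·) := (Finset.sortedLT_sort Finset.univ).pairwise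
  rw [hl, List.pairwise_append, List.pairwise_cons] at hs
  exact ⟨l₁, l₂, hl, fun i hi => hs.2.2 i hi j List.mem_cons_self, hs.2.1.1⟩

/-- The exterior product with a covector that comes from the factor with index `j`. -/
lemma ι_mul_wedgeMap (h : ∀ i, IsBoundedDomain (Ω i) (φ i)) (j : ι)
    (m : ∀ i, (X i).Model →ₗ[ℝ] ℂ) (β : ∀ i, CForm (X i).Model) :
    ExteriorAlgebra.ι ℂ (m j ∘ₗ tangentProj X j) * (piData h).wedgeMap β =
      (piData h).wedgeMap fun i => leibnizSlot (fiberParity X) j i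
        (β i, ExteriorAlgebra.ι ℂ (m i) * β i) := by
  obtain ⟨l₁, l₂, hl, h₁, h₂⟩ := piData_exists_split h j
  rw [ProductData.wedgeMap_apply, ProductData.wedgeMap_apply, hl]
  refine ((piData h).ι_mul_prod j (m j) l₁ l₂ β).trans ?_
  rw [List.map_append, List.map_cons, List.prod_append, List.prod_cons, mul_assoc,
    leibnizSlot_self]
  congr 2
  · refine List.map_congr_left fun i hi => ?_
    rw [leibnizSlot_of_lt _ (h₁ i hi)]
    rfl
  · congr 1
    refine List.map_congr_left fun i hi => ?_
    rw [leibnizSlot_of_gt _ (h₂ i hi)]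

/-- The restriction of a test function on a product to a line parallel to an axis. -/
lemma IsTestFunction.slice {x₀ : pi X} {ψ : (pi X).Model → ℂ}
    (hψ : IsTestFunction (piDomain Ω) x₀ ψ) (z : ∀ i, (X i).Model) (j : ι) :
    IsTestFunction (Ω j) (x₀ j) fun t => ψ (Function.update z j t) := by
  have hc : Continuous fun t : (X j).Model => Function.update z j t :=
    continuous_const.update j continuous_id
  have hcl : IsClosed ((fun t : (X j).Model => Function.update z j t) ⁻¹' tsupport ψ) :=
    (isClosed_tsupport ψ).preimage hc
  have hts : tsupport (fun t : (X j).Model => ψ (Function.update z j t)) ⊆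
      (fun t : (X j).Model => Function.update z j t) ⁻¹' tsupport ψ :=
    closure_minimal (fun t ht => subset_tsupport ψ ht) hcl
  refine ⟨?_, ?_, ?_⟩
  · exact ContDiff.comp (E := (X j).Model) (F := ∀ i, (X i).Model) (g := ψ) hψ.smooth
      (contDiff_update (𝕜 := ℝ) ∞ z j)
  · refine (hψ.hasCompactSupport.isCompact.image
      (continuous_apply j : Continuous fun z : ∀ i, (X i).Model => z j)).of_isClosed_subset
      (isClosed_tsupport _) fun t ht => ?_
    exact ⟨_, hts ht, Function.update_self j t z⟩
  · intro t ht
    obtain ⟨h1, h2⟩ := hψ.tsupport_subset (hts ht)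
    have h3 : Function.update z j t j ∈ ((X j).chart (x₀ j)).target := h1 j trivial
    have h4 : ((X j).chart (x₀ j)).symm (Function.update z j t j) ∈ Ω j := h2 j
    rw [Function.update_self] at h3 h4
    exact ⟨h3, h4⟩

/-- The operators `τ` on the factors. -/
abbrev parityMap (X : ι → HermitianManifold.{u, v}) (Ω : ∀ i, Set (X i)) (φ : ∀ i, X i → ℝ) (i : ι) :
    (X i).L2 (Ω i) (φ i) →ₗ[ℂ] (X i).L2 (Ω i) (φ i) := (parity (X := X i)).toLinearMap

/-- A representative of the factors in the Leibniz rule. -/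
def leibnizRep (f g : ∀ i, (X i).PreL2 (Ω i) (φ i)) (j i : ι) : (X i).PreL2 (Ω i) (φ i) :=
  if i < j then PreL2.parity (f i) else if i = j then g i else f i

lemma toL2_leibnizRep (f g : ∀ i, (X i).PreL2 (Ω i) (φ i)) (j i : ι) :
    (leibnizRep f g j i).toL2 =
      leibnizSlot (parityMap X Ω φ) j i ((f i).toL2, (g i).toL2) := by
  rcases lt_trichotomy i j with hi | rfl | hi
  · rw [leibnizSlot_of_lt _ hi, leibnizRep, if_pos hi]; rfl
  · rw [leibnizSlot_self, leibnizRep, if_neg (lt_irrefl i), if_pos rfl]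
  · rw [leibnizSlot_of_gt _ hi, leibnizRep, if_neg hi.asymm, if_neg hi.ne']

lemma inChart_leibnizRep (f g : ∀ i, (X i).PreL2 (Ω i) (φ i)) (j i : ι) (x₀ x : X i) :
    (leibnizRep f g j i).form.inChart x₀ x = leibnizSlot (fiberParity X) j i
      ((f i).form.inChart x₀ x, (g i).form.inChart x₀ x) := by
  rcases lt_trichotomy i j with hi | rfl | hi
  · rw [leibnizSlot_of_lt _ hi, leibnizRep, if_pos hi]
    exact CForm.pullback_parity _ _
  · rw [leibnizSlot_self, leibnizRep, if_neg (lt_irrefl i), if_pos rfl]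
  · rw [leibnizSlot_of_gt _ hi, leibnizRep, if_neg hi.asymm, if_neg hi.ne']

/-- The part of `∂̄ψ` in the directions of one factor. -/
def dbarPart (ψ : (pi X).Model → ℂ) (i : ι) (z : (pi X).Model) : (X i).Model →ₗ[ℝ] ℂ :=
  CForm.dbarFun (fun t => ψ (Function.update (β := fun i => (X i).Model) z i t)) (z i)

lemma dbarFun_eq_sum_dbarPart {ψ : (pi X).Model → ℂ} (hψ : ContDiff ℝ ∞ ψ) (z : (pi X).Model) :
    CForm.dbarFun ψ z = ∑ i, dbarPart ψ i z ∘ₗ tangentProj X i :=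
  CForm.dbarFun_pi (E := fun i => (X i).Model) (hψ.differentiable (by simp) z)

lemma dbarPart_comp_tangentProj {ψ : (pi X).Model → ℂ} (hψ : ContDiff ℝ ∞ ψ) (z : (pi X).Model)
    (j : ι) : dbarPart ψ j z ∘ₗ tangentProj X j = CForm.dbarFun ψ z ∘ₗ
      (LinearMap.single ℝ (fun i => (X i).Model) j ∘ₗ tangentProj X j) := by
  rw [dbarFun_eq_sum_dbarPart hψ]
  refine LinearMap.ext fun w => ?_
  simp only [LinearMap.comp_apply, LinearMap.sum_apply]
  rw [Finset.sum_eq_single j]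
  · exact congrArg _ (Pi.single_eq_same (M := fun i => (X i).Model) j (w j)).symm
  · intro i _ hi
    exact (congrArg _ (Pi.single_eq_of_ne (M := fun i => (X i).Model) hi (w j))).trans
      (map_zero _)
  · simp

/-- The exterior products of forms in the domains of `∂̄` on the factors are in the domain of `∂̄` on
the product, and the Leibniz rule holds: by Fubini's theorem it suffices to integrate by parts on the
lines parallel to the factors. -/
theorem tensor_mem_dbarGraph (h : ∀ i, IsBoundedDomain (Ω i) (φ i))
    {p : ∀ i, (X i).L2 (Ω i) (φ i) × (X i).L2 (Ω i) (φ i)}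
    (hp : ∀ i, p i ∈ (X i).dbarGraph (Ω i) (φ i)) :
    ((piData h).tensor (fun i => (p i).1), leibniz (parityMap X Ω φ) (piData h).tensor p) ∈
      (pi X).dbarGraph (piDomain Ω) (piWeight φ) := by
  choose f g hf hg hfg using hp
  obtain rfl : p = fun i => ((f i).toL2, (g i).toL2) := funext fun i => Prod.ext (hf i).symm (hg i).symm
  have hpi := IsBoundedDomain.pi h
  rw [hpi.mem_dbarGraph_iff]
  intro x₀ ψ hψ l
  rw [leibniz_apply, map_sum, eq_neg_iff_add_eq_zero]
  simp only [← toL2_leibnizRep, ProductData.tensor_toL2, hpi.functional_toL2,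
    hpi.dbarFunctional_toL2]
  -- the contributions of the factors to `∂̄ψ ∧ f`
  have hint : ∀ j, Integrable (fun z : (pi X).Model => l (ExteriorAlgebra.ι ℂ (dbarPart ψ j z ∘ₗ
      tangentProj X j) * ((piData h).tensorPre f).form.inChart x₀ (((pi X).chart x₀).symm z)))
      (pi X).haar := by
    intro j
    have h1 : ∀ z : (pi X).Model, l (ExteriorAlgebra.ι ℂ (dbarPart ψ j z ∘ₗ
        tangentProj X j) * ((piData h).tensorPre f).form.inChart x₀ (((pi X).chart x₀).symm z)) =
        ∑ k, dbarComp ψ k z * (l ∘ₗ LinearMap.mulLeft ℂ (ExteriorAlgebra.ι ℂ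
          (coordCovector (pi X) k ∘ₗ (LinearMap.single ℝ (fun i => (X i).Model) j ∘ₗ
          tangentProj X j)))) (((piData h).tensorPre f).form.inChart x₀
          (((pi X).chart x₀).symm z)) := by
      intro z
      have h2 : CForm.dbarFun ψ z = ∑ k, dbarComp ψ k z • coordCovector (pi X) k :=
        (sum_coordCovector _).symm
      have h3 : dbarPart ψ j z ∘ₗ tangentProj X j = ∑ k, dbarComp ψ k z •
          (coordCovector (pi X) k ∘ₗ (LinearMap.single ℝ (fun i => (X i).Model) j ∘ₗ
          tangentProj X j)) := by
        rw [dbarPart_comp_tangentProj hψ.smooth, h2]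
        refine LinearMap.ext fun w => ?_
        simp only [LinearMap.comp_apply, LinearMap.sum_apply, LinearMap.smul_apply]
      rw [h3, map_sum, Finset.sum_mul, map_sum]
      refine Finset.sum_congr rfl fun k _ => ?_
      rw [map_smul, smul_mul_assoc, map_smul, smul_eq_mul]
      rfl
    simp only [h1]
    exact integrable_finsetSum _ fun k _ => hpi.integrable_cutoff (hψ.dbarComp k).isCutoff _ _
  have hsplit : ∀ z : (pi X).Model, l (ExteriorAlgebra.ι ℂ (CForm.dbarFun ψ z) *
      ((piData h).tensorPre f).form.inChart x₀ (((pi X).chart x₀).symm z)) =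
      ∑ j, l (ExteriorAlgebra.ι ℂ (dbarPart ψ j z ∘ₗ tangentProj X j) *
        ((piData h).tensorPre f).form.inChart x₀ (((pi X).chart x₀).symm z)) := fun z => by
    rw [dbarFun_eq_sum_dbarPart hψ.smooth, map_sum, Finset.sum_mul, map_sum]
  simp only [hsplit]
  rw [integral_finsetSum _ fun j _ => hint j, ← Finset.sum_add_distrib]
  refine Finset.sum_eq_zero fun j _ => ?_
  have hint' := hpi.integrable_cutoff hψ.isCutoff l ((piData h).tensorPre (leibnizRep f g j))
  rw [← integral_add hint' (hint j)]
  -- the integrand, in terms of the forms on the factors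
  let H : (pi X).Model → ℂ := fun z =>
    ψ z * l ((piData h).wedgeMap fun i => leibnizSlot (fiberParity X) j i
      ((f i).form.inChart (x₀ i) (((X i).chart (x₀ i)).symm (z i)),
        (g i).form.inChart (x₀ i) (((X i).chart (x₀ i)).symm (z i)))) +
    l ((piData h).wedgeMap fun i => leibnizSlot (fiberParity X) j i
      ((f i).form.inChart (x₀ i) (((X i).chart (x₀ i)).symm (z i)),
        ExteriorAlgebra.ι ℂ (dbarPart ψ i z) *
          (f i).form.inChart (x₀ i) (((X i).chart (x₀ i)).symm (z i))))
  have hH : (fun z => ψ z * l (((piData h).tensorPre (leibnizRep f g j)).form.inChart x₀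
      (((pi X).chart x₀).symm z)) + l (ExteriorAlgebra.ι ℂ (dbarPart ψ j z ∘ₗ
        tangentProj X j) * ((piData h).tensorPre f).form.inChart x₀ (((pi X).chart x₀).symm z))) =
      H := by
    funext z
    simp only [H, ← ι_mul_wedgeMap h j (fun i => dbarPart ψ i z)]
    by_cases hz : z ∈ tsupport ψ
    · have hs := ((pi X).chart x₀).map_target (hψ.tsupport_subset hz).1
      rw [ProductData.form_tensorPre, ProductData.form_tensorPre,
        (piData h).inChart_tensorForm _ hs, (piData h).inChart_tensorForm _ hs,
        ← ProductData.wedgeMap_apply, ← ProductData.wedgeMap_apply]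
      simp only [inChart_leibnizRep]
      rfl
    · rw [dbarPart_comp_tangentProj hψ.smooth, image_eq_zero_of_notMem_tsupport hz,
        support_dbarFun_subset hz]
      simp
  have hHi : Integrable H (pi X).haar := hH ▸ hint'.add (hint j)
  rw [hH]
  have hc : ENNReal.ofReal (haarFactor X)⁻¹ ≠ 0 :=
    (ENNReal.ofReal_pos.2 (inv_pos.2 haarFactor_pos)).ne'
  rw [pi_haar] at hHi ⊢
  refine (integral_smul_measure H _).trans ?_
  refine (congrArg _ (integral_pi_eq_zero_of_slices (fun i => (X i).haar)
    ((integrable_smul_measure hc ENNReal.ofReal_ne_top).1 hHi) j fun z => ?_)).trans (smul_zero _)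
  -- the functional obtained by fixing the forms on the other factors
  let β : ∀ i, CForm (X i).Model := fun i => leibnizSlot (fiberParity X) j i
    ((f i).form.inChart (x₀ i) (((X i).chart (x₀ i)).symm (z i)), 0)
  let l' : Module.Dual ℂ (CForm (X j).Model) := l ∘ₗ (piData h).wedgeMap.toLinearMap β j
  obtain ⟨h1, h2, h3⟩ := hfg j (x₀ j) _ (hψ.slice z j) l'
  have hslot : ∀ (t : (X j).Model) (q : ∀ i, CForm (X i).Model),
      ((piData h).wedgeMap fun i => leibnizSlot (fiberParity X) j i
      ((f i).form.inChart (x₀ i) (((X i).chart (x₀ i)).symm (Function.update z j t i)), q i)) =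
      (piData h).wedgeMap.toLinearMap β j (q j) := by
    intro t q
    refine congrArg _ (funext fun i => ?_)
    by_cases hi : i = j
    · subst hi
      refine (leibnizSlot_self _ _).trans ?_
      rw [Function.update_self i (q i) β]
    · rw [Function.update_of_ne hi, Function.update_of_ne hi]
      exact leibnizSlot_congr _ hi rfl
  refine Eq.trans (integral_congr_ae (Filter.Eventually.of_forall fun t => ?_))
    ((integral_add h1 h2).trans ?_)
  · simp only [H]
    rw [hslot t fun i => (g i).form.inChart (x₀ i) (((X i).chart (x₀ i)).symm
      (Function.update z j t i)), hslot t fun i => ExteriorAlgebra.ι ℂ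
      (dbarPart ψ i (Function.update z j t)) *
      (f i).form.inChart (x₀ i) (((X i).chart (x₀ i)).symm (Function.update z j t i))]
    simp only [dbarPart, Function.update_self, Function.update_idem]
    rfl
  · exact add_eq_zero_iff_eq_neg.2 h3

end LeibnizDbar

end HermitianManifold

/-! ### Multilinear maps and tensor products of Hilbert spaces -/

section TensorProduct

variable {ι : Type*} [Fintype ι]

/-- If a continuous multilinear map sends families of elements of sets `T i` to a closed subspace,
then also families of elements of the closed spans of these sets. -/
lemma MultilinearMap.mem_of_topologicalClosure_span {A : ι → Type*} {B : Type*}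
    [∀ i, AddCommGroup (A i)] [∀ i, Module ℂ (A i)] [∀ i, TopologicalSpace (A i)]
    [∀ i, ContinuousAdd (A i)] [∀ i, ContinuousConstSMul ℂ (A i)]
    [AddCommGroup B] [Module ℂ B] [TopologicalSpace B] (M : MultilinearMap ℂ A B)
    (hM : Continuous M) {K : Submodule ℂ B} (hK : IsClosed (K : Set B)) {T : ∀ i, Set (A i)}
    (hT : ∀ p : ∀ i, A i, (∀ i, p i ∈ T i) → M p ∈ K) {p : ∀ i, A i}
    (hp : ∀ i, p i ∈ (Submodule.span ℂ (T i)).topologicalClosure) : M p ∈ K := by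
  classical
  suffices h : ∀ s : Finset ι, ∀ p : ∀ i, A i,
      (∀ i ∈ s, p i ∈ (Submodule.span ℂ (T i)).topologicalClosure) → (∀ i ∉ s, p i ∈ T i) →
      M p ∈ K from h Finset.univ p (fun i _ => hp i) fun i hi => absurd (Finset.mem_univ i) hi
  intro s
  induction s using Finset.induction_on with
  | empty => exact fun p _ h => hT p fun i => h i (Finset.notMem_empty i)
  | insert a s ha ih =>
    intro p h1 h2
    have hC : IsClosed ((K.comap (M.toLinearMap p a) : Submodule ℂ (A a)) : Set (A a)) :=
      hK.preimage (hM.comp (continuous_const.update a continuous_id))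
    have hle : (Submodule.span ℂ (T a)).topologicalClosure ≤ K.comap (M.toLinearMap p a) := by
      refine Submodule.topologicalClosure_minimal _ (Submodule.span_le.2 fun x hx => ?_) hC
      refine ih _ (fun i hi => ?_) fun i hi => ?_
      · rw [Function.update_of_ne (ne_of_mem_of_not_mem hi ha)]
        exact h1 i (Finset.mem_insert_of_mem hi)
      · rcases eq_or_ne i a with rfl | hia
        · rwa [Function.update_self]
        · rw [Function.update_of_ne hia]
          exact h2 i fun h => (Finset.mem_insert.1 h).elim hia hi
    have := hle (h1 a (Finset.mem_insert_self a s))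
    rwa [Submodule.mem_comap, MultilinearMap.toLinearMap_apply, Function.update_eq_self] at this

/-- If a graph is given by orthogonality relations, the corresponding elements span the graph of the
adjoint. -/
lemma Submodule.adjoint_le_topologicalClosure_span {V : Type*} [NormedAddCommGroup V]
    [InnerProductSpace ℂ V] [CompleteSpace V] {G : Submodule ℂ (V × V)} {T : Set (V × V)}
    (hG : ∀ p : V × V, (∀ q ∈ T, ⟪q.1, p.2⟫_ℂ = ⟪q.2, p.1⟫_ℂ) → p ∈ G) :
    G.adjoint ≤ (Submodule.span ℂ T).topologicalClosure := by
  intro x hx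
  let e := WithLp.prodContinuousLinearEquiv 2 ℂ V V
  let K : Submodule ℂ (WithLp 2 (V × V)) :=
    (Submodule.span ℂ T).topologicalClosure.comap e.toContinuousLinearMap.toLinearMap
  have hK : IsClosed (K : Set (WithLp 2 (V × V))) :=
    (Submodule.span ℂ T).isClosed_topologicalClosure.preimage e.continuous
  have : CompleteSpace K := hK.completeSpace_coe
  suffices h : WithLp.toLp 2 x ∈ Kᗮᗮ by
    rw [Submodule.orthogonal_orthogonal] at h
    exact h
  refine (Submodule.mem_orthogonal _ _).2 fun r hr => ?_
  have hr' : ((-r.ofLp.2, r.ofLp.1) : V × V) ∈ G := by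
    refine hG _ fun q hq => ?_
    have h1 : WithLp.toLp 2 q ∈ K :=
      (Submodule.span ℂ T).le_topologicalClosure (Submodule.subset_span hq)
    have h2 := (Submodule.mem_orthogonal _ _).1 hr _ h1
    rw [WithLp.prod_inner_apply] at h2
    rw [inner_neg_right]
    exact eq_neg_of_add_eq_zero_left h2
  have h3 := (Submodule.mem_adjoint_iff G x).1 hx _ _ hr'
  rw [WithLp.prod_inner_apply]
  rw [inner_neg_left, sub_neg_eq_add] at h3
  exact h3

variable {V : ι → Type*} {H : Type*} [∀ j, NormedAddCommGroup (V j)]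
  [∀ j, InnerProductSpace ℂ (V j)] [NormedAddCommGroup H] [InnerProductSpace ℂ H]
  {t : MultilinearMap ℂ V H}

lemma IsHilbertTensorProduct.norm_apply (ht : IsHilbertTensorProduct t) (x : ∀ j, V j) :
    ‖t x‖ = ∏ j, ‖x j‖ := by
  have h1 : ((‖t x‖ ^ 2 : ℝ) : ℂ) = ((∏ j, ‖x j‖) ^ 2 : ℝ) := by
    push_cast
    refine (inner_self_eq_norm_sq_to_K (𝕜 := ℂ) (t x)).symm.trans ?_
    rw [ht.inner_apply, ← Finset.prod_pow]
    exact Finset.prod_congr rfl fun j _ => inner_self_eq_norm_sq_to_K _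
  exact (pow_left_inj₀ (norm_nonneg _) (Finset.prod_nonneg fun j _ => norm_nonneg _)
    two_ne_zero).1 (Complex.ofReal_injective h1)

lemma IsHilbertTensorProduct.continuous (ht : IsHilbertTensorProduct t) : Continuous t :=
  t.continuous_of_bound 1 fun x => by rw [ht.norm_apply, one_mul]

lemma IsHilbertTensorProduct.eq_zero (ht : IsHilbertTensorProduct t) {w : H}
    (hw : ∀ x, ⟪t x, w⟫_ℂ = 0) : w = 0 := by
  refine ht.dense_span.eq_zero_of_inner_right ℂ fun v hv => ?_
  refine Submodule.span_induction (p := fun v _ => ⟪v, w⟫_ℂ = 0) ?_ ?_ ?_ ?_ hv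
  · rintro _ ⟨x, rfl⟩
    exact hw x
  · exact inner_zero_left _
  · intro x y _ _ hx hy
    rw [inner_add_left, hx, hy, add_zero]
  · intro c x _ hx
    rw [inner_smul_left, hx, mul_zero]

/-- Bounded operators which agree on tensors are equal. -/
lemma IsHilbertTensorProduct.ext_clm (ht : IsHilbertTensorProduct t) {B : Type*}
    [AddCommMonoid B] [Module ℂ B] [TopologicalSpace B] [T2Space B]
    {S T : H →L[ℂ] B} (h : ∀ x, S (t x) = T (t x)) : S = T := by
  refine ContinuousLinearMap.ext fun w => ?_
  exact congrFun (Continuous.ext_on ht.dense_span S.continuous T.continuous fun v hv =>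
    LinearMap.eqOn_span (f := S.toLinearMap) (g := T.toLinearMap) (by
      rintro _ ⟨x, rfl⟩
      exact h x) hv) w

variable [LinearOrder ι]

lemma continuous_leibnizSlot (τ : ∀ i, V i →L[ℂ] V i) (j i : ι) :
    Continuous (leibnizSlot (fun i => (τ i).toLinearMap) j i) := by
  unfold leibnizSlot
  split_ifs
  · exact (τ i).continuous.comp continuous_fst
  · exact continuous_snd
  · exact continuous_fst

lemma IsHilbertTensorProduct.continuous_leibniz (ht : IsHilbertTensorProduct t)
    (τ : ∀ i, V i →L[ℂ] V i) :
    Continuous fun p : ∀ i, V i × V i => leibniz (fun i => (τ i).toLinearMap) t p := by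
  simp only [leibniz_apply]
  exact continuous_finsetSum _ fun j _ => ht.continuous.comp
    (continuous_pi fun i => (continuous_leibnizSlot τ j i).comp (continuous_apply i))

end TensorProduct

namespace HermitianManifold

section Product

lemma ProductData.isHilbertTensorProduct {α : Type} [Fintype α] {Z : HermitianManifold.{u, v}}
    {ΩZ : Set Z} {φZ : Z → ℝ} {Y : α → HermitianManifold.{u, v}} {Ω : ∀ a, Set (Y a)}
    {φ : ∀ a, Y a → ℝ} (D : ProductData Z ΩZ φZ Y Ω φ)
    (hD : Z.measurableSpace ≤ MeasurableSpace.comap (fun x a => D.proj a x) MeasurableSpace.pi)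
    (h : ∀ a, IsBoundedDomain (Ω a) (φ a)) : IsHilbertTensorProduct D.tensor where
  completeSpace := inferInstance
  t0Space := inferInstance
  inner_apply := D.inner_tensor
  dense_span := by
    refine Submodule.dense_iff_topologicalClosure_eq_top.2
      (Submodule.topologicalClosure_eq_top_iff.2 ((Submodule.eq_bot_iff _).2 fun F hF => ?_))
    exact D.eq_zero_of_inner_tensor hD h F fun G =>
      (Submodule.mem_orthogonal _ _).1 hF _ (Submodule.subset_span ⟨G, rfl⟩)

lemma isHilbertTensorProduct_piData {ι : Type} [Fintype ι] [LinearOrder ι]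
    {X : ι → HermitianManifold.{u, v}} {Ω : ∀ i, Set (X i)} {φ : ∀ i, X i → ℝ}
    (h : ∀ i, IsBoundedDomain (Ω i) (φ i)) : IsHilbertTensorProduct (piData h).tensor :=
  (piData h).isHilbertTensorProduct (fun s hs => ⟨s, hs, rfl⟩) h

lemma exists_fiberInner_eq {X : HermitianManifold.{u, v}} (x : X) (l : Module.Dual ℂ (CForm X.Model)) :
    ∃ β, ∀ α, X.fiberInner x β α = l α := by
  let _ : NormedAddCommGroup (CForm X.Model) := (X.fiberCore x).toNormedAddCommGroup
  let _ : InnerProductSpace ℂ (CForm X.Model) := InnerProductSpace.ofCore (X.fiberCore x).toCore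
  have := FiniteDimensional.complete ℂ (CForm X.Model)
  refine ⟨(InnerProductSpace.toDual ℂ _).symm (LinearMap.toContinuousLinearMap l), fun α => ?_⟩
  have h : ⟪(InnerProductSpace.toDual ℂ (CForm X.Model)).symm
      (LinearMap.toContinuousLinearMap l), α⟫_ℂ = l α := InnerProductSpace.toDual_symm_apply
  exact h

end Product

end HermitianManifold

/-! ### The Leibniz rule for the adjoint of the Cauchy-Riemann operator -/

namespace HermitianManifold

section AdjointLeibniz

lemma inner_parity_left {X : HermitianManifold.{u, v}} {Ω : Set X} {φ : X → ℝ}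
    (F G : X.L2 Ω φ) : ⟪parity F, G⟫_ℂ = ⟪F, parity G⟫_ℂ := by
  obtain ⟨f, rfl⟩ := PreL2.exists_rep F
  obtain ⟨g, rfl⟩ := PreL2.exists_rep G
  have h1 : PreL2.parity (PreL2.parity f) = f := PreL2.ext (funext fun x =>
    CliffordAlgebra.involute_involute _)
  change ⟪(PreL2.parity f).toL2, g.toL2⟫_ℂ = ⟪f.toL2, (PreL2.parity g).toL2⟫_ℂ
  rw [PreL2.inner_toL2, PreL2.inner_toL2, ← PreL2.parity.inner_map_map, h1]

lemma parity_parity {X : HermitianManifold.{u, v}} {Ω : Set X} {φ : X → ℝ} (F : X.L2 Ω φ) :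
    parity (parity F) = F := by
  obtain ⟨f, rfl⟩ := PreL2.exists_rep F
  exact congrArg PreL2.toL2 (PreL2.ext (funext fun x => CliffordAlgebra.involute_involute _))

/-- The pairs `(a, b)` such that the inner products with `a` and with `-b` are the functionals
`f ↦ ∫ ψ l(f)` and `f ↦ ∫ l(∂̄ψ ∧ f)` by which `∂̄` is defined. -/
def testPairs {X : HermitianManifold.{u, v}} {Ω : Set X} {φ : X → ℝ} (h : IsBoundedDomain Ω φ) :
    Set (X.L2 Ω φ × X.L2 Ω φ) :=
  {q | ∃ (x₀ : X) (ψ : X.Model → ℂ) (hψ : IsTestFunction Ω x₀ ψ) (l : _),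
    ∀ F, ⟪q.1, F⟫_ℂ = h.functional hψ.isCutoff l F ∧ ⟪q.2, F⟫_ℂ = - h.dbarFunctional hψ l F}

/-- The graph of `∂̄` is determined by the test pairs, because bounded functionals are represented by
elements of the Hilbert space. -/
lemma mem_dbarGraph_of_testPairs {X : HermitianManifold.{u, v}} {Ω : Set X} {φ : X → ℝ}
    (h : IsBoundedDomain Ω φ) (p : X.L2 Ω φ × X.L2 Ω φ)
    (hp : ∀ q ∈ testPairs h, ⟪q.1, p.2⟫_ℂ = ⟪q.2, p.1⟫_ℂ) : p ∈ X.dbarGraph Ω φ := by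
  rw [h.mem_dbarGraph_iff]
  intro x₀ ψ hψ l
  have h1 : ∀ A F, ⟪(InnerProductSpace.toDual ℂ (X.L2 Ω φ)).symm A, F⟫_ℂ = A F := fun A F =>
    InnerProductSpace.toDual_symm_apply
  have := hp ((InnerProductSpace.toDual ℂ _).symm (h.functional hψ.isCutoff l),
    (InnerProductSpace.toDual ℂ _).symm (- h.dbarFunctional hψ l))
    ⟨x₀, ψ, hψ, l, fun F => ⟨h1 _ _, h1 _ _⟩⟩
  rw [h1, h1] at this
  exact this

lemma _root_.Submodule.isClosed_adjoint {V : Type*} [NormedAddCommGroup V] [InnerProductSpace ℂ V]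
    (G : Submodule ℂ (V × V)) : IsClosed (G.adjoint : Set (V × V)) := by
  have : (G.adjoint : Set (V × V)) = ⋂ p ∈ G, {x | ⟪p.2, x.1⟫_ℂ - ⟪p.1, x.2⟫_ℂ = 0} := by
    ext x
    simp only [SetLike.mem_coe, Submodule.mem_adjoint_iff, mem_iInter, mem_ofPred_eq, Prod.forall]
  rw [this]
  exact isClosed_biInter fun p _ => isClosed_eq (by fun_prop) continuous_const

variable {ι : Type} [Fintype ι] [LinearOrder ι] {X : ι → HermitianManifold.{u, v}}
  {Ω : ∀ i, Set (X i)} {φ : ∀ i, X i → ℝ}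

/-- Products of functionals on the factors, in the fibers. -/
lemma exists_dual_wedgeMap (h : ∀ i, IsBoundedDomain (Ω i) (φ i)) (x₀ : ∀ i, X i)
    (l : ∀ i, Module.Dual ℂ (CForm (X i).Model)) :
    ∃ L : Module.Dual ℂ (CForm (pi X).Model), ∀ β, L ((piData h).wedgeMap β) = ∏ i, l i (β i) := by
  choose b hb using fun i => exists_fiberInner_eq (x₀ i) (l i)
  refine ⟨LinearMap.mk ⟨fun α => (pi X).fiberInner x₀ ((piData h).wedgeMap b) α, fun α β => ?_⟩
    fun r α => ?_, fun β => ?_⟩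
  · exact ((pi X).fiberInner_conj x₀ _ _).symm.trans ((congrArg conj
      ((pi X).fiberInner_add_left x₀ _ _ _)).trans ((map_add _ _ _).trans (congrArg₂ _
        ((pi X).fiberInner_conj x₀ _ _) ((pi X).fiberInner_conj x₀ _ _))))
  · refine ((pi X).fiberInner_conj x₀ _ _).symm.trans ((congrArg conj
      ((pi X).fiberInner_smul_left x₀ _ _ _)).trans ((map_mul _ _ _).trans (congrArg₂ _
        (Complex.conj_conj _) ((pi X).fiberInner_conj x₀ _ _))))
  · refine ((piData h).fiberInner_tensorForm (fun i _ => b i) (fun i _ => β i) x₀).trans ?_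
    exact Finset.prod_congr rfl fun i _ => hb i _

lemma IsTestFunction.pi {x₀ : ∀ i, X i} {ψ : ∀ i, (X i).Model → ℂ}
    (hψ : ∀ i, IsTestFunction (Ω i) (x₀ i) (ψ i)) :
    IsTestFunction (X := HermitianManifold.pi X) (piDomain Ω) x₀
      (fun z : (HermitianManifold.pi X).Model => ∏ i, ψ i (z i)) := by
  let K : Set (∀ i, (X i).Model) := Set.pi univ fun i => tsupport (ψ i)
  have hK : IsCompact K := isCompact_univ_pi fun i => (hψ i).hasCompactSupport
  have hs : ∀ z : ∀ i, (X i).Model, z ∉ K → ∏ i, ψ i (z i) = 0 := fun z hz => by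
    simp only [K, Set.mem_univ_pi, not_forall] at hz
    obtain ⟨i, hi⟩ := hz
    exact Finset.prod_eq_zero (Finset.mem_univ i) (image_eq_zero_of_notMem_tsupport hi)
  refine ⟨?_, HasCompactSupport.intro (α := ∀ i, (X i).Model) hK hs, ?_⟩
  · have : ∀ i, ContDiff ℝ ∞ fun z : ∀ i, (X i).Model => ψ i (z i) := fun i =>
      (hψ i).smooth.comp (ContinuousLinearMap.proj (R := ℝ) (φ := fun i => (X i).Model) i).contDiff
    exact contDiff_prod fun i _ => this i
  · have h1 : tsupport (fun z : ∀ i, (X i).Model => ∏ i, ψ i (z i)) ⊆ K :=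
      closure_minimal (fun z hz => by
        by_contra h
        exact hz (hs z h)) hK.isClosed
    intro z hz
    have h2 := h1 hz
    exact ⟨fun i _ => ((hψ i).tsupport_subset (h2 i trivial)).1,
      fun i => ((hψ i).tsupport_subset (h2 i trivial)).2⟩

lemma dbarPart_prod {ψ : ∀ i, (X i).Model → ℂ} (hψ : ∀ i, ContDiff ℝ ∞ (ψ i)) (z : (pi X).Model)
    (j : ι) : dbarPart (fun z : (pi X).Model => ∏ i, ψ i (z i)) j z =
      (∏ i ∈ Finset.univ.erase j, ψ i (z i)) • CForm.dbarFun (ψ j) (z j) := by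
  have h1 : ∀ z : ∀ i, (X i).Model, (fun t => ∏ i, ψ i (Function.update z j t i)) =
      fun t => (∏ i ∈ Finset.univ.erase j, ψ i (z i)) * ψ j t := by
    intro z
    funext t
    rw [← Finset.mul_prod_erase _ _ (Finset.mem_univ j), Function.update_self, mul_comm]
    refine congrArg (· * _) (Finset.prod_congr rfl fun i hi => ?_)
    rw [Function.update_of_ne (Finset.ne_of_mem_erase hi)]
  refine (congrArg (fun ψ => CForm.dbarFun ψ (z j)) (h1 z)).trans ((dbarFun_mul
    (differentiableAt_const _) ((hψ j).differentiable (by simp) (z j))).trans ?_)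
  have h2 : CForm.dbarFun (fun _ : (X j).Model => ∏ i ∈ Finset.univ.erase j, ψ i (z i)) (z j) =
      0 := by
    ext w
    simp [CForm.dbarFun]
  rw [h2, smul_zero, add_zero]

/-- The functionals which define `∂̄` on the product, for products of test functions. -/
lemma inner_tensor_testPairs (h : ∀ i, IsBoundedDomain (Ω i) (φ i))
    {q : ∀ i, (X i).L2 (Ω i) (φ i) × (X i).L2 (Ω i) (φ i)} (hq : ∀ i, q i ∈ testPairs (h i)) :
    ∃ (x₀ : pi X) (ψ : (pi X).Model → ℂ) (hψ : IsTestFunction (piDomain Ω) x₀ ψ) (l : _),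
      ∀ F, (haarFactor X)⁻¹ * ⟪(piData h).tensor fun i => (q i).1, F⟫_ℂ =
          (IsBoundedDomain.pi h).functional hψ.isCutoff l F ∧
        (haarFactor X)⁻¹ * ⟪leibniz (parityMap X Ω φ) (piData h).tensor q, F⟫_ℂ =
          - (IsBoundedDomain.pi h).dbarFunctional hψ l F := by
  choose x₀ ψ hψ l hl using hq
  obtain ⟨L, hL⟩ := exists_dual_wedgeMap h x₀ l
  have hpi := IsBoundedDomain.pi h
  refine ⟨x₀, _, IsTestFunction.pi hψ, L, ?_⟩
  -- integrals of products
  have hint : ∀ g : ∀ i, (X i).Model → ℂ, ∫ z : (pi X).Model, ∏ i, g i (z i) ∂(pi X).haar =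
      (haarFactor X)⁻¹ * ∏ i, ∫ z, g i z ∂(X i).haar := by
    intro g
    rw [pi_haar]
    refine (integral_smul_measure _ _).trans ?_
    rw [ENNReal.toReal_ofReal (inv_pos.2 haarFactor_pos).le, ← integral_fintype_prod_eq_prod]
    rw [Complex.real_smul]
    rfl
  have ht := isHilbertTensorProduct_piData h
  -- the coefficients of the factors
  let β : ∀ (f : ∀ i, (X i).PreL2 (Ω i) (φ i)) (i : ι), (X i).Model → CForm (X i).Model :=
    fun f i z => (f i).form.inChart (x₀ i) (((X i).chart (x₀ i)).symm z)
  have hβ : ∀ f, ∀ z : (pi X).Model, (∀ i, z i ∈ tsupport (ψ i)) →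
      ((piData h).tensorPre f).form.inChart x₀ (((pi X).chart x₀).symm z) =
        (piData h).wedgeMap fun i => β f i (z i) := fun f z hz =>
    (piData h).inChart_tensorForm _
      (((pi X).chart x₀).map_target fun i _ => ((hψ i).tsupport_subset (hz i)).1)
  have key1 : ∀ f : ∀ i, (X i).PreL2 (Ω i) (φ i),
      hpi.functional (IsTestFunction.pi hψ).isCutoff L ((piData h).tensor fun i => (f i).toL2) =
      (haarFactor X)⁻¹ * ∏ i, (h i).functional (hψ i).isCutoff (l i) (f i).toL2 := by
    intro f
    simp only [ProductData.tensor_toL2, IsBoundedDomain.functional_toL2]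
    refine Eq.trans ?_ (hint fun i z => ψ i z * l i (β f i z))
    refine integral_congr_ae (Filter.Eventually.of_forall fun z => ?_)
    by_cases hz : ∀ i, z i ∈ tsupport (ψ i)
    · refine (congrArg _ ((congrArg L (hβ f z hz)).trans (hL _))).trans
        Finset.prod_mul_distrib.symm
    · push Not at hz
      obtain ⟨i, hi⟩ := hz
      have h0 := image_eq_zero_of_notMem_tsupport hi
      exact (mul_eq_zero_of_left (Finset.prod_eq_zero (Finset.mem_univ i) h0) _).trans
        (Finset.prod_eq_zero (Finset.mem_univ i) (mul_eq_zero_of_left h0 _)).symm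
  have key2 : ∀ f : ∀ i, (X i).PreL2 (Ω i) (φ i),
      hpi.dbarFunctional (IsTestFunction.pi hψ) L ((piData h).tensor fun i => (f i).toL2) =
      (haarFactor X)⁻¹ * ∑ j, ∏ i, if i < j then
        (h i).functional (hψ i).isCutoff (l i) (PreL2.parity (f i)).toL2 else if i = j then
        (h i).dbarFunctional (hψ i) (l i) (f i).toL2 else
        (h i).functional (hψ i).isCutoff (l i) (f i).toL2 := by
    intro f
    let g : ι → ∀ i, (X i).Model → ℂ := fun j i z => if i < j then
      ψ i z * l i (CForm.parity (β f i z)) else if i = j then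
      l i (ExteriorAlgebra.ι ℂ (CForm.dbarFun (ψ i) z) * β f i z) else ψ i z * l i (β f i z)
    have hgf : ∀ j i, Integrable (g j i) (X i).haar ∧ ∫ z, g j i z ∂(X i).haar = if i < j then
        (h i).functional (hψ i).isCutoff (l i) (PreL2.parity (f i)).toL2 else if i = j then
        (h i).dbarFunctional (hψ i) (l i) (f i).toL2 else
        (h i).functional (hψ i).isCutoff (l i) (f i).toL2 := by
      intro j i
      have h1 : ∀ z, CForm.parity (β f i z) = (PreL2.parity (f i)).form.inChart (x₀ i)
          (((X i).chart (x₀ i)).symm z) := fun z => (CForm.pullback_parity _ _).symm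
      simp only [g]
      split_ifs
      · simp only [h1]
        exact ⟨(h i).integrable_cutoff (hψ i).isCutoff _ _,
          ((h i).functional_toL2 (hψ i).isCutoff _ _).symm⟩
      · exact ⟨(h i).integrable_dbar (hψ i) _ _, ((h i).dbarFunctional_toL2 (hψ i) _ _).symm⟩
      · exact ⟨(h i).integrable_cutoff (hψ i).isCutoff _ _,
          ((h i).functional_toL2 (hψ i).isCutoff _ _).symm⟩
    simp only [← fun j i => (hgf j i).2]
    rw [ProductData.tensor_toL2, Finset.mul_sum]
    refine (hpi.dbarFunctional_toL2 _ _ _).trans ?_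
    simp only [← hint]
    rw [← integral_finsetSum _ fun j _ => ?_]
    · refine integral_congr_ae (Filter.Eventually.of_forall fun z => ?_)
      have hpart : ∀ j, dbarPart (fun z : (pi X).Model => ∏ i, ψ i (z i)) j z =
          (∏ i ∈ Finset.univ.erase j, ψ i (z i)) • CForm.dbarFun (ψ j) (z j) := fun j =>
        dbarPart_prod (fun i => (hψ i).smooth) z j
      refine (congrArg (fun m => L (ExteriorAlgebra.ι ℂ m * _))
        (dbarFun_eq_sum_dbarPart (IsTestFunction.pi hψ).smooth z)).trans ?_
      simp only [map_sum, Finset.sum_mul]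
      refine Finset.sum_congr rfl fun j _ => ?_
      by_cases hz : ∀ i, z i ∈ tsupport (ψ i)
      · refine (congrArg (fun b => L (_ * b)) (hβ f z hz)).trans ?_
        refine (congrArg L (ι_mul_wedgeMap h j (fun i => dbarPart _ i z) _)).trans
          ((hL _).trans ?_)
        rw [← Finset.mul_prod_erase _ _ (Finset.mem_univ j),
          ← Finset.mul_prod_erase _ (fun i => g j i (z i)) (Finset.mem_univ j)]
        rw [leibnizSlot_self, hpart, map_smul, smul_mul_assoc, map_smul, smul_eq_mul]
        have h2 : g j j (z j) = l j (ExteriorAlgebra.ι ℂ (CForm.dbarFun (ψ j) (z j)) *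
            β f j (z j)) := by simp [g]
        rw [h2, mul_comm (∏ i ∈ _, _), mul_assoc, ← Finset.prod_mul_distrib]
        refine congrArg _ (Finset.prod_congr rfl fun i hi => ?_)
        rcases (Finset.ne_of_mem_erase hi).lt_or_gt with hij | hij
        · rw [leibnizSlot_of_lt _ hij]
          simp only [g, if_pos hij]
          rfl
        · rw [leibnizSlot_of_gt _ hij]
          simp only [g, if_neg hij.asymm, if_neg hij.ne']
      · push Not at hz
        obtain ⟨i, hi⟩ := hz
        have h0 := image_eq_zero_of_notMem_tsupport hi
        have h1 := support_dbarFun_subset hi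
        have h3 : (∏ i ∈ Finset.univ.erase j, ψ i (z i)) • CForm.dbarFun (ψ j) (z j) = 0 := by
          rcases eq_or_ne i j with rfl | hij
          · rw [h1, smul_zero]
          · rw [Finset.prod_eq_zero (Finset.mem_erase.2 ⟨hij, Finset.mem_univ i⟩) h0, zero_smul]
        have h4 : g j i (z i) = 0 := by
          simp only [g, h0, h1, map_zero, zero_mul, ite_self]
        rw [hpart, h3, LinearMap.zero_comp, map_zero, zero_mul, map_zero,
          Finset.prod_eq_zero (Finset.mem_univ i) h4]
    · rw [pi_haar]
      exact (Integrable.fintype_prod_dep fun i => (hgf j i).1).smul_measure ENNReal.ofReal_ne_top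
  intro F
  constructor
  · refine DFunLike.congr_fun (F := _ →L[ℂ] ℂ) (f := (((haarFactor X)⁻¹ : ℝ) : ℂ) • innerSL ℂ
      ((piData h).tensor fun i => (q i).1)) (ht.ext_clm fun x => ?_) F
    choose f hf using fun i => PreL2.exists_rep (x i)
    obtain rfl : (fun i => (f i).toL2) = x := funext hf
    rw [key1]
    refine congrArg ((((haarFactor X)⁻¹ : ℝ) : ℂ) * ·) ((ht.inner_apply _ _).trans ?_)
    exact Finset.prod_congr rfl fun i _ => (hl i _).1
  · refine DFunLike.congr_fun (F := _ →L[ℂ] ℂ) (f := (((haarFactor X)⁻¹ : ℝ) : ℂ) • innerSL ℂ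
      (leibniz (parityMap X Ω φ) (piData h).tensor q)) (g := -hpi.dbarFunctional
        (IsTestFunction.pi hψ) L) (ht.ext_clm fun x => ?_) F
    choose f hf using fun i => PreL2.exists_rep (x i)
    obtain rfl : (fun i => (f i).toL2) = x := funext hf
    refine Eq.trans ?_ (congrArg Neg.neg (key2 f)).symm
    rw [← mul_neg]
    refine congrArg ((((haarFactor X)⁻¹ : ℝ) : ℂ) * ·) ?_
    change ⟪leibniz (parityMap X Ω φ) (piData h).tensor q, _⟫_ℂ = _
    rw [leibniz_apply, sum_inner, ← Finset.sum_neg_distrib]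
    refine Finset.sum_congr rfl fun j _ => (ht.inner_apply _ _).trans ?_
    rw [← Finset.mul_prod_erase _ _ (Finset.mem_univ j)]
    conv_rhs => rw [← Finset.mul_prod_erase _ _ (Finset.mem_univ j)]
    rw [leibnizSlot_self, (hl j _).2, if_neg (lt_irrefl j), if_pos rfl, neg_mul]
    refine congrArg Neg.neg (congrArg _ (Finset.prod_congr rfl fun i hi => ?_))
    rcases (Finset.ne_of_mem_erase hi).lt_or_gt with hij | hij
    · rw [leibnizSlot_of_lt _ hij, if_pos hij, ← (hl i _).1]
      exact inner_parity_left _ _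
    · rw [leibnizSlot_of_gt _ hij, if_neg hij.asymm, if_neg hij.ne', (hl i _).1]

/-- The Leibniz rule for the adjoint of `∂̄`. The graph of the adjoint on a factor is the closed span
of the pairs that represent the functionals by which `∂̄` is defined, and for these the rule is
obtained from products of test functions. -/
theorem tensor_mem_dbarGraph_adjoint (h : ∀ i, IsBoundedDomain (Ω i) (φ i))
    {p : ∀ i, (X i).L2 (Ω i) (φ i) × (X i).L2 (Ω i) (φ i)}
    (hp : ∀ i, p i ∈ ((X i).dbarGraph (Ω i) (φ i)).adjoint) :
    ((piData h).tensor (fun i => (p i).1), leibniz (parityMap X Ω φ) (piData h).tensor p) ∈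
      ((pi X).dbarGraph (piDomain Ω) (piWeight φ)).adjoint := by
  have ht := isHilbertTensorProduct_piData h
  let M := ((piData h).tensor.compLinearMap fun i => LinearMap.fst ℂ ((X i).L2 (Ω i) (φ i))
    ((X i).L2 (Ω i) (φ i))).prod (leibniz (parityMap X Ω φ) (piData h).tensor)
  have hM : Continuous M := (ht.continuous.comp (continuous_pi fun i =>
    continuous_fst.comp (continuous_apply i))).prodMk
      (ht.continuous_leibniz fun i => parity (X := X i) (Ω := Ω i) (φ := φ i))
  refine M.mem_of_topologicalClosure_span hM (Submodule.isClosed_adjoint _)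
    (T := fun i => testPairs (h i)) (fun q hq => ?_) fun i =>
      Submodule.adjoint_le_topologicalClosure_span (mem_dbarGraph_of_testPairs (h i)) (hp i)
  obtain ⟨x₀, ψ, hψ, l, hl⟩ := inner_tensor_testPairs h hq
  refine (Submodule.mem_adjoint_iff _ _).2 fun F G hFG => ?_
  have h1 := ((IsBoundedDomain.pi h).mem_dbarGraph_iff _).1 hFG x₀ ψ hψ l
  rw [← (hl G).1, ← (hl F).2] at h1
  have h2 := mul_left_cancel₀ (by
    simpa using (haarFactor_pos (X := X)).ne') h1
  have h3 := congrArg conj h2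
  rw [inner_conj_symm, inner_conj_symm] at h3
  exact sub_eq_zero.2 h3

end AdjointLeibniz

end HermitianManifold

/-! ### Hilbert complexes with closed range -/

section HilbertComplex

variable {V : Type*} [NormedAddCommGroup V] [InnerProductSpace ℂ V]

/-- `G` is the graph of a closed densely defined operator `d` with `d² = 0` which anticommutes with
the unitary involution `τ`. (If `V` is graded and `d` has degree one, `τ` is multiplication by
`(-1) ^ k` in degree `k`.) -/
structure IsHilbertComplex (τ : V →L[ℂ] V) (G : Submodule ℂ (V × V)) : Prop where
  isClosed : IsClosed (G : Set (V × V))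
  unique : ∀ y, (0, y) ∈ G → y = 0
  eq_zero_of_inner : ∀ w, (∀ p ∈ G, ⟪p.1, w⟫_ℂ = 0) → w = 0
  sq_mem : ∀ p ∈ G, (p.2, 0) ∈ G
  parity_parity : ∀ x, τ (τ x) = x
  inner_parity : ∀ x y, ⟪τ x, y⟫_ℂ = ⟪x, τ y⟫_ℂ
  parity_mem : ∀ p ∈ G, (τ p.1, -τ p.2) ∈ G

namespace Submodule

/-- The kernel of the operator with graph `G`. -/
def graphKer (G : Submodule ℂ (V × V)) : Submodule ℂ V := G.comap (LinearMap.inl ℂ V V)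

/-- The range of the operator with graph `G`. -/
def graphRange (G : Submodule ℂ (V × V)) : Submodule ℂ V := G.map (LinearMap.snd ℂ V V)

lemma mem_graphKer {G : Submodule ℂ (V × V)} {x : V} : x ∈ G.graphKer ↔ (x, 0) ∈ G := Iff.rfl

lemma mem_graphRange {G : Submodule ℂ (V × V)} {y : V} : y ∈ G.graphRange ↔ ∃ x, (x, y) ∈ G := by
  simp [graphRange]

/-- The harmonic elements: the orthogonal complement of the range in the kernel. -/
def harmonics (G : Submodule ℂ (V × V)) : Submodule ℂ V := G.graphKer ⊓ G.graphRangeᗮ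

/-- The orthogonal projection onto the harmonic elements. -/
def harmonicProj [CompleteSpace V] (G : Submodule ℂ (V × V)) : V →L[ℂ] V :=
  G.harmonics.topologicalClosure.starProjection

/-- `K` is the inverse of the operator with graph `G` that takes values orthogonal to the kernel, and
vanishes on the orthogonal complement of the range. -/
structure IsCanonicalInverse (G : Submodule ℂ (V × V)) (K : V →L[ℂ] V) : Prop where
  mem_orthogonal : ∀ f ∈ G.graphRange, K f ∈ G.graphKerᗮ
  mem_graph : ∀ f ∈ G.graphRange, (K f, f) ∈ G
  eq_zero : ∀ f ∈ G.graphRangeᗮ, K f = 0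

end Submodule

namespace IsHilbertComplex

open Submodule

variable {τ : V →L[ℂ] V} {G : Submodule ℂ (V × V)}

lemma isClosed_graphKer (hG : IsHilbertComplex τ G) : IsClosed (G.graphKer : Set V) :=
  hG.isClosed.preimage (f := fun x : V => (x, (0 : V))) (by fun_prop)

lemma isClosed_harmonics (hG : IsHilbertComplex τ G) : IsClosed (G.harmonics : Set V) :=
  hG.isClosed_graphKer.inter G.graphRange.isClosed_orthogonal

lemma graphRange_le_graphKer (hG : IsHilbertComplex τ G) : G.graphRange ≤ G.graphKer := by
  intro y hy
  obtain ⟨x, hx⟩ := mem_graphRange.1 hy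
  exact hG.sq_mem _ hx

variable [CompleteSpace V]

lemma harmonicProj_mem (hG : IsHilbertComplex τ G) (x : V) : G.harmonicProj x ∈ G.harmonics := by
  exact hG.isClosed_harmonics.submodule_topologicalClosure_eq.le
    (starProjection_apply_mem G.harmonics.topologicalClosure x)

lemma harmonicProj_eq (hG : IsHilbertComplex τ G) {x y : V} (hy : y ∈ G.harmonics)
    (hxy : ∀ w ∈ G.harmonics, ⟪x - y, w⟫_ℂ = 0) : G.harmonicProj x = y := by
  refine eq_starProjection_of_mem_of_inner_eq_zero (le_topologicalClosure _ hy) fun w hw => ?_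
  rw [hG.isClosed_harmonics.submodule_topologicalClosure_eq] at hw
  exact hxy w hw

lemma inner_harmonicProj (G : Submodule ℂ (V × V)) (x y : V) :
    ⟪G.harmonicProj x, y⟫_ℂ = ⟪x, G.harmonicProj y⟫_ℂ := inner_starProjection_left_eq_right _ _ _

lemma harmonicProj_of_mem {x : V} (hx : x ∈ G.harmonics) : G.harmonicProj x = x :=
  starProjection_eq_self_iff.2 (le_topologicalClosure _ hx)

lemma harmonicProj_of_mem_graphRange (hG : IsHilbertComplex τ G) {x : V} (hx : x ∈ G.graphRange) :
    G.harmonicProj x = 0 :=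
  hG.harmonicProj_eq (zero_mem _) fun w hw => by
    rw [sub_zero]
    exact (Submodule.mem_orthogonal _ _).1 hw.2 x hx

/-- An operator with closed range has a bounded inverse with values orthogonal to the kernel. -/
theorem exists_isCanonicalInverse (hG : IsHilbertComplex τ G)
    (hcl : IsClosed (G.graphRange : Set V)) : ∃ K, G.IsCanonicalInverse K := by
  -- the graph of the restriction to the orthogonal complement of the kernel; by the open mapping
  -- theorem, its projection to the range is an isomorphism
  let Γ : Submodule ℂ (V × V) := G ⊓ G.graphKerᗮ.comap (LinearMap.fst ℂ V V)
  have hΓ : IsClosed (Γ : Set (V × V)) :=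
    hG.isClosed.inter (G.graphKer.isClosed_orthogonal.preimage continuous_fst)
  have : CompleteSpace Γ := hΓ.completeSpace_coe
  have : CompleteSpace G.graphRange := hcl.completeSpace_coe
  have : CompleteSpace G.graphKer := hG.isClosed_graphKer.completeSpace_coe
  let s : Γ →L[ℂ] G.graphRange := ((ContinuousLinearMap.snd ℂ V V).comp Γ.subtypeL).codRestrict
    G.graphRange fun p => mem_graphRange.2 ⟨p.1.1, p.2.1⟩
  have hker : s.ker = ⊥ := by
    refine (Submodule.eq_bot_iff _).2 fun p hp => ?_
    have h1 : p.1.2 = 0 := congrArg Subtype.val hp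
    have h2 : p.1.1 ∈ G.graphKer := by
      have := p.2.1
      rwa [show p.1 = (p.1.1, 0) from Prod.ext rfl h1] at this
    have h3 : p.1.1 = 0 :=
      inner_self_eq_zero.1 ((Submodule.mem_orthogonal _ _).1 p.2.2 _ h2)
    exact Subtype.ext (Prod.ext h3 h1)
  have hrange : s.range = ⊤ := by
    refine LinearMap.range_eq_top.2 fun y => ?_
    obtain ⟨x, hx⟩ := mem_graphRange.1 y.2
    have hm : (x - G.graphKer.starProjection x, y.1) ∈ G := by
      have := G.sub_mem hx (mem_graphKer.1 (starProjection_apply_mem G.graphKer x))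
      rwa [Prod.mk_sub_mk, sub_zero] at this
    exact ⟨⟨_, hm, sub_starProjection_mem_orthogonal x⟩, rfl⟩
  let e := ContinuousLinearEquiv.ofBijective s hker hrange
  let K : V →L[ℂ] V := ((ContinuousLinearMap.fst ℂ V V).comp Γ.subtypeL).comp
    (e.symm.toContinuousLinearMap.comp G.graphRange.orthogonalProjectionOnto)
  have hK : ∀ f (hf : f ∈ G.graphRange), K f = (e.symm ⟨f, hf⟩).1.1 ∧
      (e.symm ⟨f, hf⟩).1.2 = f := fun f hf => by
    constructor
    · have : G.graphRange.orthogonalProjectionOnto f = ⟨f, hf⟩ :=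
        orthogonalProjectionOnto_mem_subspace_eq_self (K := G.graphRange) ⟨f, hf⟩
      simp only [K, ContinuousLinearMap.comp_apply, this]
      rfl
    · exact congrArg Subtype.val (e.apply_symm_apply ⟨f, hf⟩)
  refine ⟨K, fun f hf => ?_, fun f hf => ?_, fun f hf => ?_⟩
  · rw [(hK f hf).1]
    exact (e.symm ⟨f, hf⟩).2.2
  · have := (e.symm ⟨f, hf⟩).2.1
    rwa [show (e.symm ⟨f, hf⟩).1 = (K f, f) from
      Prod.ext (hK f hf).1.symm (hK f hf).2] at this
  · have : G.graphRange.orthogonalProjectionOnto f = 0 :=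
      (Submodule.orthogonalProjectionOnto_eq_zero_iff).2 hf
    simp only [K, ContinuousLinearMap.comp_apply, this, map_zero]

variable {K : V →L[ℂ] V}

/-- The values of the canonical inverse are orthogonal to the kernel, also outside of the range. -/
lemma canonicalInverse_mem (hcl : IsClosed (G.graphRange : Set V))
    (hK : G.IsCanonicalInverse K) (x : V) : K x ∈ G.graphKerᗮ := by
  have : CompleteSpace G.graphRange := hcl.completeSpace_coe
  have h := hK.eq_zero _ (sub_starProjection_mem_orthogonal (K := G.graphRange) x)
  rw [map_sub, sub_eq_zero] at h
  rw [h]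
  exact hK.mem_orthogonal _ (starProjection_apply_mem _ _)

/-- The homotopy formula, for a single complex: `d K f + K d f = f - P f`. -/
lemma homotopy (hG : IsHilbertComplex τ G) (hcl : IsClosed (G.graphRange : Set V))
    (hK : G.IsCanonicalInverse K) {p : V × V} (hp : p ∈ G) :
    (K p.1, p.1 - G.harmonicProj p.1 - K p.2) ∈ G := by
  have : CompleteSpace G.graphRange := hcl.completeSpace_coe
  have h0 : p.2 ∈ G.graphRange := mem_graphRange.2 ⟨_, hp⟩
  -- the decomposition of `f - K d f` into its harmonic and exact components
  set z := p.1 - K p.2 with hz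
  have hz' : z ∈ G.graphKer := by
    have := G.sub_mem hp (hK.mem_graph _ h0)
    rwa [show p - (K p.2, p.2) = (z, 0) from Prod.ext rfl (sub_self _)] at this
  set b := G.graphRange.starProjection p.1
  have hb : b ∈ G.graphRange := starProjection_apply_mem _ _
  have hKb : K p.1 = K b := by
    have h := hK.eq_zero _ (sub_starProjection_mem_orthogonal (K := G.graphRange) p.1)
    rwa [map_sub, sub_eq_zero] at h
  have hKo : K p.2 ∈ G.graphKerᗮ := hK.mem_orthogonal _ h0
  have hP : G.harmonicProj p.1 = z - b := by
    refine hG.harmonicProj_eq ⟨G.graphKer.sub_mem hz' (hG.graphRange_le_graphKer hb), ?_⟩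
      fun w hw => ?_
    · have h1 : p.1 - b ∈ G.graphRangeᗮ := sub_starProjection_mem_orthogonal p.1
      have h2 : K p.2 ∈ G.graphRangeᗮ :=
        Submodule.orthogonal_le hG.graphRange_le_graphKer hKo
      have := G.graphRangeᗮ.sub_mem h1 h2
      rwa [show p.1 - b - K p.2 = z - b by rw [hz]; abel] at this
    · rw [show p.1 - (z - b) = K p.2 + b by rw [hz]; abel, inner_add_left,
        (Submodule.mem_orthogonal' _ _).1 hKo w hw.1, (Submodule.mem_orthogonal _ _).1 hw.2 b hb,
        add_zero]
  rw [hP, hKb, show p.1 - (z - b) - K p.2 = b by rw [hz]; abel]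
  exact hK.mem_graph b hb

/-- `d K x` is the orthogonal projection of `x` to the range. -/
lemma exists_mem_graph (hcl : IsClosed (G.graphRange : Set V))
    (hK : G.IsCanonicalInverse K) (x : V) : ∃ y ∈ G.graphRange, (K x, y) ∈ G ∧ x - y ∈ G.graphRangeᗮ := by
  have : CompleteSpace G.graphRange := hcl.completeSpace_coe
  have h := hK.eq_zero _ (sub_starProjection_mem_orthogonal (K := G.graphRange) x)
  rw [map_sub, sub_eq_zero] at h
  refine ⟨G.graphRange.starProjection x, starProjection_apply_mem _ _, ?_,
    sub_starProjection_mem_orthogonal x⟩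
  rw [h]
  exact hK.mem_graph _ (starProjection_apply_mem _ _)

/-- The canonical inverse is odd, like `d` itself. -/
lemma parity_canonicalInverse (hG : IsHilbertComplex τ G) (hcl : IsClosed (G.graphRange : Set V))
    (hK : G.IsCanonicalInverse K) (x : V) : K (τ x) = - τ (K x) := by
  have hτR : ∀ y ∈ G.graphRange, τ y ∈ G.graphRange := fun y hy => by
    obtain ⟨x, hx⟩ := mem_graphRange.1 hy
    refine mem_graphRange.2 ⟨-τ x, ?_⟩
    have := G.neg_mem (hG.parity_mem _ hx)
    rwa [Prod.neg_mk, neg_neg] at this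
  have hτZ : ∀ y ∈ G.graphKer, τ y ∈ G.graphKer := fun y hy => by
    have := hG.parity_mem _ (mem_graphKer.1 hy)
    rwa [map_zero, neg_zero] at this
  obtain ⟨y, hy, hKy, hxy⟩ := exists_mem_graph hcl hK x
  have h1 : K x = K y := by
    have := hK.eq_zero _ hxy
    rwa [map_sub, sub_eq_zero] at this
  have h2 : K (τ x) = K (τ y) := by
    have := hK.eq_zero (τ (x - y)) ((Submodule.mem_orthogonal _ _).2 fun w hw => by
      rw [← hG.inner_parity]
      exact (Submodule.mem_orthogonal _ _).1 hxy _ (hτR w hw))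
    rwa [map_sub, map_sub, sub_eq_zero] at this
  have h3 := hK.mem_orthogonal _ (hτR y hy)
  have h4 : τ (K y) ∈ G.graphKerᗮ := (Submodule.mem_orthogonal _ _).2 fun w hw => by
    rw [← hG.inner_parity]
    exact (Submodule.mem_orthogonal _ _).1 (hK.mem_orthogonal y hy) _ (hτZ w hw)
  have h5 := G.add_mem (hK.mem_graph _ (hτR y hy)) (hG.parity_mem _ (hK.mem_graph y hy))
  rw [Prod.mk_add_mk, add_neg_cancel] at h5
  have h6 := inner_self_eq_zero.1
    ((Submodule.mem_orthogonal _ _).1 (G.graphKerᗮ.add_mem h3 h4) _ h5)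
  rw [h1, h2]
  exact eq_neg_of_add_eq_zero_left h6

lemma parity_harmonicProj (hG : IsHilbertComplex τ G) (x : V) : G.harmonicProj (τ x) = τ (G.harmonicProj x) := by
  have hτH : ∀ y ∈ G.harmonics, τ y ∈ G.harmonics := fun y hy => by
    have h2 := hG.parity_mem _ (mem_graphKer.1 hy.1)
    rw [map_zero, neg_zero] at h2
    refine ⟨h2, (Submodule.mem_orthogonal _ _).2 fun w hw => ?_⟩
    obtain ⟨v, hv⟩ := mem_graphRange.1 hw
    have h1 := G.neg_mem (hG.parity_mem _ hv)
    rw [Prod.neg_mk, neg_neg] at h1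
    rw [← hG.inner_parity]
    exact (Submodule.mem_orthogonal _ _).1 hy.2 _ (mem_graphRange.2 ⟨_, h1⟩)
  refine hG.harmonicProj_eq (hτH _ (hG.harmonicProj_mem x)) fun w hw => ?_
  rw [← map_sub, hG.inner_parity, inner_sub_left, inner_harmonicProj,
    harmonicProj_of_mem (hτH w hw), sub_self]

end IsHilbertComplex

end HilbertComplex

/-! ### Tensor products of bounded operators -/

section TensorOperators

variable {ι : Type*} [Fintype ι] {V : ι → Type*} {H : Type*} [∀ j, NormedAddCommGroup (V j)]
  [∀ j, InnerProductSpace ℂ (V j)] [∀ j, CompleteSpace (V j)] [NormedAddCommGroup H]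
  [InnerProductSpace ℂ H] {t : MultilinearMap ℂ V H}

/-- An operator acting on one factor. It is bounded since `‖A‖² - A* A` is of the form `C* C`: the
difference of the two sides of the estimate is the square of the norm of the vector obtained with
`C` in place of `A`. -/
lemma IsHilbertTensorProduct.exists_slot (ht : IsHilbertTensorProduct t) [DecidableEq ι] (i : ι)
    (A : V i →L[ℂ] V i) : ∃ T : H →L[ℂ] H, ∀ x, T (t x) = t (Function.update x i (A (x i))) := by
  have := ht.completeSpace
  obtain ⟨C, hC⟩ := CStarAlgebra.nonneg_iff_eq_star_mul_self.1
    (sub_nonneg.2 (CStarAlgebra.star_mul_le_algebraMap_norm_sq (a := A)))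
  have hC' : ∀ x y, ⟪C x, C y⟫_ℂ = (‖A‖ ^ 2 : ℝ) * ⟪x, y⟫_ℂ - ⟪A x, A y⟫_ℂ := fun x y => by
    have h1 := congrArg (fun B : V i →L[ℂ] V i => ⟪x, B y⟫_ℂ) hC
    simp only [ContinuousLinearMap.star_eq_adjoint, ContinuousLinearMap.mul_def,
      ContinuousLinearMap.comp_apply, ContinuousLinearMap.adjoint_inner_right, sub_apply,
      inner_sub_right, Algebra.algebraMap_eq_smul_one, smul_apply] at h1
    rw [← h1]
    congr 1
    exact inner_smul_right_eq_smul x y (‖A‖ ^ 2)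
  -- finite linear combinations of tensors
  let S : (V i →L[ℂ] V i) → ((∀ j, V j) →₀ ℂ) →ₗ[ℂ] H := fun B =>
    Finsupp.linearCombination ℂ fun x => t (Function.update x i (B (x i)))
  let S₀ : ((∀ j, V j) →₀ ℂ) →ₗ[ℂ] H := Finsupp.linearCombination ℂ t
  have hinner : ∀ (B : V i →L[ℂ] V i) (e : (∀ j, V j) →₀ ℂ), ⟪S B e, S B e⟫_ℂ = ∑ x ∈ e.support, ∑ y ∈ e.support,
      conj (e x) * (e y * (⟪B (x i), B (y i)⟫_ℂ * ∏ j ∈ Finset.univ.erase i, ⟪x j, y j⟫_ℂ)) := by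
    intro B e
    simp only [S, Finsupp.linearCombination_apply, Finsupp.sum]
    rw [sum_inner]
    refine Finset.sum_congr rfl fun x _ => ?_
    rw [inner_sum]
    refine Finset.sum_congr rfl fun y _ => ?_
    rw [inner_smul_left, inner_smul_right, ht.inner_apply,
      ← Finset.mul_prod_erase _ _ (Finset.mem_univ i), Function.update_self, Function.update_self]
    congr 3
    refine Finset.prod_congr rfl fun j hj => ?_
    rw [Function.update_of_ne (Finset.ne_of_mem_erase hj),
      Function.update_of_ne (Finset.ne_of_mem_erase hj)]
  have hid : S (ContinuousLinearMap.id ℂ _) = S₀ := by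
    simp only [S, S₀, ContinuousLinearMap.id_apply, Function.update_eq_self]
  have hbound : ∀ e, ‖S A e‖ ≤ ‖A‖ * ‖S₀ e‖ := by
    intro e
    have h1 : ⟪S C e, S C e⟫_ℂ = (‖A‖ ^ 2 : ℝ) * ⟪S₀ e, S₀ e⟫_ℂ - ⟪S A e, S A e⟫_ℂ := by
      rw [← hid, hinner, hinner, hinner, Finset.mul_sum, ← Finset.sum_sub_distrib]
      refine Finset.sum_congr rfl fun x _ => ?_
      rw [Finset.mul_sum, ← Finset.sum_sub_distrib]
      refine Finset.sum_congr rfl fun y _ => ?_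
      rw [hC', ContinuousLinearMap.id_apply, ContinuousLinearMap.id_apply]
      ring
    have h2 : 0 ≤ ‖A‖ ^ 2 * ‖S₀ e‖ ^ 2 - ‖S A e‖ ^ 2 := by
      have h3 := congrArg Complex.re h1
      rw [Complex.sub_re, Complex.re_ofReal_mul] at h3
      have h4 : ∀ v : H, (⟪v, v⟫_ℂ).re = ‖v‖ ^ 2 := fun v => (norm_sq_eq_re_inner (𝕜 := ℂ) v).symm
      rw [h4, h4, h4] at h3
      rw [← h3]
      positivity
    refine (pow_le_pow_iff_left₀ (norm_nonneg _) (by positivity) two_ne_zero).1 ?_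
    rw [mul_pow]
    linarith
  have hdense : DenseRange S₀ := by
    have : Set.range S₀ = (Submodule.span ℂ (Set.range t) : Set H) := by
      rw [← Finsupp.range_linearCombination]
      rfl
    rw [DenseRange, this]
    exact ht.dense_span
  refine ⟨(S A).extendOfNorm S₀, fun x => ?_⟩
  have h1 := LinearMap.extendOfNorm_eq hdense ⟨‖A‖, hbound⟩ (Finsupp.single x 1)
  simp only [S₀, S, Finsupp.linearCombination_single, one_smul] at h1
  exact h1

/-- Bounded operators `A i` have a tensor product. -/
lemma IsHilbertTensorProduct.exists_map (ht : IsHilbertTensorProduct t)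
    (A : ∀ i, V i →L[ℂ] V i) : ∃ T : H →L[ℂ] H, ∀ x, T (t x) = t fun i => A i (x i) := by
  classical
  suffices h : ∀ s : Finset ι, ∃ T : H →L[ℂ] H, ∀ x,
      T (t x) = t fun i => if i ∈ s then A i (x i) else x i by
    obtain ⟨T, hT⟩ := h Finset.univ
    exact ⟨T, fun x => by simpa using hT x⟩
  intro s
  induction s using Finset.induction_on with
  | empty => exact ⟨ContinuousLinearMap.id ℂ H, fun x => by simp⟩
  | insert a s ha ih =>
    obtain ⟨T, hT⟩ := ih
    obtain ⟨T', hT'⟩ := ht.exists_slot a (A a)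
    refine ⟨T'.comp T, fun x => ?_⟩
    rw [ContinuousLinearMap.comp_apply, hT, hT']
    congr 1
    funext i
    rcases eq_or_ne i a with rfl | hi
    · simp [ha]
    · simp [hi]

/-- The tensor product of bounded operators. -/
def IsHilbertTensorProduct.map (ht : IsHilbertTensorProduct t) (A : ∀ i, V i →L[ℂ] V i) : H →L[ℂ] H :=
  (ht.exists_map A).choose

lemma IsHilbertTensorProduct.map_apply (ht : IsHilbertTensorProduct t) (A : ∀ i, V i →L[ℂ] V i)
    (x : ∀ i, V i) : ht.map A (t x) = t fun i => A i (x i) :=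
  (ht.exists_map A).choose_spec x

/-- The tensor product of operators is compatible with adjoints. -/
lemma IsHilbertTensorProduct.inner_map (ht : IsHilbertTensorProduct t) {A B : ∀ i, V i →L[ℂ] V i}
    (hAB : ∀ i x y, ⟪A i x, y⟫_ℂ = ⟪x, B i y⟫_ℂ) (u v : H) :
    ⟪ht.map A u, v⟫_ℂ = ⟪u, ht.map B v⟫_ℂ := by
  have := ht.completeSpace
  have h1 : ∀ y w, ⟪t y, ht.map A w⟫_ℂ = ⟪ht.map B (t y), w⟫_ℂ := fun y w => by
    have h2 : innerSL ℂ (t y) ∘SL ht.map A = innerSL ℂ (ht.map B (t y)) := ht.ext_clm fun x => by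
      rw [ContinuousLinearMap.comp_apply, ht.map_apply, ht.map_apply, innerSL_apply_apply,
        innerSL_apply_apply, ht.inner_apply, ht.inner_apply]
      refine Finset.prod_congr rfl fun i _ => ?_
      rw [← inner_conj_symm, hAB, inner_conj_symm]
    exact DFunLike.congr_fun h2 w
  have h3 : (ht.map A).adjoint = ht.map B := ht.ext_clm fun y => ext_inner_right ℂ fun w => by
    rw [ContinuousLinearMap.adjoint_inner_left, h1]
  rw [← h3, ContinuousLinearMap.adjoint_inner_right]

end TensorOperators

/-! ### A parametrix of a Hilbert complex -/

section Parametrix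

variable {V : Type*} [NormedAddCommGroup V] [InnerProductSpace ℂ V] [CompleteSpace V]
  {τ K : V →L[ℂ] V} {G : Submodule ℂ (V × V)}

open Submodule ContinuousLinearMap

/-- The injective selfadjoint operator `A = P + K K* + K* K`; it satisfies `d A = K*` and
`d* A = K`, so that it maps everything into the domains of `d` and of `d*`. -/
def parametrix (G : Submodule ℂ (V × V)) (K : V →L[ℂ] V) : V →L[ℂ] V :=
  G.harmonicProj + K ∘L K.adjoint + K.adjoint ∘L K

lemma parametrix_apply (x : V) :
    parametrix G K x = G.harmonicProj x + K (K.adjoint x) + K.adjoint (K x) := rfl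

lemma inner_parametrix (x y : V) : ⟪parametrix G K x, y⟫_ℂ = ⟪x, parametrix G K y⟫_ℂ := by
  simp only [parametrix_apply, inner_add_left, inner_add_right, adjoint_inner_left,
    adjoint_inner_right, IsHilbertComplex.inner_harmonicProj]
  rw [← adjoint_inner_right K (K.adjoint x), adjoint_inner_left]

namespace IsHilbertComplex

lemma adjoint_mem_graphRange (hcl : IsClosed (G.graphRange : Set V))
    (hK : G.IsCanonicalInverse K) (x : V) : K.adjoint x ∈ G.graphRange := by
  have : CompleteSpace G.graphRange := hcl.completeSpace_coe
  rw [← orthogonal_orthogonal G.graphRange]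
  refine (Submodule.mem_orthogonal' _ _).2 fun w hw => ?_
  rw [adjoint_inner_left, hK.eq_zero w hw, inner_zero_right]

lemma adjoint_eq_zero (hcl : IsClosed (G.graphRange : Set V))
    (hK : G.IsCanonicalInverse K) {x : V} (hx : x ∈ G.graphKer) : K.adjoint x = 0 := by
  refine ext_inner_right ℂ fun w => ?_
  rw [adjoint_inner_left, inner_zero_left]
  exact (Submodule.mem_orthogonal _ _).1 (canonicalInverse_mem hcl hK w) x hx

/-- `d A = K*` -/
lemma parametrix_mem (hG : IsHilbertComplex τ G) (hcl : IsClosed (G.graphRange : Set V))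
    (hK : G.IsCanonicalInverse K) (x : V) : (parametrix G K x, K.adjoint x) ∈ G := by
  have h1 : (G.harmonicProj x, 0) ∈ G := (hG.harmonicProj_mem x).1
  have h2 := hK.mem_graph _ (adjoint_mem_graphRange hcl hK x)
  have h3 : (K.adjoint (K x), 0) ∈ G :=
    hG.graphRange_le_graphKer (adjoint_mem_graphRange hcl hK (K x))
  simpa [parametrix_apply] using G.add_mem (G.add_mem h1 h2) h3

lemma harmonicProj_mem_adjoint (hG : IsHilbertComplex τ G) (x : V) :
    (G.harmonicProj x, 0) ∈ G.adjoint := by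
  refine (mem_adjoint_iff _ _).2 fun a b hab => ?_
  rw [inner_zero_right, sub_zero]
  exact (Submodule.mem_orthogonal _ _).1 (hG.harmonicProj_mem x).2 b (mem_graphRange.2 ⟨a, hab⟩)

/-- `d* A = K` -/
lemma parametrix_mem_adjoint (hG : IsHilbertComplex τ G) (hcl : IsClosed (G.graphRange : Set V))
    (hK : G.IsCanonicalInverse K) (x : V) : (parametrix G K x, K x) ∈ G.adjoint := by
  refine (mem_adjoint_iff _ _).2 fun a b hab => ?_
  have hb := mem_graphRange.2 ⟨a, hab⟩
  have h1 : ⟪b, G.harmonicProj x⟫_ℂ = 0 :=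
    (Submodule.mem_orthogonal _ _).1 (hG.harmonicProj_mem x).2 b hb
  have h2 : ⟪b, K (K.adjoint x)⟫_ℂ = 0 := (Submodule.mem_orthogonal _ _).1
    (canonicalInverse_mem hcl hK _) b (hG.graphRange_le_graphKer hb)
  have h3 : a - K b ∈ G.graphKer := by
    have := G.sub_mem hab (hK.mem_graph b hb)
    rwa [Prod.mk_sub_mk, sub_self] at this
  have h4 : ⟪a - K b, K x⟫_ℂ = 0 :=
    (Submodule.mem_orthogonal _ _).1 (canonicalInverse_mem hcl hK x) _ h3
  rw [inner_sub_left, sub_eq_zero] at h4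
  rw [parametrix_apply, inner_add_right, inner_add_right, h1, h2, adjoint_inner_right, h4]
  ring

lemma parity_parametrix (hG : IsHilbertComplex τ G) (hcl : IsClosed (G.graphRange : Set V))
    (hK : G.IsCanonicalInverse K) (x : V) :
    parametrix G K (τ x) = τ (parametrix G K x) := by
  have h1 : ∀ x, K.adjoint (τ x) = - τ (K.adjoint x) := fun x => ext_inner_right ℂ fun w => by
    rw [adjoint_inner_left, hG.inner_parity, inner_neg_left, hG.inner_parity, adjoint_inner_left,
      hG.parity_canonicalInverse hcl hK, inner_neg_right, neg_neg]
  simp only [parametrix_apply, h1, hG.parity_canonicalInverse hcl hK, hG.parity_harmonicProj,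
    map_neg, neg_neg, map_add]

/-- `⟪A x, x⟫ = ‖P x‖² + ‖K* x‖² + ‖K x‖²`. If this is zero, then `x` is orthogonal to the range by
`K x = 0` and in the kernel by `K* x = 0`, thus harmonic, and `x = P x = 0`. -/
lemma parametrix_injective (hG : IsHilbertComplex τ G) (hcl : IsClosed (G.graphRange : Set V))
    (hK : G.IsCanonicalInverse K) {x : V} (hx : parametrix G K x = 0) : x = 0 := by
  have h0 : ‖G.harmonicProj x‖ ^ 2 + ‖K.adjoint x‖ ^ 2 + ‖K x‖ ^ 2 = 0 := by
    have h1 : ⟪parametrix G K x, x⟫_ℂ = 0 := by rw [hx, inner_zero_left]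
    have h2 : ⟪G.harmonicProj x, x⟫_ℂ = ⟪G.harmonicProj x, G.harmonicProj x⟫_ℂ := by
      rw [← inner_harmonicProj, harmonicProj_of_mem (hG.harmonicProj_mem x)]
    rw [parametrix_apply, inner_add_left, inner_add_left, adjoint_inner_left, h2,
      ← adjoint_inner_right K (K.adjoint x)] at h1
    have h4 : ∀ v : V, (⟪v, v⟫_ℂ).re = ‖v‖ ^ 2 := fun v => (norm_sq_eq_re_inner (𝕜 := ℂ) v).symm
    have h5 := congrArg Complex.re h1
    rwa [Complex.add_re, Complex.add_re, h4, h4, h4, Complex.zero_re] at h5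
  have hP : G.harmonicProj x = 0 := by
    have : ‖G.harmonicProj x‖ ^ 2 = 0 := by
      nlinarith [sq_nonneg ‖G.harmonicProj x‖, sq_nonneg ‖K.adjoint x‖, sq_nonneg ‖K x‖]
    simpa using this
  have hKs : K.adjoint x = 0 := by
    have : ‖K.adjoint x‖ ^ 2 = 0 := by
      nlinarith [sq_nonneg ‖G.harmonicProj x‖, sq_nonneg ‖K.adjoint x‖, sq_nonneg ‖K x‖]
    simpa using this
  have hKx : K x = 0 := by
    have : ‖K x‖ ^ 2 = 0 := by
      nlinarith [sq_nonneg ‖G.harmonicProj x‖, sq_nonneg ‖K.adjoint x‖, sq_nonneg ‖K x‖]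
    simpa using this
  -- `x` is orthogonal to the range
  obtain ⟨y, hy, hxy, ho⟩ := exists_mem_graph hcl hK x
  rw [hKx] at hxy
  rw [hG.unique y hxy, sub_zero] at ho
  -- the component of `x` orthogonal to the kernel is orthogonal to the domain
  have : CompleteSpace G.graphKer := hG.isClosed_graphKer.completeSpace_coe
  have hw : x - G.graphKer.starProjection x = 0 := by
    refine hG.eq_zero_of_inner _ fun p hp => ?_
    have h1 := sub_starProjection_mem_orthogonal (K := G.graphKer) x
    have hr : p.2 ∈ G.graphRange := mem_graphRange.2 ⟨_, hp⟩
    have h2 : p.1 - K p.2 ∈ G.graphKer := by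
      have := G.sub_mem hp (hK.mem_graph _ hr)
      rwa [show p - (K p.2, p.2) = (p.1 - K p.2, 0) from Prod.ext rfl (sub_self _)] at this
    have h3 := (Submodule.mem_orthogonal _ _).1 h1 _ h2
    rw [inner_sub_left, sub_eq_zero] at h3
    rw [h3, ← adjoint_inner_right, map_sub, hKs,
      adjoint_eq_zero hcl hK (starProjection_apply_mem G.graphKer x), sub_zero, inner_zero_right]
  have hxZ : x ∈ G.graphKer := by
    rw [sub_eq_zero.1 hw]
    exact starProjection_apply_mem _ _
  rw [← hP, harmonicProj_of_mem ⟨hxZ, ho⟩]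

end IsHilbertComplex

end Parametrix

/-! ### Tensor products of Hilbert complexes -/

section TensorComplex

variable {ι : Type*} [Fintype ι] [LinearOrder ι] {V : ι → Type*} {H : Type*}
  [∀ j, NormedAddCommGroup (V j)] [∀ j, InnerProductSpace ℂ (V j)] [∀ j, CompleteSpace (V j)]
  [NormedAddCommGroup H] [InnerProductSpace ℂ H]

open Submodule

/-- The operators with index `i` in the `j`-th summand of the operators
`∑ j, L₁ ⊗ ⋯ ⊗ M_j ⊗ ⋯ ⊗ R_N`. -/
def leibnizOp (L M R : ∀ i, V i →L[ℂ] V i) (j i : ι) : V i →L[ℂ] V i :=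
  if i < j then L i else if i = j then M i else R i

lemma leibnizSlot_eq_leibnizOp (τ A M : ∀ i, V i →L[ℂ] V i) (j i : ι) (x : V i) :
    leibnizSlot (fun i => (τ i).toLinearMap) j i (A i x, M i x) =
      leibnizOp (fun i => τ i ∘L A i) M A j i x := by
  unfold leibnizSlot leibnizOp
  split_ifs <;> rfl

/-- The operator with graph `D` on the Hilbert space tensor product `H` extends the operator given
by the Leibniz rule, and so does its adjoint. -/
structure IsTensorComplex (t : MultilinearMap ℂ V H) (τ : ∀ i, V i →L[ℂ] V i)
    (G : ∀ i, Submodule ℂ (V i × V i)) (σ : H →L[ℂ] H) (D : Submodule ℂ (H × H)) : Prop where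
  tensor : IsHilbertTensorProduct t
  factor : ∀ i, IsHilbertComplex (τ i) (G i)
  isClosed_range : ∀ i, IsClosed ((G i).graphRange : Set (V i))
  complex : IsHilbertComplex σ D
  mem : ∀ p : ∀ i, V i × V i, (∀ i, p i ∈ G i) →
    (t fun i => (p i).1, leibniz (fun i => (τ i).toLinearMap) t p) ∈ D
  mem_adjoint : ∀ p : ∀ i, V i × V i, (∀ i, p i ∈ (G i).adjoint) →
    (t fun i => (p i).1, leibniz (fun i => (τ i).toLinearMap) t p) ∈ D.adjoint

namespace IsTensorComplex

variable {t : MultilinearMap ℂ V H} {τ : ∀ i, V i →L[ℂ] V i} {G : ∀ i, Submodule ℂ (V i × V i)}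
  {σ : H →L[ℂ] H} {D : Submodule ℂ (H × H)} {K : ∀ i, V i →L[ℂ] V i}

/-- The elements of the graph that come from tensors. -/
def tensorGraph (t : MultilinearMap ℂ V H) (τ : ∀ i, V i →L[ℂ] V i)
    (G : ∀ i, Submodule ℂ (V i × V i)) : Submodule ℂ (H × H) :=
  (Submodule.span ℂ {q | ∃ p : ∀ i, V i × V i, (∀ i, p i ∈ G i) ∧
    q = (t fun i => (p i).1, leibniz (fun i => (τ i).toLinearMap) t p)}).topologicalClosure

lemma tensorGraph_le (h : IsTensorComplex t τ G σ D) : tensorGraph t τ G ≤ D := by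
  refine topologicalClosure_minimal _ (span_le.2 ?_) h.complex.isClosed
  rintro _ ⟨p, hp, rfl⟩
  exact h.mem p hp

/-- The tensor product of the operators `A` of the factors. -/
def parametrixMap (h : IsTensorComplex t τ G σ D) (K : ∀ i, V i →L[ℂ] V i) : H →L[ℂ] H :=
  h.tensor.map fun i => parametrix (G i) (K i)

/-- The operator given by the Leibniz rule for `d A = K*`. -/
def dParametrixMap (h : IsTensorComplex t τ G σ D) (K : ∀ i, V i →L[ℂ] V i) : H →L[ℂ] H :=
  ∑ j, h.tensor.map (leibnizOp (fun i => τ i ∘L parametrix (G i) (K i))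
    (fun i => (K i).adjoint) (fun i => parametrix (G i) (K i)) j)

/-- The operator `⊗ A_i` maps everything into the domain, and its values are limits of tensors in
the graph norm. -/
lemma parametrixMap_mem (h : IsTensorComplex t τ G σ D)
    (hK : ∀ i, (G i).IsCanonicalInverse (K i)) (w : H) :
    (h.parametrixMap K w, h.dParametrixMap K w) ∈ tensorGraph t τ G := by
  let M : H →L[ℂ] H × H := (h.parametrixMap K).prod (h.dParametrixMap K)
  have hC : IsClosed (((tensorGraph t τ G).comap M.toLinearMap : Submodule ℂ H) : Set H) :=
    (isClosed_topologicalClosure _).preimage M.continuous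
  have hle : (span ℂ (Set.range t)).topologicalClosure ≤ (tensorGraph t τ G).comap M.toLinearMap := by
    refine topologicalClosure_minimal _ (span_le.2 ?_) hC
    rintro _ ⟨x, rfl⟩
    refine le_topologicalClosure _ (subset_span ⟨fun i => (parametrix (G i) (K i) (x i),
      (K i).adjoint (x i)), fun i => (h.factor i).parametrix_mem (h.isClosed_range i) (hK i) _, ?_⟩)
    refine Prod.ext (h.tensor.map_apply _ x) ?_
    change (h.dParametrixMap K) (t x) = _
    rw [dParametrixMap, sum_apply, leibniz_apply]
    refine Finset.sum_congr rfl fun j _ => (h.tensor.map_apply _ x).trans (congrArg t ?_)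
    funext i
    exact (leibnizSlot_eq_leibnizOp τ (fun i => parametrix (G i) (K i)) (fun i => (K i).adjoint)
      j i (x i)).symm
  rw [dense_iff_topologicalClosure_eq_top.1 h.tensor.dense_span] at hle
  exact hle (mem_top (x := w))

/-- The operator `⊗ A_i` commutes with `d` on the domain. By duality, this is the Leibniz rule for the
adjoint, because the operators `A_i` are selfadjoint and `d* A_i = K_i`. -/
lemma dParametrixMap_fst (h : IsTensorComplex t τ G σ D)
    (hK : ∀ i, (G i).IsCanonicalInverse (K i)) {p : H × H} (hp : p ∈ D) :
    h.dParametrixMap K p.1 = h.parametrixMap K p.2 := by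
  refine sub_eq_zero.1 (h.tensor.eq_zero fun x => ?_)
  rw [inner_sub_right, sub_eq_zero]
  have h1 := h.mem_adjoint (fun i => (parametrix (G i) (K i) (x i), K i (x i))) fun i =>
    (h.factor i).parametrix_mem_adjoint (h.isClosed_range i) (hK i) (x i)
  have h2 := sub_eq_zero.1 ((mem_adjoint_iff _ _).1 h1 p.1 p.2 hp)
  have h3 : ⟪t x, h.parametrixMap K p.2⟫_ℂ = ⟪t fun i => parametrix (G i) (K i) (x i), p.2⟫_ℂ := by
    rw [← h.tensor.map_apply (fun i => parametrix (G i) (K i)) x]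
    exact (h.tensor.inner_map (fun i => inner_parametrix) _ _).symm
  have h5 := congrArg conj h2
  rw [inner_conj_symm, inner_conj_symm] at h5
  refine Eq.trans ?_ (h5.symm.trans h3.symm)
  rw [leibniz_apply, sum_inner, dParametrixMap, sum_apply, inner_sum]
  refine Finset.sum_congr rfl fun j _ => ?_
  have h4 := h.tensor.inner_map (A := leibnizOp (fun i => τ i ∘L parametrix (G i) (K i))
    K (fun i => parametrix (G i) (K i)) j) (B := leibnizOp (fun i => τ i ∘L parametrix (G i) (K i))
    (fun i => (K i).adjoint) (fun i => parametrix (G i) (K i)) j) (fun i x y => by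
      unfold leibnizOp
      split_ifs
      · rw [ContinuousLinearMap.comp_apply, ContinuousLinearMap.comp_apply,
          (h.factor i).inner_parity, inner_parametrix,
          (h.factor i).parity_parametrix (h.isClosed_range i) (hK i)]
      · rw [ContinuousLinearMap.adjoint_inner_right]
      · exact inner_parametrix x y) (t x) p.1
  rw [← h4, h.tensor.map_apply]
  congr 2
  funext i
  exact (leibnizSlot_eq_leibnizOp τ (fun i => parametrix (G i) (K i)) K j i (x i)).symm

/-- The ranges of the selfadjoint injective operators `A_i` are dense, and an element annihilated by
`⊗ A_i` is orthogonal to the tensors of elements of these ranges. -/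
lemma parametrixMap_injective (h : IsTensorComplex t τ G σ D)
    (hK : ∀ i, (G i).IsCanonicalInverse (K i)) {w : H} (hw : h.parametrixMap K w = 0) : w = 0 := by
  refine h.tensor.eq_zero fun x => ?_
  have h1 : ∀ y : ∀ i, V i, (∀ i, y i ∈ Set.range (parametrix (G i) (K i))) →
      t y ∈ (span ℂ {w})ᗮ := by
    intro y hy
    choose z hz using hy
    obtain rfl : (fun i => parametrix (G i) (K i) (z i)) = y := funext hz
    rw [mem_orthogonal_singleton_iff_inner_left,
      ← h.tensor.map_apply (fun i => parametrix (G i) (K i)) z]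
    refine (h.tensor.inner_map (fun i => inner_parametrix) _ _).trans ?_
    exact (congrArg _ hw).trans (inner_zero_right _)
  have h2 := t.mem_of_topologicalClosure_span h.tensor.continuous
    (isClosed_orthogonal _) h1 (p := x) fun i => ?_
  · exact mem_orthogonal_singleton_iff_inner_left.1 h2
  · have h3 : (span ℂ (Set.range (parametrix (G i) (K i)))).topologicalClosure = ⊤ := by
      refine topologicalClosure_eq_top_iff.2 ((Submodule.eq_bot_iff _).2 fun v hv => ?_)
      refine (h.factor i).parametrix_injective (h.isClosed_range i) (hK i)
        (ext_inner_left ℂ fun u => ?_)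
      rw [← inner_parametrix, inner_zero_right]
      exact (Submodule.mem_orthogonal _ _).1 hv _ (subset_span ⟨u, rfl⟩)
    rw [h3]
    exact mem_top

/-- The graph is the closed span of the tensors in it. An element of the graph which is orthogonal to
these tensors is annihilated by the injective operator `⊗ A_i`, which maps the graph to the closed
span of tensors. -/
theorem eq_tensorGraph (h : IsTensorComplex t τ G σ D)
    (hK : ∀ i, (G i).IsCanonicalInverse (K i)) : D = tensorGraph t τ G := by
  have := h.tensor.completeSpace
  refine le_antisymm (fun p hp => ?_) h.tensorGraph_le
  let e := WithLp.prodContinuousLinearEquiv 2 ℂ H H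
  let Γ : Submodule ℂ (WithLp 2 (H × H)) := (tensorGraph t τ G).comap e.toContinuousLinearMap.toLinearMap
  have hΓ : IsClosed (Γ : Set (WithLp 2 (H × H))) :=
    (isClosed_topologicalClosure _).preimage e.continuous
  have : CompleteSpace Γ := hΓ.completeSpace_coe
  -- the component of `p` orthogonal to the tensors, with respect to the graph norm
  set q : H × H := e (WithLp.toLp 2 p - Γ.starProjection (WithLp.toLp 2 p)) with hq
  have hΓp : e (Γ.starProjection (WithLp.toLp 2 p)) ∈ tensorGraph t τ G :=
    starProjection_apply_mem Γ _
  have hqp : q = p - e (Γ.starProjection (WithLp.toLp 2 p)) := map_sub e _ _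
  have hqD : q ∈ D := hqp ▸ D.sub_mem hp (h.tensorGraph_le hΓp)
  have horth : ∀ r ∈ tensorGraph t τ G, ⟪r.1, q.1⟫_ℂ + ⟪r.2, q.2⟫_ℂ = 0 := fun r hr =>
    (Submodule.mem_orthogonal _ _).1
      (sub_starProjection_mem_orthogonal (K := Γ) (WithLp.toLp 2 p)) (WithLp.toLp 2 r) hr
  -- with `A = ⊗ A_i`, the element `A A q` of the closed span of tensors is orthogonal to `q`, hence
  -- `‖A q.1‖² + ‖A q.2‖² = 0`
  have h1 := h.parametrixMap_mem hK q.1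
  have h2 := h.dParametrixMap_fst hK hqD
  have h3 := h.parametrixMap_mem hK (h.parametrixMap K q.1)
  have h4 := h.dParametrixMap_fst hK (h.tensorGraph_le h1)
  rw [h2] at h4
  have h5 := horth _ h3
  simp only [h4] at h5
  have hsa : ∀ u v, ⟪h.parametrixMap K u, v⟫_ℂ = ⟪u, h.parametrixMap K v⟫_ℂ :=
    h.tensor.inner_map fun i => inner_parametrix
  rw [hsa _ q.1, hsa _ q.2] at h5
  have h6 : ∀ v : H, (⟪v, v⟫_ℂ).re = ‖v‖ ^ 2 := fun v => (norm_sq_eq_re_inner (𝕜 := ℂ) v).symm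
  have h7 := congrArg Complex.re h5
  rw [Complex.add_re, h6, h6, Complex.zero_re] at h7
  have h8 : ∀ v, ‖h.parametrixMap K v‖ ^ 2 = 0 → v = 0 := fun v hv =>
    h.parametrixMap_injective hK (by simpa using hv)
  have h10 := sq_nonneg ‖h.parametrixMap K q.1‖
  have h11 := sq_nonneg ‖h.parametrixMap K q.2‖
  have hq1 := h8 q.1 (by linarith)
  have hq2 := h8 q.2 (by linarith)
  have h9 : q = 0 := Prod.ext hq1 hq2
  rw [hqp, sub_eq_zero] at h9
  rw [h9]
  exact hΓp

end IsTensorComplex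

end TensorComplex

/-! ### The homotopy formula on tensor products -/

section TensorHomotopy

variable {ι : Type*} [Fintype ι] [LinearOrder ι] {V : ι → Type*} {H : Type*}
  [∀ j, NormedAddCommGroup (V j)] [∀ j, InnerProductSpace ℂ (V j)] [∀ j, CompleteSpace (V j)]
  [NormedAddCommGroup H] [InnerProductSpace ℂ H] [CompleteSpace H]

namespace IsTensorComplex

open Submodule

variable {t : MultilinearMap ℂ V H} {τ : ∀ i, V i →L[ℂ] V i} {G : ∀ i, Submodule ℂ (V i × V i)}
  {σ : H →L[ℂ] H} {D : Submodule ℂ (H × H)} {K : ∀ i, V i →L[ℂ] V i}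

/-- The operator `τP ⊗ ⋯ ⊗ τP ⊗ K_j ⊗ 1 ⊗ ⋯ ⊗ 1`. -/
def solutionTerm (h : IsTensorComplex t τ G σ D) (K : ∀ i, V i →L[ℂ] V i) (j : ι) : H →L[ℂ] H :=
  h.tensor.map (leibnizOp (fun i => τ i ∘L (G i).harmonicProj) K
    (fun i => ContinuousLinearMap.id ℂ (V i)) j)

/-- The operator `∑ j, τP ⊗ ⋯ ⊗ τP ⊗ K_j ⊗ 1 ⊗ ⋯ ⊗ 1`. -/
def solution (h : IsTensorComplex t τ G σ D) (K : ∀ i, V i →L[ℂ] V i) : H →L[ℂ] H :=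
  ∑ j, h.solutionTerm K j

/-- The tensor product of the harmonic projections. -/
def harmonicMap (h : IsTensorComplex t τ G σ D) : H →L[ℂ] H :=
  h.tensor.map fun i => (G i).harmonicProj

lemma harmonicMap_mem_adjoint (h : IsTensorComplex t τ G σ D) (x : ∀ i, V i) :
    (t fun i => (G i).harmonicProj (x i), 0) ∈ D.adjoint := by
  have h1 := h.mem_adjoint (fun i => ((G i).harmonicProj (x i), 0)) fun i =>
    (h.factor i).harmonicProj_mem_adjoint (x i)
  rwa [leibniz_apply, Finset.sum_eq_zero fun j _ =>
    t.map_coord_zero j (leibnizSlot_self _ _)] at h1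

lemma harmonicMap_mem_graphKer (h : IsTensorComplex t τ G σ D) (w : H) :
    h.harmonicMap w ∈ D.graphKer := by
  have hC : IsClosed ((D.graphKer.comap h.harmonicMap.toLinearMap : Submodule ℂ H) : Set H) :=
    h.complex.isClosed_graphKer.preimage h.harmonicMap.continuous
  have hle : (span ℂ (Set.range t)).topologicalClosure ≤ D.graphKer.comap h.harmonicMap.toLinearMap := by
    refine topologicalClosure_minimal _ (span_le.2 ?_) hC
    rintro _ ⟨x, rfl⟩
    have h1 := h.mem (fun i => ((G i).harmonicProj (x i), 0)) fun i =>
      ((h.factor i).harmonicProj_mem (x i)).1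
    rw [leibniz_apply, Finset.sum_eq_zero fun j _ =>
      t.map_coord_zero j (leibnizSlot_self _ _)] at h1
    change h.harmonicMap (t x) ∈ D.graphKer
    rw [harmonicMap, h.tensor.map_apply]
    exact h1
  rw [dense_iff_topologicalClosure_eq_top.1 h.tensor.dense_span] at hle
  exact hle (mem_top (x := w))

lemma inner_harmonicMap (h : IsTensorComplex t τ G σ D) (u v : H) :
    ⟪h.harmonicMap u, v⟫_ℂ = ⟪u, h.harmonicMap v⟫_ℂ :=
  h.tensor.inner_map (fun i => IsHilbertComplex.inner_harmonicProj (G i)) u v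

lemma harmonicMap_of_mem_graphRange (h : IsTensorComplex t τ G σ D) {v : H}
    (hv : v ∈ D.graphRange) : h.harmonicMap v = 0 := by
  obtain ⟨u, hu⟩ := mem_graphRange.1 hv
  refine h.tensor.eq_zero fun x => ?_
  rw [← inner_harmonicMap, harmonicMap, h.tensor.map_apply, ← inner_conj_symm,
    sub_eq_zero.1 ((mem_adjoint_iff _ _).1 (h.harmonicMap_mem_adjoint x) u v hu),
    inner_zero_right, map_zero]

lemma harmonicMap_mem_harmonics (h : IsTensorComplex t τ G σ D) (w : H) :
    h.harmonicMap w ∈ D.harmonics :=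
  ⟨h.harmonicMap_mem_graphKer w, (Submodule.mem_orthogonal _ _).2 fun v hv => by
    rw [← inner_harmonicMap, h.harmonicMap_of_mem_graphRange hv, inner_zero_left]⟩

/-- The homotopy formula on tensors: in the Leibniz rule for `d (S f)` and in `S (d f)` the terms in
which `d` and `K` act on different factors cancel, and the remaining terms form a telescoping sum. -/
lemma solution_leibniz (h : IsTensorComplex t τ G σ D)
    (hK : ∀ i, (G i).IsCanonicalInverse (K i)) {p : ∀ i, V i × V i} (hp : ∀ i, p i ∈ G i) :
    (h.solution K (t fun i => (p i).1), (t fun i => (p i).1) - h.harmonicMap (t fun i => (p i).1) -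
      h.solution K (leibniz (fun i => (τ i).toLinearMap) t p)) ∈ D := by
  -- the derivative of `K`
  let r : ∀ i, V i := fun i => (p i).1 - (G i).harmonicProj (p i).1 - K i (p i).2
  have hr : ∀ i, (K i (p i).1, r i) ∈ G i := fun i =>
    (h.factor i).homotopy (h.isClosed_range i) (hK i) (hp i)
  -- the factors of the `j`-th term, with their derivatives
  let q : ι → ∀ i, V i × V i := fun j i => if i < j then (τ i ((G i).harmonicProj (p i).1), 0) else
    if i = j then (K i (p i).1, r i) else p i
  have hq : ∀ j i, q j i ∈ G i := by
    intro j i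
    simp only [q]
    split_ifs
    · have := (h.factor i).parity_mem _ ((h.factor i).harmonicProj_mem (p i).1).1
      simpa using this
    · exact hr i
    · exact hp i
  have hterm : ∀ j, (h.solutionTerm K j (t fun i => (p i).1),
      ∑ k, t fun i => leibnizSlot (fun i => (τ i).toLinearMap) k i (q j i)) ∈ D := by
    intro j
    have h1 := h.mem (q j) (hq j)
    rw [leibniz_apply] at h1
    have h2 : h.solutionTerm K j (t fun i => (p i).1) = t fun i => (q j i).1 := by
      rw [solutionTerm, h.tensor.map_apply]
      congr 1
      funext i
      simp only [leibnizOp, q]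
      split_ifs <;> rfl
    rwa [h2]
  have hsum := D.sum_mem (t := Finset.univ) fun j _ => hterm j
  have hfst : (∑ j, (h.solutionTerm K j (t fun i => (p i).1),
      ∑ k, t fun i => leibnizSlot (fun i => (τ i).toLinearMap) k i (q j i))) =
      (h.solution K (t fun i => (p i).1),
        ∑ j, ∑ k, t fun i => leibnizSlot (fun i => (τ i).toLinearMap) k i (q j i)) := by
    refine Prod.ext ?_ ?_
    · rw [Prod.fst_sum, solution, sum_apply]
    · rw [Prod.snd_sum]
  rw [hfst] at hsum
  convert hsum using 2
  have hS : h.solution K (leibniz (fun i => (τ i).toLinearMap) t p) = ∑ j, ∑ k,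
      t fun i => leibnizOp (fun i => τ i ∘L (G i).harmonicProj) K
        (fun i => ContinuousLinearMap.id ℂ (V i)) j i
          (leibnizSlot (fun i => (τ i).toLinearMap) k i (p i)) := by
    rw [solution, sum_apply]
    refine Finset.sum_congr rfl fun j _ => ?_
    rw [leibniz_apply, map_sum]
    exact Finset.sum_congr rfl fun k _ => h.tensor.map_apply _ _
  rw [hS, sub_eq_iff_eq_add, ← Finset.sum_add_distrib]
  simp only [← Finset.sum_add_distrib]
  have hττ : ∀ i x, τ i (τ i x) = x := fun i => (h.factor i).parity_parity
  have hPτ : ∀ i x, (G i).harmonicProj (τ i x) = τ i ((G i).harmonicProj x) := fun i =>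
    (h.factor i).parity_harmonicProj
  have hKτ : ∀ i x, K i (τ i x) = - τ i (K i x) := fun i =>
    (h.factor i).parity_canonicalInverse (h.isClosed_range i) (hK i)
  have hPy : ∀ i, (G i).harmonicProj (p i).2 = 0 := fun i =>
    (h.factor i).harmonicProj_of_mem_graphRange (mem_graphRange.2 ⟨_, hp i⟩)
  -- the terms of `d (S f)` and `S (d f)` in which `K` has the index `j` and `d` has the index `k`
  have hjk : ∀ j k, ((t fun i => leibnizSlot (fun i => (τ i).toLinearMap) k i (q j i)) +
      t fun i => leibnizOp (fun i => τ i ∘L (G i).harmonicProj) K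
        (fun i => ContinuousLinearMap.id ℂ (V i)) j i
          (leibnizSlot (fun i => (τ i).toLinearMap) k i (p i))) = if k = j then
      t (fun i => if i < j then (G i).harmonicProj (p i).1 else if i = j then
        (p i).1 - (G i).harmonicProj (p i).1 else (p i).1) else 0 := by
    intro j k
    rcases lt_trichotomy k j with hkj | rfl | hkj
    -- both terms vanish, by `d P = 0` and `P d = 0`
    · rw [if_neg hkj.ne, t.map_coord_zero k, t.map_coord_zero k, add_zero]
      · rw [leibnizSlot_self]
        simp [leibnizOp, hkj, hPy]
      · rw [leibnizSlot_self]
        simp [q, hkj]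
    -- the homotopy formula `d K + K d = 1 - P` on one factor
    · let w : ∀ i, V i := fun i => if i < k then (G i).harmonicProj (p i).1 else (p i).1
      have e1 : (fun i => leibnizSlot (fun i => (τ i).toLinearMap) k i (q k i)) =
          Function.update w k (r k) := by
        funext i
        rcases lt_trichotomy i k with hi | rfl | hi
        · rw [Function.update_of_ne hi.ne, leibnizSlot_of_lt _ hi]
          simp [q, w, hi, hττ]
        · rw [Function.update_self, leibnizSlot_self]
          simp [q]
        · rw [Function.update_of_ne hi.ne', leibnizSlot_of_gt _ hi]
          simp [q, w, hi.asymm, hi.ne']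
      have e2 : (fun i => leibnizOp (fun i => τ i ∘L (G i).harmonicProj) K
          (fun i => ContinuousLinearMap.id ℂ (V i)) k i
          (leibnizSlot (fun i => (τ i).toLinearMap) k i (p i))) =
          Function.update w k (K k (p k).2) := by
        funext i
        rcases lt_trichotomy i k with hi | rfl | hi
        · rw [Function.update_of_ne hi.ne, leibnizSlot_of_lt _ hi]
          simp [leibnizOp, w, hi, hττ, hPτ]
        · rw [Function.update_self, leibnizSlot_self]
          simp [leibnizOp]
        · rw [Function.update_of_ne hi.ne', leibnizSlot_of_gt _ hi]
          simp [leibnizOp, w, hi.asymm, hi.ne']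
      rw [e1, e2, ← t.map_update_add, if_pos rfl]
      congr 1
      funext i
      rcases eq_or_ne i k with rfl | hi
      · simp [r]
      · simp [hi, w]
    · -- the two families differ by the sign of the factor with index `j`
      rw [if_neg hkj.ne']
      have e1 : (fun i => leibnizOp (fun i => τ i ∘L (G i).harmonicProj) K
          (fun i => ContinuousLinearMap.id ℂ (V i)) j i
          (leibnizSlot (fun i => (τ i).toLinearMap) k i (p i))) =
          Function.update (fun i => leibnizSlot (fun i => (τ i).toLinearMap) k i (q j i)) j
            ((-1 : ℂ) • leibnizSlot (fun i => (τ i).toLinearMap) k j (q j j)) := by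
        funext i
        rcases lt_trichotomy i j with hi | rfl | hi
        · rw [Function.update_of_ne hi.ne, leibnizSlot_of_lt _ (hi.trans hkj),
            leibnizSlot_of_lt _ (hi.trans hkj)]
          simp [leibnizOp, q, hi, hττ, hPτ]
        · rw [Function.update_self, leibnizSlot_of_lt _ hkj, leibnizSlot_of_lt _ hkj]
          simp [leibnizOp, q, hKτ]
        · rw [Function.update_of_ne hi.ne']
          simp [leibnizOp, q, hi.asymm, hi.ne']
      rw [e1, t.map_update_smul, Function.update_eq_self, neg_one_smul, add_neg_cancel]
  simp only [hjk, Finset.sum_ite_eq', Finset.mem_univ, if_true]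
  -- the remaining sum telescopes to the difference of the tensors of `P x_i` and of `x_i`
  have htel := t.map_piecewise_sub_map_piecewise (fun i => (G i).harmonicProj (p i).1)
    (fun i => (p i).1) (fun i => (p i).1) Finset.univ
  simp only [Finset.piecewise_univ, Finset.mem_univ, if_true] at htel
  rw [harmonicMap, h.tensor.map_apply, ← neg_sub, htel, ← Finset.sum_neg_distrib]
  refine Finset.sum_congr rfl fun j _ => ?_
  have e1 : (fun i => if i < j then (G i).harmonicProj (p i).1 else if i = j then
      (G i).harmonicProj (p i).1 - (p i).1 else (p i).1) =
      Function.update (fun i => if i < j then (G i).harmonicProj (p i).1 else if i = j then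
        (p i).1 - (G i).harmonicProj (p i).1 else (p i).1) j
        ((-1 : ℂ) • ((p j).1 - (G j).harmonicProj (p j).1)) := by
    funext i
    rcases eq_or_ne i j with rfl | hi
    · simp
    · simp [hi]
  have e2 := t.map_update_smul (fun i => if i < j then (G i).harmonicProj (p i).1 else
    if i = j then (p i).1 - (G i).harmonicProj (p i).1 else (p i).1) j (-1)
    ((p j).1 - (G j).harmonicProj (p j).1)
  rw [e1, e2, neg_one_smul, neg_neg]
  congr 1
  funext i
  rcases eq_or_ne i j with rfl | hi
  · simp
  · simp [hi]

/-- The homotopy formula `d S + S d = 1 - P`. It extends from tensors to the whole graph, because the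
tensors in the graph span it and `d` is closed. -/
theorem homotopy_solution (h : IsTensorComplex t τ G σ D)
    (hK : ∀ i, (G i).IsCanonicalInverse (K i)) {p : H × H} (hp : p ∈ D) :
    (h.solution K p.1, p.1 - h.harmonicMap p.1 - h.solution K p.2) ∈ D := by
  let M : H × H →L[ℂ] H × H := ((h.solution K) ∘L ContinuousLinearMap.fst ℂ H H).prod
    (ContinuousLinearMap.fst ℂ H H - h.harmonicMap ∘L ContinuousLinearMap.fst ℂ H H -
      (h.solution K) ∘L ContinuousLinearMap.snd ℂ H H)
  have hC : IsClosed ((D.comap M.toLinearMap : Submodule ℂ (H × H)) : Set (H × H)) :=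
    h.complex.isClosed.preimage M.continuous
  have hle : tensorGraph t τ G ≤ D.comap M.toLinearMap := by
    refine topologicalClosure_minimal _ (span_le.2 ?_) hC
    rintro _ ⟨p, hp, rfl⟩
    exact h.solution_leibniz hK hp
  rw [h.eq_tensorGraph hK] at hp
  exact hle hp

lemma sub_harmonicMap_mem_graphRange (h : IsTensorComplex t τ G σ D)
    (hK : ∀ i, (G i).IsCanonicalInverse (K i)) {w : H} (hw : w ∈ D.graphKer) :
    w - h.harmonicMap w ∈ D.graphRange := by
  have h1 := h.homotopy_solution hK (mem_graphKer.1 hw)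
  rw [map_zero, sub_zero] at h1
  exact mem_graphRange.2 ⟨_, h1⟩

/-- The range consists of the closed elements without harmonic component, and thus it is closed. -/
lemma mem_graphRange_iff (h : IsTensorComplex t τ G σ D)
    (hK : ∀ i, (G i).IsCanonicalInverse (K i)) {w : H} :
    w ∈ D.graphRange ↔ w ∈ D.graphKer ∧ h.harmonicMap w = 0 := by
  refine ⟨fun hw => ⟨h.complex.graphRange_le_graphKer hw, h.harmonicMap_of_mem_graphRange hw⟩,
    fun hw => ?_⟩
  have := h.sub_harmonicMap_mem_graphRange hK hw.1
  rwa [hw.2, sub_zero] at this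

lemma isClosed_graphRange (h : IsTensorComplex t τ G σ D)
    (hK : ∀ i, (G i).IsCanonicalInverse (K i)) : IsClosed (D.graphRange : Set H) := by
  have : (D.graphRange : Set H) = (D.graphKer : Set H) ∩ {w | h.harmonicMap w = 0} := by
    ext w
    exact h.mem_graphRange_iff hK
  rw [this]
  exact h.complex.isClosed_graphKer.inter
    (isClosed_eq h.harmonicMap.continuous continuous_const)

lemma harmonicProj_eq_harmonicMap (h : IsTensorComplex t τ G σ D)
    (hK : ∀ i, (G i).IsCanonicalInverse (K i)) : D.harmonicProj = h.harmonicMap := by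
  ext w
  refine h.complex.harmonicProj_eq (h.harmonicMap_mem_harmonics w) fun v hv => ?_
  have h1 := h.sub_harmonicMap_mem_graphRange hK hv.1
  have h2 := D.graphRangeᗮ.sub_mem hv.2 (h.harmonicMap_mem_harmonics v).2
  have h3 := inner_self_eq_zero.1 ((Submodule.mem_orthogonal _ _).1 h2 _ h1)
  rw [inner_sub_left, inner_harmonicMap, ← sub_eq_zero.1 h3, sub_self]

lemma solution_mem (h : IsTensorComplex t τ G σ D)
    (hK : ∀ i, (G i).IsCanonicalInverse (K i)) {f : H} (hf : f ∈ D.graphRange) :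
    (h.solution K f, f) ∈ D := by
  have h1 := h.homotopy_solution hK (mem_graphKer.1 (h.complex.graphRange_le_graphKer hf))
  rwa [map_zero, sub_zero, h.harmonicMap_of_mem_graphRange hf, sub_zero] at h1

end IsTensorComplex

end TensorHomotopy

/-! ### The Cauchy-Riemann complex of a product -/

namespace HermitianManifold

section Complex

variable {X : HermitianManifold.{u, v}} {Ω : Set X} {φ : X → ℝ}

/-- `∂̄` anticommutes with `τ`. -/
lemma parity_mem_dbarGraph {p : X.L2 Ω φ × X.L2 Ω φ} (hp : p ∈ X.dbarGraph Ω φ) :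
    (parity p.1, -parity p.2) ∈ X.dbarGraph Ω φ := by
  obtain ⟨f, g, hf, hg, hfg⟩ := hp
  rw [← hf, ← hg]
  refine ⟨PreL2.parity f, -PreL2.parity g, rfl, rfl, fun x₀ ψ hψ l => ?_⟩
  obtain ⟨h1, h2, h3⟩ := hfg x₀ ψ hψ (-(l ∘ₗ CForm.parity.toLinearMap))
  have e1 : ∀ z, ψ z * l ((-PreL2.parity g).form.inChart x₀ ((X.chart x₀).symm z)) =
      ψ z * (-(l ∘ₗ CForm.parity.toLinearMap)) (g.form.inChart x₀ ((X.chart x₀).symm z)) :=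
    fun z => congrArg (ψ z * ·) ((congrArg l ((map_neg _ _).trans
      (congrArg Neg.neg (CForm.pullback_parity _ _)))).trans (map_neg _ _))
  have e2 : ∀ z, l (ExteriorAlgebra.ι ℂ (CForm.dbarFun ψ z) *
      (PreL2.parity f).form.inChart x₀ ((X.chart x₀).symm z)) =
      (-(l ∘ₗ CForm.parity.toLinearMap)) (ExteriorAlgebra.ι ℂ (CForm.dbarFun ψ z) *
        f.form.inChart x₀ ((X.chart x₀).symm z)) := fun z => by
    have h4 : (PreL2.parity f).form.inChart x₀ ((X.chart x₀).symm z) =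
      CForm.parity (f.form.inChart x₀ ((X.chart x₀).symm z)) := CForm.pullback_parity _ _
    rw [h4, LinearMap.neg_apply, LinearMap.comp_apply, AlgHom.toLinearMap_apply, map_mul CForm.parity,
      CForm.parity_ι, neg_mul, map_neg, neg_neg]
  simp only [e1, e2]
  exact ⟨h1, h2, h3⟩

theorem IsBoundedDomain.isHilbertComplex (h : IsBoundedDomain Ω φ) :
    IsHilbertComplex (parity (X := X)) (X.dbarGraph Ω φ) where
  isClosed := h.isClosed_dbarGraph
  unique y hy := h.eq_zero_of_functional y fun x₀ ψ hψ l => by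
    rw [(h.mem_dbarGraph_iff _).1 hy x₀ ψ hψ l, map_zero, neg_zero]
  eq_zero_of_inner w hw := by
    refine h.dense_domain.eq_zero_of_inner_right ℂ fun v hv => ?_
    have h1 := (LinearPMap.mem_domain_iff).1 hv
    obtain ⟨y, hy⟩ := h1
    exact hw (v, y) (h.graph_dbar ▸ hy)
  sq_mem p hp := h.dbar_dbar hp
  parity_parity := parity_parity
  inner_parity := inner_parity_left
  parity_mem p hp := parity_mem_dbarGraph hp

lemma IsBoundedDomain.exists_dbar_eq_iff (h : IsBoundedDomain Ω φ) (f g : X.L2 Ω φ) :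
    (∃ hf : f ∈ (X.dbar Ω φ).domain, X.dbar Ω φ ⟨f, hf⟩ = g) ↔ (f, g) ∈ X.dbarGraph Ω φ := by
  rw [← h.graph_dbar, LinearPMap.mem_graph_iff]
  constructor
  · rintro ⟨hf, rfl⟩
    exact ⟨⟨f, hf⟩, rfl, rfl⟩
  · rintro ⟨y, rfl, hy⟩
    exact ⟨y.2, hy⟩

lemma IsBoundedDomain.dbarKer_eq (h : IsBoundedDomain Ω φ) :
    X.dbarKer Ω φ = (X.dbarGraph Ω φ).graphKer := by
  ext f
  rw [Submodule.mem_graphKer, ← h.exists_dbar_eq_iff]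
  constructor
  · rintro ⟨y, hy, rfl⟩
    exact ⟨y.2, hy⟩
  · rintro ⟨hf, hy⟩
    exact ⟨⟨f, hf⟩, hy, rfl⟩

lemma IsBoundedDomain.dbarRange_eq (h : IsBoundedDomain Ω φ) :
    X.dbarRange Ω φ = (X.dbarGraph Ω φ).graphRange := by
  ext g
  rw [Submodule.mem_graphRange]
  simp only [← h.exists_dbar_eq_iff]
  constructor
  · rintro ⟨y, hy⟩
    exact ⟨y.1, y.2, hy⟩
  · rintro ⟨f, hf, hy⟩
    exact ⟨⟨f, hf⟩, hy⟩

lemma IsBoundedDomain.harmonic_eq (h : IsBoundedDomain Ω φ) :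
    X.harmonic Ω φ = (X.dbarGraph Ω φ).harmonics := by
  have h1 : X.dbarAdjointKer Ω φ = (X.dbarGraph Ω φ).graphRangeᗮ := by
    ext f
    have h2 : f ∈ X.dbarAdjointKer Ω φ ↔ (f, 0) ∈ (X.dbar Ω φ).adjoint.graph := by
      rw [LinearPMap.mem_graph_iff]
      constructor
      · rintro ⟨y, hy, rfl⟩
        exact ⟨y, rfl, hy⟩
      · rintro ⟨y, rfl, hy⟩
        exact ⟨y, hy, rfl⟩
    rw [h2, LinearPMap.adjoint_graph_eq_graph_adjoint h.dense_domain, h.graph_dbar,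
      Submodule.mem_adjoint_iff, Submodule.mem_orthogonal]
    simp only [inner_zero_right, sub_zero, Submodule.mem_graphRange]
    exact ⟨fun H u ⟨x, hx⟩ => H x u hx, fun H x u hx => H u ⟨x, hx⟩⟩
  rw [harmonic, h1, h.dbarKer_eq]
  rfl

lemma IsBoundedDomain.harmonicProjection_eq (h : IsBoundedDomain Ω φ) :
    X.harmonicProjection Ω φ = (X.dbarGraph Ω φ).harmonicProj := by
  have : ∀ A B : Submodule ℂ (X.L2 Ω φ), A = B →
      A.topologicalClosure.starProjection = B.topologicalClosure.starProjection := by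
    rintro A _ rfl
    rfl
  exact this _ _ h.harmonic_eq

lemma IsBoundedDomain.isCanonicalSolution_iff (h : IsBoundedDomain Ω φ)
    (K : X.L2 Ω φ →L[ℂ] X.L2 Ω φ) :
    IsCanonicalSolution K ↔ (X.dbarGraph Ω φ).IsCanonicalInverse K := by
  constructor
  · rintro ⟨h1, h2⟩
    rw [h.dbarRange_eq] at h1 h2
    rw [h.dbarKer_eq] at h1
    exact ⟨fun f hf => (h1 f hf).1, fun f hf => (h.exists_dbar_eq_iff _ _).1 (h1 f hf).2, h2⟩
  · rintro ⟨h1, h2, h3⟩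
    refine ⟨?_, ?_⟩
    · rw [h.dbarRange_eq, h.dbarKer_eq]
      exact fun f hf => ⟨h1 f hf, (h.exists_dbar_eq_iff _ _).2 (h2 f hf)⟩
    · rw [h.dbarRange_eq]
      exact h3

lemma IsBoundedDomain.isCanonicalInverse_canonicalSolution (h : IsBoundedDomain Ω φ)
    (hcl : X.HasClosedRange Ω φ) :
    (X.dbarGraph Ω φ).IsCanonicalInverse (X.canonicalSolution Ω φ) := by
  rw [HasClosedRange, h.dbarRange_eq] at hcl
  obtain ⟨K, hK⟩ := h.isHilbertComplex.exists_isCanonicalInverse hcl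
  have hex : ∃ K : X.L2 Ω φ →L[ℂ] X.L2 Ω φ, IsCanonicalSolution K :=
    ⟨K, (h.isCanonicalSolution_iff K).2 hK⟩
  rw [canonicalSolution, dif_pos hex]
  exact (h.isCanonicalSolution_iff _).1 hex.choose_spec

end Complex

section PiComplex

variable {ι : Type} [Fintype ι] [LinearOrder ι] {X : ι → HermitianManifold.{u, v}}
  {Ω : ∀ i, Set (X i)} {φ : ∀ i, X i → ℝ}

/-- The Cauchy-Riemann complex of a product of domains is the tensor product of the complexes of the
factors: the Leibniz rule holds for `∂̄` and for its adjoint. -/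
theorem isTensorComplex_pi (h : ∀ i, IsBoundedDomain (Ω i) (φ i))
    (hcl : ∀ i, (X i).HasClosedRange (Ω i) (φ i)) :
    IsTensorComplex (piData h).tensor (fun i => parity (X := X i))
      (fun i => (X i).dbarGraph (Ω i) (φ i)) (parity (X := pi X))
      ((pi X).dbarGraph (piDomain Ω) (piWeight φ)) where
  tensor := isHilbertTensorProduct_piData h
  factor i := (h i).isHilbertComplex
  isClosed_range i := (h i).dbarRange_eq ▸ hcl i
  complex := (IsBoundedDomain.pi h).isHilbertComplex
  mem _ hp := tensor_mem_dbarGraph h hp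
  mem_adjoint _ hp := tensor_mem_dbarGraph_adjoint h hp

end PiComplex

end HermitianManifold

/-! ### The operators on three factors -/

namespace HermitianManifold

section Blocks

variable {ι : Type} [Fintype ι] [LinearOrder ι] {X : ι → HermitianManifold.{u, v}}
  {Ω : ∀ i, Set (X i)} {φ : ∀ i, X i → ℝ}

lemma piData_order_split (h : ∀ i, IsBoundedDomain (Ω i) (φ i)) (j : ι) :
    (piData h).order = (piData fun i : {i // i < j} => h i).order.map Subtype.val ++
      j :: (piData fun i : {i // j < i} => h i).order.map Subtype.val := by
  have hs : (piData h).order.Pairwise (· < ·) := (Finset.sortedLT_sort Finset.univ).pairwise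
  have h₀ : (piData fun i : {i // i < j} => h i).order.Pairwise (· < ·) :=
    (Finset.sortedLT_sort Finset.univ).pairwise
  have h₁ : (piData fun i : {i // j < i} => h i).order.Pairwise (· < ·) :=
    (Finset.sortedLT_sort Finset.univ).pairwise
  refine List.Pairwise.eq_of_mem_iff hs ?_ fun i => ?_
  · refine List.pairwise_append.2 ⟨List.pairwise_map.2 h₀, List.pairwise_cons.2
      ⟨fun i hi => ?_, List.pairwise_map.2 h₁⟩, fun i hi k hk => ?_⟩
    · obtain ⟨a, _, rfl⟩ := List.mem_map.1 hi
      exact a.2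
    · obtain ⟨a, _, rfl⟩ := List.mem_map.1 hi
      rcases List.mem_cons.1 hk with rfl | hk
      · exact a.2
      · obtain ⟨b, _, rfl⟩ := List.mem_map.1 hk
        exact a.2.trans b.2
  · refine ⟨fun _ => ?_, fun _ => (piData h).mem_order i⟩
    rw [List.mem_append, List.mem_cons]
    rcases lt_trichotomy i j with hi | rfl | hi
    · exact Or.inl (List.mem_map.2 ⟨⟨i, hi⟩, ProductData.mem_order _ _, rfl⟩)
    · exact Or.inr (Or.inl rfl)
    · exact Or.inr (Or.inr (List.mem_map.2 ⟨⟨i, hi⟩, ProductData.mem_order _ _, rfl⟩))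

/-- The exterior product of forms on the factors, as a product of three forms. -/
lemma tensorForm_blockData (h : ∀ i, IsBoundedDomain (Ω i) (φ i)) (j : ι)
    (f : ∀ i, (X i).Form) (g : ∀ a, (blockManifold X j a).Form)
    (hb : g (some false) = (piData fun i : {i // i < j} => h i).tensorForm fun i => f i)
    (hj : g none = f j)
    (ha : g (some true) = (piData fun i : {i // j < i} => h i).tensorForm fun i => f i) :
    (blockData j h).tensorForm g = (piData h).tensorForm f := by
  funext x
  have e₀ : CForm.pullback (blockDproj X j (some false)) (g (some false) fun i => x i) =
      (((piData fun i : {i // i < j} => h i).order.map Subtype.val).map fun i =>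
        CForm.pullback (tangentProj X i) (f i (x i))).prod := by
    refine (congrArg (fun q : (blockManifold X j (some false)).Form =>
      CForm.pullback (blockDproj X j (some false)) (q fun i => x i)) hb).trans
      ((map_list_prod (CForm.pullback (blockDproj X j (some false))) _).trans ?_)
    refine congrArg List.prod (List.map_map.trans (Eq.trans ?_ List.map_map.symm))
    exact List.map_congr_left fun i _ => CForm.pullback_pullback _ _ _
  have e₁ : CForm.pullback (blockDproj X j (some true)) (g (some true) fun i => x i) =
      (((piData fun i : {i // j < i} => h i).order.map Subtype.val).map fun i =>
        CForm.pullback (tangentProj X i) (f i (x i))).prod := by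
    refine (congrArg (fun q : (blockManifold X j (some true)).Form =>
      CForm.pullback (blockDproj X j (some true)) (q fun i => x i)) ha).trans
      ((map_list_prod (CForm.pullback (blockDproj X j (some true))) _).trans ?_)
    refine congrArg List.prod (List.map_map.trans (Eq.trans ?_ List.map_map.symm))
    exact List.map_congr_left fun i _ => CForm.pullback_pullback _ _ _
  have e₂ : (piData h).tensorForm f x = (((piData h).order).map fun i =>
    CForm.pullback (tangentProj X i) (f i (x i))).prod := rfl
  rw [e₂, piData_order_split h j, List.map_append, List.prod_append, List.map_cons,
    List.prod_cons, ← e₀, ← e₁, ← hj]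
  exact congrArg₂ (· * ·) rfl (congrArg₂ (· * ·) rfl (mul_one _))

/-- The associativity of the tensor product. -/
lemma tensor_blockData (h : ∀ i, IsBoundedDomain (Ω i) (φ i)) (j : ι)
    (F : ∀ i, (X i).L2 (Ω i) (φ i))
    (G : ∀ a, (blockManifold X j a).L2 (blockDomain Ω j a) (blockWeight φ j a))
    (hb : G (some false) = (piData fun i : {i // i < j} => h i).tensor fun i => F i)
    (hj : G none = F j)
    (ha : G (some true) = (piData fun i : {i // j < i} => h i).tensor fun i => F i) :
    (blockData j h).tensor G = (piData h).tensor F := by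
  choose f hf using fun i => PreL2.exists_rep (F i)
  obtain rfl : (fun i => (f i).toL2) = F := funext hf
  let g : ∀ a, (blockManifold X j a).PreL2 (blockDomain Ω j a) (blockWeight φ j a)
    | none => f j
    | some false => (piData fun i : {i // i < j} => h i).tensorPre fun i => f i
    | some true => (piData fun i : {i // j < i} => h i).tensorPre fun i => f i
  obtain rfl : (fun a => (g a).toL2) = G := by
    funext a
    match a with
    | none => exact hj.symm
    | some false => exact (ProductData.tensor_toL2 _ _).symm.trans hb.symm
    | some true => exact (ProductData.tensor_toL2 _ _).symm.trans ha.symm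
  rw [ProductData.tensor_toL2, ProductData.tensor_toL2]
  exact congrArg PreL2.toL2 (PreL2.ext (tensorForm_blockData h j (fun i => (f i).form)
    (fun a => (g a).form) rfl rfl rfl))

lemma exists_tensor_blockData (h : ∀ i, IsBoundedDomain (Ω i) (φ i)) (j : ι)
    (F : ∀ i, (X i).L2 (Ω i) (φ i)) : ∃ G, (blockData j h).tensor G = (piData h).tensor F ∧
      G (some false) = ((piData fun i : {i // i < j} => h i).tensor fun i => F i) ∧
      G none = F j ∧
      G (some true) = (piData fun i : {i // j < i} => h i).tensor fun i => F i := by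
  let G : ∀ a, (blockManifold X j a).L2 (blockDomain Ω j a) (blockWeight φ j a)
    | none => F j
    | some false => (piData fun i : {i // i < j} => h i).tensor fun i => F i
    | some true => (piData fun i : {i // j < i} => h i).tensor fun i => F i
  exact ⟨G, tensor_blockData h j F G rfl rfl rfl, rfl, rfl, rfl⟩

lemma isHilbertTensorProduct_blockData (h : ∀ i, IsBoundedDomain (Ω i) (φ i)) (j : ι) :
    IsHilbertTensorProduct (blockData j h).tensor where
  completeSpace := inferInstance
  t0Space := inferInstance
  inner_apply := (blockData j h).inner_tensor
  dense_span := by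
    refine (isHilbertTensorProduct_piData h).dense_span.mono (Submodule.span_mono ?_)
    rintro _ ⟨F, rfl⟩
    obtain ⟨G, hG, -⟩ := exists_tensor_blockData h j F
    exact ⟨G, hG⟩

lemma parity_tensor (h : ∀ i, IsBoundedDomain (Ω i) (φ i)) (F : ∀ i, (X i).L2 (Ω i) (φ i)) :
    parity (X := pi X) ((piData h).tensor F) = (piData h).tensor fun i => parity (F i) := by
  choose f hf using fun i => PreL2.exists_rep (F i)
  obtain rfl : (fun i => (f i).toL2) = F := funext hf
  refine (congrArg (parity (X := pi X)) ((piData h).tensor_toL2 f)).trans (Eq.trans ?_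
    ((piData h).tensor_toL2 fun i => PreL2.parity (f i)).symm)
  refine congrArg PreL2.toL2 (PreL2.ext (funext fun x => ?_))
  refine (map_list_prod (CForm.parity (E := (pi X).Model)) _).trans ?_
  rw [List.map_map]
  refine congrArg List.prod (List.map_congr_left fun i _ => ?_)
  exact (CForm.pullback_parity _ _).symm

end Blocks

section FinBlocks

variable {N : ℕ} {X : Fin N → HermitianManifold.{u, v}} {Ω : ∀ j, Set (X j)} {φ : ∀ j, X j → ℝ}

/-- The summands of the solution operator are tensor products of operators on three factors. -/
theorem isTensorOpAt_solutionTerm (h : ∀ i, IsBoundedDomain (Ω i) (φ i))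
    (hcl : ∀ i, (X i).HasClosedRange (Ω i) (φ i)) (j : Fin N) :
    IsTensorOpAt j (parityHarmonicBefore Ω φ j) ((X j).canonicalSolution (Ω j) (φ j))
      (ContinuousLinearMap.id ℂ _) ((isTensorComplex_pi h hcl).solutionTerm
        (fun i => (X i).canonicalSolution (Ω i) (φ i)) j) := by
  have ht := isHilbertTensorProduct_blockData h j
  let A : ∀ a, (blockManifold X j a).L2 (blockDomain Ω j a) (blockWeight φ j a) →L[ℂ]
      (blockManifold X j a).L2 (blockDomain Ω j a) (blockWeight φ j a)
    | none => (X j).canonicalSolution (Ω j) (φ j)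
    | some false => parityHarmonicBefore Ω φ j
    | some true => ContinuousLinearMap.id ℂ (L2After Ω φ j)
  have hA : (isTensorComplex_pi h hcl).solutionTerm
      (fun i => (X i).canonicalSolution (Ω i) (φ i)) j = ht.map A := by
    refine (isHilbertTensorProduct_piData h).ext_clm fun F => ?_
    obtain ⟨G, hG, hb, hj, ha⟩ := exists_tensor_blockData h j F
    refine ((isHilbertTensorProduct_piData h).map_apply _ F).trans (Eq.trans ?_
      (congrArg (ht.map A) hG))
    refine Eq.trans (Eq.symm ?_) (ht.map_apply A G).symm
    refine tensor_blockData h j _ _ ?_ ?_ ?_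
    -- the harmonic projection on the product of the first factors is a tensor product
    · have hbd : ∀ i : {i // i < j}, IsBoundedDomain (Ω i) (φ i) := fun i => h i
      have hQ := (IsBoundedDomain.pi hbd).harmonicProjection_eq.trans
        ((isTensorComplex_pi hbd fun i => hcl i).harmonicProj_eq_harmonicMap
          (K := fun i : {i // i < j} => (X i).canonicalSolution (Ω i) (φ i)) fun i =>
            (h i).isCanonicalInverse_canonicalSolution (hcl i))
      refine (congrArg (parityHarmonicBefore Ω φ j) hb).trans ?_
      refine (congrArg (fun Q : L2Before Ω φ j →L[ℂ] L2Before Ω φ j => parity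
        (X := pi fun i : {i // i < j} => X i) (Q ((piData hbd).tensor fun i => F i))) hQ).trans ?_
      refine (congrArg (parity (X := pi fun i : {i // i < j} => X i))
        ((isHilbertTensorProduct_piData hbd).map_apply _ _)).trans ?_
      refine (parity_tensor hbd _).trans (congrArg _ (funext fun i => ?_))
      rw [leibnizOp, if_pos i.2]
      rfl
    · rw [leibnizOp, if_neg (lt_irrefl j), if_pos rfl]
      exact congrArg ((X j).canonicalSolution (Ω j) (φ j)) hj
    · refine ha.trans (congrArg _ (funext fun i => ?_))
      rw [leibnizOp, if_neg i.2.asymm, if_neg i.2.ne']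
      rfl
  rw [hA]
  intro F G H
  refine ⟨_, _, isTensorAt_tensor h j F G H, isTensorAt_tensor h j _ _ _,
    (ht.map_apply A _).trans (congrArg _ (funext fun a => ?_))⟩
  match a with
  | none => rfl
  | some false => rfl
  | some true => rfl

end FinBlocks

end HermitianManifold

/-! ### The Künneth formula -/

namespace HermitianManifold

section Cohomology

variable {X : HermitianManifold.{u, v}} {Ω : Set X} {φ : X → ℝ}

lemma IsBoundedDomain.harmonicProjection_mem_dbarKer (h : IsBoundedDomain Ω φ) (f : X.L2 Ω φ) :
    X.harmonicProjection Ω φ f ∈ X.dbarKer Ω φ := by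
  rw [h.dbarKer_eq, h.harmonicProjection_eq]
  exact (h.isHilbertComplex.harmonicProj_mem f).1

lemma IsBoundedDomain.harmonicProjection_harmonicProjection (h : IsBoundedDomain Ω φ)
    (f : X.L2 Ω φ) : X.harmonicProjection Ω φ (X.harmonicProjection Ω φ f) =
      X.harmonicProjection Ω φ f := by
  rw [h.harmonicProjection_eq]
  exact IsHilbertComplex.harmonicProj_of_mem (h.isHilbertComplex.harmonicProj_mem f)

lemma IsBoundedDomain.sub_harmonicProjection_mem (h : IsBoundedDomain Ω φ)
    (hcl : X.HasClosedRange Ω φ) {f : X.L2 Ω φ} (hf : f ∈ X.dbarKer Ω φ) :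
    f - X.harmonicProjection Ω φ f ∈ X.dbarRange Ω φ := by
  rw [h.dbarKer_eq] at hf
  rw [h.dbarRange_eq, h.harmonicProjection_eq]
  have := h.isHilbertComplex.homotopy (h.dbarRange_eq ▸ hcl)
    (h.isCanonicalInverse_canonicalSolution hcl) (Submodule.mem_graphKer.1 hf)
  rw [map_zero, sub_zero] at this
  exact Submodule.mem_graphRange.2 ⟨_, this⟩

namespace Cohomology

lemma mk_eq_mk {f g : X.dbarKer Ω φ} : mk f = mk g ↔ (f : X.L2 Ω φ) - g ∈ X.dbarRange Ω φ :=
  Submodule.Quotient.eq _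

lemma mk_surjective (c : X.Cohomology Ω φ) : ∃ f, mk f = c := Submodule.mkQ_surjective _ c

/-- The harmonic representative of a cohomology class. -/
lemma orthRep_mk (h : IsBoundedDomain Ω φ) (hcl : X.HasClosedRange Ω φ) (f : X.dbarKer Ω φ) :
    orthRep (mk f) = X.harmonicProjection Ω φ f := by
  refine Submodule.eq_starProjection_of_mem_orthogonal (K := (X.dbarRange Ω φ)ᗮ) ?_
    (Submodule.le_orthogonal_orthogonal _ (h.sub_harmonicProjection_mem hcl f.2))
  rw [h.dbarRange_eq, h.harmonicProjection_eq]
  exact (h.isHilbertComplex.harmonicProj_mem _).2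

lemma mk_harmonicProjection (h : IsBoundedDomain Ω φ) (hcl : X.HasClosedRange Ω φ)
    (f : X.dbarKer Ω φ) : mk ⟨_, h.harmonicProjection_mem_dbarKer (f : X.L2 Ω φ)⟩ = mk f :=
  (mk_eq_mk.2 (h.sub_harmonicProjection_mem hcl f.2)).symm

lemma inner_eq (a b : X.Cohomology Ω φ) : ⟪a, b⟫_ℂ = ⟪orthRep a, orthRep b⟫_ℂ := rfl

lemma isometry_orthRep : Isometry (orthRep (X := X) (Ω := Ω) (φ := φ)) := by
  refine AddMonoidHomClass.isometry_of_norm _ fun c => ?_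
  have : ‖orthRep c‖ ^ 2 = ‖c‖ ^ 2 := by
    rw [norm_sq_eq_re_inner (𝕜 := ℂ), norm_sq_eq_re_inner (𝕜 := ℂ), inner_eq]
  exact (pow_left_inj₀ (norm_nonneg _) (norm_nonneg _) two_ne_zero).1 this

lemma orthRep_injective (h : IsBoundedDomain Ω φ) (hcl : X.HasClosedRange Ω φ) :
    Function.Injective (orthRep (X := X) (Ω := Ω) (φ := φ)) := by
  refine (injective_iff_map_eq_zero _).2 fun c hc => ?_
  obtain ⟨f, rfl⟩ := mk_surjective c
  rw [orthRep_mk h hcl] at hc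
  have h1 := h.sub_harmonicProjection_mem hcl f.2
  rw [hc, sub_zero] at h1
  rw [← map_zero mk, mk_eq_mk]
  simpa using h1

lemma completeSpace (h : IsBoundedDomain Ω φ) (hcl : X.HasClosedRange Ω φ) :
    CompleteSpace (X.Cohomology Ω φ) := by
  refine (completeSpace_iff_isComplete_range isometry_orthRep.isUniformInducing).2 ?_
  have : Set.range (orthRep (X := X) (Ω := Ω) (φ := φ)) = (X.harmonic Ω φ : Set (X.L2 Ω φ)) := by
    rw [h.harmonic_eq]
    ext w
    constructor
    · rintro ⟨c, rfl⟩
      obtain ⟨f, rfl⟩ := mk_surjective c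
      rw [orthRep_mk h hcl, h.harmonicProjection_eq]
      exact h.isHilbertComplex.harmonicProj_mem _
    · intro hw
      have hw' : w ∈ X.dbarKer Ω φ := by
        rw [h.dbarKer_eq]
        exact hw.1
      refine ⟨mk ⟨w, hw'⟩, ?_⟩
      rw [orthRep_mk h hcl, h.harmonicProjection_eq]
      exact IsHilbertComplex.harmonicProj_of_mem hw
  rw [this, h.harmonic_eq]
  exact h.isHilbertComplex.isClosed_harmonics.isComplete

/-- The class of the harmonic component of a form. -/
def harmonicClass (h : IsBoundedDomain Ω φ) : X.L2 Ω φ →ₗ[ℂ] X.Cohomology Ω φ :=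
  mk ∘ₗ (X.harmonicProjection Ω φ).toLinearMap.codRestrict _ h.harmonicProjection_mem_dbarKer

lemma orthRep_harmonicClass (h : IsBoundedDomain Ω φ) (hcl : X.HasClosedRange Ω φ)
    (w : X.L2 Ω φ) : orthRep (harmonicClass h w) = X.harmonicProjection Ω φ w :=
  (orthRep_mk h hcl ⟨_, h.harmonicProjection_mem_dbarKer w⟩).trans
    (h.harmonicProjection_harmonicProjection w)

lemma continuous_harmonicClass (h : IsBoundedDomain Ω φ) (hcl : X.HasClosedRange Ω φ) :
    Continuous (harmonicClass h) := by
  refine isometry_orthRep.isUniformInducing.isInducing.continuous_iff.2 ?_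
  exact (X.harmonicProjection Ω φ).continuous.congr fun w => (orthRep_harmonicClass h hcl w).symm

lemma harmonicClass_surjective (h : IsBoundedDomain Ω φ) (hcl : X.HasClosedRange Ω φ) :
    Function.Surjective (harmonicClass h) := fun c => by
  obtain ⟨f, rfl⟩ := mk_surjective c
  exact ⟨f, mk_harmonicProjection h hcl f⟩

end Cohomology

end Cohomology

section Kunneth

variable {ι : Type} [Fintype ι] [LinearOrder ι] {X : ι → HermitianManifold.{u, v}}
  {Ω : ∀ i, Set (X i)} {φ : ∀ i, X i → ℝ}

lemma hasClosedRange_pi (h : ∀ i, IsBoundedDomain (Ω i) (φ i))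
    (hcl : ∀ i, (X i).HasClosedRange (Ω i) (φ i)) :
    (pi X).HasClosedRange (piDomain Ω) (piWeight φ) := by
  rw [HasClosedRange, (IsBoundedDomain.pi h).dbarRange_eq]
  exact (isTensorComplex_pi h hcl).isClosed_graphRange fun i =>
    (h i).isCanonicalInverse_canonicalSolution (hcl i)

lemma harmonicProjection_pi (h : ∀ i, IsBoundedDomain (Ω i) (φ i))
    (hcl : ∀ i, (X i).HasClosedRange (Ω i) (φ i)) :
    (pi X).harmonicProjection (piDomain Ω) (piWeight φ) =
      (isTensorComplex_pi h hcl).harmonicMap :=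
  (IsBoundedDomain.pi h).harmonicProjection_eq.trans
    ((isTensorComplex_pi h hcl).harmonicProj_eq_harmonicMap fun i =>
      (h i).isCanonicalInverse_canonicalSolution (hcl i))

lemma harmonicProjection_tensor (h : ∀ i, IsBoundedDomain (Ω i) (φ i))
    (hcl : ∀ i, (X i).HasClosedRange (Ω i) (φ i)) (F : ∀ i, (X i).L2 (Ω i) (φ i)) :
    (pi X).harmonicProjection (piDomain Ω) (piWeight φ) ((piData h).tensor F) =
      (piData h).tensor fun i => (X i).harmonicProjection (Ω i) (φ i) (F i) := by
  rw [harmonicProjection_pi h hcl]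
  refine ((isHilbertTensorProduct_piData h).map_apply _ F).trans (congrArg _ (funext fun i => ?_))
  rw [(h i).harmonicProjection_eq]

lemma tensor_mem_dbarKer (h : ∀ i, IsBoundedDomain (Ω i) (φ i)) {F : ∀ i, (X i).L2 (Ω i) (φ i)}
    (hF : ∀ i, F i ∈ (X i).dbarKer (Ω i) (φ i)) :
    (piData h).tensor F ∈ (pi X).dbarKer (piDomain Ω) (piWeight φ) := by
  rw [(IsBoundedDomain.pi h).dbarKer_eq]
  have h1 := tensor_mem_dbarGraph h (p := fun i => (F i, 0)) fun i => by
    have := hF i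
    rwa [(h i).dbarKer_eq] at this
  rwa [leibniz_apply, Finset.sum_eq_zero fun j _ =>
    (piData h).tensor.map_coord_zero j (leibnizSlot_self _ _)] at h1

lemma orthRep_mem_dbarKer (h : ∀ i, IsBoundedDomain (Ω i) (φ i))
    (hcl : ∀ i, (X i).HasClosedRange (Ω i) (φ i)) (i : ι) (c : (X i).Cohomology (Ω i) (φ i)) :
    Cohomology.orthRep c ∈ (X i).dbarKer (Ω i) (φ i) := by
  obtain ⟨f, rfl⟩ := Cohomology.mk_surjective c
  rw [Cohomology.orthRep_mk (h i) (hcl i)]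
  exact (h i).harmonicProjection_mem_dbarKer _

/-- The product of cohomology classes: the class of the tensor product of their harmonic
representatives. -/
def kunneth (h : ∀ i, IsBoundedDomain (Ω i) (φ i)) (hcl : ∀ i, (X i).HasClosedRange (Ω i) (φ i)) :
    MultilinearMap ℂ (fun i => (X i).Cohomology (Ω i) (φ i))
      ((pi X).Cohomology (piDomain Ω) (piWeight φ)) :=
  Cohomology.mk.compMultilinearMap
    (((piData h).tensor.compLinearMap fun i => Cohomology.orthRep).codRestrict
      ((pi X).dbarKer (piDomain Ω) (piWeight φ)) fun c =>
        tensor_mem_dbarKer h fun i => orthRep_mem_dbarKer h hcl i (c i))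

/-- The tensor product of closed forms is cohomologous to the tensor product of their harmonic
components, because the latter is its harmonic component. -/
lemma kunneth_mk (h : ∀ i, IsBoundedDomain (Ω i) (φ i))
    (hcl : ∀ i, (X i).HasClosedRange (Ω i) (φ i)) (F : ∀ i, (X i).dbarKer (Ω i) (φ i)) :
    kunneth h hcl (fun i => Cohomology.mk (F i)) =
      Cohomology.mk ⟨_, tensor_mem_dbarKer h fun i => (F i).2⟩ := by
  refine Eq.trans ?_ (Cohomology.mk_harmonicProjection (IsBoundedDomain.pi h)
    (hasClosedRange_pi h hcl) _)
  refine congrArg Cohomology.mk (Subtype.ext ?_)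
  refine Eq.trans ?_ (harmonicProjection_tensor h hcl fun i => (F i : (X i).L2 (Ω i) (φ i))).symm
  exact congrArg (piData h).tensor (funext fun i => Cohomology.orthRep_mk (h i) (hcl i) (F i))

lemma orthRep_kunneth (h : ∀ i, IsBoundedDomain (Ω i) (φ i))
    (hcl : ∀ i, (X i).HasClosedRange (Ω i) (φ i)) (c : ∀ i, (X i).Cohomology (Ω i) (φ i)) :
    Cohomology.orthRep (kunneth h hcl c) = (piData h).tensor fun i => Cohomology.orthRep (c i) := by
  refine (Cohomology.orthRep_mk (IsBoundedDomain.pi h) (hasClosedRange_pi h hcl) _).trans ?_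
  refine (harmonicProjection_tensor h hcl _).trans (congrArg _ (funext fun i => ?_))
  obtain ⟨f, hf⟩ := Cohomology.mk_surjective (c i)
  rw [← hf, Cohomology.orthRep_mk (h i) (hcl i), (h i).harmonicProjection_harmonicProjection]

theorem isHilbertTensorProduct_kunneth (h : ∀ i, IsBoundedDomain (Ω i) (φ i))
    (hcl : ∀ i, (X i).HasClosedRange (Ω i) (φ i)) :
    IsHilbertTensorProduct (kunneth h hcl) where
  completeSpace := Cohomology.completeSpace (IsBoundedDomain.pi h) (hasClosedRange_pi h hcl)
  t0Space := t0Space_of_injective_of_continuous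
    (Cohomology.orthRep_injective (IsBoundedDomain.pi h) (hasClosedRange_pi h hcl))
    Cohomology.isometry_orthRep.continuous
  inner_apply x y := by
    rw [Cohomology.inner_eq, orthRep_kunneth, orthRep_kunneth, ProductData.inner_tensor]
    rfl
  dense_span := by
    have hpi := IsBoundedDomain.pi h
    have hpc := hasClosedRange_pi h hcl
    -- the class of the harmonic component depends continuously on a form and maps tensors to products
    -- of classes
    have hle : Submodule.span ℂ (Set.range (piData h).tensor) ≤
        (Submodule.span ℂ (Set.range (kunneth h hcl))).comap (Cohomology.harmonicClass hpi) := by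
      refine Submodule.span_le.2 ?_
      rintro _ ⟨F, rfl⟩
      refine Submodule.subset_span
        ⟨fun i => Cohomology.mk ⟨_, (h i).harmonicProjection_mem_dbarKer (F i)⟩, ?_⟩
      refine (kunneth_mk h hcl _).trans ?_
      exact congrArg Cohomology.mk (Subtype.ext (harmonicProjection_tensor h hcl F).symm)
    exact ((Cohomology.harmonicClass_surjective hpi hpc).denseRange.dense_image
      (Cohomology.continuous_harmonicClass hpi hpc) (isHilbertTensorProduct_piData h).dense_span).mono
      (Set.image_subset_iff.2 hle)

end Kunneth

end HermitianManifold

/-! ### Rotations of the antiholomorphic variables -/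

section Rotation

open Submodule

variable {V : Type*} [NormedAddCommGroup V] [InnerProductSpace ℂ V]

/-- For the graph `G` of an operator `d` of degree one with respect to a grading with degrees
`0, …, n`, the properties of the operator `U` that multiplies elements of degree `q` by `ζ ^ q`. The
grading itself is only present through the spectral condition `sum_eq_zero`, which says that `ζ ^ q`
with `q ≤ n` are the only eigenvalues of `U`. -/
structure IsRotation (G : Submodule ℂ (V × V)) (U : V →L[ℂ] V) (ζ : ℂ) (m n : ℕ) : Prop where
  inner_map : ∀ x y, ⟪U x, U y⟫_ℂ = ⟪x, y⟫_ℂ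
  mem : ∀ p ∈ G, (ζ • U p.1, U p.2) ∈ G
  pow_apply : ∀ x, (U ^ m) x = x
  sum_eq_zero : ∀ w : ℂ, w ^ m = 1 → (∀ q ≤ n, w * ζ ^ q ≠ 1) → ∀ x,
    ∑ k ∈ Finset.range m, w ^ k • (U ^ k) x = 0

lemma geom_sum_eq_zero_of_pow_eq_one {w : ℂ} {m : ℕ} (hw : w ^ m = 1) (h1 : w ≠ 1) :
    ∑ k ∈ Finset.range m, w ^ k = 0 := by
  rw [geom_sum_eq h1, hw, sub_self, zero_div]

lemma ContinuousLinearMap.pow_succ_apply (U : V →L[ℂ] V) (k : ℕ) (x : V) :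
    (U ^ (k + 1)) x = U ((U ^ k) x) := by
  rw [pow_succ']
  rfl

lemma pow_apply_of_eigenvector {U : V →L[ℂ] V} {x : V} {c : ℂ} (hx : U x = c • x) (k : ℕ) :
    (U ^ k) x = c ^ k • x := by
  induction k with
  | zero => simp
  | succ k ih =>
    rw [U.pow_succ_apply, ih, map_smul, hx, smul_smul, pow_succ]

namespace IsRotation

variable {G : Submodule ℂ (V × V)} {U : V →L[ℂ] V} {ζ : ℂ} {m n : ℕ}

lemma mem_pow (h : IsRotation G U ζ m n) {p : V × V} (hp : p ∈ G) (k : ℕ) :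
    (ζ ^ k • (U ^ k) p.1, (U ^ k) p.2) ∈ G := by
  induction k with
  | zero => simpa using hp
  | succ k ih =>
    have := h.mem _ ih
    simpa only [map_smul, smul_smul, ← pow_succ', ← U.pow_succ_apply] using this

/-- An element `x` of degree zero is orthogonal to the range of `d`: it is orthogonal to the
elements of positive degree. -/
lemma mem_adjoint_of_invariant (h : IsRotation G U ζ m n) (hζ : IsPrimitiveRoot ζ m)
    (hn : n + 1 < m) {τ : V →L[ℂ] V} (hG : IsHilbertComplex τ G) {x : V} (hx : U x = x) :
    (x, 0) ∈ G.adjoint := by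
  refine (mem_adjoint_iff _ _).2 fun u g hug => ?_
  rw [inner_zero_right, sub_zero]
  -- the average over the rotations of the part of `(u, g)` with `g` of degree zero: its first
  -- component would have degree `-1`, hence vanishes
  have h1 : ∑ k ∈ Finset.range m, (ζ ^ k • (U ^ k) u, (U ^ k) g) ∈ G :=
    G.sum_mem fun k _ => h.mem_pow hug k
  have h2 : ∑ k ∈ Finset.range m, (ζ ^ k • (U ^ k) u, (U ^ k) g) =
      (0, ∑ k ∈ Finset.range m, (U ^ k) g) := by
    refine Prod.ext ?_ Prod.snd_sum
    refine Prod.fst_sum.trans (h.sum_eq_zero ζ hζ.pow_eq_one (fun q hq h3 => ?_) u)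
    rw [← pow_succ'] at h3
    exact Nat.not_dvd_of_pos_of_lt (by omega) (by omega) ((hζ.pow_eq_one_iff_dvd _).1 h3)
  rw [h2] at h1
  have h4 : ∀ k, ⟪(U ^ k) g, x⟫_ℂ = ⟪g, x⟫_ℂ := fun k => by
    induction k with
    | zero => rfl
    | succ k ih =>
      conv_lhs => rw [U.pow_succ_apply, ← hx]
      rw [h.inner_map, ih]
  have h5 : (m : ℂ) * ⟪g, x⟫_ℂ = 0 := by
    have := congrArg (fun y => ⟪y, x⟫_ℂ) (hG.unique _ h1)
    simpa only [sum_inner, h4, Finset.sum_const, Finset.card_range, nsmul_eq_mul,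
      inner_zero_left] using this
  exact (mul_eq_zero.1 h5).resolve_left (Nat.cast_ne_zero.2 (by omega))

/-- Every element is a sum of homogeneous elements. -/
lemma mem_span_eigenvectors (h : IsRotation G U ζ m n) (hζ : IsPrimitiveRoot ζ m) (hm : 0 < m)
    (x : V) : x ∈ span ℂ {y | ∃ q ≤ n, U y = ζ ^ q • y} := by
  have hz : ζ ≠ 0 := hζ.ne_zero hm.ne'
  -- the component of degree `q`, multiplied by `m`
  let E : ℕ → V := fun q => ∑ k ∈ Finset.range m, ((ζ⁻¹) ^ q) ^ k • (U ^ k) x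
  have hE : ∀ q, U (E q) = ζ ^ q • E q := fun q => by
    have h1 : ∀ k, U (((ζ⁻¹) ^ q) ^ k • (U ^ k) x) =
        ζ ^ q • ((ζ⁻¹) ^ q) ^ (k + 1) • (U ^ (k + 1)) x := fun k => by
      rw [map_smul, smul_smul, U.pow_succ_apply, pow_succ']
      congr 1
      rw [← mul_assoc, ← mul_pow, mul_inv_cancel₀ hz, one_pow, one_mul]
    have h2 := Finset.sum_range_succ (fun k => ((ζ⁻¹) ^ q) ^ k • (U ^ k) x) m
    have h3 : ((ζ⁻¹) ^ q) ^ m = 1 := by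
      rw [← pow_mul, mul_comm, pow_mul, inv_pow, hζ.pow_eq_one, inv_one, one_pow]
    rw [Finset.sum_range_succ', h.pow_apply, h3, pow_zero, pow_zero] at h2
    rw [map_sum, Finset.sum_congr rfl fun k _ => h1 k, ← Finset.smul_sum, add_right_cancel h2]
  have h0 : ∀ q ∈ Finset.range m, E q ∈ span ℂ {y | ∃ q ≤ n, U y = ζ ^ q • y} := by
    intro q hq
    by_cases hqn : q ≤ n
    · exact subset_span ⟨q, hqn, hE q⟩
    · have : E q = 0 := h.sum_eq_zero _ (by
        rw [← pow_mul, mul_comm, pow_mul, inv_pow, hζ.pow_eq_one, inv_one, one_pow]) (by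
        intro q' hq' h3
        rw [inv_pow, inv_mul_eq_one₀ (pow_ne_zero _ hz)] at h3
        rw [Finset.mem_range] at hq
        have := hζ.pow_inj hq (by omega) h3
        omega) x
      rw [this]
      exact zero_mem _
  have h1 : ∑ q ∈ Finset.range m, E q = (m : ℂ) • x := by
    simp only [E]
    rw [Finset.sum_comm, Finset.sum_eq_single_of_mem 0 (Finset.mem_range.2 hm)]
    · simp [Nat.cast_smul_eq_nsmul]
    · intro k hk hk0
      rw [← Finset.sum_smul]
      have : ∀ q, ((ζ⁻¹) ^ q) ^ k = ((ζ⁻¹) ^ k) ^ q := fun q => by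
        rw [← pow_mul, mul_comm, pow_mul]
      rw [Finset.sum_congr rfl fun q _ => this q, geom_sum_eq_zero_of_pow_eq_one, zero_smul]
      · rw [← pow_mul, mul_comm, pow_mul, inv_pow, hζ.pow_eq_one, inv_one, one_pow]
      · rw [inv_pow, Ne, inv_eq_one, hζ.pow_eq_one_iff_dvd]
        exact Nat.not_dvd_of_pos_of_lt (Nat.pos_of_ne_zero hk0) (Finset.mem_range.1 hk)
  have h2 : x = (m : ℂ)⁻¹ • ∑ q ∈ Finset.range m, E q := by
    rw [h1, smul_smul, inv_mul_cancel₀ (Nat.cast_ne_zero.2 hm.ne'), one_smul]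
  rw [h2]
  exact smul_mem _ _ (sum_mem h0)

end IsRotation

end Rotation

section TensorRotation

open Submodule

variable {ι : Type*} [Fintype ι] [LinearOrder ι] {V : ι → Type*} {H : Type*}
  [∀ j, NormedAddCommGroup (V j)] [∀ j, InnerProductSpace ℂ (V j)] [∀ j, CompleteSpace (V j)]
  [NormedAddCommGroup H] [InnerProductSpace ℂ H] [CompleteSpace H]

namespace IsTensorComplex

variable {t : MultilinearMap ℂ V H} {τ : ∀ i, V i →L[ℂ] V i} {G : ∀ i, Submodule ℂ (V i × V i)}
  {σ : H →L[ℂ] H} {D : Submodule ℂ (H × H)} {K : ∀ i, V i →L[ℂ] V i}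

/-- If the `j`-th factor has degree one and the other factors have degree zero, the summand
`τPx₁ ⊗ ⋯ ⊗ Kx_j ⊗ ⋯ ⊗ x_N` of the solution is in the range of the adjoint. -/
lemma inner_solutionTerm_eq_zero (h : IsTensorComplex t τ G σ D)
    (hK : ∀ i, (G i).IsCanonicalInverse (K i)) {z : H} (hz : z ∈ D.graphKer) {x : ∀ i, V i} {j : ι}
    (hx : ∀ i ≠ j, (x i, 0) ∈ (G i).adjoint) : ⟪z, h.solutionTerm K j (t x)⟫_ℂ = 0 := by
  let p : ∀ i, V i × V i := fun i => if i < j then ((G i).harmonicProj (x i), 0)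
    else if i = j then (parametrix (G i) (K i) (x i), K i (x i)) else (x i, 0)
  have hp : ∀ i, p i ∈ (G i).adjoint := fun i => by
    by_cases h1 : i < j
    · simp only [p, if_pos h1]
      exact (h.factor i).harmonicProj_mem_adjoint (x i)
    · by_cases h2 : i = j
      · simp only [p, if_neg h1, if_pos h2]
        exact (h.factor i).parametrix_mem_adjoint (h.isClosed_range i) (hK i) (x i)
      · simp only [p, if_neg h1, if_neg h2]
        exact hx i h2
  have h1 := h.mem_adjoint p hp
  have h2 : leibniz (fun i => (τ i).toLinearMap) t p = h.solutionTerm K j (t x) := by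
    rw [leibniz_apply, Finset.sum_eq_single_of_mem j (Finset.mem_univ j)]
    · refine Eq.trans (congrArg t (funext fun i => ?_)) (h.tensor.map_apply _ x).symm
      by_cases h1 : i < j
      · simp only [leibnizSlot, leibnizOp, p, if_pos h1]
        rfl
      · by_cases h2 : i = j
        · simp only [leibnizSlot, leibnizOp, p, if_neg h1, if_pos h2]
          rfl
        · simp only [leibnizSlot, leibnizOp, p, if_neg h1, if_neg h2]
          rfl
    · intro k _ hk
      refine t.map_coord_zero k ((leibnizSlot_self _ _).trans ?_)
      simp only [p, if_neg hk]
      split_ifs <;> rfl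
  rw [h2] at h1
  simpa using (mem_adjoint_iff _ _).1 h1 z 0 hz

/-- On elements of degree one, the solution operator takes values orthogonal to the kernel. -/
theorem solution_mem_orthogonal (h : IsTensorComplex t τ G σ D)
    (hK : ∀ i, (G i).IsCanonicalInverse (K i)) {ζ : ℂ} {m : ℕ} (hζ : IsPrimitiveRoot ζ m)
    {n : ι → ℕ} (hm : ∑ i, n i + 1 < m) {U : ∀ i, V i →L[ℂ] V i}
    (hU : ∀ i, IsRotation (G i) (U i) ζ m (n i)) {W : H →L[ℂ] H}
    (hW : ∀ x, W (t x) = t fun i => U i (x i)) {f : H} (hf : W f = ζ • f) :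
    h.solution K f ∈ D.graphKerᗮ := by
  refine (Submodule.mem_orthogonal _ _).2 fun z hz => ?_
  have hni : ∀ i, n i ≤ ∑ i, n i := fun i =>
    Finset.single_le_sum (fun _ _ => Nat.zero_le _) (Finset.mem_univ i)
  -- `m` times the projection to the elements of degree one
  let A : H →L[ℂ] H := ∑ k ∈ Finset.range m, (ζ ^ (m - 1)) ^ k • W ^ k
  have hA : ∀ {c : ℂ} {y : H}, W y = c • y →
      A y = (∑ k ∈ Finset.range m, (ζ ^ (m - 1) * c) ^ k) • y := fun hy => by
    simp only [A, sum_apply, smul_apply, pow_apply_of_eigenvector hy, smul_smul, Finset.sum_smul,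
      mul_pow]
  -- tensor products of homogeneous elements
  have h1 : ∀ x : ∀ i, V i, (∀ i, ∃ q ≤ n i, U i (x i) = ζ ^ q • x i) →
      t x ∈ LinearMap.ker ((innerSL ℂ z) ∘L h.solution K ∘L A).toLinearMap := by
    intro x hx
    choose q hq hqx using hx
    have hWx : W (t x) = ζ ^ (∑ i, q i) • t x := by
      rw [hW, funext hqx, t.map_smul_univ, Finset.prod_pow_eq_pow_sum]
    have hs : ∑ i, q i ≤ ∑ i, n i := Finset.sum_le_sum fun i _ => hq i
    change ⟪z, h.solution K (A (t x))⟫_ℂ = 0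
    rw [hA hWx, map_smul, inner_smul_right, ← pow_add]
    -- if the total degree is one, exactly one factor has positive degree; other total degrees are
    -- annihilated by `A`, since they are not congruent to one modulo `m`
    by_cases h2 : ∑ i, q i = 1
    · refine mul_eq_zero_of_right _ ?_
      rw [solution, sum_apply, inner_sum]
      refine Finset.sum_eq_zero fun j _ => ?_
      have hinv : ∀ i, q i = 0 → (x i, 0) ∈ (G i).adjoint := fun i hi =>
        (hU i).mem_adjoint_of_invariant hζ (by have := hni i; omega) (h.factor i)
          (by rw [hqx, hi, pow_zero, one_smul])
      by_cases hj : q j = 0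
      -- `K` vanishes on the orthogonal complement of the range
      · have h3 : K j (x j) = 0 := by
          refine (hK j).eq_zero _ ((Submodule.mem_orthogonal _ _).2 fun g hg => ?_)
          obtain ⟨u, hu⟩ := mem_graphRange.1 hg
          simpa using (mem_adjoint_iff _ _).1 (hinv j hj) u g hu
        rw [solutionTerm, h.tensor.map_apply, t.map_coord_zero j, inner_zero_right]
        rw [leibnizOp, if_neg (lt_irrefl j), if_pos rfl, h3]
      · refine h.inner_solutionTerm_eq_zero hK hz fun i hi => hinv i ?_
        have h4 : q i + q j ≤ ∑ i, q i := by
          rw [← Finset.sum_pair hi]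
          exact Finset.sum_le_sum_of_subset (Finset.subset_univ _)
        omega
    · rw [geom_sum_eq_zero_of_pow_eq_one, zero_mul]
      · rw [← pow_mul, mul_comm, pow_mul, hζ.pow_eq_one, one_pow]
      · rw [Ne, hζ.pow_eq_one_iff_dvd]
        rintro ⟨c, hc⟩
        have : c = 0 ∨ c = 1 ∨ 2 ≤ c := by omega
        rcases this with rfl | rfl | hc2
        · omega
        · omega
        · have := Nat.mul_le_mul_left m hc2
          omega
  -- the tensor products of homogeneous elements span a dense subspace
  have h2 : (innerSL ℂ z) ∘L h.solution K ∘L A = 0 := h.tensor.ext_clm fun x => by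
    refine t.mem_of_topologicalClosure_span (T := fun i => {y | ∃ q ≤ n i, U i y = ζ ^ q • y})
      h.tensor.continuous
      (((innerSL ℂ z) ∘L h.solution K ∘L A).isClosed_ker) h1 fun i => ?_
    exact le_topologicalClosure _ ((hU i).mem_span_eigenvectors hζ (by omega) (x i))
  have h3 : ⟪z, h.solution K (A f)⟫_ℂ = 0 := congrArg (· f) h2
  have h4 : ζ ^ (m - 1) * ζ = 1 := by
    rw [← pow_succ, Nat.sub_add_cancel (by omega), hζ.pow_eq_one]
  rw [hA hf, h4] at h3
  simp only [one_pow, Finset.sum_const, Finset.card_range, nsmul_eq_mul, mul_one, map_smul,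
    inner_smul_right] at h3
  exact (mul_eq_zero.1 h3).resolve_left (Nat.cast_ne_zero.2 (by omega))

/-- On closed elements of degree one, the solution operator is the canonical one. -/
theorem solution_eq_canonicalInverse (h : IsTensorComplex t τ G σ D)
    (hK : ∀ i, (G i).IsCanonicalInverse (K i)) {ζ : ℂ} {m : ℕ} (hζ : IsPrimitiveRoot ζ m)
    {n : ι → ℕ} (hm : ∑ i, n i + 1 < m) {U : ∀ i, V i →L[ℂ] V i}
    (hU : ∀ i, IsRotation (G i) (U i) ζ m (n i)) {W : H →L[ℂ] H}
    (hW : ∀ x, W (t x) = t fun i => U i (x i)) {f : H} (hf : W f = ζ • f) (hfD : f ∈ D.graphKer)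
    {L : H →L[ℂ] H} (hL : D.IsCanonicalInverse L) : h.solution K f = L f := by
  have h1 := h.homotopy_solution hK (mem_graphKer.1 hfD)
  have h2 := h.complex.homotopy (h.isClosed_graphRange hK) hL (mem_graphKer.1 hfD)
  simp only [map_zero, sub_zero, h.harmonicProj_eq_harmonicMap hK] at h1 h2
  have h3 : h.solution K f - L f ∈ D.graphKer := by
    have := D.sub_mem h1 h2
    rwa [Prod.mk_sub_mk, sub_self] at this
  have h4 : h.solution K f - L f ∈ D.graphKerᗮ := sub_mem
    (h.solution_mem_orthogonal hK hζ hm hU hW hf)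
    (IsHilbertComplex.canonicalInverse_mem (h.isClosed_graphRange hK) hL f)
  exact sub_eq_zero.1 (inner_self_eq_zero.1 ((Submodule.mem_orthogonal _ _).1 h4 _ h3))

end IsTensorComplex

end TensorRotation

/-! ### Rotations of forms -/

namespace CForm

section Rotate

variable {E F : Type*} [NormedAddCommGroup E] [NormedSpace ℂ E] [NormedAddCommGroup F]
  [NormedSpace ℂ F]

/-- For `|μ| = 1`, the operator on covectors that fixes the complex-linear ones and multiplies the
conjugate-linear ones by `μ²`. -/
def rotateCovector (E : Type*) [NormedAddCommGroup E] [NormedSpace ℂ E] (μ : ℂ) :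
    (E →ₗ[ℝ] ℂ) →ₗ[ℂ] (E →ₗ[ℝ] ℂ) where
  toFun a := μ • a ∘ₗ (conj μ • LinearMap.id : E →ₗ[ℂ] E).restrictScalars ℝ
  map_add' _ _ := LinearMap.ext fun _ => mul_add μ _ _
  map_smul' r _ := LinearMap.ext fun _ => mul_left_comm μ r _

/-- For `|μ| = 1`, the operator that multiplies forms of bidegree `(p, q)` by `μ ^ (2 * q)`. -/
def rotate (μ : ℂ) : CForm E →ₐ[ℂ] CForm E := ExteriorAlgebra.map (rotateCovector E μ)

lemma rotateCovector_apply (μ : ℂ) (a : E →ₗ[ℝ] ℂ) (v : E) :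
    rotateCovector E μ a v = μ * a (conj μ • v) := rfl

lemma rotate_ι (μ : ℂ) (a : E →ₗ[ℝ] ℂ) :
    rotate μ (ExteriorAlgebra.ι ℂ a) = ExteriorAlgebra.ι ℂ (rotateCovector E μ a) :=
  ExteriorAlgebra.map_apply_ι _ _

lemma scalarPart_rotate (μ : ℂ) (x : CForm E) : scalarPart (rotate μ x) = scalarPart x := by
  induction x using CliffordAlgebra.left_induction with
  | algebraMap r => simp
  | add x y hx hy => simp [hx, hy]
  | ι_mul x m hx =>
    change scalarPart (rotate μ (ExteriorAlgebra.ι ℂ m * x)) =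
      scalarPart (ExteriorAlgebra.ι ℂ m * x)
    rw [map_mul (rotate μ), rotate_ι, scalarPart_ι_mul, scalarPart_ι_mul]

/-- The contraction of a rotated form with a vector is the rotated contraction with the rotated
vector. -/
lemma interior_rotate (μ : ℂ) (v : E) (x : CForm E) :
    interior v (rotate μ x) = μ • rotate μ (interior (conj μ • v) x) := by
  induction x using CliffordAlgebra.left_induction with
  | algebraMap r =>
    rw [AlgHom.commutes]
    erw [interior_algebraMap, interior_algebraMap]
    rw [map_zero, smul_zero]
  | add x y hx hy => rw [map_add, map_add, hx, hy, map_add, map_add, smul_add]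
  | ι_mul x m hx =>
    change interior v (rotate μ (ExteriorAlgebra.ι ℂ m * x)) =
      μ • rotate μ (interior (conj μ • v) (ExteriorAlgebra.ι ℂ m * x))
    rw [map_mul (rotate μ), rotate_ι, interior_ι_mul, interior_ι_mul, hx, map_sub, map_smul,
      map_mul (rotate μ), rotate_ι, smul_sub, smul_smul, rotateCovector_apply, mul_smul_comm]

lemma pullback_rotate (μ : ℂ) (A : E →ₗ[ℂ] F) (x : CForm F) :
    pullback (A.restrictScalars ℝ) (rotate μ x) = rotate μ (pullback (A.restrictScalars ℝ) x) := by
  induction x using CliffordAlgebra.left_induction with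
  | algebraMap r => simp
  | add x y hx hy => rw [map_add, map_add, hx, hy, map_add, map_add]
  | ι_mul x m hx =>
    change pullback (A.restrictScalars ℝ) (rotate μ (ExteriorAlgebra.ι ℂ m * x)) =
      rotate μ (pullback (A.restrictScalars ℝ) (ExteriorAlgebra.ι ℂ m * x))
    rw [map_mul (rotate μ), map_mul (pullback _), map_mul (pullback _), map_mul (rotate μ), hx,
      rotate_ι, pullback_ι, pullback_ι, rotate_ι]
    congr 2
    exact LinearMap.ext fun v => congrArg (fun w => μ * m w) (A.map_smul (conj μ) v).symm

lemma pairing_rotate {ι : Type*} [Fintype ι] {μ : ℂ} (hμ : ‖μ‖ = 1) (b : ι → E)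
    (c : Matrix ι ι ℝ) (k : ℕ) (α β : CForm E) :
    pairing b c k (rotate μ α) (rotate μ β) = pairing (fun i => conj μ • b i) c k α β := by
  have h1 : μ * conj μ = 1 := by rw [Complex.mul_conj', hμ]; norm_num
  induction k generalizing α β with
  | zero => simp [pairing, scalarPart_rotate]
  | succ k ih =>
    simp only [pairing, interior_rotate, pairing_smul_left, pairing_smul_right, ih]
    refine Finset.sum_congr rfl fun i _ => Finset.sum_congr rfl fun j _ => ?_
    rw [← mul_assoc μ, h1, one_mul]

lemma inner_rotate [FiniteDimensional ℂ E] {h : E →ₗ⋆[ℂ] E →ₗ[ℂ] ℂ} (hh : IsHermitianInner h)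
    {μ : ℂ} (hμ : ‖μ‖ = 1) (α β : CForm E) :
    inner h (rotate μ α) (rotate μ β) = inner h α β := by
  have h0 : conj μ ≠ 0 := by
    rw [Ne, map_eq_zero]
    rintro rfl
    simp at hμ
  have hA : Function.Injective (conj μ • ContinuousLinearMap.id ℂ E) := fun x y hxy =>
    smul_right_injective E h0 hxy
  rw [inner_eq_frame hh _ hA α β, inner]
  refine Finset.sum_congr rfl fun k _ => ?_
  rw [pairing_rotate hμ, pairing_pullback]
  congr 3
  ext i j
  change (h _ _).re = (h (conj μ • _) (conj μ • _)).re
  rw [LinearMap.map_smulₛₗ₂, map_smul, smul_eq_mul, smul_eq_mul, ← mul_assoc, Complex.conj_conj,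
    Complex.mul_conj', hμ]
  norm_num

lemma conj_smul_of_conjLinear {a : E →ₗ[ℝ] ℂ} (ha : ∀ v, a (Complex.I • v) = -Complex.I * a v)
    (μ : ℂ) (v : E) : a (conj μ • v) = μ * a v := by
  have h1 : conj μ • v = μ.re • v + (-μ.im) • Complex.I • v := by
    rw [← Complex.coe_smul μ.re, ← Complex.coe_smul (-μ.im), smul_smul, ← add_smul]
    congr 1
    apply Complex.ext <;> simp
  rw [h1, map_add, map_smul, map_smul, ha, Complex.real_smul, Complex.real_smul]
  conv_rhs => rw [← Complex.re_add_im μ]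
  push_cast
  ring

lemma rotateCovector_of_conjLinear {a : E →ₗ[ℝ] ℂ}
    (ha : ∀ v, a (Complex.I • v) = -Complex.I * a v) (μ : ℂ) :
    rotateCovector E μ a = μ ^ 2 • a := LinearMap.ext fun v => by
  rw [rotateCovector_apply, conj_smul_of_conjLinear ha, LinearMap.smul_apply, smul_eq_mul]
  ring

lemma rotateCovector_of_linear {a : E →ₗ[ℝ] ℂ}
    (ha : ∀ v, a (Complex.I • v) = Complex.I * a v) {μ : ℂ} (hμ : ‖μ‖ = 1) :
    rotateCovector E μ a = a := LinearMap.ext fun v => by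
  have h1 : conj μ • v = μ.re • v + (-μ.im) • Complex.I • v := by
    rw [← Complex.coe_smul μ.re, ← Complex.coe_smul (-μ.im), smul_smul, ← add_smul]
    congr 1
    apply Complex.ext <;> simp
  have h2 : a (conj μ • v) = conj μ * a v := by
    rw [h1, map_add, map_smul, map_smul, ha, Complex.real_smul, Complex.real_smul,
      ← mul_assoc, ← add_mul]
    congr 1
    apply Complex.ext <;> simp
  rw [rotateCovector_apply, h2, ← mul_assoc, Complex.mul_conj', hμ]
  norm_num

lemma dbarFun_I_smul (ψ : E → ℂ) (z v : E) :
    dbarFun ψ z (Complex.I • v) = -Complex.I * dbarFun ψ z v := by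
  change (fderiv ℝ ψ z (Complex.I • v) + Complex.I * fderiv ℝ ψ z (Complex.I • Complex.I • v)) / 2
    = -Complex.I * ((fderiv ℝ ψ z v + Complex.I * fderiv ℝ ψ z (Complex.I • v)) / 2)
  rw [smul_smul, Complex.I_mul_I, neg_one_smul, map_neg]
  linear_combination (fderiv ℝ ψ z (Complex.I • v) / 2) * Complex.I_mul_I

lemma rotate_dbarFun_mul (μ : ℂ) (ψ : E → ℂ) (z : E) (x : CForm E) :
    rotate μ (ExteriorAlgebra.ι ℂ (dbarFun ψ z) * x) =
      μ ^ 2 • (ExteriorAlgebra.ι ℂ (dbarFun ψ z) * rotate μ x) := by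
  rw [map_mul (rotate μ), rotate_ι, rotateCovector_of_conjLinear (dbarFun_I_smul ψ z), map_smul,
    smul_mul_assoc]

lemma rotate_of_mem_bidegree {p q : ℕ} {x : CForm E} (hx : x ∈ bidegree E p q) {μ : ℂ}
    (hμ : ‖μ‖ = 1) : rotate μ x = (μ ^ 2) ^ q • x := by
  -- powers of a subspace of eigenvectors
  have hpow : ∀ (S : Submodule ℂ (CForm E)) (c : ℂ), (∀ y ∈ S, rotate μ y = c • y) →
      ∀ (k : ℕ), ∀ y ∈ S ^ k, rotate μ y = c ^ k • y := by
    intro S c hS k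
    induction k with
    | zero =>
      intro y hy
      rw [pow_zero, Submodule.mem_one] at hy
      obtain ⟨r, rfl⟩ := hy
      rw [AlgHom.commutes, pow_zero, one_smul]
    | succ k ih =>
      intro y hy
      rw [pow_succ] at hy
      induction hy using Submodule.mul_induction_on' with
      | mem_mul_mem a ha b hb =>
        rw [map_mul (rotate μ), ih a ha, hS b hb, smul_mul_smul_comm, pow_succ]
      | add a _ b _ h1 h2 => rw [map_add, h1, h2, smul_add]
  have hspan : ∀ (T : Set (E →ₗ[ℝ] ℂ)) (c : ℂ), (∀ a ∈ T, rotateCovector E μ a = c • a) →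
      ∀ y ∈ Submodule.span ℂ (ExteriorAlgebra.ι ℂ '' T), rotate μ y = c • y := by
    intro T c hT y hy
    induction hy using Submodule.span_induction with
    | mem y hy =>
      obtain ⟨a, ha, rfl⟩ := hy
      rw [rotate_ι, hT a ha, map_smul]
    | zero => rw [map_zero, smul_zero]
    | add a b _ _ h1 h2 => rw [map_add, h1, h2, smul_add]
    | smul r a _ h1 => rw [map_smul, h1, smul_comm]
  rw [bidegree] at hx
  induction hx using Submodule.mul_induction_on' with
  | mem_mul_mem a ha b hb =>
    rw [map_mul (rotate μ), hpow _ 1 (hspan _ 1 fun a ha => by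
        rw [rotateCovector_of_linear ha hμ, one_smul]) p a ha,
      hpow _ (μ ^ 2) (hspan _ _ fun a ha => rotateCovector_of_conjLinear ha μ) q b hb, one_pow,
      one_smul, mul_smul_comm]
  | add a _ b _ h1 h2 => rw [map_add, h1, h2, smul_add]

/-- The sums of forms whose antiholomorphic degree is at most `n`, characterized by the action of the
rotations. -/
def antiholomorphicDegreeLE (E : Type*) [NormedAddCommGroup E] [NormedSpace ℂ E] (n : ℕ) :
    Submodule ℂ (CForm E) :=
  Submodule.span ℂ {x | ∃ q ≤ n, ∀ μ : ℂ, ‖μ‖ = 1 → rotate μ x = (μ ^ 2) ^ q • x}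

lemma antiholomorphicDegreeLE_mono {n n' : ℕ} (h : n ≤ n') :
    antiholomorphicDegreeLE E n ≤ antiholomorphicDegreeLE E n' :=
  Submodule.span_mono fun _ ⟨q, hq, hx⟩ => ⟨q, hq.trans h, hx⟩

lemma ι_mul_mem_antiholomorphicDegreeLE {n : ℕ} {x : CForm E}
    (hx : x ∈ antiholomorphicDegreeLE E n) (a : E →ₗ[ℝ] ℂ) :
    ExteriorAlgebra.ι ℂ a * x ∈ antiholomorphicDegreeLE E (n + 1) := by
  -- the complex-linear and the conjugate-linear part of `a`
  let J : E →ₗ[ℝ] E := (Complex.I • LinearMap.id : E →ₗ[ℂ] E).restrictScalars ℝ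
  let b : E →ₗ[ℝ] ℂ := (1 / 2 : ℂ) • (a - Complex.I • (a ∘ₗ J))
  let c : E →ₗ[ℝ] ℂ := (1 / 2 : ℂ) • (a + Complex.I • (a ∘ₗ J))
  have hJ : ∀ v, a (J (Complex.I • v)) = - a v := fun v => by
    change a (Complex.I • Complex.I • v) = _
    rw [smul_smul, Complex.I_mul_I, neg_one_smul, map_neg]
  have hb : ∀ v, b (Complex.I • v) = Complex.I * b v := fun v => by
    change (1 / 2 : ℂ) * (a (J v) - Complex.I * a (J (Complex.I • v))) =
      Complex.I * ((1 / 2 : ℂ) * (a v - Complex.I * a (J v)))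
    rw [hJ]
    linear_combination (a (J v) / 2) * Complex.I_mul_I
  have hc : ∀ v, c (Complex.I • v) = -Complex.I * c v := fun v => by
    change (1 / 2 : ℂ) * (a (J v) + Complex.I * a (J (Complex.I • v))) =
      -Complex.I * ((1 / 2 : ℂ) * (a v + Complex.I * a (J v)))
    rw [hJ]
    linear_combination (a (J v) / 2) * Complex.I_mul_I
  have habc : a = b + c := LinearMap.ext fun v => by
    change a v = (1 / 2 : ℂ) * (a v - Complex.I * a (J v)) + (1 / 2 : ℂ) * (a v + Complex.I * a (J v))
    ring
  have h1 : ∀ x ∈ antiholomorphicDegreeLE E n,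
      ExteriorAlgebra.ι ℂ b * x ∈ antiholomorphicDegreeLE E (n + 1) := fun x hx => by
    induction hx using Submodule.span_induction with
    | mem y hy =>
      obtain ⟨q, hq, hy⟩ := hy
      refine Submodule.subset_span ⟨q, by omega, fun μ hμ => ?_⟩
      rw [map_mul (rotate μ), rotate_ι, rotateCovector_of_linear hb hμ, hy μ hμ, mul_smul_comm]
    | zero => rw [mul_zero]; exact zero_mem _
    | add x y _ _ h1 h2 => rw [mul_add]; exact add_mem h1 h2
    | smul r x _ h1 => rw [mul_smul_comm]; exact Submodule.smul_mem _ _ h1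
  have h2 : ∀ x ∈ antiholomorphicDegreeLE E n,
      ExteriorAlgebra.ι ℂ c * x ∈ antiholomorphicDegreeLE E (n + 1) := fun x hx => by
    induction hx using Submodule.span_induction with
    | mem y hy =>
      obtain ⟨q, hq, hy⟩ := hy
      refine Submodule.subset_span ⟨q + 1, by omega, fun μ hμ => ?_⟩
      rw [map_mul (rotate μ), rotate_ι, rotateCovector_of_conjLinear hc, hy μ hμ, mul_smul_comm,
        map_smul, smul_mul_assoc, smul_smul, ← pow_succ]
    | zero => rw [mul_zero]; exact zero_mem _
    | add x y _ _ h1 h2 => rw [mul_add]; exact add_mem h1 h2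
    | smul r x _ h1 => rw [mul_smul_comm]; exact Submodule.smul_mem _ _ h1
  rw [habc, map_add, add_mul]
  exact add_mem (h1 x hx) (h2 x hx)

/-- The antiholomorphic degrees are bounded. -/
lemma exists_antiholomorphicDegreeLE_eq_top (E : Type*) [NormedAddCommGroup E] [NormedSpace ℂ E]
    [FiniteDimensional ℂ E] : ∃ n, antiholomorphicDegreeLE E n = ⊤ := by
  have h1 : ∀ x : CForm E, ∃ n, x ∈ antiholomorphicDegreeLE E n := fun x => by
    induction x using CliffordAlgebra.left_induction with
    | algebraMap r =>
      refine ⟨0, Submodule.subset_span ⟨0, le_rfl, fun μ _ => ?_⟩⟩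
      rw [pow_zero, one_smul]
      exact AlgHom.commutes _ r
    | add x y hx hy =>
      obtain ⟨n, hn⟩ := hx
      obtain ⟨n', hn'⟩ := hy
      exact ⟨max n n', add_mem (antiholomorphicDegreeLE_mono (le_max_left _ _) hn)
        (antiholomorphicDegreeLE_mono (le_max_right _ _) hn')⟩
    | ι_mul x m hx =>
      obtain ⟨n, hn⟩ := hx
      exact ⟨n + 1, ι_mul_mem_antiholomorphicDegreeLE hn m⟩
  choose n hn using h1
  obtain ⟨s, hs⟩ := (Module.Finite.fg_top : (⊤ : Submodule ℂ (CForm E)).FG)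
  refine ⟨s.sup n, top_le_iff.1 ?_⟩
  rw [← hs, Submodule.span_le]
  exact fun x hx => antiholomorphicDegreeLE_mono (Finset.le_sup hx) (hn x)

end Rotate

end CForm

/-! ### Rotations of square integrable forms -/

namespace HermitianManifold

section Rotate

variable {X : HermitianManifold.{u, v}} {Ω : Set X} {φ : X → ℝ}

lemma inChart_rotate (μ : ℂ) (f : X.Form) (x₀ x : X) :
    Form.inChart (fun x => CForm.rotate μ (f x)) x₀ x = CForm.rotate μ (f.inChart x₀ x) :=
  CForm.pullback_rotate μ (X.frame x₀ x).toLinearMap (f x)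

lemma form_rotate_aemeas (μ : ℂ) {f : X.Form} {m : Measure X} (hf : f.AEMeas m) :
    Form.AEMeas (fun x => CForm.rotate μ (f x)) m := by
  intro x₀ l
  simp only [inChart_rotate]
  exact hf x₀ (l ∘ₗ (CForm.rotate μ).toLinearMap)

lemma fiberInner_rotate (μ : Circle) (x : X) (α β : CForm X.Model) :
    X.fiberInner x (CForm.rotate μ α) (CForm.rotate μ β) = X.fiberInner x α β :=
  CForm.inner_rotate (X.metric_hermitian x) (Circle.norm_coe μ) α β

/-- Multiplication of forms of bidegree `(p, q)` by `μ ^ (2 * q)`. -/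
def PreL2.rotate (μ : Circle) : X.PreL2 Ω φ →ₗᵢ[ℂ] X.PreL2 Ω φ where
  toFun f := ⟨fun x => CForm.rotate μ (f.form x), form_rotate_aemeas μ f.2.1, by
    have := f.2.2
    simp only [fiberInner_rotate] at this ⊢
    exact this⟩
  map_add' f g := Subtype.ext (funext fun x => map_add (CForm.rotate μ) (f.form x) (g.form x))
  map_smul' r f := Subtype.ext (funext fun x => map_smul (CForm.rotate μ) r (f.form x))
  norm_map' f := by
    have h : ∀ g : X.PreL2 Ω φ, ‖g‖ ^ 2 =
        RCLike.re (∫ x, X.fiberInner x (g.form x) (g.form x) ∂X.weightedVolume Ω φ) := fun g => by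
      rw [@norm_sq_eq_re_inner ℂ, inner_def]
    refine (sq_eq_sq₀ (norm_nonneg _) (norm_nonneg _)).1 ?_
    rw [h, h]
    congr 2
    funext x
    exact fiberInner_rotate μ _ _ _

/-- The unitary operator on `L²_*(Ω)` that multiplies forms of bidegree `(p, q)` by
`μ ^ (2 * q)`. -/
def rotate (μ : Circle) : X.L2 Ω φ →L[ℂ] X.L2 Ω φ :=
  SeparationQuotient.liftCLM
    ((SeparationQuotient.mkCLM ℂ (X.PreL2 Ω φ)).comp (PreL2.rotate μ).toContinuousLinearMap)
    fun f g hfg => by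
      rw [Metric.inseparable_iff] at hfg
      have h : dist (PreL2.rotate μ f) (PreL2.rotate μ g) = 0 := by
        rw [(PreL2.rotate μ).dist_map, hfg]
      exact SeparationQuotient.mk_eq_mk.2 (Metric.inseparable_iff.2 h)

lemma rotate_toL2 (μ : Circle) (f : X.PreL2 Ω φ) : rotate μ f.toL2 = (PreL2.rotate μ f).toL2 := rfl

lemma inner_rotate (μ : Circle) (F G : X.L2 Ω φ) : ⟪rotate μ F, rotate μ G⟫_ℂ = ⟪F, G⟫_ℂ := by
  obtain ⟨f, rfl⟩ := PreL2.exists_rep F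
  obtain ⟨g, rfl⟩ := PreL2.exists_rep G
  rw [rotate_toL2, rotate_toL2, PreL2.inner_toL2, PreL2.inner_toL2]
  exact (PreL2.rotate μ).inner_map_map f g

lemma rotate_mem_dbarGraph (μ : Circle) {p : X.L2 Ω φ × X.L2 Ω φ} (hp : p ∈ X.dbarGraph Ω φ) :
    ((μ : ℂ) ^ 2 • rotate μ p.1, rotate μ p.2) ∈ X.dbarGraph Ω φ := by
  obtain ⟨f, g, hf, hg, hfg⟩ := hp
  rw [← hf, ← hg]
  refine ⟨(μ : ℂ) ^ 2 • PreL2.rotate μ f, PreL2.rotate μ g, rfl, rfl, fun x₀ ψ hψ l => ?_⟩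
  obtain ⟨h1, h2, h3⟩ := hfg x₀ ψ hψ (l ∘ₗ (CForm.rotate μ).toLinearMap)
  have e1 : ∀ z, ψ z * l ((PreL2.rotate μ g).form.inChart x₀ ((X.chart x₀).symm z)) =
      ψ z * (l ∘ₗ (CForm.rotate μ).toLinearMap) (g.form.inChart x₀ ((X.chart x₀).symm z)) :=
    fun z => congrArg (ψ z * l ·) (inChart_rotate μ g.form x₀ _)
  have e2 : ∀ z, l (ExteriorAlgebra.ι ℂ (CForm.dbarFun ψ z) *
      ((μ : ℂ) ^ 2 • PreL2.rotate μ f).form.inChart x₀ ((X.chart x₀).symm z)) =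
      (l ∘ₗ (CForm.rotate μ).toLinearMap) (ExteriorAlgebra.ι ℂ (CForm.dbarFun ψ z) *
        f.form.inChart x₀ ((X.chart x₀).symm z)) := fun z => by
    have h4 : ((μ : ℂ) ^ 2 • PreL2.rotate μ f).form.inChart x₀ ((X.chart x₀).symm z) =
        (μ : ℂ) ^ 2 • CForm.rotate μ (f.form.inChart x₀ ((X.chart x₀).symm z)) :=
      (map_smul (CForm.pullback _) _ _).trans (congrArg _ (inChart_rotate μ f.form x₀ _))
    rw [h4, mul_smul_comm, ← CForm.rotate_dbarFun_mul]
    rfl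
  simp only [e1, e2]
  exact ⟨h1, h2, h3⟩

/-- Linear combinations of powers of a rotation are computed pointwise. -/
lemma sum_rotate_pow_toL2 (μ : Circle) (c : ℕ → ℂ) (s : Finset ℕ) (f : X.PreL2 Ω φ) :
    ∃ g : X.PreL2 Ω φ, ∑ k ∈ s, c k • (rotate μ ^ k) f.toL2 = g.toL2 ∧
      ∀ x, g.form x = ∑ k ∈ s, c k • ((CForm.rotate μ).toLinearMap ^ k) (f.form x) := by
  have h1 : ∀ k, ∃ g : X.PreL2 Ω φ, (rotate μ ^ k) f.toL2 = g.toL2 ∧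
      ∀ x, g.form x = ((CForm.rotate μ).toLinearMap ^ k) (f.form x) := fun k => by
    induction k with
    | zero => exact ⟨f, rfl, fun x => rfl⟩
    | succ k ih =>
      obtain ⟨g, hg, hgx⟩ := ih
      refine ⟨PreL2.rotate μ g, ?_, fun x => ?_⟩
      · rw [ContinuousLinearMap.pow_succ_apply, hg, rotate_toL2]
      · rw [pow_succ']
        exact congrArg (CForm.rotate μ) (hgx x)
  choose g hg hgx using h1
  induction s using Finset.induction_on with
  | empty => exact ⟨0, by rw [Finset.sum_empty]; rfl, fun x => by rw [Finset.sum_empty]; rfl⟩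
  | insert k s hk ih =>
    obtain ⟨g', hg', hgx'⟩ := ih
    refine ⟨c k • g k + g', ?_, fun x => ?_⟩
    · rw [Finset.sum_insert hk, hg', hg]
      rfl
    · rw [Finset.sum_insert hk, ← hgx', ← hgx]
      rfl

lemma pow_rotate_apply {E : Type*} [NormedAddCommGroup E] [NormedSpace ℂ E] {μ c : ℂ} {x : CForm E}
    (hx : CForm.rotate μ x = c • x) (k : ℕ) :
    ((CForm.rotate μ).toLinearMap ^ k) x = c ^ k • x := by
  induction k with
  | zero => rw [pow_zero, pow_zero, one_smul]; rfl
  | succ k ih =>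
    rw [pow_succ']
    refine (congrArg (CForm.rotate μ) ih).trans ?_
    rw [map_smul, hx, smul_smul, pow_succ]

/-- Rotation by an `m`-th root of unity `μ ^ 2` is a rotation of the Cauchy-Riemann complex with
respect to the antiholomorphic degree. -/
theorem isRotation_rotate (X : HermitianManifold.{u, v}) {n : ℕ}
    (hn : CForm.antiholomorphicDegreeLE X.Model n = ⊤) {m : ℕ} (μ : Circle)
    (hμ : ((μ : ℂ) ^ 2) ^ m = 1) (Ω : Set X) (φ : X → ℝ) :
    IsRotation (X.dbarGraph Ω φ) (rotate μ) ((μ : ℂ) ^ 2) m n where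
  inner_map := inner_rotate μ
  mem p hp := rotate_mem_dbarGraph μ hp
  pow_apply F := by
    obtain ⟨f, rfl⟩ := PreL2.exists_rep F
    obtain ⟨g, hg, hgx⟩ := sum_rotate_pow_toL2 μ 1 {m} f
    rw [Finset.sum_singleton, Pi.one_apply, one_smul] at hg
    rw [hg]
    refine congrArg PreL2.toL2 (PreL2.ext (funext fun x => ?_))
    rw [hgx, Finset.sum_singleton, Pi.one_apply, one_smul]
    have h1 : ∀ α ∈ CForm.antiholomorphicDegreeLE X.Model n,
        ((CForm.rotate (μ : ℂ)).toLinearMap ^ m) α = α := fun α hα => by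
      refine LinearMap.eqOn_span (f := (CForm.rotate (μ : ℂ)).toLinearMap ^ m)
        (g := LinearMap.id) ?_ hα
      rintro α ⟨q, -, hα⟩
      rw [pow_rotate_apply (hα μ (Circle.norm_coe μ)), ← pow_mul, mul_comm, pow_mul, hμ, one_pow,
        one_smul]
      rfl
    exact h1 _ (hn ▸ Submodule.mem_top)
  sum_eq_zero w hw hwq F := by
    obtain ⟨f, rfl⟩ := PreL2.exists_rep F
    obtain ⟨g, hg, hgx⟩ := sum_rotate_pow_toL2 μ (fun k => w ^ k) (Finset.range m) f
    rw [hg]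
    refine congrArg PreL2.toL2 (PreL2.ext (g := 0) (funext fun x => ?_))
    rw [hgx]
    have h1 : ∀ α ∈ CForm.antiholomorphicDegreeLE X.Model n,
        (∑ k ∈ Finset.range m, w ^ k • (CForm.rotate (μ : ℂ)).toLinearMap ^ k) α = 0 := fun α hα => by
      refine LinearMap.eqOn_span
        (f := ∑ k ∈ Finset.range m, w ^ k • (CForm.rotate (μ : ℂ)).toLinearMap ^ k) (g := 0) ?_ hα
      rintro α ⟨q, hq, hα⟩
      simp only [LinearMap.sum_apply, LinearMap.smul_apply,
        pow_rotate_apply (hα μ (Circle.norm_coe μ)), smul_smul, ← mul_pow, ← Finset.sum_smul]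
      rw [geom_sum_eq_zero_of_pow_eq_one _ (hwq q hq), zero_smul, LinearMap.zero_apply]
      rw [mul_pow, hw, ← pow_mul, mul_comm q, pow_mul, hμ, one_pow, one_mul]
    have h2 := h1 (f.form x) (hn ▸ Submodule.mem_top)
    rw [LinearMap.sum_apply] at h2
    exact h2

lemma rotate_of_isBidegree (μ : Circle) {p q : ℕ} {F : X.L2 Ω φ} (hF : IsBidegree p q F) :
    rotate μ F = ((μ : ℂ) ^ 2) ^ q • F := by
  obtain ⟨f, rfl, hf⟩ := hF
  exact congrArg PreL2.toL2 (PreL2.ext (f := PreL2.rotate μ f) (g := ((μ : ℂ) ^ 2) ^ q • f)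
    (funext fun x => CForm.rotate_of_mem_bidegree (hf x) (Circle.norm_coe μ)))

variable {ι : Type} [Fintype ι] [LinearOrder ι] {Y : ι → HermitianManifold.{u, v}}
  {D : ∀ i, Set (Y i)} {w : ∀ i, Y i → ℝ}

lemma rotate_tensor (h : ∀ i, IsBoundedDomain (D i) (w i)) (μ : Circle)
    (F : ∀ i, (Y i).L2 (D i) (w i)) :
    rotate (X := pi Y) μ ((piData h).tensor F) = (piData h).tensor fun i => rotate μ (F i) := by
  choose f hf using fun i => PreL2.exists_rep (F i)
  obtain rfl : (fun i => (f i).toL2) = F := funext hf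
  refine (congrArg (rotate (X := pi Y) μ) ((piData h).tensor_toL2 f)).trans (Eq.trans ?_
    ((piData h).tensor_toL2 fun i => PreL2.rotate μ (f i)).symm)
  refine congrArg PreL2.toL2 (PreL2.ext (funext fun x => ?_))
  refine (map_list_prod (CForm.rotate (E := (pi Y).Model) μ) _).trans ?_
  rw [List.map_map]
  refine congrArg List.prod (List.map_congr_left fun i _ => ?_)
  exact (CForm.pullback_rotate (μ : ℂ)
    (LinearMap.proj i : (∀ i, (Y i).Model) →ₗ[ℂ] (Y i).Model) _).symm

/-- On closed forms of bidegree `(p, 1)`, the solution operator is the canonical one. -/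
theorem solution_eq_canonicalSolution (h : ∀ i, IsBoundedDomain (D i) (w i))
    (hcl : ∀ i, (Y i).HasClosedRange (D i) (w i)) {p : ℕ} {f : PiL2 D w}
    (hf : f ∈ (pi Y).dbarKer (piDomain D) (piWeight w)) (hfp : IsBidegree p 1 f) :
    (isTensorComplex_pi h hcl).solution (fun i => (Y i).canonicalSolution (D i) (w i)) f =
      (pi Y).canonicalSolution (piDomain D) (piWeight w) f := by
  choose n hn using fun i => CForm.exists_antiholomorphicDegreeLE_eq_top (Y i).Model
  -- a root of unity whose order exceeds all degrees that occur
  let m : ℕ := ∑ i, n i + 2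
  have hm : m ≠ 0 := by omega
  let μ : Circle := Circle.exp (Real.pi / m)
  have hμ : (μ : ℂ) ^ 2 = Complex.exp (2 * Real.pi * Complex.I / m) := by
    rw [Circle.coe_exp, ← Complex.exp_nat_mul]
    congr 1
    push_cast
    ring
  have hζ : IsPrimitiveRoot ((μ : ℂ) ^ 2) m := hμ ▸ Complex.isPrimitiveRoot_exp m hm
  have hpi := IsBoundedDomain.pi h
  have h1 := rotate_of_isBidegree μ hfp
  rw [pow_one] at h1
  exact (isTensorComplex_pi h hcl).solution_eq_canonicalInverse
    (fun i => (h i).isCanonicalInverse_canonicalSolution (hcl i)) hζ (n := n) (by omega)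
    (fun i => isRotation_rotate (Y i) (hn i) μ hζ.pow_eq_one (D i) (w i))
    (rotate_tensor h μ) h1 (hpi.dbarKer_eq ▸ hf)
    (hpi.isCanonicalInverse_canonicalSolution (hasClosedRange_pi h hcl))

end Rotate

end HermitianManifold

end

theorem mainTheorem1 {N : ℕ} (X : Fin N → HermitianManifold.{u, v}) (Ω : ∀ j, Set (X j))
    (φ : ∀ j, X j → ℝ) (hΩ : ∀ j, HermitianManifold.IsLipschitzDomain (Ω j))
    (hφ : ∀ j, ContinuousOn (φ j) (closure (Ω j)))
    (hcl : ∀ j, (X j).HasClosedRange (Ω j) (φ j)) :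
    -- the square integrable forms on the product are the Hilbert tensor product
    (∃ t : MultilinearMap ℂ (fun j => (X j).L2 (Ω j) (φ j)) (HermitianManifold.PiL2 Ω φ),
      IsHilbertTensorProduct t ∧ ∀ F, HermitianManifold.IsTensor F (t F)) ∧
    -- closed range
    (HermitianManifold.pi X).HasClosedRange (HermitianManifold.piDomain Ω)
      (HermitianManifold.piWeight φ) ∧
    -- the Künneth formula
    (∃ κ : MultilinearMap ℂ (fun j => (X j).Cohomology (Ω j) (φ j))
        ((HermitianManifold.pi X).Cohomology (HermitianManifold.piDomain Ω)
          (HermitianManifold.piWeight φ)),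
      IsHilbertTensorProduct κ ∧
      ∀ F : ∀ j, (X j).dbarKer (Ω j) (φ j), ∃ T : (HermitianManifold.pi X).dbarKer
          (HermitianManifold.piDomain Ω) (HermitianManifold.piWeight φ),
        HermitianManifold.IsTensor (fun j => (F j : (X j).L2 (Ω j) (φ j))) T.1 ∧
        κ (fun j => HermitianManifold.Cohomology.mk (F j)) =
          HermitianManifold.Cohomology.mk T) ∧
    -- the harmonic projection
    HermitianManifold.IsTensorOp (fun j => (X j).harmonicProjection (Ω j) (φ j))
      ((HermitianManifold.pi X).harmonicProjection (HermitianManifold.piDomain Ω)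
        (HermitianManifold.piWeight φ)) ∧
    -- the solution operator
    ∃ T : Fin N → HermitianManifold.PiL2 Ω φ →L[ℂ] HermitianManifold.PiL2 Ω φ,
      (∀ j, HermitianManifold.IsTensorOpAt j (HermitianManifold.parityHarmonicBefore Ω φ j)
        ((X j).canonicalSolution (Ω j) (φ j)) (ContinuousLinearMap.id ℂ _) (T j)) ∧
      -- the homotopy formula
      (∀ f : ((HermitianManifold.pi X).dbar (HermitianManifold.piDomain Ω)
          (HermitianManifold.piWeight φ)).domain,
        ∃ h : (∑ j, T j) f.1 ∈ ((HermitianManifold.pi X).dbar (HermitianManifold.piDomain Ω)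
            (HermitianManifold.piWeight φ)).domain,
          (HermitianManifold.pi X).dbar _ _ ⟨(∑ j, T j) f.1, h⟩ +
            (∑ j, T j) ((HermitianManifold.pi X).dbar _ _ f) =
          f.1 - (HermitianManifold.pi X).harmonicProjection _ _ f.1) ∧
      -- it solves the equation
      (∀ f ∈ (HermitianManifold.pi X).dbarRange (HermitianManifold.piDomain Ω)
          (HermitianManifold.piWeight φ),
        ∃ h : (∑ j, T j) f ∈ ((HermitianManifold.pi X).dbar (HermitianManifold.piDomain Ω)
            (HermitianManifold.piWeight φ)).domain,
          (HermitianManifold.pi X).dbar _ _ ⟨(∑ j, T j) f, h⟩ = f) ∧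
      -- it is the canonical solution operator on closed forms of bidegree `(p, 1)`
      ∀ (p : ℕ), ∀ f ∈ (HermitianManifold.pi X).dbarKer (HermitianManifold.piDomain Ω)
          (HermitianManifold.piWeight φ), HermitianManifold.IsBidegree p 1 f →
        (∑ j, T j) f = (HermitianManifold.pi X).canonicalSolution _ _ f := by
  have h : ∀ j, HermitianManifold.IsBoundedDomain (Ω j) (φ j) := fun j =>
    ⟨(hΩ j).isOpen, (hΩ j).isCompact_closure, hφ j⟩
  have hpi := HermitianManifold.IsBoundedDomain.pi h
  have hK := fun j => (h j).isCanonicalInverse_canonicalSolution (hcl j)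
  have hC := HermitianManifold.isTensorComplex_pi h hcl
  refine ⟨⟨(HermitianManifold.piData h).tensor, HermitianManifold.isHilbertTensorProduct_piData h,
      HermitianManifold.isTensor_tensor h⟩, HermitianManifold.hasClosedRange_pi h hcl,
    ⟨HermitianManifold.kunneth h hcl, HermitianManifold.isHilbertTensorProduct_kunneth h hcl,
      fun F => ⟨⟨_, HermitianManifold.tensor_mem_dbarKer h fun j => (F j).2⟩,
        HermitianManifold.isTensor_tensor h _, HermitianManifold.kunneth_mk h hcl F⟩⟩,
    fun F => ⟨_, _, HermitianManifold.isTensor_tensor h F, HermitianManifold.isTensor_tensor h _,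
      HermitianManifold.harmonicProjection_tensor h hcl F⟩,
    hC.solutionTerm fun j => (X j).canonicalSolution (Ω j) (φ j),
    HermitianManifold.isTensorOpAt_solutionTerm h hcl, fun f => ?_, fun f hf => ?_,
    fun p f hf hfp => HermitianManifold.solution_eq_canonicalSolution h hcl hf hfp⟩
  · have h1 := hC.homotopy_solution hK ((hpi.exists_dbar_eq_iff f.1 _).1 ⟨f.2, rfl⟩)
    obtain ⟨h2, h3⟩ := (hpi.exists_dbar_eq_iff _ _).2 h1
    refine ⟨h2, (eq_sub_iff_add_eq.1 h3).trans ?_⟩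
    rw [← hC.harmonicProj_eq_harmonicMap hK, ← hpi.harmonicProjection_eq]
  · exact (hpi.exists_dbar_eq_iff _ _).2 (hC.solution_mem hK (hpi.dbarRange_eq ▸ hf))
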